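/- Let $n\ge 1$ and let $\Delta$ be the cyclic quiver with vertex set $\mathbb Z/n\mathbb Z$. All modules are left modules, and $J_\Omega$ denotes the Jacobson radical of a ring $\Omega$. **Orders of type $\Delta$.** Let $R$ be a complete discrete valuation ring with finite residue field and quotient field $K$. An $R$-order is an $R$-algebra that is a finitely generated projective $R$-module. An $R$-order $\Lambda$ is of type $\Delta$ if it is Morita equivalent to $T_n(\Omega)=\{(x_{ij})\in M_n(\Omega) : x_{ij}\in J_\Omega \text{ for } i<j\}$ for some maximal $R$-order $\Omega$ in a finite-dimensional division $K$-algebra; put $q_\Lambda=\#(\Omega/J_\Omega)$. The simple $\Lambda$-modules are labelled $S_i$ $(i\in\mathbb Z/n\mathbb Z)$ so that there is a nonsplit extension with quotient $S_i$ and submodule $S_{i+1}$. Let $S_{ij}$ $(j\ge1)$ be the indecomposable module with top $S_i$ and length $j$, and $P_i$ the projective cover of $S_i$. Let $\Pi$ be the set of $n$-tuples of partitions $\lambda=(1^{l_{i1}}2^{l_{i2}}\cdots)_{i\in\mathbb Z/n\mathbb Z}$ and put $M(\lambda)=\bigoplus_{i,j}S_{ij}^{l_{ij}}$. For $m\ge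 0$ let $\Pi^\infty_m$ be the set of $\mu=(m_i)_{i\in\mathbb Z/n\mathbb Z}$ with $m_i\in\mathbb Z_{\ge0}$ and $\sum_i m_i=m$, and put $M(\mu)=\bigoplus_iP_i^{m_i}$. For $\Lambda$-modules $X,Y,Z$ let $F^Y_{XZ}$ be the number of submodules $W\subseteq Y$ with $W\cong Z$ and $Y/W\cong X$. **Generic Hall algebra and modules.** For $\lambda,\mu,\nu\in\Pi$ there is a unique $\phi^\mu_{\lambda\nu}\in\mathbb Z[T]$ with $F^{M(\mu)}_{M(\lambda)M(\nu)}=\phi^\mu_{\lambda\nu}(q_\Lambda)$ for every order $\Lambda$ of type $\Delta$; for $\lambda\in\Pi$ and $\mu,\nu\in\Pi^\infty_m$ there is a unique $\psi^\mu_{\lambda\nu}\in\mathbb Z[T]$ with $F^{M(\mu)}_{M(\lambda)M(\nu)}=\psi^\mu_{\lambda\nu}(q_\Lambda)$ for every such $\Lambda$ (all these numbers are finite). For given $\lambda,\nu\in\Pi$ only finitely many $\phi^\mu_{\lambda\nu}$ are nonzero. The free $\mathbb Z[T]$-module $H(\Delta)$ with basis $(u_\lambda)_{\lambda\in\Pi}$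 and multiplication $u_\lambda u_\nu=\sum_{\mu\in\Pi}\phi^\mu_{\lambda\nu}u_\mu$ is an associative algebra with identity $u_0$ (the generic Hall algebra), and the free $\mathbb Z[T]$-module $M_m(\Delta)$ with basis $(u_\mu)_{\mu\in\Pi^\infty_m}$ and action $u_\lambda u_\nu=\sum_{\mu\in\Pi^\infty_m}\psi^\mu_{\lambda\nu}u_\mu$ is a unital $H(\Delta)$-module (the generic Hall module). Put $H(\Delta)^{\mathbb C}_1=H(\Delta)\otimes_{\mathbb Z}\mathbb C/(T-1)$ and $M_m(\Delta)^{\mathbb C}_1=M_m(\Delta)\otimes_{\mathbb Z}\mathbb C/(T-1)$; the latter is an $H(\Delta)^{\mathbb C}_1$-module. **Theorem.** There exist a two-sided ideal $I$ of $H(\Delta)^{\mathbb C}_1$ and an isomorphism of $\mathbb C$-algebras $\theta:H(\Delta)^{\mathbb C}_1/I\to U(\mathfrak{gl}_n)$ such that, for every $m\ge0$, the $H(\Delta)^{\mathbb C}_1$-module $M_m(\Delta)^{\mathbb C}_1$ is annihilated by $I$, and, regarded as a $U(\mathfrak{gl}_n)$-module through $\theta$ and restricted to $U(\mathfrak{sl}_n)$,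 it is the irreducible $U(\mathfrak{sl}_n)$-module with highest weight $m\omega_1$, which has dimension $\binom{m+n-1}{n-1}$. Here $\omega_1(h_i)=\delta_{1i}$ for $1\le i<n$, where $h_i=e_i-e_{i+1}$ and $e_i\in\mathfrak{gl}_n$ is the $i$-th diagonal matrix unit, and the highest weight is taken with respect to the upper triangular matrices. -/

import Mathlib

open Polynomial TensorProduct

attribute [local instance 100] LieRing.ofAssociativeRing

noncomputable section

namespace IyamaHall

/-! ## Orders whose type is the cyclic quiver with `n` vertices -/

/-- `T_n(Ω)`: the ring of `n × n` matrices over `Ω` whose entries strictly above the diagonal lie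
in the Jacobson radical of `Ω`. -/
def triangularSubring (n : ℕ) (Ω : Type) [Ring Ω] : Subring (Matrix (Fin n) (Fin n) Ω) where
  carrier := {x | ∀ i j, i < j → x i j ∈ Ring.jacobson Ω}
  mul_mem' := by
    intro x y hx hy i j hij
    rw [Matrix.mul_apply]
    refine Submodule.sum_mem _ fun k _ => ?_
    by_cases hik : i < k
    · exact Ideal.mul_mem_right _ _ (hx i k hik)
    · exact Ideal.mul_mem_left _ _ (hy k j (lt_of_le_of_lt (not_lt.mp hik) hij))
  one_mem' := by
    intro i j hij
    rw [Matrix.one_apply_ne hij.ne]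
    exact Submodule.zero_mem _
  add_mem' := by
    intro x y hx hy i j hij
    exact Submodule.add_mem _ (hx i j hij) (hy i j hij)
  zero_mem' := by
    intro i j _
    exact Submodule.zero_mem _
  neg_mem' := by
    intro x hx i j hij
    exact Submodule.neg_mem _ (hx i j hij)

/-- An `R`-order in the finite dimensional algebra `D` over the fraction field of `R`: a subring
that is a finitely generated projective `R`-module and spans `D` over the fraction field. -/
def IsOrderIn (R D : Type) [CommRing R] [IsDomain R] [Ring D] [Algebra R D]
    [Algebra (FractionRing R) D] (Ω : Subalgebra R D) : Prop :=
  Module.Finite R Ω ∧ Module.Projective R Ω ∧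
    Submodule.span (FractionRing R) (Ω : Set D) = ⊤

/-- A maximal order: an order that is contained in no other order of the same algebra. -/
def IsMaximalOrderIn (R D : Type) [CommRing R] [IsDomain R] [Ring D] [Algebra R D]
    [Algebra (FractionRing R) D] (Ω : Subalgebra R D) : Prop :=
  IsOrderIn R D Ω ∧ ∀ Ω' : Subalgebra R D, IsOrderIn R D Ω' → Ω ≤ Ω' → Ω' = Ω

/-- An order `Λ` of type `Δ`, where `Δ` is the cyclic quiver with `n` vertices: an `R`-order over a
complete discrete valuation ring `R` with finite residue field, which is Morita equivalent to
`T_n(Ω)` for a maximal order `Ω` in a finite dimensional division algebra `D` over the fraction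
field of `R`. -/
structure CyclicOrder (n : ℕ) where
  R : Type
  [commRing : CommRing R]
  [isDomain : IsDomain R]
  [isDVR : IsDiscreteValuationRing R]
  complete : IsAdicComplete (IsLocalRing.maximalIdeal R) R
  finite_residueField : Finite (IsLocalRing.ResidueField R)
  /-- the order itself -/
  Λ : Type
  [ring : Ring Λ]
  [algebra : Algebra R Λ]
  finite : Module.Finite R Λ
  projective : Module.Projective R Λ
  /-- the division algebra -/
  D : Type
  [divisionRing : DivisionRing D]
  [algebraR : Algebra R D]
  [algebraK : Algebra (FractionRing R) D]
  [isScalarTower : IsScalarTower R (FractionRing R) D]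
  finiteDimensional : FiniteDimensional (FractionRing R) D
  /-- the maximal order in the division algebra -/
  Ω : Subalgebra R D
  isMaximalOrder : IsMaximalOrderIn R D Ω
  morita : IsMoritaEquivalent ℤ Λ (triangularSubring n Ω)

attribute [instance] CyclicOrder.ring

/-- `q_Λ`, the number of elements of `Ω / J_Ω`. -/
def CyclicOrder.q {n : ℕ} (O : CyclicOrder n) : ℕ :=
  letI := O.commRing
  letI := O.divisionRing
  letI := O.algebraR
  Nat.card (O.Ω ⧸ Ring.jacobson O.Ω)

/-! ## The simple, the indecomposable finite length, and the projective modules -/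

section Modules

variable {Λ : Type} [Ring Λ]

/-- An enumeration `(S_i)` of the simple `Λ`-modules by the vertices `ℤ/n` of the cyclic quiver:
every simple module is isomorphic to exactly one `S_i`, and for every `i` there is a nonsplit
extension with quotient `S_i` and submodule `S_{i+1}` (an arrow `i → i+1`). -/
structure IsCyclicLabelling {n : ℕ} (S : ZMod n → ModuleCat.{0} Λ) : Prop where
  simple : ∀ i, IsSimpleModule Λ (S i)
  injective : ∀ i j, Nonempty (S i ≃ₗ[Λ] S j) → i = j
  exhaustive : ∀ X : ModuleCat.{0} Λ, IsSimpleModule Λ X → ∃ i, Nonempty (X ≃ₗ[Λ] S i)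
  arrow : ∀ i, ∃ (E : ModuleCat.{0} Λ) (N : Submodule Λ E),
    Nonempty (N ≃ₗ[Λ] S (i + 1)) ∧ Nonempty ((E ⧸ N) ≃ₗ[Λ] S i) ∧ ¬ ∃ N', IsCompl N N'

/-- `X` is an indecomposable module with top `S` and of length `j`. -/
def IsIndecomposableOf (S : ModuleCat.{0} Λ) (j : ℕ+) (X : ModuleCat.{0} Λ) : Prop :=
  (Nontrivial X ∧ ∀ N N' : Submodule Λ X, IsCompl N N' → N = ⊥ ∨ N' = ⊥) ∧
    Nonempty ((X ⧸ Module.jacobson Λ X) ≃ₗ[Λ] S) ∧ Module.length Λ X = ((j : ℕ) : ℕ∞)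

/-- `P` is a projective cover of `S`: it is projective and has a surjection onto `S` with
superfluous kernel. -/
def IsProjectiveCover (S P : ModuleCat.{0} Λ) : Prop :=
  Module.Projective Λ P ∧ ∃ f : P →ₗ[Λ] S, Function.Surjective f ∧
    ∀ N : Submodule Λ P, N ⊔ LinearMap.ker f = ⊤ → N = ⊤

/-- The set `Π` of `n`-tuples of partitions. An element is given by the multiplicities `l i j` of
the part `j ≥ 1` in the `i`-th partition. -/
abbrev PartitionTuple (n : ℕ) : Type := (ZMod n × ℕ+) →₀ ℕ

/-- The set of tuples `(m_i)` of natural numbers, indexed by `ℤ/n`, with sum `m`. -/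
abbrev LatticeIndex (n m : ℕ) [NeZero n] : Type := {μ : ZMod n → ℕ // ∑ i, μ i = m}

/-- `X ≅ M(λ) = ⨁_{i,j} S_{ij}^{l_{ij}}`. -/
def IsFinModule {n : ℕ} (S : ZMod n → ModuleCat.{0} Λ) (l : PartitionTuple n)
    (X : ModuleCat.{0} Λ) : Prop :=
  ∃ N : ZMod n × ℕ+ → ModuleCat.{0} Λ, (∀ p, IsIndecomposableOf (S p.1) p.2 (N p)) ∧
    Nonempty (X ≃ₗ[Λ] DirectSum (Σ p : ZMod n × ℕ+, Fin (l p)) fun a => N a.1)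

/-- `L ≅ M(μ) = ⨁_i P_i^{m_i}`. -/
def IsLattice {n : ℕ} (S : ZMod n → ModuleCat.{0} Λ) (μ : ZMod n → ℕ)
    (L : ModuleCat.{0} Λ) : Prop :=
  ∃ P : ZMod n → ModuleCat.{0} Λ, (∀ i, IsProjectiveCover (S i) (P i)) ∧
    Nonempty (L ≃ₗ[Λ] DirectSum (Σ i : ZMod n, Fin (μ i)) fun a => P a.1)

/-- The set of submodules `W` of `Y` with `W ≅ Z` and `Y / W ≅ X`; its cardinality is `F^Y_{XZ}`. -/
def hallSet (X Y Z : ModuleCat.{0} Λ) : Set (Submodule Λ Y) :=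
  {W | Nonempty (W ≃ₗ[Λ] Z) ∧ Nonempty ((Y ⧸ W) ≃ₗ[Λ] X)}

end Modules

/-! ## Hall polynomials -/

/-- `p` is a Hall polynomial for `λ, μ, ν`: for every order of type `Δ`, the number
`F^{M(μ)}_{M(λ) M(ν)}` is finite and equal to `p(q_Λ)`. -/
def IsHallPolynomial (n : ℕ) (lam mu nu : PartitionTuple n) (p : ℤ[X]) : Prop :=
  ∀ (O : CyclicOrder n) (S : ZMod n → ModuleCat.{0} O.Λ), IsCyclicLabelling S →
    ∀ X Y Z : ModuleCat.{0} O.Λ, IsFinModule S lam X → IsFinModule S mu Y → IsFinModule S nu Z →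
      (hallSet X Y Z).Finite ∧ ((hallSet X Y Z).ncard : ℤ) = p.eval (O.q : ℤ)

/-- `p` is a Hall polynomial for the finite length module `M(λ)` and the lattices `M(μ), M(ν)`. -/
def IsHallModulePolynomial (n m : ℕ) [NeZero n] (lam : PartitionTuple n)
    (mu nu : LatticeIndex n m) (p : ℤ[X]) : Prop :=
  ∀ (O : CyclicOrder n) (S : ZMod n → ModuleCat.{0} O.Λ), IsCyclicLabelling S →
    ∀ X Y Z : ModuleCat.{0} O.Λ, IsFinModule S lam X → IsLattice S mu.1 Y → IsLattice S nu.1 Z →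
      (hallSet X Y Z).Finite ∧ ((hallSet X Y Z).ncard : ℤ) = p.eval (O.q : ℤ)

/-- The Hall polynomial `φ^μ_{λν}`. -/
def hallPolynomial (n : ℕ) (lam mu nu : PartitionTuple n) : ℤ[X] :=
  Classical.epsilon (IsHallPolynomial n lam mu nu)

/-- The polynomial `ψ^μ_{λν}`. -/
def hallModulePolynomial (n m : ℕ) [NeZero n] (lam : PartitionTuple n)
    (mu nu : LatticeIndex n m) : ℤ[X] :=
  Classical.epsilon (IsHallModulePolynomial n m lam mu nu)

/-! ## The generic Hall algebra and the generic Hall modules -/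

/-- The free `ℤ[T]`-module underlying the generic Hall algebra, with basis `(u_λ)`. -/
def GenericHallAlgebra (n : ℕ) : Type := PartitionTuple n →₀ ℤ[X]

instance (n : ℕ) : AddCommGroup (GenericHallAlgebra n) :=
  inferInstanceAs (AddCommGroup (PartitionTuple n →₀ ℤ[X]))

instance (n : ℕ) : Module ℤ[X] (GenericHallAlgebra n) :=
  inferInstanceAs (Module ℤ[X] (PartitionTuple n →₀ ℤ[X]))

/-- The basis element `u_λ`. -/
def GenericHallAlgebra.u {n : ℕ} (lam : PartitionTuple n) : GenericHallAlgebra n :=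
  (Finsupp.single lam 1 : PartitionTuple n →₀ ℤ[X])

/-- The multiplication `u_λ u_ν = ∑_μ φ^μ_{λν} u_μ` of the generic Hall algebra. -/
def genericMul (n : ℕ) :
    GenericHallAlgebra n →ₗ[ℤ[X]] GenericHallAlgebra n →ₗ[ℤ[X]] GenericHallAlgebra n :=
  Finsupp.linearCombination ℤ[X] fun lam : PartitionTuple n =>
    (Finsupp.linearCombination ℤ[X] fun nu : PartitionTuple n =>
      ∑ᶠ mu : PartitionTuple n, hallPolynomial n lam mu nu • GenericHallAlgebra.u mu :
      (PartitionTuple n →₀ ℤ[X]) →ₗ[ℤ[X]] GenericHallAlgebra n)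

theorem genericMul_u (n : ℕ) (lam nu : PartitionTuple n) :
    genericMul n (GenericHallAlgebra.u lam) (GenericHallAlgebra.u nu) =
      ∑ᶠ mu : PartitionTuple n, hallPolynomial n lam mu nu • GenericHallAlgebra.u mu := by
  unfold genericMul GenericHallAlgebra.u
  erw [Finsupp.linearCombination_single, one_smul, Finsupp.linearCombination_single, one_smul]

/-- The free `ℤ[T]`-module underlying the `m`-th generic Hall module. -/
def GenericHallModule (n m : ℕ) [NeZero n] : Type := LatticeIndex n m →₀ ℤ[X]

instance (n m : ℕ) [NeZero n] : AddCommGroup (GenericHallModule n m) :=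
  inferInstanceAs (AddCommGroup (LatticeIndex n m →₀ ℤ[X]))

instance (n m : ℕ) [NeZero n] : Module ℤ[X] (GenericHallModule n m) :=
  inferInstanceAs (Module ℤ[X] (LatticeIndex n m →₀ ℤ[X]))

/-- The basis element `u_μ`. -/
def GenericHallModule.u {n m : ℕ} [NeZero n] (mu : LatticeIndex n m) : GenericHallModule n m :=
  (Finsupp.single mu 1 : LatticeIndex n m →₀ ℤ[X])

/-- The action `u_λ u_ν = ∑_μ ψ^μ_{λν} u_μ` on the generic Hall module (a sum over the finite set
of all `μ` with the same total `m`). -/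
def genericAct (n m : ℕ) [NeZero n] :
    GenericHallAlgebra n →ₗ[ℤ[X]] GenericHallModule n m →ₗ[ℤ[X]] GenericHallModule n m :=
  Finsupp.linearCombination ℤ[X] fun lam : PartitionTuple n =>
    (Finsupp.linearCombination ℤ[X] fun nu : LatticeIndex n m =>
      ∑ᶠ mu : LatticeIndex n m, hallModulePolynomial n m lam mu nu • GenericHallModule.u mu :
      (LatticeIndex n m →₀ ℤ[X]) →ₗ[ℤ[X]] GenericHallModule n m)

theorem genericAct_u (n m : ℕ) [NeZero n] (lam : PartitionTuple n) (nu : LatticeIndex n m) :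
    genericAct n m (GenericHallAlgebra.u lam) (GenericHallModule.u nu) =
      ∑ᶠ mu : LatticeIndex n m, hallModulePolynomial n m lam mu nu • GenericHallModule.u mu := by
  unfold genericAct GenericHallAlgebra.u GenericHallModule.u
  erw [Finsupp.linearCombination_single, one_smul, Finsupp.linearCombination_single, one_smul]

/-! ## Specialization at `T = 1` over `ℂ` -/

/-- `ℂ = ℤ[T] ⊗ ℂ / (T - 1)` as a `ℤ[T]`-algebra: `T` acts as `1`. -/
instance complexAtOne : Algebra ℤ[X] ℂ :=
  (Polynomial.eval₂RingHom (Int.castRingHom ℂ) 1).toAlgebra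

/-- Base change of a bilinear map along `ℤ[T] → ℂ`, `T ↦ 1`. -/
def specialize {M N P : Type} [AddCommGroup M] [Module ℤ[X] M] [AddCommGroup N] [Module ℤ[X] N]
    [AddCommGroup P] [Module ℤ[X] P] (f : M →ₗ[ℤ[X]] N →ₗ[ℤ[X]] P) :
    (ℂ ⊗[ℤ[X]] M) →ₗ[ℂ] (ℂ ⊗[ℤ[X]] N) →ₗ[ℂ] (ℂ ⊗[ℤ[X]] P) :=
  LinearMap.liftBaseChange ℂ ((LinearMap.baseChangeHom ℤ[X] ℂ N P).comp f)

theorem specialize_tmul {M N P : Type} [AddCommGroup M] [Module ℤ[X] M] [AddCommGroup N]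
    [Module ℤ[X] N] [AddCommGroup P] [Module ℤ[X] P] (f : M →ₗ[ℤ[X]] N →ₗ[ℤ[X]] P)
    (a b : ℂ) (x : M) (y : N) :
    specialize f (a ⊗ₜ x) (b ⊗ₜ y) = (a * b) ⊗ₜ f x y := by
  simp [specialize, LinearMap.liftBaseChange_tmul, TensorProduct.smul_tmul']

/-- The specialized generic Hall algebra `H(Δ) ⊗_ℤ ℂ / (T - 1) = ℂ ⊗_{ℤ[T]} H(Δ)`. -/
def HallAlgebraOne (n : ℕ) : Type := ℂ ⊗[ℤ[X]] GenericHallAlgebra n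

instance (n : ℕ) : AddCommGroup (HallAlgebraOne n) :=
  inferInstanceAs (AddCommGroup (ℂ ⊗[ℤ[X]] GenericHallAlgebra n))

instance (n : ℕ) : Module ℂ (HallAlgebraOne n) :=
  inferInstanceAs (Module ℂ (ℂ ⊗[ℤ[X]] GenericHallAlgebra n))

/-- The multiplication of the specialized Hall algebra as a bilinear map. -/
def mulOne (n : ℕ) : HallAlgebraOne n →ₗ[ℂ] HallAlgebraOne n →ₗ[ℂ] HallAlgebraOne n :=
  specialize (genericMul n)

instance (n : ℕ) : Mul (HallAlgebraOne n) := ⟨fun x y => mulOne n x y⟩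

instance (n : ℕ) : NonUnitalNonAssocRing (HallAlgebraOne n) :=
  { (inferInstance : AddCommGroup (HallAlgebraOne n)),
    (inferInstance : Mul (HallAlgebraOne n)) with
    left_distrib := fun x y z => (mulOne n x).map_add y z
    right_distrib := fun x y z => LinearMap.map_add₂ (mulOne n) x y z
    zero_mul := fun x => LinearMap.map_zero₂ (mulOne n) x
    mul_zero := fun x => (mulOne n x).map_zero }

/-- The specialized generic Hall module `M_m(Δ) ⊗_ℤ ℂ / (T - 1) = ℂ ⊗_{ℤ[T]} M_m(Δ)`. -/
abbrev HallModuleOne (n m : ℕ) [NeZero n] : Type := ℂ ⊗[ℤ[X]] GenericHallModule n m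

/-- The action of the specialized Hall algebra on the specialized Hall module. -/
def actOne (n m : ℕ) [NeZero n] :
    HallAlgebraOne n →ₗ[ℂ] HallModuleOne n m →ₗ[ℂ] HallModuleOne n m :=
  specialize (genericAct n m)

/-! ## `U(gl_n)`, `U(sl_n)` and the highest weight `m ω_1` -/

/-- `U(gl_n)`. -/
abbrev Ugl (n : ℕ) : Type := UniversalEnvelopingAlgebra ℂ (Matrix (Fin n) (Fin n) ℂ)

/-- `U(sl_n)`. -/
abbrev Usl (n : ℕ) : Type :=
  UniversalEnvelopingAlgebra ℂ (LieAlgebra.SpecialLinear.sl (Fin n) ℂ)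

/-- The canonical algebra homomorphism `U(sl_n) → U(gl_n)`. -/
def UslToUgl (n : ℕ) : Usl n →ₐ[ℂ] Ugl n :=
  UniversalEnvelopingAlgebra.lift ℂ
    ((UniversalEnvelopingAlgebra.ι ℂ : Matrix (Fin n) (Fin n) ℂ →ₗ⁅ℂ⁆ Ugl n).comp
      (LieAlgebra.SpecialLinear.sl (Fin n) ℂ).incl)

/-- The `U(sl_n)`-module given by `ρ` is simple. -/
def IsIrreducibleModule {n : ℕ} {V : Type} [AddCommGroup V] [Module ℂ V]
    (ρ : Usl n →ₐ[ℂ] Module.End ℂ V) : Prop :=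
  letI : Module (Usl n) V := Module.compHom V ρ.toRingHom
  IsSimpleModule (Usl n) V

/-- `h_i = e_i - e_{i+1}`, where `e_i` is the `i`-th diagonal matrix unit (indices from `0`). -/
def hElem (n i : ℕ) (hi : i + 1 < n) : LieAlgebra.SpecialLinear.sl (Fin n) ℂ :=
  LieAlgebra.SpecialLinear.singleSubSingle
    (⟨i, Nat.lt_of_succ_lt hi⟩ : Fin n) (⟨i + 1, hi⟩ : Fin n) (1 : ℂ)

/-- `ω(h_i) = c` is recorded by `c i`: the `U(sl_n)`-module given by `ρ` has a nonzero vector of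
that weight which is annihilated by all strictly upper triangular matrix units. For an irreducible
module, this says that `c` is its highest weight. -/
def HasHighestWeight {n : ℕ} {V : Type} [AddCommGroup V] [Module ℂ V]
    (ρ : Usl n →ₐ[ℂ] Module.End ℂ V) (c : ℕ → ℂ) : Prop :=
  ∃ v : V, v ≠ 0 ∧
    (∀ (i j : Fin n) (hij : i < j),
      ρ (UniversalEnvelopingAlgebra.ι ℂ (LieAlgebra.SpecialLinear.single i j hij.ne 1)) v = 0) ∧
    ∀ (i : ℕ) (hi : i + 1 < n), ρ (UniversalEnvelopingAlgebra.ι ℂ (hElem n i hi)) v = c i • v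

/-- The fundamental weight `ω_1`: its values on `h_1, h_2, …` (numbered from `0`) are
`1, 0, 0, …`. -/
def omegaOne (i : ℕ) : ℂ := if i = 0 then 1 else 0

end IyamaHall

end

/-! The proof has four stages.

Reduction to one class of rings. The radical of a maximal order `Ω` in a division algebra is
generated by a normal element `ϖ` (`IsMaximalOrderIn.exists_uniformizer`). In `T_n(Ω)` the cyclic
shift matrix with corner entry `ϖ` is therefore a normal regular element `u` that generates the
radical and permutes the diagonal idempotents cyclically. `CycRing` records exactly this, and Hall
numbers survive the Morita equivalence (`CyclicOrder.exists_cycRing`). Over such a ring the relevant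
indecomposables are the uniserial modules `C (k, j)` with top `k` and length `j ≤ ∞`, the infinite
length giving the projectives. Finite direct sums of them are classified by multisets of pairs `(k,
j)` (`HasType.unique`), and every finite module killed by a power of `u` is such a sum
(`exists_hasType_of_finite`).

Hall polynomials. If the quotient is semisimple, splitting off a longest summand gives a recursion
whose coefficients are powers of `q` (`ncard_hT_cons`). For a general quotient type, chains whose
two upper subquotients have the types of its top and of its radical are counted in two ways. This is
a triangular system with leading coefficient `1`, and it is solved by induction
(`isPolynomialHall`). Every prime is the `q` of the order `T_n(𝔽_p[[t]])`, so identities between the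
polynomials may be checked on these orders; associativity and the module axiom are again double
counts of chains (`HasType.sum_hallNumber`).

The value at `T = 1`. Over an `𝔽_p`-algebra the torus `𝔽_p^×` scales one direct summand of a module
and permutes freely the submodules that are not products. Modulo `p - 1` only products count, and
for an indecomposable quotient these just shorten one summand (`ncard_hT_modEq`). As `P(p) ≡ P(1)`
modulo `p - 1` for all primes `p`, this determines `P(1)` (`eval_one_hallPolynomial`,
`eval_one_hallModulePolynomial`).

Comparison with `gl_n`. Write `u_(i,j)` for the basis element of the indecomposable with top `i` and
length `j`. At `T = 1` these elements have the commutators of the matrix units `E_(i,i+j)`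
(`commutator_u_single`). They generate the Hall algebra, and a triangularity argument in the style
of Poincaré, Birkhoff and Witt shows that the commutators are its only relations
(`ker_freeToHall_le`). Hence `u_(i,j) ↦ E_(i,i+j)`, with indices modulo `n`, defines a surjection
onto `U(gl_n)`, and `I` is its kernel. On the Hall module `u_(i,j)` turns a summand `P_i` into
`P_(i+j)`; in formulas `E_(i,k)` acts as `x_i ∂/∂x_k` on the divided power monomials of degree `m`.
This depends on the end points modulo `n` only, so the action factors through `U(gl_n)`, and the
module is the `m`-th symmetric power of the natural representation. Irreducibility is seen by moving
all boxes to one vertex and back. -/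

noncomputable section
namespace IyamaHall

/-! ## Rings with a cyclic normal uniformizer -/

/-- The structure of `T_n(Ω)` used below: a complete system of orthogonal idempotents permuted
cyclically by a normal regular element `u` that generates the radical. -/
structure CycRing (n : ℕ) [NeZero n] (A : Type) [Ring A] where
  e : ZMod n → A
  u : A
  q : ℕ
  e_mul_self : ∀ i, e i * e i = e i
  e_mul_ne : ∀ i j, i ≠ j → e i * e j = 0
  sum_e : ∑ i, e i = 1
  u_mul_e : ∀ i, u * e i = e (i + 1) * u
  left_normal : ∀ a, ∃ b, u * a = b * u
  right_normal : ∀ a, ∃ b, a * u = u * b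
  eq_zero_of_mul_u : ∀ a, a * u = 0 → a = 0
  dvd_off : ∀ i j a, i ≠ j → u ∣ e i * a * e j
  dvd_or : ∀ i a, u ∣ e i * a * e i ∨ ∃ b, b * (e i * a * e i) = e i
  sep : ∀ a, (∀ N : ℕ, u ^ N ∣ a) → a = 0
  one_lt_q : 1 < q
  residue : ∀ k, ∃ (F : Type) (_ : AddCommGroup F) (f : A →+ F), Function.Surjective f ∧
    (∀ a, f a = 0 ↔ u ∣ a * e k) ∧ Nat.card F = q

namespace CycRing

variable {n : ℕ} [NeZero n] {A : Type} [Ring A] (c : CycRing n A)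

theorem pow_left_normal (N : ℕ) (a : A) : ∃ b, c.u ^ N * a = b * c.u ^ N := by
  induction N with
  | zero => exact ⟨a, by simp⟩
  | succ N ih =>
    obtain ⟨b, hb⟩ := ih
    obtain ⟨d, hd⟩ := c.left_normal b
    exact ⟨d, by rw [pow_succ', mul_assoc, hb, ← mul_assoc, hd, mul_assoc]⟩

theorem pow_right_normal (N : ℕ) (a : A) : ∃ b, a * c.u ^ N = c.u ^ N * b := by
  induction N generalizing a with
  | zero => exact ⟨a, by simp⟩
  | succ N ih =>
    obtain ⟨b, hb⟩ := c.right_normal a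
    obtain ⟨d, hd⟩ := ih b
    exact ⟨d, by rw [pow_succ', ← mul_assoc, hb, mul_assoc, hd, mul_assoc]⟩

/-- Divisibility by `u ^ N` is membership in the right ideal `u ^ N A`. Normality of `u` makes this
ideal two-sided. -/
theorem pow_dvd_mul_left {N : ℕ} {a : A} (b : A) (h : c.u ^ N ∣ a) : c.u ^ N ∣ b * a := by
  obtain ⟨d, rfl⟩ := h
  obtain ⟨b', hb⟩ := c.pow_right_normal N b
  exact ⟨b' * d, by rw [← mul_assoc, hb, mul_assoc]⟩

theorem pow_mul_e (N : ℕ) (i : ZMod n) : c.u ^ N * c.e i = c.e (i + N) * c.u ^ N := by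
  induction N with
  | zero => simp
  | succ N ih =>
    rw [pow_succ', mul_assoc, ih, ← mul_assoc, c.u_mul_e, mul_assoc, Nat.cast_succ, add_assoc]

theorem eq_zero_of_mul_pow {N : ℕ} {a : A} (h : a * c.u ^ N = 0) : a = 0 := by
  induction N with
  | zero => simpa using h
  | succ N ih => exact ih (c.eq_zero_of_mul_u _ (by rw [mul_assoc, ← pow_succ, h]))

/-- Normality moves the factor `u ^ m` to the right end, where regularity cancels it. -/
theorem pow_dvd_of_dvd_mul_pow {N m : ℕ} {a : A} (h : c.u ^ (N + m) ∣ a * c.u ^ m) :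
    c.u ^ N ∣ a := by
  obtain ⟨b, hb⟩ := h
  obtain ⟨d, hd⟩ := c.pow_left_normal m b
  refine ⟨d, ?_⟩
  rw [← sub_eq_zero]
  apply c.eq_zero_of_mul_pow (N := m)
  rw [sub_mul, hb, pow_add, mul_assoc, hd, mul_assoc, sub_self]

/-- Modulo `u` only the diagonal corner `e k A e k` of the column `A e k` survives, by `dvd_off`,
and there `dvd_or` supplies left inverses. -/
theorem exists_left_inv {k : ZMod n} {b : A} (h : ¬ c.u ∣ b * c.e k) :
    ∃ x, x * (b * c.e k) = c.e k := by
  have h1 : ¬ c.u ∣ c.e k * b * c.e k := by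
    intro h1
    apply h
    have : b * c.e k = ∑ i, c.e i * b * c.e k := by
      rw [← Finset.sum_mul, ← Finset.sum_mul, c.sum_e, one_mul]
    rw [this]
    refine Finset.dvd_sum fun i _ => ?_
    by_cases hik : i = k
    · exact hik ▸ h1
    · exact c.dvd_off i k b hik
  obtain ⟨x, hx⟩ := (c.dvd_or k b).resolve_left h1
  exact ⟨x * c.e k, by rw [mul_assoc, ← mul_assoc (c.e k), hx]⟩

/-! ### The cyclic modules -/

/-- The left ideal with quotient the indecomposable module of top `k` and length `j`. -/
def I (p : ZMod n × ℕ∞) : Submodule A A where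
  carrier := {a | ∀ N : ℕ, (N : ℕ∞) ≤ p.2 → c.u ^ N ∣ a * c.e p.1}
  add_mem' ha hb N hN := by rw [add_mul]; exact dvd_add (ha N hN) (hb N hN)
  zero_mem' N _ := by simp
  smul_mem' b a ha N hN := by
    rw [smul_eq_mul, mul_assoc]; exact c.pow_dvd_mul_left b (ha N hN)

theorem mem_I {p : ZMod n × ℕ∞} {a : A} :
    a ∈ c.I p ↔ ∀ N : ℕ, (N : ℕ∞) ≤ p.2 → c.u ^ N ∣ a * c.e p.1 := Iff.rfl

/-- The uniserial module with top `p.1` and length `p.2`; it is projective if `p.2 = ⊤`. -/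
abbrev C (p : ZMod n × ℕ∞) : Type := A ⧸ c.I p

/-- The canonical generator. -/
def gen (p : ZMod n × ℕ∞) : c.C p := Submodule.Quotient.mk 1

theorem smul_gen (p : ZMod n × ℕ∞) (a : A) : a • c.gen p = Submodule.Quotient.mk a := by
  rw [gen, ← Submodule.Quotient.mk_smul, smul_eq_mul, mul_one]

theorem exists_smul_gen {p : ZMod n × ℕ∞} (x : c.C p) : ∃ a : A, x = a • c.gen p := by
  obtain ⟨a, rfl⟩ := Submodule.Quotient.mk_surjective _ x
  exact ⟨a, (c.smul_gen p a).symm⟩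

theorem smul_gen_eq_zero {p : ZMod n × ℕ∞} {a : A} :
    a • c.gen p = 0 ↔ ∀ N : ℕ, (N : ℕ∞) ≤ p.2 → c.u ^ N ∣ a * c.e p.1 := by
  rw [smul_gen, Submodule.Quotient.mk_eq_zero, mem_I]

theorem mul_e_smul_gen (p : ZMod n × ℕ∞) (a : A) : (a * c.e p.1) • c.gen p = a • c.gen p := by
  rw [← sub_eq_zero, ← sub_smul, smul_gen_eq_zero]
  intro N _
  rw [sub_mul, mul_assoc, c.e_mul_self, sub_self]
  exact dvd_zero _

theorem e_smul_gen (p : ZMod n × ℕ∞) : c.e p.1 • c.gen p = c.gen p := by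
  simpa using c.mul_e_smul_gen p 1

theorem pow_smul_gen_eq_zero {p : ZMod n × ℕ∞} {N : ℕ} (h : p.2 ≤ N) :
    c.u ^ N • c.gen p = 0 := by
  rw [smul_gen_eq_zero]
  intro M hM
  exact Dvd.dvd.mul_right (pow_dvd_pow _ (by exact_mod_cast hM.trans h)) _

section Hom

variable {Y : Type} [AddCommGroup Y] [Module A Y]

/-- The homomorphism from a cyclic module that maps the generator to a given element. -/
def lift (p : ZMod n × ℕ∞) (y : Y) (h1 : c.e p.1 • y = y)
    (h2 : ∀ N : ℕ, p.2 = N → c.u ^ N • y = 0) : c.C p →ₗ[A] Y :=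
  (c.I p).liftQ (LinearMap.toSpanSingleton A Y y) (by
    intro a ha
    rw [LinearMap.mem_ker, LinearMap.toSpanSingleton_apply, ← h1, smul_smul]
    -- For infinite length, separatedness shows that `I p` annihilates `e p.1`. For length `N` the
    -- elements `a` of `I p` satisfy `a e ∈ u ^ N A`, and normality moves `u ^ N` next to `y`, which
    -- it kills.
    rcases hp : p.2 with _ | N
    · have : a * c.e p.1 = 0 := c.sep _ fun N => ha N (by rw [hp]; exact le_top)
      rw [this, zero_smul]
    · obtain ⟨b, hb⟩ := ha N (by rw [hp]; exact le_rfl)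
      have hb' : a * c.e p.1 = c.u ^ N * b * c.e p.1 := by
        rw [← hb, mul_assoc, c.e_mul_self]
      obtain ⟨d, hd⟩ := c.pow_left_normal N b
      rw [hb', mul_smul, h1, hd, mul_smul, h2 N hp, smul_zero])

@[simp] theorem lift_gen (p : ZMod n × ℕ∞) (y : Y) (h1 : c.e p.1 • y = y)
    (h2 : ∀ N : ℕ, p.2 = N → c.u ^ N • y = 0) : c.lift p y h1 h2 (c.gen p) = y := by
  simp [lift, gen]

theorem hom_ext {p : ZMod n × ℕ∞} {f g : c.C p →ₗ[A] Y} (h : f (c.gen p) = g (c.gen p)) :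
    f = g := by
  ext
  simpa [gen] using h

variable (Y) in
/-- The submodule `u ^ N Y`. -/
def radN (N : ℕ) : Submodule A Y where
  carrier := {y | ∃ x, y = c.u ^ N • x}
  add_mem' := by
    rintro _ _ ⟨x, rfl⟩ ⟨y, rfl⟩
    exact ⟨x + y, (smul_add _ _ _).symm⟩
  zero_mem' := ⟨0, (smul_zero _).symm⟩
  smul_mem' := by
    rintro a _ ⟨x, rfl⟩
    obtain ⟨b, hb⟩ := c.pow_right_normal N a
    exact ⟨b • x, by rw [smul_smul, smul_smul, hb]⟩

theorem mem_radN {N : ℕ} {y : Y} : y ∈ c.radN Y N ↔ ∃ x, y = c.u ^ N • x := Iff.rfl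

theorem pow_smul_mem_radN (N : ℕ) (y : Y) : c.u ^ N • y ∈ c.radN Y N := ⟨y, rfl⟩

theorem u_smul_mem_radN (y : Y) : c.u • y ∈ c.radN Y 1 := ⟨y, by rw [pow_one]⟩

theorem radN_zero : c.radN Y 0 = ⊤ := by
  rw [eq_top_iff]
  rintro y -
  exact ⟨y, by simp⟩

theorem radN_anti {M N : ℕ} (h : M ≤ N) : c.radN Y N ≤ c.radN Y M := by
  rintro _ ⟨x, rfl⟩
  exact ⟨c.u ^ (N - M) • x, by rw [smul_smul, ← pow_add, Nat.add_sub_cancel' h]⟩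

theorem pow_smul_mem_radN_add {M N : ℕ} {y : Y} (hy : y ∈ c.radN Y N) :
    c.u ^ M • y ∈ c.radN Y (M + N) := by
  obtain ⟨x, rfl⟩ := hy
  exact ⟨x, by rw [smul_smul, pow_add]⟩

theorem map_mem_radN {Z : Type} [AddCommGroup Z] [Module A Z] (f : Y →ₗ[A] Z) {N : ℕ} {y : Y}
    (hy : y ∈ c.radN Y N) : f y ∈ c.radN Z N := by
  obtain ⟨x, rfl⟩ := hy
  exact ⟨f x, f.map_smul _ _⟩

theorem radN_map_equiv {Z : Type} [AddCommGroup Z] [Module A Z] (f : Y ≃ₗ[A] Z) (N : ℕ) :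
    (c.radN Y N).map (f : Y →ₗ[A] Z) = c.radN Z N := by
  ext z
  constructor
  · rintro ⟨y, hy, rfl⟩
    exact c.map_mem_radN _ hy
  · intro hz
    exact ⟨f.symm z, c.map_mem_radN (f.symm : Z →ₗ[A] Y) hz, by simp⟩

theorem radN_prod {Z : Type} [AddCommGroup Z] [Module A Z] (N : ℕ) :
    c.radN (Y × Z) N = (c.radN Y N).prod (c.radN Z N) := by
  ext ⟨y, z⟩
  constructor
  · rintro ⟨⟨a, b⟩, h⟩
    rw [Prod.smul_mk, Prod.mk.injEq] at h
    exact ⟨⟨a, h.1⟩, ⟨b, h.2⟩⟩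
  · rintro ⟨⟨a, ha⟩, ⟨b, hb⟩⟩
    exact ⟨(a, b), by rw [Prod.smul_mk]; exact Prod.ext ha hb⟩

end Hom

theorem smul_gen_mem_radN {p : ZMod n × ℕ∞} {N : ℕ} (h : (N : ℕ∞) ≤ p.2) {a : A} :
    a • c.gen p ∈ c.radN (c.C p) N ↔ c.u ^ N ∣ a * c.e p.1 := by
  constructor
  · rintro ⟨x, hx⟩
    obtain ⟨b, rfl⟩ := c.exists_smul_gen x
    rw [smul_smul, ← sub_eq_zero, ← sub_smul, smul_gen_eq_zero] at hx
    have := hx N h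
    rw [sub_mul, mul_assoc] at this
    exact (dvd_sub_left (Dvd.intro _ rfl)).1 this
  · rintro ⟨b, hb⟩
    exact ⟨b • c.gen p, by rw [← c.mul_e_smul_gen, hb, mul_smul]⟩

theorem radN_C_eq_bot {p : ZMod n × ℕ∞} {N : ℕ} (h : p.2 ≤ N) : c.radN (c.C p) N = ⊥ := by
  rw [eq_bot_iff]
  rintro _ ⟨x, rfl⟩
  obtain ⟨b, rfl⟩ := c.exists_smul_gen x
  obtain ⟨d, hd⟩ := c.pow_left_normal N b
  rw [smul_smul, hd, mul_smul, c.pow_smul_gen_eq_zero h, smul_zero]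
  exact Submodule.zero_mem _

theorem eq_zero_of_forall_mem_radN {p : ZMod n × ℕ∞} {x : c.C p}
    (h : ∀ N, x ∈ c.radN (c.C p) N) : x = 0 := by
  obtain ⟨a, rfl⟩ := c.exists_smul_gen x
  rw [smul_gen_eq_zero]
  exact fun N hN => (c.smul_gen_mem_radN hN).1 (h N)

/-- The coefficient of an element outside the radical is not divisible by `u`, hence left invertible
by `exists_left_inv`. So the radical is the only maximal submodule, which is the source of
uniseriality and of indecomposability. -/
theorem exists_smul_eq_gen {p : ZMod n × ℕ∞} {y : c.C p} (h : y ∉ c.radN (c.C p) 1) :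
    ∃ r : A, r • y = c.gen p := by
  obtain ⟨a, rfl⟩ := c.exists_smul_gen y
  have hp : ((1 : ℕ) : ℕ∞) ≤ p.2 := by
    by_contra hp
    have hp0 : p.2 = 0 := by
      rw [not_le, Nat.cast_one, Order.lt_one_iff] at hp; exact hp
    apply h
    have : a • c.gen p ∈ c.radN (c.C p) 0 := by rw [radN_zero]; trivial
    rw [c.radN_C_eq_bot (N := 0) (by simp [hp0]), Submodule.mem_bot] at this
    rw [this]; exact Submodule.zero_mem _
  rw [c.smul_gen_mem_radN hp, pow_one] at h
  obtain ⟨x, hx⟩ := c.exists_left_inv h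
  exact ⟨x, by rw [← c.mul_e_smul_gen, smul_smul, hx, c.e_smul_gen]⟩

/-- The cyclic modules are uniserial. -/
theorem submodule_C {p : ZMod n × ℕ∞} (S : Submodule A (c.C p)) :
    S = ⊥ ∨ ∃ m : ℕ, S = c.radN (c.C p) m := by
  classical
  by_cases hS : S = ⊥
  · exact Or.inl hS
  right
  -- The radical powers intersect in `0`, so a nonzero `S` leaves some radical layer; the least such
  -- `m` is the answer.
  have hex : ∃ m : ℕ, ∃ x ∈ S, x ∉ c.radN (c.C p) (m + 1) := by
    obtain ⟨x, hx, hx0⟩ := Submodule.exists_mem_ne_zero_of_ne_bot hS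
    by_contra! hcon
    apply hx0
    apply c.eq_zero_of_forall_mem_radN
    exact fun N => c.radN_anti (Nat.le_succ N) (hcon N x hx)
  obtain ⟨x, hx, hxm⟩ := Nat.find_spec hex
  have hle : S ≤ c.radN (c.C p) (Nat.find hex) := by
    intro z hz
    rcases Nat.eq_zero_or_pos (Nat.find hex) with h0 | h0
    · rw [h0, radN_zero]; trivial
    · have := Nat.find_min hex (Nat.sub_lt h0 one_pos)
      push Not at this
      rw [Nat.sub_add_cancel (show 1 ≤ Nat.find hex from h0)] at this
      exact this z hz
  refine ⟨Nat.find hex, le_antisymm hle ?_⟩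
  -- The witness is `x = u ^ m y` with `y` outside the radical. Then `y` generates the module, and
  -- normality shows that `u ^ m y` generates all of `u ^ m C`.
  obtain ⟨y, rfl⟩ := hle hx
  have hy : y ∉ c.radN (c.C p) 1 := fun hy => hxm (c.pow_smul_mem_radN_add hy)
  obtain ⟨r, hr⟩ := c.exists_smul_eq_gen hy
  rintro _ ⟨z, rfl⟩
  obtain ⟨a, rfl⟩ := c.exists_smul_gen z
  obtain ⟨d, hd⟩ := c.pow_left_normal (Nat.find hex) (a * r)
  rw [← hr, smul_smul a, smul_smul, hd, mul_smul]
  exact S.smul_mem _ hx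

/-- Multiplication by `u ^ m` on cyclic modules. -/
def shiftHom (p : ZMod n × ℕ∞) (m : ℕ) : c.C (p.1 + m, p.2 - m) →ₗ[A] c.C p :=
  c.lift (p.1 + m, p.2 - m) (c.u ^ m • c.gen p)
    (by rw [smul_smul, ← c.pow_mul_e, mul_smul, c.e_smul_gen])
    (by
      intro N hN
      rw [smul_smul, ← pow_add]
      apply c.pow_smul_gen_eq_zero
      rw [Nat.cast_add]
      exact tsub_le_iff_right.1 hN.le)

theorem shiftHom_smul_gen (p : ZMod n × ℕ∞) (m : ℕ) (a : A) :
    c.shiftHom p m (a • c.gen _) = (a * c.u ^ m) • c.gen p := by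
  rw [map_smul, shiftHom, lift_gen, smul_smul]

theorem shiftHom_injective (p : ZMod n × ℕ∞) (m : ℕ) : Function.Injective (c.shiftHom p m) := by
  rw [injective_iff_map_eq_zero]
  intro x hx
  obtain ⟨a, rfl⟩ := c.exists_smul_gen x
  rw [shiftHom_smul_gen, smul_gen_eq_zero] at hx
  rw [smul_gen_eq_zero]
  intro N hN
  rcases Nat.eq_zero_or_pos N with rfl | hN0
  · simp
  have h1 : ((N + m : ℕ) : ℕ∞) ≤ p.2 := by
    -- Subtraction is truncated: for `m > p.2` the source has length `0`, which is incompatible with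
    -- `N > 0`.
    have hm : (m : ℕ∞) ≤ p.2 := by
      by_contra hm
      have : p.2 - m = 0 := tsub_eq_zero_of_le (le_of_not_ge hm)
      simp only [this] at hN
      have : N = 0 := by simpa using hN
      omega
    rw [Nat.cast_add]
    exact (add_le_add_left hN _).trans_eq (tsub_add_cancel_of_le hm)
  have := hx _ h1
  rw [mul_assoc, c.pow_mul_e, ← mul_assoc] at this
  exact c.pow_dvd_of_dvd_mul_pow this

theorem range_shiftHom (p : ZMod n × ℕ∞) (m : ℕ) :
    LinearMap.range (c.shiftHom p m) = c.radN (c.C p) m := by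
  apply le_antisymm
  · rintro _ ⟨x, rfl⟩
    obtain ⟨a, rfl⟩ := c.exists_smul_gen x
    rw [shiftHom_smul_gen, mul_smul]
    exact Submodule.smul_mem _ _ (c.pow_smul_mem_radN m _)
  · rintro _ ⟨x, rfl⟩
    obtain ⟨a, rfl⟩ := c.exists_smul_gen x
    obtain ⟨d, hd⟩ := c.pow_left_normal m a
    exact ⟨d • c.gen _, by rw [shiftHom_smul_gen, smul_smul, hd]⟩

/-- `u ^ m C(k, j)` is `C(k + m, j - m)`. -/
def radEquiv (p : ZMod n × ℕ∞) (m : ℕ) : c.radN (c.C p) m ≃ₗ[A] c.C (p.1 + m, p.2 - m) :=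
  ((LinearEquiv.ofInjective _ (c.shiftHom_injective p m)).trans
    (LinearEquiv.ofEq _ _ (c.range_shiftHom p m))).symm

/-- The projection from `C(k, j)` to `C(k, m)`. -/
def projHom (p : ZMod n × ℕ∞) (m : ℕ) (h : (m : ℕ∞) ≤ p.2) : c.C p →ₗ[A] c.C (p.1, m) :=
  c.lift p (c.gen (p.1, m)) (c.e_smul_gen (p.1, (m : ℕ∞)))
    fun N hN => c.pow_smul_gen_eq_zero (by simpa [hN] using h)

theorem projHom_surjective (p : ZMod n × ℕ∞) (m : ℕ) (h : (m : ℕ∞) ≤ p.2) :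
    Function.Surjective (c.projHom p m h) := by
  intro x
  obtain ⟨a, rfl⟩ := c.exists_smul_gen x
  exact ⟨a • c.gen p, by rw [map_smul, projHom, lift_gen]⟩

theorem ker_projHom (p : ZMod n × ℕ∞) (m : ℕ) (h : (m : ℕ∞) ≤ p.2) :
    LinearMap.ker (c.projHom p m h) = c.radN (c.C p) m := by
  ext x
  obtain ⟨a, rfl⟩ := c.exists_smul_gen x
  rw [LinearMap.mem_ker, map_smul, projHom, lift_gen, c.smul_gen_mem_radN h, smul_gen_eq_zero]
  constructor
  · exact fun H => H m le_rfl
  · intro H N hN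
    exact (pow_dvd_pow _ (Nat.cast_le.1 hN)).trans H

/-- `C(k, j) / u ^ m` is `C(k, m)` for `m ≤ j`. -/
def quotRadEquiv (p : ZMod n × ℕ∞) (m : ℕ) (h : (m : ℕ∞) ≤ p.2) :
    (c.C p ⧸ c.radN (c.C p) m) ≃ₗ[A] c.C (p.1, m) :=
  (Submodule.quotEquivOfEq _ _ (c.ker_projHom p m h).symm).trans
    ((c.projHom p m h).quotKerEquivOfSurjective (c.projHom_surjective p m h))

theorem card_C_one (k : ZMod n) : Nat.card (c.C (k, 1)) = c.q := by
  obtain ⟨F, _, f, hf, hker, hcard⟩ := c.residue k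
  rw [← hcard]
  have : (c.I (k, 1)).toAddSubgroup = f.ker := by
    ext a
    rw [Submodule.mem_toAddSubgroup, mem_I, AddMonoidHom.mem_ker, hker]
    constructor
    · intro h
      simpa using h 1 (by simp)
    · intro h N hN
      have : N ≤ 1 := Nat.cast_le.1 (hN.trans_eq Nat.cast_one.symm)
      interval_cases N
      · simp
      · simpa using h
  have e1 : (A ⧸ (c.I (k, 1)).toAddSubgroup) ≃ (A ⧸ f.ker) := by rw [this]
  exact Nat.card_congr (e1.trans (QuotientAddGroup.quotientKerEquivOfSurjective f hf).toEquiv)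

theorem subsingleton_C_zero (k : ZMod n) : Subsingleton (c.C (k, 0)) := by
  have := c.radN_C_eq_bot (p := (k, 0)) (N := 0) (by simp)
  rw [radN_zero] at this
  exact (Submodule.subsingleton_iff A).1 (subsingleton_of_bot_eq_top this.symm)

/-- Equal indices give isomorphic cyclic modules. -/
def congrC {p p' : ZMod n × ℕ∞} (h : p = p') : c.C p ≃ₗ[A] c.C p' :=
  Submodule.quotEquivOfEq _ _ (congrArg c.I h)

/-- The radical of a cyclic module of finite length. -/
def radEquivNat (k : ZMod n) (N : ℕ) :
    c.radN (c.C (k, (N + 1 : ℕ))) 1 ≃ₗ[A] c.C (k + 1, (N : ℕ∞)) :=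
  (c.radEquiv _ 1).trans (c.congrC (by
    have h : ((N + 1 : ℕ) : ℕ∞) - (1 : ℕ) = (N : ℕ∞) := by
      rw [← ENat.natCast_sub, Nat.add_sub_cancel]
    exact Prod.ext (by simp) h))

/-- The top of a cyclic module. -/
def topEquiv (p : ZMod n × ℕ∞) (h : p.2 ≠ 0) :
    (c.C p ⧸ c.radN (c.C p) 1) ≃ₗ[A] c.C (p.1, 1) :=
  (c.quotRadEquiv p 1 (by simpa using Order.one_le_iff_ne_zero.2 h)).trans (c.congrC (by simp))

theorem card_C (N : ℕ) (k : ZMod n) : Nat.card (c.C (k, N)) = c.q ^ N := by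
  induction N generalizing k with
  | zero =>
    have : Subsingleton (c.C (k, (0 : ℕ))) := c.subsingleton_C_zero k
    have : Nonempty (c.C (k, (0 : ℕ))) := ⟨c.gen _⟩
    rw [pow_zero, Nat.card_eq_one_iff_unique]
    exact ⟨inferInstance, inferInstance⟩
  | succ N ih =>
    rw [Submodule.card_eq_card_quotient_mul_card (c.radN (c.C (k, (N + 1 : ℕ))) 1),
      Nat.card_congr (c.radEquivNat k N).toEquiv,
      Nat.card_congr (c.topEquiv (k, (N + 1 : ℕ)) (by simp)).toEquiv, pow_succ, ih, c.card_C_one,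
      mul_comm]

theorem finite_C (N : ℕ) (k : ZMod n) : Finite (c.C (k, N)) := by
  apply Nat.finite_of_card_ne_zero
  rw [card_C]
  exact pow_ne_zero _ (by have := c.one_lt_q; omega)

theorem nontrivial_C_one (k : ZMod n) : Nontrivial (c.C (k, 1)) := by
  have h := c.card_C_one k
  have := c.one_lt_q
  have : Finite (c.C (k, 1)) := Nat.finite_of_card_ne_zero (by omega)
  rw [← Finite.one_lt_card_iff_nontrivial]
  omega

theorem isSimpleModule_C_one (k : ZMod n) : IsSimpleModule A (c.C (k, 1)) := by
  have := c.nontrivial_C_one k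
  rw [isSimpleModule_iff]
  refine { exists_pair_ne := ⟨⊥, ⊤, bot_ne_top⟩, eq_bot_or_eq_top := fun S => ?_ }
  rcases c.submodule_C S with h | ⟨m, rfl⟩
  · exact Or.inl h
  · rcases Nat.eq_zero_or_pos m with rfl | hm
    · exact Or.inr c.radN_zero
    · exact Or.inl (c.radN_C_eq_bot (by simpa using Nat.one_le_iff_ne_zero.2 hm.ne'))

theorem length_C (N : ℕ) (k : ZMod n) : Module.length A (c.C (k, N)) = N := by
  induction N generalizing k with
  | zero =>
    have : Subsingleton (c.C (k, (0 : ℕ))) := c.subsingleton_C_zero k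
    rw [Module.length_eq_zero, Nat.cast_zero]
  | succ N ih =>
    have := c.isSimpleModule_C_one k
    rw [Module.length_eq_add_of_exact (c.radN (c.C (k, (N + 1 : ℕ))) 1).subtype
      (c.radN (c.C (k, (N + 1 : ℕ))) 1).mkQ Subtype.val_injective (Submodule.mkQ_surjective _)
      (LinearMap.exact_subtype_mkQ _), (c.radEquivNat k N).length_eq,
      (c.topEquiv (k, (N + 1 : ℕ)) (by simp)).length_eq, ih, Module.length_eq_one, Nat.cast_succ]

end CycRing

end IyamaHall
end

noncomputable section
namespace IyamaHall

/-! ### Products of submodules -/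

section ProdSub

variable {A Y Z : Type} [Ring A] [AddCommGroup Y] [Module A Y] [AddCommGroup Z] [Module A Z]

/-- A product of submodules is the product of the modules. -/
def prodSubEquiv (S : Submodule A Y) (T : Submodule A Z) : S.prod T ≃ₗ[A] S × T where
  toFun x := (⟨x.1.1, x.2.1⟩, ⟨x.1.2, x.2.2⟩)
  invFun x := ⟨(x.1.1, x.2.1), ⟨x.1.2, x.2.2⟩⟩
  map_add' _ _ := rfl
  map_smul' _ _ := rfl
  left_inv _ := rfl
  right_inv _ := rfl

/-- The quotient by a product of submodules is the product of the quotients. -/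
def prodQuotEquiv (S : Submodule A Y) (T : Submodule A Z) :
    ((Y × Z) ⧸ S.prod T) ≃ₗ[A] (Y ⧸ S) × (Z ⧸ T) :=
  (Submodule.quotEquivOfEq _ _ (by
    ext ⟨y, z⟩
    simp [Submodule.mem_prod])).trans
  ((S.mkQ.prodMap T.mkQ).quotKerEquivOfSurjective
    (Prod.map_surjective.2 ⟨S.mkQ_surjective, T.mkQ_surjective⟩))

end ProdSub

namespace CycRing

variable {n : ℕ} [NeZero n] {A : Type} [Ring A] (c : CycRing n A)

/-! ### Types of modules -/

/-- The direct sum of the cyclic modules given by a list. -/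
def Md : List (ZMod n × ℕ∞) → ModuleCat.{0} A
  | [] => ModuleCat.of A PUnit
  | p :: l => ModuleCat.of A (c.C p × Md l)

instance : Subsingleton (c.Md []) := inferInstanceAs (Subsingleton PUnit)

/-- The model of a nonempty list is a product. -/
def MdCons (p : ZMod n × ℕ∞) (l : List (ZMod n × ℕ∞)) : c.Md (p :: l) ≃ₗ[A] c.C p × c.Md l :=
  LinearEquiv.refl A (c.C p × c.Md l)

theorem Md_perm {l l' : List (ZMod n × ℕ∞)} (h : l.Perm l') :
    Nonempty (c.Md l ≃ₗ[A] c.Md l') := by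
  induction h with
  | nil => exact ⟨LinearEquiv.refl _ _⟩
  | cons p _ ih =>
    obtain ⟨f⟩ := ih
    exact ⟨(c.MdCons _ _).trans (((LinearEquiv.refl A _).prodCongr f).trans (c.MdCons _ _).symm)⟩
  | swap p p' l =>
    let f : ∀ p p', c.Md (p :: p' :: l) ≃ₗ[A] c.C p × c.C p' × c.Md l := fun p p' =>
      (c.MdCons _ _).trans ((LinearEquiv.refl A _).prodCongr (c.MdCons _ _))
    exact ⟨(f p' p).trans <| (LinearEquiv.prodAssoc A _ _ _).symm.trans <|
      ((LinearEquiv.prodComm A _ _).prodCongr (LinearEquiv.refl A _)).trans <|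
      (LinearEquiv.prodAssoc A _ _ _).trans (f p p').symm⟩
  | trans _ _ h1 h2 =>
    obtain ⟨f⟩ := h1
    obtain ⟨g⟩ := h2
    exact ⟨f.trans g⟩

/-- `Y` is the direct sum of the modules `C p` for `p` in the multiset `t`. -/
structure HasType (t : Multiset (ZMod n × ℕ∞)) (Y : Type) [AddCommGroup Y] [Module A Y] :
    Prop where
  -- Pairs of length `0` describe zero modules and would destroy the uniqueness of the type.
  ne_zero : ∀ p ∈ t, p.2 ≠ 0
  equiv : ∃ l : List (ZMod n × ℕ∞), (l : Multiset (ZMod n × ℕ∞)) = t ∧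
    Nonempty (Y ≃ₗ[A] c.Md l)

variable {Y Z : Type} [AddCommGroup Y] [Module A Y] [AddCommGroup Z] [Module A Z]
  {t s : Multiset (ZMod n × ℕ∞)}

variable {c}

theorem HasType.congr (h : c.HasType t Y) (f : Y ≃ₗ[A] Z) : c.HasType t Z := by
  obtain ⟨h0, l, hl, ⟨g⟩⟩ := h
  exact ⟨h0, l, hl, ⟨f.symm.trans g⟩⟩

theorem HasType.nonempty_equiv (h : c.HasType t Y) (h' : c.HasType t Z) :
    Nonempty (Y ≃ₗ[A] Z) := by
  obtain ⟨_, l, hl, ⟨f⟩⟩ := h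
  obtain ⟨_, l', hl', ⟨g⟩⟩ := h'
  obtain ⟨e⟩ := c.Md_perm (Multiset.coe_eq_coe.1 (hl.trans hl'.symm))
  exact ⟨f.trans (e.trans g.symm)⟩

theorem hasType_zero [Subsingleton Y] : c.HasType 0 Y :=
  ⟨by simp, [], rfl, ⟨LinearEquiv.ofSubsingleton _ _⟩⟩

theorem HasType.subsingleton (h : c.HasType 0 Y) : Subsingleton Y := by
  obtain ⟨_, l, hl, ⟨f⟩⟩ := h
  rw [Multiset.coe_eq_zero] at hl
  subst hl
  exact f.injective.subsingleton

theorem HasType.cons {p : ZMod n × ℕ∞} (hp : p.2 ≠ 0) (h : c.HasType t Y) :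
    c.HasType (p ::ₘ t) (c.C p × Y) := by
  obtain ⟨h0, l, hl, ⟨f⟩⟩ := h
  refine ⟨?_, p :: l, by rw [← hl]; rfl,
    ⟨((LinearEquiv.refl A _).prodCongr f).trans (c.MdCons _ _).symm⟩⟩
  intro p' hp'
  rcases Multiset.mem_cons.1 hp' with rfl | h
  · exact hp
  · exact h0 _ h

theorem HasType.exists_cons {p : ZMod n × ℕ∞} (h : c.HasType (p ::ₘ t) Y) :
    ∃ Y' : ModuleCat.{0} A, c.HasType t Y' ∧ Nonempty (Y ≃ₗ[A] c.C p × Y') := by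
  obtain ⟨h0, l, hl, ⟨f⟩⟩ := h
  obtain ⟨l', rfl⟩ := Quot.exists_rep t
  obtain ⟨g⟩ := c.Md_perm (l := l) (l' := p :: l') (Multiset.coe_eq_coe.1 hl)
  exact ⟨c.Md l', ⟨fun p' hp' => h0 _ (Multiset.mem_cons_of_mem hp'), l', rfl,
    ⟨LinearEquiv.refl _ _⟩⟩, ⟨(f.trans g).trans (c.MdCons _ _)⟩⟩

theorem hasType_C {p : ZMod n × ℕ∞} (hp : p.2 ≠ 0) : c.HasType {p} (c.C p) :=
  (HasType.cons hp (hasType_zero (Y := PUnit))).congr LinearEquiv.prodUnique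

variable (c) in
theorem hasType_Md (l : List (ZMod n × ℕ∞)) (hl : ∀ p ∈ (l : Multiset (ZMod n × ℕ∞)), p.2 ≠ 0) :
    c.HasType l (c.Md l) := ⟨hl, l, rfl, ⟨LinearEquiv.refl _ _⟩⟩

theorem exists_hasType (t : Multiset (ZMod n × ℕ∞)) (ht : ∀ p ∈ t, p.2 ≠ 0) :
    ∃ Y : ModuleCat.{0} A, c.HasType t Y := by
  obtain ⟨l, rfl⟩ := Quot.exists_rep t
  exact ⟨c.Md l, ht, l, rfl, ⟨LinearEquiv.refl _ _⟩⟩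

theorem HasType.prod (h : c.HasType t Y) (h' : c.HasType s Z) : c.HasType (t + s) (Y × Z) := by
  induction t using Multiset.induction generalizing Y with
  | empty =>
    have := h.subsingleton
    let _ : Unique Y := { default := 0, uniq := fun _ => Subsingleton.elim _ _ }
    rw [zero_add]
    exact h'.congr LinearEquiv.uniqueProd.symm
  | cons p t ih =>
    obtain ⟨Y', hY', ⟨f⟩⟩ := h.exists_cons
    rw [Multiset.cons_add]
    exact ((ih hY').cons (h.ne_zero p (Multiset.mem_cons_self _ _))).congr
      ((LinearEquiv.prodAssoc A _ _ _).symm.trans (f.symm.prodCongr (LinearEquiv.refl A Z)))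

/-! ### Radicals and tops -/

/-- The type of `u ^ m C(p)`. -/
def sh (m : ℕ) (p : ZMod n × ℕ∞) : Multiset (ZMod n × ℕ∞) :=
  if p.2 ≤ m then 0 else {(p.1 + m, p.2 - m)}

theorem hasType_sh (m : ℕ) (p : ZMod n × ℕ∞) : c.HasType (sh m p) (c.radN (c.C p) m) := by
  unfold sh
  split_ifs with h
  · rw [c.radN_C_eq_bot h]
    exact hasType_zero
  · refine (hasType_C ?_).congr (c.radEquiv p m).symm
    exact (tsub_pos_of_lt (not_le.1 h)).ne'

theorem HasType.radN (h : c.HasType t Y) (m : ℕ) :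
    c.HasType (t.bind (sh m)) (c.radN Y m) := by
  induction t using Multiset.induction generalizing Y with
  | empty =>
    have := h.subsingleton
    exact hasType_zero
  | cons p t ih =>
    obtain ⟨Y', hY', ⟨f⟩⟩ := h.exists_cons
    rw [Multiset.cons_bind]
    refine ((hasType_sh m p).prod (ih hY')).congr ?_
    have e1 : c.radN Y m ≃ₗ[A] c.radN (c.C p × Y') m :=
      (f.submoduleMap (c.radN Y m)).trans (LinearEquiv.ofEq _ _ (c.radN_map_equiv f m))
    have e2 : c.radN (c.C p × Y') m ≃ₗ[A] c.radN (c.C p) m × c.radN Y' m :=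
      (LinearEquiv.ofEq _ _ (c.radN_prod m)).trans (prodSubEquiv _ _)
    exact e2.symm.trans e1.symm

/-- The quotient by the radical of isomorphic modules. -/
def quotRadCongr (c : CycRing n A) (f : Y ≃ₗ[A] Z) (m : ℕ) :
    (Y ⧸ c.radN Y m) ≃ₗ[A] Z ⧸ c.radN Z m :=
  Submodule.Quotient.equiv _ _ f (c.radN_map_equiv f m)

theorem HasType.top (h : c.HasType t Y) :
    c.HasType (t.map fun p => (p.1, 1)) (Y ⧸ c.radN Y 1) := by
  induction t using Multiset.induction generalizing Y with
  | empty =>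
    have := h.subsingleton
    exact hasType_zero
  | cons p t ih =>
    obtain ⟨Y', hY', ⟨f⟩⟩ := h.exists_cons
    rw [Multiset.map_cons, ← Multiset.singleton_add]
    refine (((hasType_C (c := c) (p := (p.1, 1)) one_ne_zero).congr (c.topEquiv p (h.ne_zero p
      (Multiset.mem_cons_self _ _))).symm).prod (ih hY')).congr ?_
    have e2 : ((c.C p × Y') ⧸ c.radN (c.C p × Y') 1) ≃ₗ[A]
        (c.C p ⧸ c.radN (c.C p) 1) × (Y' ⧸ c.radN Y' 1) :=
      (Submodule.quotEquivOfEq _ _ (c.radN_prod 1)).trans (prodQuotEquiv _ _)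
    exact e2.symm.trans (c.quotRadCongr f 1).symm

/-! ### Uniqueness of the type -/

/-- The off-diagonal corners are divisible by `u`, and `u` kills a simple module. So `e k` acts as
the identity on the simple module with top `k`, and the other idempotents act as zero. -/
theorem e_smul_C_one (k : ZMod n) (z : c.C (k, 1)) : c.e k • z = z := by
  obtain ⟨a, rfl⟩ := c.exists_smul_gen z
  rw [smul_smul, ← sub_eq_zero, ← sub_smul, smul_gen_eq_zero]
  intro N hN
  have hN : N ≤ 1 := Nat.cast_le.1 (hN.trans_eq Nat.cast_one.symm)
  interval_cases N
  · simp
  rw [pow_one]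
  have h1 : (c.e k * a - a) * c.e k = - ∑ i ∈ Finset.univ.erase k, c.e i * a * c.e k := by
    have h2 : c.e k * a * c.e k + ∑ i ∈ Finset.univ.erase k, c.e i * a * c.e k = a * c.e k := by
      rw [Finset.add_sum_erase _ (fun i => c.e i * a * c.e k) (Finset.mem_univ k),
        ← Finset.sum_mul, ← Finset.sum_mul, c.sum_e, one_mul]
    rw [sub_mul, ← h2]
    abel
  rw [h1]
  exact (Finset.dvd_sum fun i hi => c.dvd_off i k a (Finset.ne_of_mem_erase hi)).neg_right

/-- Homomorphisms from a cyclic module to a module killed by `u`. -/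
def homEquivOfRad (c : CycRing n A) {p : ZMod n × ℕ∞} (hp : p.2 ≠ 0) (hZ : ∀ z : Z, c.u • z = 0) :
    (c.C p →ₗ[A] Z) ≃ {z : Z // c.e p.1 • z = z} where
  toFun f := ⟨f (c.gen p), by rw [← f.map_smul, e_smul_gen]⟩
  invFun z := c.lift p z.1 z.2 (by
    intro N hN
    obtain ⟨M, rfl⟩ := Nat.exists_eq_succ_of_ne_zero (n := N) (by rintro rfl; exact hp hN)
    rw [Nat.succ_eq_add_one, pow_succ, mul_smul, hZ, smul_zero])
  left_inv f := c.hom_ext (by simp)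
  right_inv z := by simp

theorem u_smul_C_one (k : ZMod n) (z : c.C (k, 1)) : c.u • z = 0 := by
  have := c.u_smul_mem_radN z
  rwa [c.radN_C_eq_bot (p := (k, 1)) (N := 1) (by simp), Submodule.mem_bot] at this

theorem card_hom_C {p : ZMod n × ℕ∞} (hp : p.2 ≠ 0) (k : ZMod n) :
    Nat.card (c.C p →ₗ[A] c.C (k, 1)) = if p.1 = k then c.q else 1 := by
  rw [Nat.card_congr (c.homEquivOfRad hp (u_smul_C_one k))]
  split_ifs with h
  · rw [← c.card_C_one k]
    exact Nat.card_congr (Equiv.subtypeUnivEquiv fun z => by rw [h, e_smul_C_one])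
  · rw [Nat.card_eq_one_iff_unique]
    refine ⟨⟨fun z w => Subtype.ext ?_⟩, ⟨⟨0, smul_zero _⟩⟩⟩
    have key : ∀ z : {z : c.C (k, 1) // c.e p.1 • z = z}, z.1 = 0 := by
      intro z
      rw [← z.2, ← e_smul_C_one k z.1, smul_smul, c.e_mul_ne _ _ h, zero_smul]
    rw [key, key]

/-- The left side does not mention the decomposition of `Y`. Hence the number of summands with a
given top is an invariant, the first step towards uniqueness of the type. -/
theorem HasType.card_hom (h : c.HasType t Y) (k : ZMod n) :
    Nat.card (Y →ₗ[A] c.C (k, 1)) = c.q ^ t.countP (fun p => p.1 = k) := by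
  induction t using Multiset.induction generalizing Y with
  | empty =>
    have := h.subsingleton
    rw [Multiset.countP_zero, pow_zero, Nat.card_eq_one_iff_unique]
    exact ⟨inferInstance, inferInstance⟩
  | cons p t ih =>
    obtain ⟨Y', hY', ⟨f⟩⟩ := h.exists_cons
    rw [Nat.card_congr (LinearEquiv.congrLeft (c.C (k, 1)) ℕ f).toEquiv,
      Nat.card_congr (LinearMap.coprodEquiv ℕ).symm.toEquiv, Nat.card_prod, ih hY',
      card_hom_C (h.ne_zero p (Multiset.mem_cons_self _ _)), Multiset.countP_cons, pow_add, mul_comm]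
    split_ifs <;> simp

theorem HasType.countP_eq (h : c.HasType t Y) (h' : c.HasType s Y) (k : ZMod n) :
    t.countP (fun p => p.1 = k) = s.countP (fun p => p.1 = k) :=
  Nat.pow_right_injective c.one_lt_q ((h.card_hom k).symm.trans (h'.card_hom k))

/-- Passing to `u ^ m Y` deletes the summands of length at most `m` and moves the tops of the others
by `m`. The tops of `u ^ m Y` therefore count the longer summands of `Y`. -/
theorem countP_bind_sh (t : Multiset (ZMod n × ℕ∞)) (m : ℕ) (k : ZMod n) :
    (t.bind (sh m)).countP (fun p => p.1 = k + m) =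
      t.countP (fun p => p.1 = k ∧ (m : ℕ∞) < p.2) := by
  induction t using Multiset.induction with
  | empty => simp
  | cons p t ih =>
    rw [Multiset.cons_bind, Multiset.countP_add, ih, Multiset.countP_cons, add_comm]
    congr 1
    unfold sh
    by_cases h : p.2 ≤ m
    · simp [h]
    · rw [if_neg h, ← Multiset.cons_zero, Multiset.countP_cons, Multiset.countP_zero]
      simp [not_le.1 h]

/-- The multiplicity of a finite length is the difference of two consecutive tail counts. The
multiplicity of the infinite length is the tail count beyond a bound `M` for all finite lengths that
occur. -/
theorem ext_of_countP (ht : ∀ p ∈ t, p.2 ≠ 0) (hs : ∀ p ∈ s, p.2 ≠ 0)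
    (h : ∀ (k : ZMod n) (m : ℕ), t.countP (fun p => p.1 = k ∧ (m : ℕ∞) < p.2) =
      s.countP (fun p => p.1 = k ∧ (m : ℕ∞) < p.2)) : t = s := by
  classical
  ext ⟨k, j⟩
  induction j using ENat.recTopCoe with
  | top =>
    obtain ⟨M, hM⟩ : ∃ M : ℕ, ∀ p ∈ t + s, p.2 ≠ ⊤ → p.2 ≤ M := by
      generalize t + s = r
      induction r using Multiset.induction with
      | empty => exact ⟨0, by simp⟩
      | cons p r ih =>
        obtain ⟨M, hM⟩ := ih
        refine ⟨max M p.2.toNat, fun p' hp' hpt => ?_⟩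
        rcases Multiset.mem_cons.1 hp' with rfl | hp'
        · rw [← ENat.natCast_toNat hpt]
          exact Nat.cast_le.2 (le_max_right _ _)
        · exact (hM p' hp' hpt).trans (Nat.cast_le.2 (le_max_left _ _))
    have key : ∀ r : Multiset (ZMod n × ℕ∞), (∀ p ∈ r, p.2 ≠ ⊤ → p.2 ≤ M) →
        r.count (k, ⊤) = r.countP (fun p => p.1 = k ∧ (M : ℕ∞) < p.2) := by
      intro r hr
      unfold Multiset.count
      apply Multiset.countP_congr rfl
      intro p hp
      rw [eq_iff_iff]
      constructor
      · rintro rfl; simp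
      · rintro ⟨h1, h2⟩
        have : p.2 = ⊤ := by
          by_contra h3
          exact absurd (hr p hp h3) (not_le.2 h2)
        rw [← h1, ← this]
    rw [key t fun p hp => hM p (Multiset.mem_add.2 (Or.inl hp)),
      key s fun p hp => hM p (Multiset.mem_add.2 (Or.inr hp)), h]
  | coe N =>
    rcases N with _ | N
    · rw [Multiset.count_eq_zero_of_notMem fun h => ht _ h rfl,
        Multiset.count_eq_zero_of_notMem fun h => hs _ h rfl]
    have key : ∀ r : Multiset (ZMod n × ℕ∞), r.count (k, ((N + 1 : ℕ) : ℕ∞)) +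
        r.countP (fun p => p.1 = k ∧ ((N + 1 : ℕ) : ℕ∞) < p.2) =
        r.countP (fun p => p.1 = k ∧ (N : ℕ∞) < p.2) := by
      intro r
      induction r using Multiset.induction with
      | empty => simp
      | cons p r ih =>
        rw [Multiset.count_cons, Multiset.countP_cons, Multiset.countP_cons, ← ih]
        have : ((if (k, ((N + 1 : ℕ) : ℕ∞)) = p then 1 else 0) +
            if p.1 = k ∧ ((N + 1 : ℕ) : ℕ∞) < p.2 then 1 else 0) =
            if p.1 = k ∧ (N : ℕ∞) < p.2 then 1 else 0 := by
          obtain ⟨i, j⟩ := p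
          have h3 : (N : ℕ∞) < j ↔ (((N + 1 : ℕ) : ℕ∞) = j ∨ ((N + 1 : ℕ) : ℕ∞) < j) := by
            rw [← le_iff_eq_or_lt, Nat.cast_succ, Order.add_one_le_iff_of_not_isMax]
            simp
          generalize ((N + 1 : ℕ) : ℕ∞) = a at h3
          simp only [Prod.mk.injEq, h3]
          by_cases hi : i = k
          · by_cases hj : a = j
            · simp [hi, hj]
            · simp [hi, hj]
          · simp [hi, Ne.symm hi]
        omega
    have h1 := key t
    have h2 := key s
    rw [h, h] at h1
    omega

/-- The theorem of Krull and Schmidt for the modules under consideration. -/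
theorem HasType.unique (h : c.HasType t Y) (h' : c.HasType s Y) : t = s := by
  refine ext_of_countP h.ne_zero h'.ne_zero fun k m => ?_
  rw [← countP_bind_sh, ← countP_bind_sh]
  exact (h.radN m).countP_eq (h'.radN m) _

end CycRing

end IyamaHall
end

noncomputable section
namespace IyamaHall
namespace CycRing

variable {n : ℕ} [NeZero n] {A : Type} [Ring A] {c : CycRing n A}
variable {Y Z : Type} [AddCommGroup Y] [Module A Y] [AddCommGroup Z] [Module A Z]
  {t s r : Multiset (ZMod n × ℕ∞)}

/-! ### Submodules of given type with quotient of given type -/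

variable (c) in
/-- The submodules of `Y` of type `t` with quotient of type `s`. -/
def hT (s : Multiset (ZMod n × ℕ∞)) (Y : Type) [AddCommGroup Y] [Module A Y]
    (t : Multiset (ZMod n × ℕ∞)) : Set (Submodule A Y) :=
  {W | c.HasType t W ∧ c.HasType s (Y ⧸ W)}

theorem hT_congr (f : Y ≃ₗ[A] Z) :
    c.hT s Z t = Submodule.map (f : Y →ₗ[A] Z) '' c.hT s Y t := by
  have key : ∀ {Y Z : Type} [AddCommGroup Y] [Module A Y] [AddCommGroup Z] [Module A Z]
      (f : Y ≃ₗ[A] Z), ∀ W ∈ c.hT s Y t, W.map (f : Y →ₗ[A] Z) ∈ c.hT s Z t :=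
    fun f W hW => ⟨hW.1.congr (f.submoduleMap W), hW.2.congr (Submodule.Quotient.equiv _ _ f rfl)⟩
  ext W
  constructor
  · intro hW
    refine ⟨_, key f.symm W hW, ?_⟩
    rw [← Submodule.map_comp]
    simp
  · rintro ⟨W, hW, rfl⟩
    exact key f W hW

theorem ncard_hT_congr (f : Y ≃ₗ[A] Z) : (c.hT s Z t).ncard = (c.hT s Y t).ncard := by
  rw [hT_congr f]
  exact Set.ncard_image_of_injective _ (Submodule.map_injective_of_injective f.injective)

theorem finite_hT_congr (f : Y ≃ₗ[A] Z) (h : (c.hT s Y t).Finite) : (c.hT s Z t).Finite := by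
  rw [hT_congr f]
  exact h.image _

theorem HasType.pow_smul_eq_zero {N : ℕ} (h : c.HasType t Y) (ht : ∀ p ∈ t, p.2 ≤ N) (y : Y) :
    c.u ^ N • y = 0 := by
  have h1 := h.radN N
  have h2 : t.bind (sh N) = 0 := by
    rw [Multiset.eq_zero_iff_forall_notMem]
    intro p hp
    obtain ⟨p', hp', h3⟩ := Multiset.mem_bind.1 hp
    rw [sh, if_pos (ht p' hp')] at h3
    simp at h3
  rw [h2] at h1
  have := h1.subsingleton
  have h4 := Subsingleton.elim (⟨_, c.pow_smul_mem_radN N y⟩ : c.radN Y N) 0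
  exact congrArg Subtype.val h4

theorem radN_le_of_quotient {N : ℕ} {W : Submodule A Y} (h : ∀ y : Y ⧸ W, c.u ^ N • y = 0) :
    c.radN Y N ≤ W := by
  rintro _ ⟨x, rfl⟩
  rw [← Submodule.Quotient.mk_eq_zero, Submodule.Quotient.mk_smul]
  exact h _

/-- `s` is the type of a semisimple module. -/
def Semisimple (s : Multiset (ZMod n × ℕ∞)) : Prop := ∀ p ∈ s, p.2 = 1

theorem HasType.u_smul (h : c.HasType s Y) (hs : Semisimple s) (y : Y) : c.u • y = 0 := by
  simpa using h.pow_smul_eq_zero (N := 1) (fun p hp => by simp [hs p hp]) y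

theorem HasType.card_hom_semisimple (h : c.HasType s Y) (hs : Semisimple s)
    {p : ZMod n × ℕ∞} (hp : p.2 ≠ 0) :
    Nat.card (c.C p →ₗ[A] Y) = c.q ^ s.countP (fun p' => p'.1 = p.1) := by
  induction s using Multiset.induction generalizing Y with
  | empty =>
    have := h.subsingleton
    rw [Multiset.countP_zero, pow_zero, Nat.card_eq_one_iff_unique]
    exact ⟨inferInstance, inferInstance⟩
  | cons p' t ih =>
    obtain ⟨Y', hY', ⟨f⟩⟩ := h.exists_cons
    obtain ⟨k, j⟩ := p'
    obtain rfl : j = 1 := hs (k, j) (Multiset.mem_cons_self _ _)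
    rw [Nat.card_congr (LinearEquiv.arrowCongrAddEquiv (LinearEquiv.refl A (c.C p)) f).toEquiv,
      Nat.card_congr (LinearMap.prodEquiv ℕ).symm.toEquiv, Nat.card_prod,
      ih hY' (fun p hp => hs p (Multiset.mem_cons_of_mem hp)),
      card_hom_C hp, Multiset.countP_cons, pow_add, mul_comm]
    congr 1
    simp only [eq_comm]
    split_ifs <;> simp

/-! ### Splitting off a summand of maximal length -/

section Split

variable {p : ZMod n × ℕ∞}

theorem gen_notMem_radN_one (hp : p.2 ≠ 0) : c.gen p ∉ c.radN (c.C p) 1 := by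
  intro h
  have h1 : c.radN (c.C p) 1 = ⊤ := by
    rw [eq_top_iff]
    rintro x -
    obtain ⟨a, rfl⟩ := c.exists_smul_gen x
    exact Submodule.smul_mem _ a h
  have := Submodule.Quotient.subsingleton_iff.2 h1
  have := (c.topEquiv p hp).symm.injective.subsingleton
  have := c.nontrivial_C_one p.1
  exact not_subsingleton (c.C (p.1, 1)) inferInstance

/-- The submodule of pairs `(x, y)` with `y ≡ g x` modulo `W`. -/
def graphSub (W : Submodule A Z) (g : Y →ₗ[A] Z ⧸ W) : Submodule A (Y × Z) :=
  LinearMap.ker (W.mkQ.comp (LinearMap.snd A Y Z) - g.comp (LinearMap.fst A Y Z))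

theorem mem_graphSub {W : Submodule A Z} {g : Y →ₗ[A] Z ⧸ W} {x : Y × Z} :
    x ∈ graphSub W g ↔ W.mkQ x.2 = g x.1 := by
  simp [graphSub, sub_eq_zero]

/-- The quotient by `graphSub`. -/
def quotGraphSub (W : Submodule A Z) (g : Y →ₗ[A] Z ⧸ W) :
    ((Y × Z) ⧸ graphSub W g) ≃ₗ[A] Z ⧸ W :=
  LinearMap.quotKerEquivOfSurjective _ (by
    intro z
    obtain ⟨z, rfl⟩ := W.mkQ_surjective z
    exact ⟨(0, z), by simp⟩)

/-- If `g` lifts, then the graph is a product. -/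
def graphSubEquiv (W : Submodule A Z) (f : Y →ₗ[A] Z) :
    graphSub W (W.mkQ.comp f) ≃ₗ[A] Y × W where
  toFun x := (x.1.1, ⟨x.1.2 - f x.1.1, by
    rw [← Submodule.Quotient.mk_eq_zero, Submodule.Quotient.mk_sub, sub_eq_zero]
    exact mem_graphSub.1 x.2⟩)
  invFun x := ⟨(x.1, x.2.1 + f x.1), mem_graphSub.2 (by simp)⟩
  map_add' x y := by
    refine Prod.ext rfl (Subtype.ext ?_)
    simp only [Submodule.coe_add, Prod.fst_add, Prod.snd_add, map_add]
    abel
  map_smul' a x := by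
    refine Prod.ext rfl (Subtype.ext ?_)
    simp [smul_sub]
  left_inv x := by simp
  right_inv x := by simp

/-- A representative of the image of the generator becomes an admissible image in `Z` after
multiplication by the idempotent, because `hY` provides the relation `u ^ N z = 0`. Thus a cyclic
module at least as long as every summand of `Z` behaves like a projective module relative to `Z`;
for this reason a longest summand is always split off. -/
theorem exists_lift_C (hY : ∀ N : ℕ, p.2 = N → ∀ z : Z, c.u ^ N • z = 0) {W : Submodule A Z}
    (g : c.C p →ₗ[A] Z ⧸ W) : ∃ f : c.C p →ₗ[A] Z, W.mkQ.comp f = g := by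
  obtain ⟨z, hz⟩ := W.mkQ_surjective (g (c.gen p))
  refine ⟨c.lift p (c.e p.1 • z) (by rw [smul_smul, c.e_mul_self]) fun N hN => hY N hN _, ?_⟩
  apply c.hom_ext
  rw [LinearMap.comp_apply, lift_gen, map_smul, hz, ← map_smul, e_smul_gen]

/-- A submodule containing some `(gen, v)` projects onto the first factor. It is then determined by
its intersection with `Z` and by the map that sends the generator to the class of `v`. -/
theorem exists_eq_graphSub (hY : ∀ N : ℕ, p.2 = N → ∀ z : Z, c.u ^ N • z = 0)
    {W : Submodule A (c.C p × Z)} {v : Z} (hv : (c.gen p, v) ∈ W) :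
    ∃ g : c.C p →ₗ[A] Z ⧸ W.comap (LinearMap.inr A _ _),
      W = graphSub (W.comap (LinearMap.inr A _ _)) g := by
  have hv' : (c.gen p, c.e p.1 • v) ∈ W := by
    have := W.smul_mem (c.e p.1) hv
    rwa [Prod.smul_mk, e_smul_gen] at this
  refine ⟨(W.comap (LinearMap.inr A _ _)).mkQ.comp (c.lift p (c.e p.1 • v)
    (by rw [smul_smul, c.e_mul_self]) fun N hN => hY N hN _), ?_⟩
  ext ⟨x, y⟩
  rw [mem_graphSub]
  obtain ⟨a, rfl⟩ := c.exists_smul_gen x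
  rw [LinearMap.comp_apply, LinearMap.map_smul (c.lift p _ _ _), lift_gen, ← sub_eq_zero,
    ← map_sub, Submodule.mkQ_apply, Submodule.Quotient.mk_eq_zero, Submodule.mem_comap,
    LinearMap.inr_apply]
  have h1 := W.smul_mem a hv'
  rw [← W.sub_mem_iff_left h1, Prod.smul_mk, Prod.mk_sub_mk, sub_self]

/-- If no `(gen, v)` lies in `W`, the projection of `W` to `C p` is proper, hence contained in the
radical by `exists_smul_eq_gen`. By hypothesis `W` also contains that radical. -/
theorem eq_prod_of_forall_notMem {W : Submodule A (c.C p × Z)} (hW : c.radN (c.C p × Z) 1 ≤ W)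
    (h : ∀ v, (c.gen p, v) ∉ W) :
    W = (c.radN (c.C p) 1).prod (W.comap (LinearMap.inr A _ _)) := by
  have key : ∀ x ∈ c.radN (c.C p) 1, (x, (0 : Z)) ∈ W := by
    intro x hx
    apply hW
    rw [radN_prod]
    exact ⟨hx, Submodule.zero_mem _⟩
  ext ⟨x, y⟩
  rw [Submodule.mem_prod]
  constructor
  · intro hxy
    have hx : x ∈ c.radN (c.C p) 1 := by
      by_contra hx
      obtain ⟨r, hr⟩ := c.exists_smul_eq_gen hx
      apply h (r • y)
      rw [← hr]
      exact W.smul_mem r hxy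
    refine ⟨hx, ?_⟩
    have := W.sub_mem hxy (key x hx)
    rwa [Prod.mk_sub_mk, sub_self, sub_zero] at this
  · rintro ⟨hx, hy⟩
    have := W.add_mem (key x hx) hy
    simpa using this

theorem comap_inr_graphSub (W : Submodule A Z) (g : Y →ₗ[A] Z ⧸ W) :
    (graphSub W g).comap (LinearMap.inr A _ _) = W := by
  ext z
  rw [Submodule.mem_comap, mem_graphSub, LinearMap.inr_apply, map_zero, Submodule.mkQ_apply,
    Submodule.Quotient.mk_eq_zero]

theorem graphSub_injective (W : Submodule A Z) {g g' : Y →ₗ[A] Z ⧸ W}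
    (h : graphSub W g = graphSub W g') : g = g' := by
  ext y
  obtain ⟨z, hz⟩ := W.mkQ_surjective (g y)
  have h1 : (y, z) ∈ graphSub W g := mem_graphSub.2 hz
  rw [h, mem_graphSub] at h1
  rw [← hz, h1]

theorem radN_le_comap_inr {N : ℕ} {W : Submodule A (Y × Z)} (hW : c.radN (Y × Z) N ≤ W) :
    c.radN Z N ≤ W.comap (LinearMap.inr A _ _) :=
  fun _ hz => hW (c.map_mem_radN (LinearMap.inr A Y Z) hz)

end Split

/-- The possible types of submodules that contain the radical. -/
def cand : List (ZMod n × ℕ∞) → Finset (Multiset (ZMod n × ℕ∞))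
  | [] => {0}
  -- The first family belongs to graphs, which keep the summand `p`; the second to products, in
  -- which `p` is replaced by its radical.
  | p :: l => (cand l).image (fun t => p ::ₘ t) ∪ (cand l).image fun t => sh 1 p + t

theorem pow_smul_eq_zero_of_pairwise {p : ZMod n × ℕ∞} {l : List (ZMod n × ℕ∞)}
    (hl : (p :: l).Pairwise fun a b => b.2 ≤ a.2) (hZ : c.HasType l Z) (N : ℕ) (hN : p.2 = N)
    (z : Z) : c.u ^ N • z = 0 :=
  hZ.pow_smul_eq_zero (fun p' hp' => hN ▸ (List.pairwise_cons.1 hl).1 p' hp') z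

/-- After splitting off a longest summand, `W` is either a graph over the intersection of `W` with
the rest, or the product of that intersection with the radical of the summand. In both cases the
submodule and the quotient are visible from the smaller module. -/
theorem HasType.sub_of_pairwise {l : List (ZMod n × ℕ∞)}
    (hl : l.Pairwise fun a b => b.2 ≤ a.2) (hY : c.HasType l Y) (W : Submodule A Y)
    (hW : c.radN Y 1 ≤ W) :
    (∃ t ∈ cand l, c.HasType t W) ∧ ∃ s, Semisimple s ∧ c.HasType s (Y ⧸ W) := by
  induction l generalizing Y with
  | nil =>
    have : Subsingleton Y := hY.subsingleton
    exact ⟨⟨0, by simp [cand], hasType_zero⟩, 0, fun p hp => by simp at hp, hasType_zero⟩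
  | cons p l ih =>
    obtain ⟨Z, hZ, ⟨f⟩⟩ := HasType.exists_cons (p := p) (t := (l : Multiset _)) hY
    have hp : p.2 ≠ 0 := hY.ne_zero p (by simp)
    have hlift := pow_smul_eq_zero_of_pairwise hl hZ
    suffices H : ∀ W : Submodule A (c.C p × Z), c.radN (c.C p × Z) 1 ≤ W →
        (∃ t ∈ cand (p :: l), c.HasType t W) ∧ ∃ s, Semisimple s ∧ c.HasType s ((c.C p × Z) ⧸ W) by
      obtain ⟨⟨t, ht, h1⟩, s, hs, h2⟩ := H (W.map (f : Y →ₗ[A] c.C p × Z)) (by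
        rw [← c.radN_map_equiv f]
        exact Submodule.map_mono hW)
      exact ⟨⟨t, ht, h1.congr (f.submoduleMap W).symm⟩, s, hs,
        h2.congr (Submodule.Quotient.equiv _ _ f rfl).symm⟩
    intro W hW
    obtain ⟨⟨t, ht, h1⟩, s, hs, h2⟩ := ih (List.pairwise_cons.1 hl).2 hZ
      (W.comap (LinearMap.inr A _ _)) (radN_le_comap_inr hW)
    by_cases hv : ∃ v, (c.gen p, v) ∈ W
    · obtain ⟨v, hv⟩ := hv
      obtain ⟨g, hg⟩ := exists_eq_graphSub hlift hv
      obtain ⟨f, rfl⟩ := exists_lift_C hlift g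
      rw [hg]
      refine ⟨⟨p ::ₘ t, ?_, (h1.cons hp).congr (graphSubEquiv _ f).symm⟩, s, hs,
        h2.congr (quotGraphSub _ _).symm⟩
      exact Finset.mem_union_left _ (Finset.mem_image_of_mem _ ht)
    · push Not at hv
      rw [eq_prod_of_forall_notMem hW hv]
      refine ⟨⟨sh 1 p + t, ?_, ((hasType_sh 1 p).prod h1).congr (prodSubEquiv _ _).symm⟩,
        {(p.1, 1)} + s, ?_, ?_⟩
      · exact Finset.mem_union_right _ (Finset.mem_image_of_mem _ ht)
      · intro p' hp'
        rcases Multiset.mem_add.1 hp' with h | h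
        · rw [Multiset.mem_singleton.1 h]
        · exact hs p' h
      · exact (((hasType_C one_ne_zero).congr (c.topEquiv p hp).symm).prod h2).congr
          (prodQuotEquiv _ _).symm

theorem exists_pairwise (t : Multiset (ZMod n × ℕ∞)) :
    ∃ l : List (ZMod n × ℕ∞), (l : Multiset _) = t ∧ l.Pairwise fun a b => b.2 ≤ a.2 := by
  classical
  obtain ⟨l, rfl⟩ := Quot.exists_rep t
  refine ⟨l.insertionSort fun a b => b.2 ≤ a.2, Multiset.coe_eq_coe.2 (List.perm_insertionSort _ _),
    ?_⟩
  have : IsTrans (ZMod n × ℕ∞) fun a b => b.2 ≤ a.2 := ⟨fun _ _ _ h h' => h'.trans h⟩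
  have : Std.Total (fun a b : ZMod n × ℕ∞ => b.2 ≤ a.2) := ⟨fun a b => le_total _ _⟩
  exact List.pairwise_insertionSort _ _

/-- Submodules containing a power of the radical have one of finitely many types. -/
theorem exists_types_of_submodules (t : Multiset (ZMod n × ℕ∞)) (N : ℕ) :
    ∃ S : Finset (Multiset (ZMod n × ℕ∞)), ∀ (A : Type) [Ring A] (c : CycRing n A) (Y : Type)
      [AddCommGroup Y] [Module A Y], c.HasType t Y → ∀ W : Submodule A Y, c.radN Y N ≤ W →
      ∃ t' ∈ S, c.HasType t' W := by
  classical
  induction N with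
  | zero =>
    refine ⟨{t}, fun A _ c Y _ _ hY W hW => ⟨t, Finset.mem_singleton_self _, ?_⟩⟩
    rw [radN_zero, top_le_iff] at hW
    rw [hW]
    exact hY.congr Submodule.topEquiv.symm
  | succ N ih =>
    obtain ⟨S, hS⟩ := ih
    choose l hl hsort using exists_pairwise (n := n)
    refine ⟨S.biUnion fun t => cand (l t), fun A _ c Y _ _ hY W hW => ?_⟩
    -- The submodule `W + u ^ N Y` is covered by the induction hypothesis. Since `W` contains `u`
    -- times it, only submodules containing the radical remain. The candidates depend on `t` and `N`
    -- alone, so the finite set is uniform in the ring.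
    obtain ⟨t', ht', h1⟩ := hS A c Y hY (W ⊔ c.radN Y N) le_sup_right
    rw [← hl t'] at h1
    have h2 : c.radN (W ⊔ c.radN Y N : Submodule A Y) 1 ≤ W.submoduleOf (W ⊔ c.radN Y N) := by
      rintro _ ⟨⟨x, hx⟩, rfl⟩
      obtain ⟨w, hw, z, hz, rfl⟩ := Submodule.mem_sup.1 hx
      rw [Submodule.submoduleOf, Submodule.mem_comap, Submodule.subtype_apply, Submodule.coe_smul, pow_one, smul_add]
      refine W.add_mem (W.smul_mem _ hw) (hW ?_)
      have := c.pow_smul_mem_radN_add (M := 1) hz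
      rwa [pow_one, add_comm] at this
    obtain ⟨⟨t, ht, h3⟩, -⟩ := h1.sub_of_pairwise (hsort t') _ h2
    exact ⟨t, Finset.mem_biUnion.2 ⟨t', ht', ht⟩,
      h3.congr (Submodule.submoduleOfEquivOfLe le_sup_left)⟩

/-! ### Hall numbers with semisimple quotient -/

theorem finite_hom_semisimple (h : c.HasType s Y) (hs : Semisimple s)
    {p : ZMod n × ℕ∞} (hp : p.2 ≠ 0) : Finite (c.C p →ₗ[A] Y) := by
  apply Nat.finite_of_card_ne_zero
  rw [h.card_hom_semisimple hs hp]
  exact pow_ne_zero _ (by have := c.one_lt_q; omega)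

/-- The recursion for the number of submodules with semisimple quotient. -/
theorem ncard_hT_cons {p : ZMod n × ℕ∞} {l : List (ZMod n × ℕ∞)}
    (hl : (p :: l).Pairwise fun a b => b.2 ≤ a.2) (hp : p.2 ≠ 0) (hZ : c.HasType l Z)
    (hs : Semisimple s) (hB : (c.hT (s.erase (p.1, 1)) Z (t - sh 1 p)).Finite)
    (hA : (c.hT s Z (t.erase p)).Finite) :
    (c.hT s (c.C p × Z) t).Finite ∧ (c.hT s (c.C p × Z) t).ncard =
      (if p ∈ t then c.q ^ s.countP (fun p' => p'.1 = p.1) * (c.hT s Z (t.erase p)).ncard else 0) +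
      if (p.1, 1) ∈ s ∧ sh 1 p ≤ t then (c.hT (s.erase (p.1, 1)) Z (t - sh 1 p)).ncard else 0 := by
  have hlift := pow_smul_eq_zero_of_pairwise hl hZ
  have hsub := hZ.sub_of_pairwise (List.pairwise_cons.1 hl).2
  -- `SA` collects the graphs, which project onto `C p`; `SB` collects the products with the radical
  -- of `C p`.
  set SA : Set (Submodule A (c.C p × Z)) := {W ∈ c.hT s (c.C p × Z) t | ∃ v, (c.gen p, v) ∈ W}
    with hSA
  set SB : Set (Submodule A (c.C p × Z)) := {W ∈ c.hT s (c.C p × Z) t | ∀ v, (c.gen p, v) ∉ W}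
    with hSB
  have hrad : ∀ W ∈ c.hT s (c.C p × Z) t, c.radN (c.C p × Z) 1 ≤ W := fun W hW =>
    radN_le_of_quotient fun y => by rw [pow_one]; exact hW.2.u_smul hs y
  have hunion : c.hT s (c.C p × Z) t = SA ∪ SB := by
    ext W
    simp only [hSA, hSB, Set.mem_union, Set.mem_ofPred_eq, ← and_or_left]
    refine ⟨fun h => ⟨h, ?_⟩, fun h => h.1⟩
    by_cases hv : ∃ v, (c.gen p, v) ∈ W
    · exact Or.inl hv
    · exact Or.inr (not_exists.1 hv)
  have hdisj : Disjoint SA SB := by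
    rw [Set.disjoint_left]
    rintro W ⟨-, v, hv⟩ ⟨-, h⟩
    exact h v hv
  have hAcard : SA.Finite ∧ SA.ncard = if p ∈ t then
      c.q ^ s.countP (fun p' => p'.1 = p.1) * (c.hT s Z (t.erase p)).ncard else 0 := by
    split_ifs with hpt
    · have : Finite (c.hT s Z (t.erase p)) := hA
      have : ∀ W : c.hT s Z (t.erase p), Finite (c.C p →ₗ[A] Z ⧸ W.1) := fun W =>
        finite_hom_semisimple W.2.2 hs hp
      -- A graph amounts to its intersection `W` with `Z` and a map `C p → Z ⧸ W`. Since `Z ⧸ W`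
      -- always has type `s`, the number of such maps is the same power of `q` for every `W`.
      let Φ : (Σ W : c.hT s Z (t.erase p), c.C p →ₗ[A] Z ⧸ W.1) → SA := fun x =>
        ⟨graphSub x.1.1 x.2, by
          obtain ⟨⟨W, hW⟩, g⟩ := x
          obtain ⟨f, rfl⟩ := exists_lift_C hlift g
          refine ⟨⟨?_, hW.2.congr (quotGraphSub _ _).symm⟩, f (c.gen p), mem_graphSub.2 rfl⟩
          have := (hW.1.cons hp).congr (graphSubEquiv _ f).symm
          rwa [Multiset.cons_erase hpt] at this⟩
      have hΦ : Function.Bijective Φ := by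
        constructor
        · rintro ⟨⟨W, hW⟩, g⟩ ⟨⟨W', hW'⟩, g'⟩ h
          have h : graphSub W g = graphSub W' g' := congrArg Subtype.val h
          obtain rfl : W = W' := by
            rw [← comap_inr_graphSub W g, h, comap_inr_graphSub]
          rw [graphSub_injective W h]
        · rintro ⟨W, hW, v, hv⟩
          obtain ⟨g, hg⟩ := exists_eq_graphSub hlift hv
          obtain ⟨⟨t', -, h1⟩, -⟩ := hsub _ (radN_le_comap_inr (hrad W hW))
          have h2 : c.HasType s (Z ⧸ W.comap (LinearMap.inr A _ _)) := by
            have := hW.2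
            rw [hg] at this
            exact this.congr (quotGraphSub _ _)
          have h4 : t = p ::ₘ t' := by
            obtain ⟨f, hf⟩ := exists_lift_C hlift g
            have := hW.1
            rw [hg, ← hf] at this
            exact (this.congr (graphSubEquiv _ f)).unique (h1.cons hp)
          refine ⟨⟨⟨W.comap (LinearMap.inr A _ _), ?_, h2⟩, g⟩, Subtype.ext hg.symm⟩
          rw [h4, Multiset.erase_cons_head]
          exact h1
      have hfin : Finite SA := Finite.of_surjective Φ hΦ.2
      refine ⟨hfin, ?_⟩
      rw [← Nat.card_coe_set_eq, ← Nat.card_congr (Equiv.ofBijective Φ hΦ)]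
      have := Fintype.ofFinite (c.hT s Z (t.erase p))
      rw [Nat.card_sigma, Finset.sum_congr rfl fun W _ => W.2.2.card_hom_semisimple hs hp,
        Finset.sum_const, Finset.card_univ, smul_eq_mul, mul_comm, ← Nat.card_eq_fintype_card,
        Nat.card_coe_set_eq]
    · have : SA = ∅ := by
        rw [Set.eq_empty_iff_forall_notMem]
        rintro W ⟨hW, v, hv⟩
        obtain ⟨g, hg⟩ := exists_eq_graphSub hlift hv
        obtain ⟨⟨t', -, h1⟩, -⟩ := hsub _ (radN_le_comap_inr (hrad W hW))
        obtain ⟨f, hf⟩ := exists_lift_C hlift g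
        have := hW.1
        rw [hg, ← hf] at this
        rw [(this.congr (graphSubEquiv _ f)).unique (h1.cons hp)] at hpt
        exact hpt (Multiset.mem_cons_self _ _)
      rw [this]
      exact ⟨Set.finite_empty, Set.ncard_empty _⟩
  -- In a product the first factor contributes its radical to the type of the submodule and its
  -- simple top to the type of the quotient. Both contributions are subtracted from `t` and `s`.
  have hBcard : SB.Finite ∧ SB.ncard = if (p.1, 1) ∈ s ∧ sh 1 p ≤ t then
      (c.hT (s.erase (p.1, 1)) Z (t - sh 1 p)).ncard else 0 := by
    have hB1 : ∀ W ∈ SB, (p.1, 1) ∈ s ∧ sh 1 p ≤ t ∧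
        W.comap (LinearMap.inr A _ _) ∈ c.hT (s.erase (p.1, 1)) Z (t - sh 1 p) ∧
        W = (c.radN (c.C p) 1).prod (W.comap (LinearMap.inr A _ _)) := by
      rintro W ⟨hW, hv⟩
      obtain ⟨⟨t', -, h1⟩, s', -, h2⟩ := hsub _ (radN_le_comap_inr (hrad W hW))
      have heq := eq_prod_of_forall_notMem (hrad W hW) hv
      have h3 := hW.1
      have h4 := hW.2
      rw [heq] at h3 h4
      have h5 := (h3.congr (prodSubEquiv _ _)).unique ((hasType_sh 1 p).prod h1)
      have h6 := (h4.congr (prodQuotEquiv _ _)).unique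
        (((hasType_C one_ne_zero).congr (c.topEquiv p hp).symm).prod h2)
      rw [Multiset.singleton_add] at h6
      refine ⟨by rw [h6]; exact Multiset.mem_cons_self _ _, by rw [h5]; exact Multiset.le_add_right _ _,
        ⟨?_, ?_⟩, heq⟩
      · rw [h5, add_tsub_cancel_left]
        exact h1
      · rw [h6, Multiset.erase_cons_head]
        exact h2
    split_ifs with hst
    · have : SB = (fun W => (c.radN (c.C p) 1).prod W) ''
          c.hT (s.erase (p.1, 1)) Z (t - sh 1 p) := by
        ext W
        constructor
        · intro hW
          obtain ⟨-, -, h1, h2⟩ := hB1 W hW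
          exact ⟨_, h1, h2.symm⟩
        · rintro ⟨W, hW, rfl⟩
          refine ⟨⟨?_, ?_⟩, ?_⟩
          · rw [← add_tsub_cancel_of_le hst.2]
            exact ((hasType_sh 1 p).prod hW.1).congr (prodSubEquiv _ _).symm
          · rw [← Multiset.cons_erase hst.1, ← Multiset.singleton_add]
            exact (((hasType_C one_ne_zero).congr (c.topEquiv p hp).symm).prod hW.2).congr
              (prodQuotEquiv _ _).symm
          · rintro v ⟨hv, -⟩
            exact gen_notMem_radN_one hp hv
      rw [this]
      refine ⟨hB.image _, Set.ncard_image_of_injective _ ?_⟩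
      intro W W' h
      ext z
      have := SetLike.ext_iff.1 h (0, z)
      simpa [Submodule.mem_prod] using this
    · have : SB = ∅ := by
        rw [Set.eq_empty_iff_forall_notMem]
        intro W hW
        obtain ⟨h1, h2, -⟩ := hB1 W hW
        exact hst ⟨h1, h2⟩
      rw [this]
      exact ⟨Set.finite_empty, Set.ncard_empty _⟩
  rw [hunion]
  refine ⟨hAcard.1.union hBcard.1, ?_⟩
  rw [Set.ncard_union_eq hdisj hAcard.1 hBcard.1, hAcard.2, hBcard.2]

/-- For given types, the number of submodules is a polynomial in `q`. -/
def IsPolynomialHall (s r t : Multiset (ZMod n × ℕ∞)) : Prop :=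
  ∃ P : ℤ[X], ∀ (A : Type) [Ring A] (c : CycRing n A) (Y : Type) [AddCommGroup Y] [Module A Y],
    c.HasType r Y → (c.hT s Y t).Finite ∧ ((c.hT s Y t).ncard : ℤ) = P.eval (c.q : ℤ)

theorem hT_of_subsingleton [Subsingleton Y] :
    c.hT s Y t = if s = 0 ∧ t = 0 then {⊥} else ∅ := by
  ext W
  have : W = ⊥ := Subsingleton.elim _ _
  split_ifs with h
  · obtain ⟨rfl, rfl⟩ := h
    exact ⟨fun _ => this, fun _ => ⟨hasType_zero, hasType_zero⟩⟩
  · refine ⟨fun hW => h ⟨hW.2.unique hasType_zero, hW.1.unique hasType_zero⟩, fun h => h.elim⟩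

/-- In the recursion `ncard_hT_cons` the case distinctions and the exponents of `q` depend on the
types only. Following it through the summands in order of decreasing length yields one polynomial
for all rings. -/
theorem isPolynomialHall_of_semisimple (hs : Semisimple s) (r t : Multiset (ZMod n × ℕ∞)) :
    IsPolynomialHall s r t := by
  obtain ⟨l, rfl, hl⟩ := exists_pairwise r
  induction l generalizing s t with
  | nil =>
    refine ⟨if s = 0 ∧ t = 0 then 1 else 0, fun A _ c Y _ _ hY => ?_⟩
    have : Subsingleton Y := hY.subsingleton
    rw [hT_of_subsingleton]
    split_ifs <;> simp
  | cons p l ih =>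
    have hl' := (List.pairwise_cons.1 hl).2
    obtain ⟨P1, h1⟩ := ih hs (t.erase p) hl'
    obtain ⟨P2, h2⟩ := ih (s := s.erase (p.1, 1))
      (fun p hp => hs p (Multiset.mem_of_mem_erase hp)) (t - sh 1 p) hl'
    refine ⟨(if p ∈ t then X ^ s.countP (fun p' => p'.1 = p.1) * P1 else 0) +
      if (p.1, 1) ∈ s ∧ sh 1 p ≤ t then P2 else 0, fun A _ c Y _ _ hY => ?_⟩
    obtain ⟨Z, hZ, ⟨f⟩⟩ := HasType.exists_cons (p := p) (t := (l : Multiset _)) hY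
    obtain ⟨h3, h4⟩ := h1 A c Z hZ
    obtain ⟨h5, h6⟩ := h2 A c Z hZ
    obtain ⟨h7, h8⟩ := ncard_hT_cons hl (hY.ne_zero p (by simp)) hZ hs h5 h3
    refine ⟨finite_hT_congr f.symm h7, ?_⟩
    rw [ncard_hT_congr f.symm, h8, eval_add]
    push_cast
    congr 1
    · split_ifs <;> simp [h4]
    · split_ifs <;> simp [h6]

end CycRing

end IyamaHall
end

noncomputable section
namespace IyamaHall
namespace CycRing

variable {n : ℕ} [NeZero n] {A : Type} [Ring A] {c : CycRing n A}
variable {Y Z : Type} [AddCommGroup Y] [Module A Y] [AddCommGroup Z] [Module A Z]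
  {t s r : Multiset (ZMod n × ℕ∞)}

/-! ### Finite modules -/

/-- `t` is the type of a module of finite length. -/
def FiniteType (t : Multiset (ZMod n × ℕ∞)) : Prop := ∀ p ∈ t, p.2 ≠ ⊤

/-- The length of a module of type `t`. -/
def len (t : Multiset (ZMod n × ℕ∞)) : ℕ := (t.map fun p => p.2.toNat).sum

theorem HasType.card (h : c.HasType t Y) (ht : FiniteType t) : Nat.card Y = c.q ^ len t := by
  induction t using Multiset.induction generalizing Y with
  | empty =>
    have := h.subsingleton
    rw [len, Multiset.map_zero, Multiset.sum_zero, pow_zero, Nat.card_eq_one_iff_unique]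
    exact ⟨this, ⟨0⟩⟩
  | cons p t ih =>
    obtain ⟨Y', hY', ⟨f⟩⟩ := h.exists_cons
    rw [Nat.card_congr f.toEquiv, Nat.card_prod,
      ih hY' (fun p hp => ht p (Multiset.mem_cons_of_mem hp)), len, len, Multiset.map_cons,
      Multiset.sum_cons, pow_add]
    congr 1
    obtain ⟨k, j⟩ := p
    lift j to ℕ using ht (k, j) (Multiset.mem_cons_self _ _)
    exact c.card_C j k

theorem HasType.finite (h : c.HasType t Y) (ht : FiniteType t) : Finite Y := by
  apply Nat.finite_of_card_ne_zero
  rw [h.card ht]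
  exact pow_ne_zero _ (by have := c.one_lt_q; omega)

theorem exists_bound (ht : FiniteType t) : ∃ N : ℕ, ∀ p ∈ t, p.2 ≤ N := by
  refine ⟨len t, fun p hp => ?_⟩
  rw [← ENat.natCast_toNat (ht p hp)]
  exact Nat.cast_le.2 (Multiset.single_le_sum (fun _ _ => Nat.zero_le _) _
    (Multiset.mem_map_of_mem _ hp))

/-- A summand of infinite length would map onto modules with `q ^ N` elements for every `N`. -/
theorem HasType.finiteType [Finite Y] (h : c.HasType t Y) : FiniteType t := by
  intro p hp htop
  obtain ⟨Y', -, ⟨f⟩⟩ := HasType.exists_cons (p := p) (t := t.erase p)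
    (by rwa [Multiset.cons_erase hp])
  have h1 : Finite (c.C p) := Finite.of_surjective (fun y => (f y).1)
    (Prod.fst_surjective.comp f.surjective)
  have h2 : ∀ N : ℕ, c.q ^ N ≤ Nat.card (c.C p) := by
    intro N
    rw [← c.card_C N p.1]
    exact Nat.card_le_card_of_surjective _ (c.projHom_surjective p N (by rw [htop]; exact le_top))
  exact absurd (h2 (Nat.card (c.C p))) (not_le.2 (Nat.lt_pow_self c.one_lt_q))

/-- One simple summand with top `k` is added for every pair `(k, z)` in order to reach `e k • z`. -/
theorem exists_surjection_of_rad [Finite Z] (hZ : ∀ z : Z, c.u • z = 0)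
    (F : Finset (ZMod n × Z)) :
    ∃ (s : Multiset (ZMod n × ℕ∞)) (Y : ModuleCat.{0} A) (f : Y →ₗ[A] Z), Semisimple s ∧
      c.HasType s Y ∧ ∀ x ∈ F, c.e x.1 • x.2 ∈ LinearMap.range f := by
  classical
  induction F using Finset.induction with
  | empty =>
    exact ⟨0, ModuleCat.of A PUnit, 0, fun p hp => by simp at hp,
      hasType_zero (Y := PUnit), by simp⟩
  | insert x F _ ih =>
    obtain ⟨s, Y, f, hs, hY, hf⟩ := ih
    let g : c.C (x.1, 1) →ₗ[A] Z := c.lift (x.1, 1) (c.e x.1 • x.2)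
      (by rw [smul_smul, c.e_mul_self]) (by
        intro N hN
        obtain rfl : N = 1 := by
          have : (1 : ℕ∞) = N := hN
          exact_mod_cast this.symm
        rw [pow_one, hZ])
    refine ⟨(x.1, 1) ::ₘ s, ModuleCat.of A (c.C (x.1, 1) × Y), g.coprod f, ?_,
      hY.cons one_ne_zero, ?_⟩
    · intro p hp
      rcases Multiset.mem_cons.1 hp with rfl | h
      · rfl
      · exact hs p h
    · intro y hy
      rcases Finset.mem_insert.1 hy with rfl | h
      · exact ⟨(c.gen _, 0), by simp [g]⟩
      · obtain ⟨z, hz⟩ := hf y h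
        exact ⟨(0, z), by simpa using hz⟩

/-- Every `z` is the sum of the elements `e k • z`, so the maps of the preceding lemma exhaust the
module, and quotients of semisimple modules have a semisimple type. -/
theorem exists_hasType_of_rad [Finite Z] (hZ : ∀ z : Z, c.u • z = 0) :
    ∃ s, Semisimple s ∧ c.HasType s Z := by
  have := Fintype.ofFinite Z
  obtain ⟨s, Y, f, hs, hY, hf⟩ := exists_surjection_of_rad hZ Finset.univ
  have hsurj : Function.Surjective f := by
    intro z
    have : z = ∑ k, c.e k • z := by rw [← Finset.sum_smul, c.sum_e, one_smul]
    rw [← LinearMap.mem_range, this]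
    exact Submodule.sum_mem _ fun k _ => hf (k, z) (Finset.mem_univ _)
  obtain ⟨l, rfl, hl⟩ := exists_pairwise s
  obtain ⟨-, s, hs', h⟩ := hY.sub_of_pairwise hl (LinearMap.ker f) (by
    rintro _ ⟨y, rfl⟩
    rw [pow_one, hY.u_smul hs]
    exact Submodule.zero_mem _)
  exact ⟨s, hs', h.congr (f.quotKerEquivOfSurjective hsurj)⟩

/-- A map out of a simple summand is an element fixed by an idempotent and killed by `u`. The
hypothesis provides preimages killed by `u`, and multiplication by the idempotent preserves this. -/
theorem exists_lift_semisimple {f : Y →ₗ[A] Z} (hf : ∀ z, ∃ y, f y = z ∧ c.u • y = 0)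
    {l : List (ZMod n × ℕ∞)} (hl : Semisimple (l : Multiset (ZMod n × ℕ∞)))
    (h : c.Md l →ₗ[A] Z) : ∃ g : c.Md l →ₗ[A] Y, f.comp g = h := by
  induction l with
  | nil => exact ⟨0, LinearMap.ext fun x => by rw [Subsingleton.elim x 0, map_zero, map_zero]⟩
  | cons p l ih =>
    obtain ⟨g, hg⟩ := ih (fun p' hp' => hl p' (by simp at hp' ⊢; exact Or.inr hp'))
      (h.comp ((c.MdCons p l).symm.toLinearMap.comp (LinearMap.inr A _ _)))
    obtain ⟨y, hy, huy⟩ := hf (h ((c.MdCons p l).symm (c.gen p, 0)))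
    have hp1 : p.2 = 1 := hl p (by simp)
    let g' : c.C p →ₗ[A] Y := c.lift p (c.e p.1 • y) (by rw [smul_smul, c.e_mul_self]) (by
      intro N hN
      obtain rfl : N = 1 := by exact_mod_cast hN.symm.trans hp1
      rw [pow_one, smul_smul, c.u_mul_e, mul_smul, huy, smul_zero])
    refine ⟨(g'.coprod g).comp (c.MdCons p l).toLinearMap, ?_⟩
    have h1 : f.comp g' = h.comp ((c.MdCons p l).symm.toLinearMap.comp (LinearMap.inl A _ _)) := by
      apply c.hom_ext
      simp only [g', LinearMap.comp_apply, lift_gen, map_smul, hy]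
      rw [← map_smul, LinearEquiv.coe_coe, ← map_smul, Prod.smul_mk, e_smul_gen, smul_zero]
      rfl
    have h2 : f.comp (g'.coprod g) = h.comp (c.MdCons p l).symm.toLinearMap := by
      apply LinearMap.prod_ext
      · rw [LinearMap.comp_assoc, LinearMap.coprod_inl, h1]; rfl
      · rw [LinearMap.comp_assoc, LinearMap.coprod_inr, hg]; rfl
    rw [← LinearMap.comp_assoc, h2]
    ext x
    simp

theorem u_smul_gen_ne_zero {p : ZMod n × ℕ∞} (hp : ((2 : ℕ) : ℕ∞) ≤ p.2) : c.u • c.gen p ≠ 0 := by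
  intro h
  rw [smul_gen_eq_zero] at h
  have h1 := h 2 hp
  rw [c.u_mul_e] at h1
  have h2 := c.pow_dvd_of_dvd_mul_pow (N := 1) (m := 1) (a := c.e (p.1 + 1))
    (by rwa [pow_one])
  apply gen_notMem_radN_one (c := c) (p := (p.1 + 1, 1)) one_ne_zero
  have := (c.smul_gen_mem_radN (p := (p.1 + 1, 1)) (N := 1) (by simp) (a := 1)).2 (by simpa using h2)
  simpa using this

/-- Each summand `C (k, j)` is realised as the radical of `C (k - 1, j + 1)`, its generator becoming
`u` times the new generator. The map `ψ` extends to `M` because the image of a generator is of the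
form `u x`, and the new generator is sent to `e (k - 1) x`. The clauses on `σ` say that its image is
the radical of `M` and contains everything killed by `u`. -/
theorem exists_unshift {l : List (ZMod n × ℕ∞)} (hl : FiniteType (l : Multiset (ZMod n × ℕ∞)))
    (hl0 : ∀ p ∈ l, p.2 ≠ 0) (ψ : c.Md l →ₗ[A] Y) (hψ : ∀ m, ψ m ∈ c.radN Y 1) :
    ∃ (M : ModuleCat.{0} A) (φ : M →ₗ[A] Y) (σ : c.Md l →ₗ[A] M), φ.comp σ = ψ ∧
      (∀ m : M, c.u • m ∈ LinearMap.range σ) ∧ (∀ m : M, c.u • m = 0 → m ∈ LinearMap.range σ) ∧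
      (∀ m, σ m ∈ c.radN M 1) ∧ ∃ t, c.HasType t M := by
  induction l with
  | nil =>
    refine ⟨ModuleCat.of A PUnit, 0, 0, ?_, fun m => ⟨0, ?_⟩, fun m _ => ⟨0, ?_⟩, fun m => ?_, 0,
      hasType_zero (Y := PUnit)⟩
    · exact LinearMap.ext fun x => by rw [Subsingleton.elim x 0, map_zero, map_zero]
    · exact Subsingleton.elim (α := PUnit) _ _
    · exact Subsingleton.elim (α := PUnit) _ _
    · exact Submodule.zero_mem _
  | cons p l ih =>
    obtain ⟨M, φ, σ, h1, h2, h3, h4, t, ht⟩ := ih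
      (fun p' hp' => hl p' (by simp at hp' ⊢; exact Or.inr hp'))
      (fun p' hp' => hl0 p' (List.mem_cons_of_mem _ hp'))
      (ψ.comp ((c.MdCons p l).symm.toLinearMap.comp (LinearMap.inr A _ _))) (fun m => hψ _)
    obtain ⟨k, j⟩ := p
    lift j to ℕ using hl (k, j) (by simp)
    have hj : j ≠ 0 := by
      rintro rfl
      exact hl0 (k, (0 : ℕ)) (by simp) rfl
    obtain ⟨x, hx⟩ := hψ ((c.MdCons (k, (j : ℕ∞)) l).symm (c.gen _, 0))
    have hue : c.u * c.e (k - 1) = c.e k * c.u := by rw [c.u_mul_e, sub_add_cancel]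
    let p' : ZMod n × ℕ∞ := (k - 1, ((j + 1 : ℕ) : ℕ∞))
    have hgen' : c.e (k - 1) • c.gen p' = c.gen p' := c.e_smul_gen p'
    have hgen'' : ∀ N : ℕ, j + 1 ≤ N → c.u ^ N • c.gen p' = 0 := fun N hN =>
      c.pow_smul_gen_eq_zero (Nat.cast_le.2 hN)
    let σ' : c.C (k, (j : ℕ∞)) →ₗ[A] c.C p' := c.lift _ (c.u • c.gen p')
      (by
        change c.e k • _ = _
        rw [smul_smul, ← hue, mul_smul, hgen'])
      (by
        intro N hN
        rw [smul_smul, ← pow_succ]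
        have : j = N := Nat.cast_injective (R := ℕ∞) hN
        exact hgen'' _ (by omega))
    have hψe : c.e k • ψ ((c.MdCons (k, (j : ℕ∞)) l).symm (c.gen _, 0)) =
        ψ ((c.MdCons (k, (j : ℕ∞)) l).symm (c.gen _, 0)) := by
      rw [← map_smul, ← map_smul, Prod.smul_mk, smul_zero]
      congr 3
      exact c.e_smul_gen (k, (j : ℕ∞))
    have hux : c.u • c.e (k - 1) • x = ψ ((c.MdCons (k, (j : ℕ∞)) l).symm (c.gen _, 0)) := by
      rw [smul_smul, hue, mul_smul]
      rw [pow_one] at hx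
      rw [← hx, hψe]
    let φ' : c.C p' →ₗ[A] Y := c.lift p' (c.e (k - 1) • x) (by
        change c.e (k - 1) • _ = _
        rw [smul_smul, c.e_mul_self])
      (by
        intro N hN
        have : j + 1 = N := Nat.cast_injective (R := ℕ∞) hN
        rw [← this, pow_succ, mul_smul, hux, ← map_smul, ← map_smul, Prod.smul_mk,
          c.pow_smul_gen_eq_zero le_rfl, smul_zero, Prod.mk_zero_zero, map_zero, map_zero])
    refine ⟨ModuleCat.of A (c.C p' × M), φ'.coprod φ,
      (σ'.prodMap σ).comp (c.MdCons (k, (j : ℕ∞)) l).toLinearMap, ?_, ?_, ?_, ?_,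
      p' ::ₘ t, ht.cons (by simp [p'])⟩
    · have hA : φ'.comp σ' =
          ψ.comp ((c.MdCons (k, (j : ℕ∞)) l).symm.toLinearMap.comp (LinearMap.inl A _ _)) := by
        apply c.hom_ext
        rw [LinearMap.comp_apply, lift_gen, map_smul, lift_gen, hux]
        rfl
      have hB : (φ'.coprod φ).comp (σ'.prodMap σ) =
          ψ.comp (c.MdCons (k, (j : ℕ∞)) l).symm.toLinearMap := by
        apply LinearMap.prod_ext
        · refine LinearMap.ext fun z => ?_
          have := LinearMap.congr_fun hA z
          simp at this ⊢
          exact this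
        · refine LinearMap.ext fun z => ?_
          have := LinearMap.congr_fun h1 z
          simp at this ⊢
          exact this
      rw [← LinearMap.comp_assoc]
      refine (congrArg (fun g => g.comp (c.MdCons (k, (j : ℕ∞)) l).toLinearMap) hB).trans ?_
      ext z
      simp
    · rintro ⟨m, m'⟩
      obtain ⟨a, rfl⟩ := c.exists_smul_gen m
      obtain ⟨b, hb⟩ := c.left_normal a
      obtain ⟨z, hz⟩ := h2 m'
      refine ⟨(c.MdCons (k, (j : ℕ∞)) l).symm (b • c.gen _, z), ?_⟩
      rw [LinearMap.comp_apply, LinearEquiv.coe_coe, LinearEquiv.apply_symm_apply]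
      refine Prod.ext ?_ hz
      change σ' (b • c.gen _) = c.u • a • c.gen p'
      rw [map_smul, lift_gen, smul_smul, smul_smul, hb]
    · rintro ⟨m, m'⟩ hm
      rw [Prod.smul_mk] at hm
      have hm1 : c.u • m = 0 := congrArg Prod.fst hm
      have hm2 : c.u • m' = 0 := congrArg Prod.snd hm
      obtain ⟨z, hz⟩ := h3 m' hm2
      have hmr : m ∈ c.radN (c.C p') 1 := by
        by_contra hmr
        obtain ⟨r, hr⟩ := c.exists_smul_eq_gen hmr
        obtain ⟨r', hr'⟩ := c.left_normal r
        apply u_smul_gen_ne_zero (c := c) (p := p') (Nat.cast_le.2 (by omega))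
        rw [← hr, smul_smul, hr', mul_smul, hm1, smul_zero]
      obtain ⟨y, rfl⟩ := hmr
      obtain ⟨a, rfl⟩ := c.exists_smul_gen y
      obtain ⟨b, hb⟩ := c.left_normal a
      refine ⟨(c.MdCons (k, (j : ℕ∞)) l).symm (b • c.gen _, z), ?_⟩
      rw [LinearMap.comp_apply, LinearEquiv.coe_coe, LinearEquiv.apply_symm_apply]
      refine Prod.ext ?_ hz
      change σ' (b • c.gen _) = c.u ^ 1 • a • c.gen p'
      rw [map_smul, lift_gen, smul_smul, smul_smul, pow_one, hb]
    · intro m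
      change _ ∈ c.radN (c.C p' × M) 1
      rw [radN_prod]
      refine ⟨?_, h4 _⟩
      change σ' _ ∈ _
      obtain ⟨a, ha⟩ := c.exists_smul_gen ((c.MdCons (k, (j : ℕ∞)) l) m).1
      have : σ' ((c.MdCons (k, (j : ℕ∞)) l) m).1 ∈ c.radN (c.C p') 1 := by
        rw [ha, map_smul, lift_gen]
        exact Submodule.smul_mem _ _ (c.u_smul_mem_radN _)
      exact this

/-- Finite modules that are killed by a power of `u` are direct sums of cyclic modules. -/
theorem exists_hasType_of_finite [Finite Y] {N : ℕ} (hN : ∀ y : Y, c.u ^ N • y = 0) :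
    ∃ t, FiniteType t ∧ c.HasType t Y := by
  suffices H : ∃ t, c.HasType t Y from H.imp fun t h => ⟨h.finiteType, h⟩
  induction N generalizing Y with
  | zero =>
    have : Subsingleton Y := ⟨fun x y => by
      rw [← one_smul A x, ← one_smul A y, ← pow_zero c.u, hN, hN]⟩
    exact ⟨0, hasType_zero⟩
  | succ N ih =>
    obtain ⟨t, ht⟩ := ih (Y := c.radN Y 1) (by
      rintro ⟨_, y, rfl⟩
      ext
      rw [Submodule.coe_smul, smul_smul, ← pow_add, hN, Submodule.coe_zero])
    have htf := ht.finiteType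
    obtain ⟨h0, l, rfl, ⟨f⟩⟩ := ht
    obtain ⟨M, φ, σ, h1, h2, h3, h4, t, hM⟩ := exists_unshift htf h0
      ((c.radN Y 1).subtype.comp f.symm.toLinearMap) (fun m => (f.symm m).2)
    have hinj1 : ∀ m, φ (σ m) = 0 → m = 0 := by
      intro m hm
      have : φ (σ m) = f.symm m := LinearMap.congr_fun h1 m
      rw [this] at hm
      simpa using hm
    -- The kernel of `φ` is killed by `u`, hence lies in the image of `σ`; there `φ` is injective.
    have hinj : ∀ m, φ m = 0 → m = 0 := by
      intro m hm
      obtain ⟨z, hz⟩ := h2 m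
      have hz0 : z = 0 := hinj1 z (by rw [hz, map_smul, hm, smul_zero])
      rw [hz0, map_zero] at hz
      obtain ⟨w, rfl⟩ := h3 m hz.symm
      rw [hinj1 w hm, map_zero]
    -- Every `u y` is also `u` times an element of the image of `φ`. So the quotient by that image
    -- is killed by `u`, and each coset has a representative killed by `u`. This makes the
    -- semisimple quotient split off.
    have hu : ∀ y : Y, ∃ m, c.u • y = φ (c.u • m) := by
      intro y
      let z := f ⟨c.u • y, c.u_smul_mem_radN y⟩
      obtain ⟨m, hm⟩ := h4 z
      refine ⟨m, ?_⟩
      rw [pow_one] at hm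
      rw [← hm]
      have : φ (σ z) = f.symm z := LinearMap.congr_fun h1 z
      rw [this, LinearEquiv.symm_apply_apply]
    have : Finite (Y ⧸ LinearMap.range φ) := Finite.of_surjective _ (Submodule.mkQ_surjective _)
    obtain ⟨s, hs, hQ⟩ := exists_hasType_of_rad (c := c) (Z := Y ⧸ LinearMap.range φ) (by
      intro z
      obtain ⟨y, rfl⟩ := Submodule.Quotient.mk_surjective _ z
      obtain ⟨m, hm⟩ := hu y
      rw [← Submodule.Quotient.mk_smul, Submodule.Quotient.mk_eq_zero, hm]
      exact ⟨_, rfl⟩)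
    obtain ⟨hs0, l', rfl, ⟨g⟩⟩ := hQ
    obtain ⟨τ, hτ⟩ := exists_lift_semisimple (c := c) (f := (LinearMap.range φ).mkQ) (by
      intro z
      obtain ⟨y, rfl⟩ := Submodule.Quotient.mk_surjective _ z
      obtain ⟨m, hm⟩ := hu y
      refine ⟨y - φ m, ?_, by rw [smul_sub, hm, map_smul, sub_self]⟩
      have h0 : (LinearMap.range φ).mkQ (φ m) = 0 := (Submodule.Quotient.mk_eq_zero _).2 ⟨m, rfl⟩
      rw [map_sub, h0, sub_zero]
      rfl) hs g.symm.toLinearMap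
    have hτ' : ∀ x, (LinearMap.range φ).mkQ (τ x) = g.symm x := fun x => LinearMap.congr_fun hτ x
    have hφ : ∀ m, (LinearMap.range φ).mkQ (φ m) = 0 := fun m => by
      rw [Submodule.mkQ_apply, Submodule.Quotient.mk_eq_zero]
      exact ⟨m, rfl⟩
    have hbij : Function.Bijective (φ.coprod τ) := by
      constructor
      · rw [injective_iff_map_eq_zero]
        rintro ⟨m, x⟩ h
        rw [LinearMap.coprod_apply] at h
        have hx := congrArg (LinearMap.range φ).mkQ h
        rw [map_add, hφ, hτ', zero_add, map_zero] at hx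
        have hx : x = 0 := by simpa using hx
        rw [hx, map_zero, add_zero] at h
        rw [hx, hinj m h, Prod.mk_zero_zero]
      · intro y
        have : y - τ (g ((LinearMap.range φ).mkQ y)) ∈ LinearMap.range φ := by
          rw [← Submodule.Quotient.mk_eq_zero, ← Submodule.mkQ_apply, map_sub, hτ',
            LinearEquiv.symm_apply_apply, sub_self]
        obtain ⟨m, hm⟩ := this
        exact ⟨(m, _), by rw [LinearMap.coprod_apply, hm, sub_add_cancel]⟩
    exact ⟨_, (hM.prod (c.hasType_Md l' hs0)).congr (LinearEquiv.ofBijective _ hbij)⟩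

end CycRing

end IyamaHall
end

noncomputable section
namespace IyamaHall
namespace CycRing

variable {n : ℕ} [NeZero n] {A : Type} [Ring A] {c : CycRing n A}
variable {Y Z : Type} [AddCommGroup Y] [Module A Y] [AddCommGroup Z] [Module A Z]
  {t s s₁ s₂ r : Multiset (ZMod n × ℕ∞)}

/-! ### Counting chains of submodules -/

variable (c Y) in
/-- Chains `L ≤ W ≤ Y` with subquotients of given types. -/
def chains (s₁ s₂ t : Multiset (ZMod n × ℕ∞)) : Set (Submodule A Y × Submodule A Y) :=
  {x | x.2 ≤ x.1 ∧ c.HasType s₁ (Y ⧸ x.1) ∧ c.HasType s₂ (x.1 ⧸ x.2.submoduleOf x.1) ∧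
    c.HasType t x.2}

theorem submoduleOf_map_subtype (W : Submodule A Y) (L : Submodule A W) :
    (L.map W.subtype).submoduleOf W = L :=
  Submodule.comap_map_eq_of_injective Subtype.val_injective L

/-- The quotient of a preimage under the projection to a quotient. -/
def comapMkQEquiv (L : Submodule A Y) (W : Submodule A (Y ⧸ L)) :
    (W.comap L.mkQ ⧸ L.submoduleOf (W.comap L.mkQ)) ≃ₗ[A] W :=
  (Submodule.quotEquivOfEq _ _ (by
    ext x
    rw [Submodule.submoduleOf, Submodule.mem_comap, LinearMap.mem_ker, ← Submodule.coe_eq_zero,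
      LinearMap.coe_restrict_apply, Submodule.mkQ_apply, Submodule.Quotient.mk_eq_zero]
    rfl)).trans
  ((L.mkQ.restrict (p := W.comap L.mkQ) (q := W) fun _ hx => hx).quotKerEquivOfSurjective (by
    rintro ⟨w, hw⟩
    obtain ⟨y, rfl⟩ := L.mkQ_surjective w
    exact ⟨⟨y, hw⟩, rfl⟩))

/-- The quotient by a preimage under the projection to a quotient. -/
def quotComapMkQEquiv (L : Submodule A Y) (W : Submodule A (Y ⧸ L)) :
    (Y ⧸ W.comap L.mkQ) ≃ₗ[A] (Y ⧸ L) ⧸ W :=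
  (Submodule.quotEquivOfEq _ _ (by rw [LinearMap.ker_comp, Submodule.ker_mkQ])).trans
  ((W.mkQ.comp L.mkQ).quotKerEquivOfSurjective
    (W.mkQ_surjective.comp L.mkQ_surjective))

/-- The chains are fibred over the upper term `W`, whose type is unique; `f v` is the number of
lower terms inside a submodule of type `v`. -/
theorem card_chains_left {S : Finset (Multiset (ZMod n × ℕ∞))}
    {f : Multiset (ZMod n × ℕ∞) → ℕ}
    (hS : ∀ W : Submodule A Y, c.HasType s₁ (Y ⧸ W) → ∃ v ∈ S, c.HasType v W)
    (h₁ : ∀ v ∈ S, (c.hT s₁ Y v).Finite)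
    (h₂ : ∀ v ∈ S, ∀ W : Submodule A Y, c.HasType v W →
      (c.hT s₂ W t).Finite ∧ (c.hT s₂ W t).ncard = f v) :
    Nat.card (c.chains Y s₁ s₂ t) = ∑ v ∈ S, (c.hT s₁ Y v).ncard * f v := by
  let Φ : (Σ v : S, Σ W : c.hT s₁ Y v, c.hT s₂ W.1 t) → c.chains Y s₁ s₂ t := fun x =>
    ⟨(x.2.1.1, x.2.2.1.map x.2.1.1.subtype), by
      obtain ⟨⟨v, hv⟩, ⟨W, hW⟩, ⟨L, hL⟩⟩ := x
      refine ⟨Submodule.map_subtype_le _ _, hW.2, ?_, ?_⟩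
      · change c.HasType s₂ (W ⧸ (L.map W.subtype).submoduleOf W)
        rw [submoduleOf_map_subtype]
        exact hL.2
      · exact hL.1.congr (Submodule.equivMapOfInjective _ Subtype.val_injective L)⟩
  have hΦ : Function.Bijective Φ := by
    constructor
    · rintro ⟨⟨v, hv⟩, ⟨W, hW⟩, ⟨L, hL⟩⟩ ⟨⟨v', hv'⟩, ⟨W', hW'⟩, ⟨L', hL'⟩⟩ h
      have h := congrArg Subtype.val h
      have h1 : W = W' := congrArg Prod.fst h
      subst h1
      obtain rfl := hW.1.unique hW'.1
      have h2 : L.map W.subtype = L'.map W.subtype := congrArg Prod.snd h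
      obtain rfl := Submodule.map_injective_of_injective Subtype.val_injective h2
      rfl
    · rintro ⟨⟨W, L⟩, h1, h2, h3, h4⟩
      obtain ⟨v, hv, hW⟩ := hS W h2
      exact ⟨⟨⟨v, hv⟩, ⟨W, hW, h2⟩, ⟨L.submoduleOf W,
        h4.congr (Submodule.submoduleOfEquivOfLe h1).symm, h3⟩⟩,
        Subtype.ext (Prod.ext rfl (by
          change (L.submoduleOf W).map W.subtype = L
          rw [Submodule.submoduleOf, Submodule.map_comap_subtype, inf_eq_right.2 h1]))⟩
  rw [← Nat.card_congr (Equiv.ofBijective Φ hΦ)]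
  have : ∀ v : S, Finite (c.hT s₁ Y v) := fun v => h₁ v.1 v.2
  have : ∀ (v : S) (W : c.hT s₁ Y v), Finite (c.hT s₂ W.1 t) := fun v W =>
    (h₂ v.1 v.2 W.1 W.2.1).1
  rw [Nat.card_sigma, ← Finset.sum_coe_sort S]
  refine Finset.sum_congr rfl fun v _ => ?_
  have := Fintype.ofFinite (c.hT s₁ Y v)
  rw [Nat.card_sigma, Finset.sum_congr rfl fun W _ => (Nat.card_coe_set_eq _).trans
    (h₂ v.1 v.2 W.1 W.2.1).2, Finset.sum_const, Finset.card_univ, smul_eq_mul,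
    ← Nat.card_eq_fintype_card, Nat.card_coe_set_eq]

/-- The chains are fibred over the lower term `L`. The upper terms are then submodules of `Y ⧸ L`,
and a type of this quotient is needed only when the fibre is nonempty. -/
theorem card_chains_right {S : Finset (Multiset (ZMod n × ℕ∞))}
    {f : Multiset (ZMod n × ℕ∞) → ℕ}
    (hS : ∀ L : Submodule A Y, (c.hT s₁ (Y ⧸ L) s₂).Nonempty → ∃ v ∈ S, c.HasType v (Y ⧸ L))
    (h₁ : ∀ v ∈ S, (c.hT v Y t).Finite)
    (h₂ : ∀ v ∈ S, ∀ L : Submodule A Y, c.HasType v (Y ⧸ L) →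
      (c.hT s₁ (Y ⧸ L) s₂).Finite ∧ (c.hT s₁ (Y ⧸ L) s₂).ncard = f v) :
    Nat.card (c.chains Y s₁ s₂ t) = ∑ v ∈ S, f v * (c.hT v Y t).ncard := by
  let Φ : (Σ v : S, Σ L : c.hT v Y t, c.hT s₁ (Y ⧸ L.1) s₂) → c.chains Y s₁ s₂ t := fun x =>
    ⟨(x.2.2.1.comap x.2.1.1.mkQ, x.2.1.1), by
      obtain ⟨⟨v, hv⟩, ⟨L, hL⟩, ⟨W, hW⟩⟩ := x
      exact ⟨Submodule.le_comap_mkQ _ _, hW.2.congr (quotComapMkQEquiv L W).symm,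
        hW.1.congr (comapMkQEquiv L W).symm, hL.1⟩⟩
  have hΦ : Function.Bijective Φ := by
    constructor
    · rintro ⟨⟨v, hv⟩, ⟨L, hL⟩, ⟨W, hW⟩⟩ ⟨⟨v', hv'⟩, ⟨L', hL'⟩, ⟨W', hW'⟩⟩ h
      have h := congrArg Subtype.val h
      have h1 : L = L' := congrArg Prod.snd h
      subst h1
      obtain rfl := hL.2.unique hL'.2
      have h2 : W.comap L.mkQ = W'.comap L.mkQ := congrArg Prod.fst h
      obtain rfl := Submodule.comap_injective_of_surjective L.mkQ_surjective h2
      rfl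
    · rintro ⟨⟨W, L⟩, h1, h2, h3, h4⟩
      have h5 : (W.map L.mkQ).comap L.mkQ = W := by
        rw [Submodule.comap_map_mkQ, sup_eq_right.2 h1]
      have h6 : W.map L.mkQ ∈ c.hT s₁ (Y ⧸ L) s₂ := by
        refine ⟨?_, ?_⟩
        · refine HasType.congr ?_ (comapMkQEquiv L (W.map L.mkQ))
          rw [h5]
          exact h3
        · refine HasType.congr ?_ (quotComapMkQEquiv L (W.map L.mkQ))
          rw [h5]
          exact h2
      obtain ⟨v, hv, hL⟩ := hS L ⟨_, h6⟩
      exact ⟨⟨⟨v, hv⟩, ⟨L, h4, hL⟩, ⟨_, h6⟩⟩, Subtype.ext (Prod.ext h5 rfl)⟩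
  rw [← Nat.card_congr (Equiv.ofBijective Φ hΦ)]
  have : ∀ v : S, Finite (c.hT v Y t) := fun v => h₁ v.1 v.2
  have : ∀ (v : S) (L : c.hT v Y t), Finite (c.hT s₁ (Y ⧸ L.1) s₂) := fun v L =>
    (h₂ v.1 v.2 L.1 L.2.2).1
  rw [Nat.card_sigma, ← Finset.sum_coe_sort S]
  refine Finset.sum_congr rfl fun v _ => ?_
  have := Fintype.ofFinite (c.hT v Y t)
  rw [Nat.card_sigma, Finset.sum_congr rfl fun L _ => (Nat.card_coe_set_eq _).trans
    (h₂ v.1 v.2 L.1 L.2.2).2, Finset.sum_const, Finset.card_univ, smul_eq_mul,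
    ← Nat.card_eq_fintype_card, Nat.card_coe_set_eq, mul_comm]

/-! ### Finiteness -/

theorem HasType.finite_quotient_radN (h : c.HasType t Y) (N : ℕ) : Finite (Y ⧸ c.radN Y N) := by
  induction t using Multiset.induction generalizing Y with
  | empty =>
    have := h.subsingleton
    infer_instance
  | cons p t ih =>
    obtain ⟨Y', hY', ⟨f⟩⟩ := h.exists_cons
    have h1 : Finite (c.C p ⧸ c.radN (c.C p) N) := by
      by_cases hp : (N : ℕ∞) ≤ p.2
      · have := c.finite_C N p.1
        exact Finite.of_equiv _ (c.quotRadEquiv p N hp).symm.toEquiv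
      · obtain ⟨k, j⟩ := p
        lift j to ℕ using fun h => hp (h ▸ le_top)
        have := c.finite_C j k
        exact Finite.of_surjective _ (Submodule.mkQ_surjective _)
    have h2 := ih hY'
    have e : (Y ⧸ c.radN Y N) ≃ₗ[A] (c.C p ⧸ c.radN (c.C p) N) × (Y' ⧸ c.radN Y' N) :=
      (c.quotRadCongr f N).trans
        ((Submodule.quotEquivOfEq _ _ (c.radN_prod N)).trans (prodQuotEquiv _ _))
    exact Finite.of_equiv _ e.symm.toEquiv

/-- A quotient of finite type is killed by some `u ^ N`, so the submodules in question come from the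
finite module `Y ⧸ u ^ N Y`. The module `Y` itself may be infinite, as is needed for lattices. -/
theorem HasType.finite_submodules (h : c.HasType r Y) (hs : FiniteType s) :
    {W : Submodule A Y | c.HasType s (Y ⧸ W)}.Finite := by
  obtain ⟨N, hN⟩ := exists_bound hs
  have := h.finite_quotient_radN N
  have : Finite (Submodule A (Y ⧸ c.radN Y N)) :=
    Finite.of_injective (fun W => (W : Set (Y ⧸ c.radN Y N))) SetLike.coe_injective
  refine (Set.finite_range fun W : Submodule A (Y ⧸ c.radN Y N) =>
    W.comap (c.radN Y N).mkQ).subset ?_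
  intro W hW
  refine ⟨W.map (c.radN Y N).mkQ, ?_⟩
  change Submodule.comap _ _ = W
  rw [Submodule.comap_map_mkQ, sup_eq_right]
  exact radN_le_of_quotient fun y => HasType.pow_smul_eq_zero hW hN y

theorem HasType.finite_hT (h : c.HasType r Y) (hs : FiniteType s) : (c.hT s Y t).Finite :=
  (h.finite_submodules hs).subset fun _ hW => hW.2

/-- An extension of finite modules of known type is a finite module with a type. -/
theorem exists_hasType_extension (h₁ : FiniteType s₁) (h₂ : FiniteType s₂)
    (h : (c.hT s₁ Y s₂).Nonempty) :
    ∃ v, FiniteType v ∧ len v = len s₁ + len s₂ ∧ c.HasType v Y := by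
  obtain ⟨W, hW2, hW1⟩ := h
  have hf1 := hW1.finite h₁
  have hf2 := hW2.finite h₂
  have hcard : Nat.card Y = c.q ^ (len s₁ + len s₂) := by
    rw [Submodule.card_eq_card_quotient_mul_card W, hW1.card h₁, hW2.card h₂, pow_add, mul_comm]
  have : Finite Y := by
    apply Nat.finite_of_card_ne_zero
    rw [hcard]
    exact pow_ne_zero _ (by have := c.one_lt_q; omega)
  obtain ⟨N₁, hN₁⟩ := exists_bound h₁
  obtain ⟨N₂, hN₂⟩ := exists_bound h₂
  obtain ⟨v, hv, hY⟩ := exists_hasType_of_finite (c := c) (Y := Y) (N := N₂ + N₁) (by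
    intro y
    have h1 : c.u ^ N₁ • y ∈ W := by
      rw [← Submodule.Quotient.mk_eq_zero, Submodule.Quotient.mk_smul]
      exact hW1.pow_smul_eq_zero hN₁ _
    have h2 := hW2.pow_smul_eq_zero hN₂ ⟨_, h1⟩
    rw [pow_add, mul_smul]
    exact congrArg Subtype.val h2)
  refine ⟨v, hv, Nat.pow_right_injective c.one_lt_q ?_, hY⟩
  change c.q ^ _ = c.q ^ _
  rw [← hY.card hv, hcard]

/-- The proper types of finite modules of given length. -/
def typesOfLen (L : ℕ) : Set (Multiset (ZMod n × ℕ∞)) :=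
  {v | FiniteType v ∧ (∀ p ∈ v, p.2 ≠ 0) ∧ len v = L}

/-- All parts are at most `L`, and since no part vanishes there are at most `L` of them. -/
theorem finite_typesOfLen (L : ℕ) : (typesOfLen (n := n) L).Finite := by
  classical
  let F : Finset (ZMod n × ℕ∞) :=
    Finset.univ ×ˢ (Finset.range (L + 1)).image fun i : ℕ => (i : ℕ∞)
  refine (Set.finite_Icc (0 : Multiset (ZMod n × ℕ∞)) (L • F.val)).subset ?_
  rintro v ⟨h1, h2, h3⟩
  refine ⟨Multiset.zero_le _, ?_⟩
  rw [Multiset.le_iff_count]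
  intro p
  by_cases hp : p ∈ v
  · have hpF : p ∈ F := by
      refine Finset.mem_product.2 ⟨Finset.mem_univ _, Finset.mem_image.2 ⟨p.2.toNat, ?_,
        ENat.natCast_toNat (h1 p hp)⟩⟩
      rw [Finset.mem_range, ← h3]
      exact Nat.lt_succ_of_le (Multiset.single_le_sum (fun _ _ => Nat.zero_le _) _
        (Multiset.mem_map_of_mem _ hp))
    rw [Multiset.count_nsmul, Multiset.count_eq_one_of_mem F.nodup hpF, mul_one, ← h3]
    refine (Multiset.count_le_card _ _).trans ?_
    rw [← Multiset.card_map (fun p : ZMod n × ℕ∞ => p.2.toNat), len]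
    refine Multiset.card_nsmul_le_sum (a := 1) ?_ |>.trans' (by simp)
    intro x hx
    obtain ⟨p', hp', rfl⟩ := Multiset.mem_map.1 hx
    rw [Nat.one_le_iff_ne_zero, Ne, ENat.toNat_eq_zero, not_or]
    exact ⟨h2 p' hp', h1 p' hp'⟩
  · rw [Multiset.count_eq_zero_of_notMem hp]
    exact Nat.zero_le _

/-! ### Generation by semisimple modules -/

theorem finiteType_bind_sh (hs : FiniteType s) (m : ℕ) : FiniteType (s.bind (sh m)) := by
  intro p hp
  obtain ⟨p', hp', h⟩ := Multiset.mem_bind.1 hp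
  unfold sh at h
  split_ifs at h
  · simp at h
  · rw [Multiset.mem_singleton.1 h]
    exact fun h' => hs p' hp' (by simpa using h')

theorem len_bind_sh (hs : FiniteType s) (h0 : ∀ p ∈ s, p.2 ≠ 0) :
    len (s.bind (sh 1)) + s.card = len s := by
  induction s using Multiset.induction with
  | empty => simp [len]
  | cons p s ih =>
    have ih' := ih (fun p hp => hs p (Multiset.mem_cons_of_mem hp))
      (fun p hp => h0 p (Multiset.mem_cons_of_mem hp))
    have h1 : len (sh 1 p) + 1 = p.2.toNat := by
      obtain ⟨k, j⟩ := p
      lift j to ℕ using hs (k, j) (Multiset.mem_cons_self _ _)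
      have hj : j ≠ 0 := by
        rintro rfl
        exact h0 _ (Multiset.mem_cons_self _ _) rfl
      unfold sh
      split_ifs with h
      · have : j ≤ 1 := Nat.cast_le.1 h
        have : j = 1 := by omega
        simp [len, this]
      · have e : ((j : ℕ∞) - ((1 : ℕ) : ℕ∞)) = ((j - 1 : ℕ) : ℕ∞) := (ENat.natCast_sub _ _).symm
        simp only [len, Multiset.map_singleton, Multiset.sum_singleton, ENat.toNat_natCast, e]
        omega
    have h2 : ∀ a b : Multiset (ZMod n × ℕ∞), len (a + b) = len a + len b := by
      intro a b
      simp [len]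
    rw [Multiset.cons_bind, h2, Multiset.card_cons, ← Multiset.singleton_add p s, h2]
    have h3 : len {p} = p.2.toNat := by simp [len]
    omega

theorem bind_sh_ne_zero (s : Multiset (ZMod n × ℕ∞)) (m : ℕ) : ∀ p ∈ s.bind (sh m), p.2 ≠ 0 := by
  intro p hp
  obtain ⟨p', hp', h⟩ := Multiset.mem_bind.1 hp
  unfold sh at h
  split_ifs at h with h1
  · simp at h
  · rw [Multiset.mem_singleton.1 h]
    exact (tsub_pos_of_lt (not_le.1 h1)).ne'

/-- A type is determined by the types of the top and of the radical. -/
theorem eq_of_top_rad (hs : ∀ p ∈ s, p.2 ≠ 0) (ht : ∀ p ∈ t, p.2 ≠ 0)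
    (h1 : s.map (fun p => (p.1, (1 : ℕ∞))) = t.map fun p => (p.1, (1 : ℕ∞)))
    (h2 : s.bind (sh 1) = t.bind (sh 1)) : s = t := by
  refine ext_of_countP hs ht fun k m => ?_
  rcases m with _ | m
  · have key : ∀ r : Multiset (ZMod n × ℕ∞), (∀ p ∈ r, p.2 ≠ 0) →
        r.countP (fun p => p.1 = k ∧ ((0 : ℕ) : ℕ∞) < p.2) =
          (r.map fun p => (p.1, (1 : ℕ∞))).countP fun p => p.1 = k := by
      intro r hr
      rw [Multiset.countP_map, ← Multiset.countP_eq_card_filter]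
      refine Multiset.countP_congr rfl fun p hp => ?_
      simp [pos_iff_ne_zero, hr p hp]
    rw [key s hs, key t ht, h1]
  · have key : ∀ r : Multiset (ZMod n × ℕ∞),
        r.countP (fun p => p.1 = k ∧ ((m + 1 : ℕ) : ℕ∞) < p.2) =
          (r.bind (sh 1)).countP (fun p => p.1 = k + 1 ∧ (m : ℕ∞) < p.2) := by
      intro r
      induction r using Multiset.induction with
      | empty => simp
      | cons p r ih =>
        rw [Multiset.cons_bind, Multiset.countP_add, Multiset.countP_cons, ih, add_comm]
        congr 1
        unfold sh
        by_cases h : p.2 ≤ ((1 : ℕ) : ℕ∞)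
        · rw [if_pos h, if_neg]
          · simp
          · rintro ⟨-, h3⟩
            have : ((m + 1 : ℕ) : ℕ∞) < (1 : ℕ) := h3.trans_le h
            have := Nat.cast_lt.1 this
            omega
        · rw [if_neg h, ← Multiset.cons_zero, Multiset.countP_cons, Multiset.countP_zero, zero_add]
          have h4 : ((m + 1 : ℕ) : ℕ∞) < p.2 ↔ (m : ℕ∞) < p.2 - (1 : ℕ) := by
            rw [lt_tsub_iff_right, Nat.cast_add]
          simp only [h4, Nat.cast_one, add_left_inj]
    rw [key, key, h2]

theorem semisimple_map_top (s : Multiset (ZMod n × ℕ∞)) :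
    Semisimple (s.map fun p => (p.1, (1 : ℕ∞))) := by
  intro p hp
  obtain ⟨p', -, rfl⟩ := Multiset.mem_map.1 hp
  rfl

theorem Semisimple.finiteType (hs : Semisimple s) : FiniteType s := fun p hp => by simp [hs p hp]

theorem len_map_top (s : Multiset (ZMod n × ℕ∞)) :
    len (s.map fun p => (p.1, (1 : ℕ∞))) = s.card := by
  induction s using Multiset.induction_on with
  | empty => simp [len]
  | cons a s ih => 
    rw [len] at ih
    rw [len, Multiset.map_cons, Multiset.map_cons, Multiset.sum_cons, ih, Multiset.card_cons]
    simp [add_comm]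

/-- The radical is the only submodule with its type and the top as quotient. -/
theorem HasType.hT_top_rad (h : c.HasType s Y) (hs : FiniteType s) :
    c.hT (s.map fun p => (p.1, 1)) Y (s.bind (sh 1)) = {c.radN Y 1} := by
  have hfin := h.finite hs
  ext W
  constructor
  · rintro ⟨h1, h2⟩
    have hle : c.radN Y 1 ≤ W := radN_le_of_quotient fun y => by
      rw [pow_one]
      exact h2.u_smul (semisimple_map_top s) y
    refine (SetLike.coe_injective (Set.eq_of_subset_of_ncard_le hle ?_ (Set.toFinite _))).symm
    rw [← Nat.card_coe_set_eq, ← Nat.card_coe_set_eq]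
    exact ((h1.card (finiteType_bind_sh hs 1)).trans
      ((h.radN 1).card (finiteType_bind_sh hs 1)).symm).le
  · rintro rfl
    exact ⟨h.radN 1, h.top⟩

/-- The submodule contains the radical of `Y` because its quotient is semisimple. Equal lengths
would make it the radical, and then `eq_of_top_rad` would give `t = s`. This is the triangularity
behind the recursion for Hall polynomials. -/
theorem HasType.len_lt_of_mem_hT (h : c.HasType t Y) (ht : FiniteType t) (hts : t ≠ s)
    (hs : FiniteType s) (hs0 : ∀ p ∈ s, p.2 ≠ 0)
    (hne : (c.hT (s.map fun p => (p.1, 1)) Y (s.bind (sh 1))).Nonempty) :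
    len (t.bind (sh 1)) < len (s.bind (sh 1)) := by
  have hfin := h.finite ht
  obtain ⟨W, h1, h2⟩ := hne
  have hle : c.radN Y 1 ≤ W := radN_le_of_quotient fun y => by
    rw [pow_one]
    exact h2.u_smul (semisimple_map_top s) y
  have hcard : Nat.card (c.radN Y 1) ≤ Nat.card W :=
    Nat.card_le_card_of_injective _ (Submodule.inclusion_injective hle)
  rw [(h.radN 1).card (finiteType_bind_sh ht 1), h1.card (finiteType_bind_sh hs 1)] at hcard
  refine lt_of_le_of_ne ((Nat.pow_le_pow_iff_right c.one_lt_q).1 hcard) fun heq => hts ?_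
  have hW : c.radN Y 1 = W := by
    refine SetLike.coe_injective (Set.eq_of_subset_of_ncard_le hle ?_ (Set.toFinite _))
    rw [← Nat.card_coe_set_eq, ← Nat.card_coe_set_eq]
    refine ((h1.card (finiteType_bind_sh hs 1)).trans ?_).le
    rw [← heq]
    exact ((h.radN 1).card (finiteType_bind_sh ht 1)).symm
  subst hW
  exact eq_of_top_rad h.ne_zero hs0 (h.top.unique h2) ((h.radN 1).unique h1)

/-- Hall numbers with a quotient of finite length are polynomials in `q`. -/
theorem isPolynomialHall (hs : FiniteType s) (hs0 : ∀ p ∈ s, p.2 ≠ 0)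
    (r t : Multiset (ZMod n × ℕ∞)) : IsPolynomialHall s r t := by
  classical
  -- The outer induction is on the length of the quotient, the inner one on the length of its
  -- radical at fixed total length.
  induction hL : len s using Nat.strong_induction_on generalizing s r t with
  | _ L ihL =>
  induction hM : len (s.bind (sh 1)) using Nat.strong_induction_on generalizing s r t with
  | _ M ihM =>
  by_cases hss : s = 0
  · exact isPolynomialHall_of_semisimple (by rw [hss]; intro p hp; simp at hp) r t
  set top : Multiset (ZMod n × ℕ∞) := s.map fun p => (p.1, 1) with htop
  set rad : Multiset (ZMod n × ℕ∞) := s.bind (sh 1) with hrad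
  have hlen := len_bind_sh hs hs0
  rw [← hrad] at hlen
  have hcard : 0 < s.card := Multiset.card_pos.2 hss
  obtain ⟨S, hS⟩ := exists_types_of_submodules r 1
  choose P₁ hP₁ using fun v => isPolynomialHall_of_semisimple (semisimple_map_top s) r v
  choose P₂ hP₂ using fun v => ihL (len rad) (by omega) (finiteType_bind_sh hs 1)
    (bind_sh_ne_zero s 1) v t rfl
  choose P₃ hP₃ using fun v => isPolynomialHall_of_semisimple (semisimple_map_top s) v rad
  have hfin := finite_typesOfLen (n := n) (len s)
  have hmem : s ∈ hfin.toFinset := hfin.mem_toFinset.2 ⟨hs, hs0, rfl⟩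
  have hQ : ∀ v ∈ hfin.toFinset.erase s, ∃ Q : ℤ[X], ∀ (A : Type) [Ring A] (c : CycRing n A)
      (Y : Type) [AddCommGroup Y] [Module A Y], c.HasType r Y →
      (P₃ v).eval (c.q : ℤ) * ((c.hT v Y t).ncard : ℤ) = Q.eval (c.q : ℤ) := by
    intro v hv
    obtain ⟨hvs, hv⟩ := Finset.mem_erase.1 hv
    obtain ⟨hv1, hv2, hv3⟩ := hfin.mem_toFinset.1 hv
    by_cases hlt : len (v.bind (sh 1)) < len rad
    · obtain ⟨Q, hQ⟩ := ihM _ (hM ▸ hlt) hv1 hv2 r t (hv3.trans hL) rfl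
      exact ⟨P₃ v * Q, fun A _ c Y _ _ hY => by rw [eval_mul, (hQ A c Y hY).2]⟩
    -- If the radical of `v` is not shorter than that of `s`, the coefficient of `v` vanishes by
    -- `HasType.len_lt_of_mem_hT`.
    · refine ⟨0, fun A _ c Y _ _ hY => ?_⟩
      obtain ⟨V, hV⟩ := exists_hasType (c := c) v hv2
      rw [← (hP₃ v A c V hV).2]
      have : c.hT top V rad = ∅ := by
        by_contra hne
        exact hlt (hV.len_lt_of_mem_hT hv1 hvs hs hs0 (Set.nonempty_iff_ne_empty.2 hne))
      rw [this]
      simp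
  choose! Q hQ using hQ
  -- Counted through the upper term, the chains involve semisimple quotients and quotients shorter
  -- than `s`. Counted through the lower term, they give the unknown number with coefficient `1`,
  -- since the radical is the only admissible submodule for `v = s`, plus terms known by the inner
  -- induction.
  refine ⟨∑ v ∈ S, P₁ v * P₂ v - ∑ v ∈ hfin.toFinset.erase s, Q v, fun A _ c Y _ _ hY =>
    ⟨hY.finite_hT hs, ?_⟩⟩
  have hleft := card_chains_left (c := c) (Y := Y) (s₁ := top) (s₂ := rad) (t := t) (S := S)
    (f := fun v => ((P₂ v).eval (c.q : ℤ)).toNat)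
    (fun W hW => hS A c Y hY W (radN_le_of_quotient fun y => by
      rw [pow_one]; exact hW.u_smul (semisimple_map_top s) y))
    (fun v _ => (hP₁ v A c Y hY).1)
    (fun v _ W hW => ⟨(hP₂ v A c W hW).1, by
      rw [← (hP₂ v A c W hW).2, Int.toNat_natCast]⟩)
  have hright := card_chains_right (c := c) (Y := Y) (s₁ := top) (s₂ := rad) (t := t)
    (S := hfin.toFinset) (f := fun v => ((P₃ v).eval (c.q : ℤ)).toNat)
    (fun L hL => by
      obtain ⟨v, h1, h2, h3⟩ := exists_hasType_extension (semisimple_map_top s).finiteType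
        (finiteType_bind_sh hs 1) hL
      refine ⟨v, hfin.mem_toFinset.2 ⟨h1, h3.ne_zero, ?_⟩, h3⟩
      rw [h2, len_map_top, ← hrad]
      omega)
    (fun v hv => hY.finite_hT (hfin.mem_toFinset.1 hv).1)
    (fun v _ L hL => ⟨(hP₃ v A c _ hL).1, by
      rw [← (hP₃ v A c _ hL).2, Int.toNat_natCast]⟩)
  rw [hleft] at hright
  -- `P₂ v` is known to take the value of a count only when a module of type `v` is at hand. If
  -- there is no submodule of type `v`, the other factor is zero.
  have hnn₂ : ∀ v ∈ S, (((P₂ v).eval (c.q : ℤ)).toNat : ℤ) * (c.hT top Y v).ncard =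
      (P₁ v * P₂ v).eval (c.q : ℤ) := by
    intro v _
    rw [eval_mul, ← (hP₁ v A c Y hY).2, mul_comm]
    rcases (c.hT top Y v).eq_empty_or_nonempty with h | ⟨W, hW⟩
    · rw [← htop, h]; simp
    · rw [← (hP₂ v A c W hW.1).2, Int.toNat_natCast]
  have hnn₃ : ∀ v ∈ hfin.toFinset, (((P₃ v).eval (c.q : ℤ)).toNat : ℤ) = (P₃ v).eval (c.q : ℤ) := by
    intro v hv
    obtain ⟨V, hV⟩ := exists_hasType (c := c) v (hfin.mem_toFinset.1 hv).2.1
    rw [← (hP₃ v A c V hV).2, Int.toNat_natCast]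
  have hone : (P₃ s).eval (c.q : ℤ) = 1 := by
    obtain ⟨V, hV⟩ := exists_hasType (c := c) s hs0
    rw [← (hP₃ s A c V hV).2, hV.hT_top_rad hs]
    simp
  have hz := congrArg (Nat.cast : ℕ → ℤ) hright
  push_cast at hz
  have h2 : ∀ v ∈ S, ((c.hT top Y v).ncard : ℤ) * (((P₂ v).eval (c.q : ℤ)).toNat : ℤ) =
      (P₁ v * P₂ v).eval (c.q : ℤ) := fun v hv => (mul_comm _ _).trans (hnn₂ v hv)
  have h3 : ∀ v ∈ hfin.toFinset.erase s, (((P₃ v).eval (c.q : ℤ)).toNat : ℤ) *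
      ((c.hT v Y t).ncard : ℤ) = (Q v).eval (c.q : ℤ) := fun v hv => by
    rw [hnn₃ v (Finset.mem_of_mem_erase hv), hQ v hv A c Y hY]
  rw [Finset.sum_congr rfl h2, ← Finset.add_sum_erase _ _ hmem, hnn₃ s hmem, hone, one_mul,
    Finset.sum_congr rfl h3] at hz
  rw [eval_sub, eval_finsetSum, eval_finsetSum, hz, add_sub_cancel_right]

end CycRing

end IyamaHall
end

/-! ### Triangular rings over a ring with a uniformizer -/

noncomputable section

namespace IyamaHall

/-- A ring whose Jacobson radical is generated by a normal regular element `ϖ` with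
`⋂ ϖ ^ N Ω = 0`, whose other elements are units, and whose residue ring is finite. -/
structure Uniformizer (Ω : Type) [Ring Ω] (ϖ : Ω) : Prop where
  mem_jacobson : ∀ x, x ∈ Ring.jacobson Ω ↔ ϖ ∣ x
  exists_mul_eq_one : ∀ x, x ∉ Ring.jacobson Ω → ∃ y, y * x = 1
  left_normal : ∀ a, ∃ b, ϖ * a = b * ϖ
  eq_zero_of_mul : ∀ a, a * ϖ = 0 → a = 0
  sep : ∀ a, (∀ N : ℕ, ϖ ^ N ∣ a) → a = 0
  one_lt_card : 1 < Nat.card (Ω ⧸ Ring.jacobson Ω)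

namespace Triangular

variable {m : ℕ} {Ω : Type} [Ring Ω] {ϖ : Ω} (hϖ : Uniformizer Ω ϖ)

/-- The cyclic shift matrix whose corner entry is `ϖ`. -/
def shiftMatrix (m : ℕ) (ϖ : Ω) : Matrix (Fin (m + 1)) (Fin (m + 1)) Ω :=
  fun i j => if i = j + 1 then (if j = Fin.last m then ϖ else 1) else 0

/-- Multiplication from the left moves every row down by one; the row that wraps around to the top
picks up the factor `ϖ`. -/
theorem shiftMatrix_mul_apply (b : Matrix (Fin (m + 1)) (Fin (m + 1)) Ω) (i j : Fin (m + 1)) :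
    (shiftMatrix m ϖ * b) (i + 1) j = (if i = Fin.last m then ϖ else 1) * b i j := by
  rw [Matrix.mul_apply, Finset.sum_eq_single i]
  · simp [shiftMatrix]
  · intro k _ hk
    simp [shiftMatrix, hk.symm]
  · simp

theorem mul_shiftMatrix_apply (b : Matrix (Fin (m + 1)) (Fin (m + 1)) Ω) (i j : Fin (m + 1)) :
    (b * shiftMatrix m ϖ) i j = b i (j + 1) * (if j = Fin.last m then ϖ else 1) := by
  rw [Matrix.mul_apply, Finset.sum_eq_single (j + 1)]
  · simp [shiftMatrix]
  · intro k _ hk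
    simp [shiftMatrix, hk]
  · simp

theorem eq_last_or_lt (i : Fin (m + 1)) :
    i = Fin.last m ∨ (i ≠ Fin.last m ∧ ((i + 1 : Fin (m + 1)) : ℕ) = i + 1) := by
  by_cases h : i = Fin.last m
  · exact Or.inl h
  · exact Or.inr ⟨h, Fin.val_add_one_of_lt (Fin.lt_last_iff_ne_last.2 h)⟩

include hϖ

theorem _root_.IyamaHall.Uniformizer.self_mem : ϖ ∈ Ring.jacobson Ω :=
  (hϖ.mem_jacobson ϖ).2 dvd_rfl

theorem shiftMatrix_mem : shiftMatrix m ϖ ∈ triangularSubring (m + 1) Ω := by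
  intro i j hij
  unfold shiftMatrix
  split_ifs with h1 h2
  · exact hϖ.self_mem
  · rcases eq_last_or_lt j with h | ⟨-, h⟩
    · exact absurd h h2
    · rw [Fin.lt_def, h1, h] at hij
      omega
  · exact Submodule.zero_mem _

omit hϖ in
theorem diagonal_mem (d : Fin (m + 1) → Ω) : Matrix.diagonal d ∈ triangularSubring (m + 1) Ω := by
  intro i j hij
  rw [Matrix.diagonal_apply_ne _ hij.ne]
  exact Submodule.zero_mem _

/-- The shift matrix as an element of the triangular ring. -/
def shiftElem : triangularSubring (m + 1) Ω := ⟨shiftMatrix m ϖ, shiftMatrix_mem hϖ⟩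

omit hϖ in
/-- The diagonal idempotents of the triangular ring. -/
def idem (Ω : Type) [Ring Ω] (i : Fin (m + 1)) : triangularSubring (m + 1) Ω :=
  ⟨Matrix.diagonal (Pi.single i 1), diagonal_mem _⟩

theorem shiftElem_mul_diag (b : triangularSubring (m + 1) Ω) (i : Fin (m + 1)) :
    (shiftElem hϖ * b).1 i i ∈ Ring.jacobson Ω := by
  obtain ⟨k, rfl⟩ : ∃ k, i = k + 1 := ⟨i - 1, by simp⟩
  change (shiftMatrix m ϖ * b.1) (k + 1) (k + 1) ∈ _
  rw [shiftMatrix_mul_apply]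
  rcases eq_last_or_lt k with h | ⟨h1, h2⟩
  · rw [if_pos h]
    exact Ideal.mul_mem_right _ _ hϖ.self_mem
  · rw [if_neg h1, one_mul]
    exact b.2 _ _ (by rw [Fin.lt_def, h2]; omega)

theorem mul_shiftElem_diag (b : triangularSubring (m + 1) Ω) (i : Fin (m + 1)) :
    (b * shiftElem hϖ).1 i i ∈ Ring.jacobson Ω := by
  change (b.1 * shiftMatrix m ϖ) i i ∈ _
  rw [mul_shiftMatrix_apply]
  rcases eq_last_or_lt i with h | ⟨h1, h2⟩
  · rw [if_pos h]
    exact Ideal.mul_mem_left _ _ hϖ.self_mem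
  · rw [if_neg h1, mul_one]
    exact b.2 _ _ (by rw [Fin.lt_def, h2]; omega)

/-- To divide, the rows are moved back up. Row `0` is divisible by `ϖ`, its diagonal entry by
hypothesis and the others because they lie above the diagonal. In the remaining rows the old
diagonal entries land just above the diagonal, where membership in the radical is required. -/
theorem shiftElem_dvd_iff (a : triangularSubring (m + 1) Ω) :
    shiftElem hϖ ∣ a ↔ ∀ i, a.1 i i ∈ Ring.jacobson Ω := by
  constructor
  · rintro ⟨b, rfl⟩ i
    exact shiftElem_mul_diag hϖ b i
  · intro h
    have h0 : ∀ j, ∃ d, a.1 0 j = ϖ * d := by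
      intro j
      refine (hϖ.mem_jacobson _).1 ?_
      rcases eq_or_ne j 0 with rfl | hj
      · exact h 0
      · exact a.2 0 j (Fin.pos_iff_ne_zero.2 hj)
    choose d hd using h0
    refine ⟨⟨fun k j => if k = Fin.last m then d j else a.1 (k + 1) j, ?_⟩, ?_⟩
    · intro k j hkj
      have hk : k ≠ Fin.last m := fun h => absurd (Fin.le_last j) (by rw [← h]; exact not_le.2 hkj)
      rcases eq_last_or_lt k with h1 | ⟨h1, h2⟩
      · exact absurd h1 hk
      change (if k = Fin.last m then d j else a.1 (k + 1) j) ∈ _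
      rw [if_neg hk]
      rcases eq_or_ne (k + 1) j with h3 | h3
      · rw [h3]
        exact h j
      · refine a.2 _ _ (lt_of_le_of_ne ?_ h3)
        rw [Fin.le_def, h2]
        exact hkj
    · ext i j
      obtain ⟨k, rfl⟩ : ∃ k, i = k + 1 := ⟨i - 1, by simp⟩
      refine Eq.trans ?_ (shiftMatrix_mul_apply _ k j).symm
      by_cases hk : k = Fin.last m
      · subst hk
        simp [hd]
      · simp [hk]

/-- The column version of the preceding argument. Radical elements come with `ϖ` on the left, and
`left_normal` carries it to the right. -/
theorem exists_eq_mul_shiftElem (a : triangularSubring (m + 1) Ω)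
    (h : ∀ i, a.1 i i ∈ Ring.jacobson Ω) : ∃ b, a = b * shiftElem hϖ := by
  have h0 : ∀ i, ∃ d, a.1 i (Fin.last m) = d * ϖ := by
    intro i
    have : a.1 i (Fin.last m) ∈ Ring.jacobson Ω := by
      rcases eq_or_ne i (Fin.last m) with rfl | hi
      · exact h _
      · exact a.2 _ _ (Fin.lt_last_iff_ne_last.2 hi)
    obtain ⟨d, hd⟩ := (hϖ.mem_jacobson _).1 this
    obtain ⟨d', hd'⟩ := hϖ.left_normal d
    exact ⟨d', hd.trans hd'⟩
  choose d hd using h0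
  refine ⟨⟨fun i l => if l = 0 then d i else a.1 i (l - 1), ?_⟩, ?_⟩
  · intro i l hil
    obtain ⟨k, rfl⟩ : ∃ k, l = k + 1 := ⟨l - 1, by simp⟩
    have hk : k + 1 ≠ 0 := (lt_of_le_of_lt (Fin.zero_le i) hil).ne'
    change (if k + 1 = 0 then d i else a.1 i (k + 1 - 1)) ∈ _
    rw [if_neg hk, add_sub_cancel_right]
    rcases eq_last_or_lt k with h1 | ⟨h1, h2⟩
    · rw [h1, Fin.last_add_one] at hk
      exact absurd rfl hk
    rcases eq_or_ne i k with h3 | h3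
    · rw [h3]
      exact h k
    · refine a.2 _ _ (lt_of_le_of_ne ?_ h3)
      rw [Fin.le_def]
      rw [Fin.lt_def, h2] at hil
      omega
  · ext i j
    refine Eq.trans ?_ (mul_shiftMatrix_apply _ i j).symm
    rcases eq_last_or_lt j with h1 | ⟨h1, h2⟩
    · subst h1
      simp [hd]
    · have : j + 1 ≠ 0 := fun h => by rw [h] at h2; simp at h2
      simp [h1, this]

/-- A row acquires one factor `ϖ` whenever it passes the corner, which happens once in `m + 1`
shifts. The exponent counts these passages for the row that ends in position `i` after `N` shifts.
-/
theorem pow_dvd_apply (N : ℕ) (b : triangularSubring (m + 1) Ω) (i j : Fin (m + 1)) :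
    ϖ ^ ((N + (m - i)) / (m + 1)) ∣ (shiftElem hϖ ^ N * b).1 i j := by
  induction N generalizing i with
  | zero =>
    rw [Nat.div_eq_of_lt (by omega), pow_zero]
    exact one_dvd _
  | succ N ih =>
    obtain ⟨k, rfl⟩ : ∃ k, i = k + 1 := ⟨i - 1, by simp⟩
    rw [pow_succ', mul_assoc]
    change _ ∣ (shiftMatrix m ϖ * (shiftElem hϖ ^ N * b).1) (k + 1) j
    rw [shiftMatrix_mul_apply]
    rcases eq_last_or_lt k with h1 | ⟨h1, h2⟩
    · have h3 := ih k
      subst h1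
      have h4 : (N + 1 + (m - (Fin.last m + 1 : Fin (m + 1)))) / (m + 1) =
          (N + (m - (Fin.last m : Fin (m + 1)))) / (m + 1) + 1 := by
        rw [Fin.last_add_one, Fin.val_zero, Fin.val_last, Nat.sub_self, add_zero, Nat.sub_zero,
          show N + 1 + m = N + (m + 1) by ring, Nat.add_div_right _ (Nat.succ_pos m)]
      rw [h4, if_pos rfl, pow_succ']
      exact mul_dvd_mul_left ϖ h3
    · rw [if_neg h1, one_mul, h2, show N + 1 + (m - (k + 1)) = N + (m - k) by
        have := k.2
        have : (k : ℕ) ≠ m := fun h => h1 (Fin.ext h)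
        omega]
      exact ih k

omit hϖ in
theorem idem_mul_apply (i k l : Fin (m + 1)) (a : triangularSubring (m + 1) Ω) :
    (idem Ω i * a).1 k l = if k = i then a.1 k l else 0 := by
  change (Matrix.diagonal (Pi.single i 1) * a.1 : Matrix (Fin (m + 1)) (Fin (m + 1)) Ω) k l = _
  rw [Matrix.diagonal_mul, Pi.single_apply, ite_mul, one_mul, zero_mul]

omit hϖ in
theorem mul_idem_apply (i k l : Fin (m + 1)) (a : triangularSubring (m + 1) Ω) :
    (a * idem Ω i).1 k l = if l = i then a.1 k l else 0 := by
  change (a.1 * Matrix.diagonal (Pi.single i 1) : Matrix (Fin (m + 1)) (Fin (m + 1)) Ω) k l = _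
  rw [Matrix.mul_diagonal, Pi.single_apply, mul_ite, mul_one, mul_zero]

omit hϖ in
theorem idem_apply (i k l : Fin (m + 1)) :
    (idem Ω i).1 k l = if k = l then (if k = i then 1 else 0) else 0 := by
  change Matrix.diagonal _ k l = _
  rw [Matrix.diagonal_apply, Pi.single_apply]

omit hϖ in
theorem idem_mul_self (i : Fin (m + 1)) : idem Ω i * idem Ω i = idem Ω i := by
  ext k l
  rw [idem_mul_apply, idem_apply]
  split_ifs <;> rfl

omit hϖ in
theorem idem_mul_ne (i j : Fin (m + 1)) (hij : i ≠ j) : idem Ω i * idem Ω j = 0 := by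
  ext k l
  rw [idem_mul_apply, idem_apply]
  split_ifs with h1 h2 h3
  · exact absurd (h1.symm.trans h3) hij
  all_goals rfl

omit hϖ in
theorem sum_idem : ∑ i : Fin (m + 1), idem Ω i = 1 := by
  ext k l
  rw [AddSubmonoidClass.coe_finsetSum, Matrix.sum_apply]
  simp_rw [idem_apply]
  change _ = (1 : Matrix _ _ Ω) k l
  rw [Matrix.one_apply]
  by_cases h : k = l <;> simp [h]

theorem shiftElem_mul_idem (i : Fin (m + 1)) :
    shiftElem hϖ * idem Ω i = idem Ω (i + 1) * shiftElem hϖ := by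
  ext k l
  rw [idem_mul_apply, mul_idem_apply]
  change (if l = i then shiftMatrix m ϖ k l else 0) = if k = i + 1 then shiftMatrix m ϖ k l else 0
  by_cases h : k = l + 1
  · subst h
    simp
  · simp [shiftMatrix, h]

theorem eq_zero_of_mul_shiftElem (a : triangularSubring (m + 1) Ω) (h : a * shiftElem hϖ = 0) :
    a = 0 := by
  ext i j
  obtain ⟨k, rfl⟩ : ∃ k, j = k + 1 := ⟨j - 1, by simp⟩
  have h1 : (a.1 * shiftMatrix m ϖ) i k = 0 := congrFun (congrFun (congrArg Subtype.val h) i) k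
  rw [mul_shiftMatrix_apply] at h1
  split_ifs at h1
  · exact hϖ.eq_zero_of_mul _ h1
  · rwa [mul_one] at h1

theorem shiftElem_dvd_off (i j : Fin (m + 1)) (a : triangularSubring (m + 1) Ω) (hij : i ≠ j) :
    shiftElem hϖ ∣ idem Ω i * a * idem Ω j := by
  rw [shiftElem_dvd_iff]
  intro k
  rw [mul_idem_apply, idem_mul_apply]
  split_ifs with h1 h2
  · exact absurd (h2.symm.trans h1) hij
  all_goals exact Submodule.zero_mem _

theorem shiftElem_dvd_or (i : Fin (m + 1)) (a : triangularSubring (m + 1) Ω) :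
    shiftElem hϖ ∣ idem Ω i * a * idem Ω i ∨ ∃ b, b * (idem Ω i * a * idem Ω i) = idem Ω i := by
  by_cases h : a.1 i i ∈ Ring.jacobson Ω
  · left
    rw [shiftElem_dvd_iff]
    intro k
    rw [mul_idem_apply, idem_mul_apply]
    split_ifs with h1
    · rwa [h1]
    · exact Submodule.zero_mem _
  · right
    obtain ⟨y, hy⟩ := hϖ.exists_mul_eq_one _ h
    refine ⟨⟨Matrix.diagonal fun _ => y, diagonal_mem _⟩, ?_⟩
    ext k l
    change (Matrix.diagonal (fun _ => y) * (idem Ω i * a * idem Ω i).1 :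
      Matrix (Fin (m + 1)) (Fin (m + 1)) Ω) k l = _
    rw [Matrix.diagonal_mul, mul_idem_apply, idem_mul_apply, idem_apply]
    by_cases h1 : k = i
    · subst h1
      by_cases h2 : l = k
      · subst h2
        simp [hy]
      · simp [h2, Ne.symm h2]
    · simp [h1]

theorem shiftElem_sep (a : triangularSubring (m + 1) Ω) (h : ∀ N, shiftElem hϖ ^ N ∣ a) :
    a = 0 := by
  ext i j
  refine hϖ.sep _ fun N => ?_
  obtain ⟨b, rfl⟩ := h ((m + 1) * N)
  refine (pow_dvd_pow ϖ ?_).trans (pow_dvd_apply hϖ _ b i j)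
  rw [Nat.le_div_iff_mul_le (Nat.succ_pos m), mul_comm]
  exact Nat.le_add_right _ _

theorem shiftElem_residue (k : Fin (m + 1)) :
    ∃ (F : Type) (_ : AddCommGroup F) (f : triangularSubring (m + 1) Ω →+ F),
      Function.Surjective f ∧ (∀ a, f a = 0 ↔ shiftElem hϖ ∣ a * idem Ω k) ∧
        Nat.card F = Nat.card (Ω ⧸ Ring.jacobson Ω) := by
  refine ⟨Ω ⧸ Ring.jacobson Ω, inferInstance,
    { toFun a := Submodule.Quotient.mk (a.1 k k), map_zero' := rfl, map_add' := fun _ _ => rfl },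
    ?_, ?_, rfl⟩
  · intro x
    obtain ⟨x, rfl⟩ := Submodule.Quotient.mk_surjective _ x
    refine ⟨⟨Matrix.diagonal fun _ => x, diagonal_mem _⟩, ?_⟩
    simp
  · intro a
    rw [shiftElem_dvd_iff]
    change Submodule.Quotient.mk (a.1 k k) = _ ↔ _
    rw [Submodule.Quotient.mk_eq_zero]
    refine ⟨fun h i => ?_, fun h => ?_⟩
    · rw [mul_idem_apply]
      split_ifs with h2
      · rwa [h2]
      · exact Submodule.zero_mem _
    · have := h k
      rwa [mul_idem_apply, if_pos rfl] at this

/-- The triangular ring of a ring with a uniformizer. -/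
def cycRing : CycRing (m + 1) (triangularSubring (m + 1) Ω) where
  e := idem (m := m) Ω
  u := shiftElem hϖ
  q := Nat.card (Ω ⧸ Ring.jacobson Ω)
  e_mul_self := idem_mul_self
  e_mul_ne := idem_mul_ne
  sum_e := sum_idem
  u_mul_e := shiftElem_mul_idem hϖ
  left_normal a := exists_eq_mul_shiftElem hϖ _ (shiftElem_mul_diag hϖ a)
  right_normal a := (shiftElem_dvd_iff hϖ _).2 (mul_shiftElem_diag hϖ a)
  eq_zero_of_mul_u := eq_zero_of_mul_shiftElem hϖ
  dvd_off := shiftElem_dvd_off hϖ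
  dvd_or := shiftElem_dvd_or hϖ
  sep := shiftElem_sep hϖ
  one_lt_q := hϖ.one_lt_card
  residue := shiftElem_residue hϖ

end Triangular

/-- The triangular ring of a ring with a uniformizer, for any number of vertices. -/
theorem Uniformizer.exists_cycRing (n : ℕ) [NeZero n] {Ω : Type} [Ring Ω] {ϖ : Ω}
    (hϖ : Uniformizer Ω ϖ) :
    ∃ c : CycRing n (triangularSubring n Ω), c.q = Nat.card (Ω ⧸ Ring.jacobson Ω) := by
  obtain ⟨m, rfl⟩ := Nat.exists_eq_succ_of_ne_zero (NeZero.ne n)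
  exact ⟨Triangular.cycRing hϖ, rfl⟩

end IyamaHall
end

/-! ### Orders without zero divisors over a complete discrete valuation ring -/

noncomputable section

namespace IyamaHall

section CompleteOrder

variable {R : Type} [CommRing R] [IsDomain R] [IsDiscreteValuationRing R]
  {Ω : Type} [Ring Ω] [Algebra R Ω] [Module.Finite R Ω] [Module.Free R Ω] {π : R}

theorem pow_algebraMap_dvd_iff (k : ℕ) (x : Ω) :
    algebraMap R Ω π ^ k ∣ x ↔ ∃ w, x = π ^ k • w := by
  simp_rw [Algebra.smul_def, map_pow]
  rfl

/-- Since the order is a free module, divisibility by powers of `π` is tested on coordinates.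
Separatedness and completeness are thereby inherited from `R`. -/
theorem pow_algebraMap_dvd_iff_repr (k : ℕ) (x : Ω) :
    algebraMap R Ω π ^ k ∣ x ↔ ∀ i, π ^ k ∣ (Module.Free.chooseBasis R Ω).repr x i := by
  rw [pow_algebraMap_dvd_iff]
  constructor
  · rintro ⟨w, rfl⟩ i
    simp
  · intro h
    choose d hd using h
    refine ⟨∑ i, d i • Module.Free.chooseBasis R Ω i, ?_⟩
    apply (Module.Free.chooseBasis R Ω).repr.injective
    ext i
    rw [map_smul, Finsupp.smul_apply, Module.Basis.repr_sum_self, hd]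
    rfl

theorem smodEq_span_pow_iff (m : ℕ) (a b : R) :
    a ≡ b [SMOD (Ideal.span {π} ^ m • ⊤ : Submodule R R)] ↔ π ^ m ∣ a - b := by
  rw [SModEq.sub_mem, smul_eq_mul, Ideal.mul_top, Ideal.span_singleton_pow,
    Ideal.mem_span_singleton]

theorem eq_zero_of_forall_pow_dvd [IsHausdorff (Ideal.span {π}) R] (x : Ω)
    (h : ∀ k, algebraMap R Ω π ^ k ∣ x) : x = 0 := by
  simp_rw [pow_algebraMap_dvd_iff_repr] at h
  apply (Module.Free.chooseBasis R Ω).repr.injective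
  ext i
  rw [map_zero, Finsupp.zero_apply]
  refine IsHausdorff.haus' (I := Ideal.span {π}) _ fun n => ?_
  rw [smodEq_span_pow_iff, sub_zero]
  exact h n i

theorem exists_limit [IsPrecomplete (Ideal.span {π}) R] (f : ℕ → Ω)
    (hf : ∀ k, algebraMap R Ω π ^ k ∣ f (k + 1) - f k) :
    ∃ L, ∀ k, algebraMap R Ω π ^ k ∣ L - f k := by
  simp_rw [pow_algebraMap_dvd_iff_repr] at hf ⊢
  have key : ∀ i, ∃ L : R, ∀ k, π ^ k ∣ L - (Module.Free.chooseBasis R Ω).repr (f k) i := by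
    intro i
    obtain ⟨L, hL⟩ := IsPrecomplete.prec' (I := Ideal.span {π})
      (fun k => (Module.Free.chooseBasis R Ω).repr (f k) i) (by
        intro m n hmn
        rw [smodEq_span_pow_iff]
        induction n, hmn using Nat.le_induction with
        | base => simp
        | succ n hmn ih =>
          have h1 := hf n i
          rw [map_sub, Finsupp.sub_apply] at h1
          have h2 := dvd_sub ih ((pow_dvd_pow π hmn).trans h1)
          convert h2 using 1
          ring)
    refine ⟨L, fun k => ?_⟩
    have := hL k
    rw [smodEq_span_pow_iff, dvd_sub_comm] at this
    exact this
  choose L hL using key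
  refine ⟨∑ i, L i • Module.Free.chooseBasis R Ω i, fun k i => ?_⟩
  rw [map_sub, Finsupp.sub_apply, Module.Basis.repr_sum_self]
  exact hL i k

theorem isUnit_of_left_inverse [NoZeroDivisors Ω] [Nontrivial Ω] {x y : Ω} (h : y * x = 1) :
    IsUnit x := by
  have hx : x ≠ 0 := by
    rintro rfl
    simp at h
  have h2 : x * y = 1 := by
    have : (x * y - 1) * x = 0 := by rw [sub_mul, mul_assoc, h, mul_one, one_mul, sub_self]
    exact sub_eq_zero.1 ((mul_eq_zero.1 this).resolve_right hx)
  exact ⟨⟨x, y, h2, h⟩, rfl⟩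

/-- The left ideal generated by `1 - x` together with `π Ω` is everything, so by Nakayama's lemma
the left ideal is everything. Without zero divisors a left inverse is an inverse. -/
theorem isUnit_one_sub [NoZeroDivisors Ω] [Nontrivial Ω] (hπ : Irreducible π) {x : Ω}
    (hx : algebraMap R Ω π ∣ x) : IsUnit (1 - x) := by
  obtain ⟨w, rfl⟩ := hx
  have h := Submodule.le_of_le_smul_of_le_jacobson_bot (I := Ideal.span {π})
    (N := LinearMap.range (LinearMap.mulRight R (1 - algebraMap R Ω π * w)))
    (N' := ⊤) Module.Finite.fg_top (by
      rw [← hπ.maximalIdeal_eq]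
      exact IsLocalRing.maximalIdeal_le_jacobson _) (by
      intro y _
      have : y = y * (1 - algebraMap R Ω π * w) + π • (y * w) := by
        rw [Algebra.smul_def, mul_sub, mul_one, ← mul_assoc, ← Algebra.commutes, mul_assoc,
          sub_add_cancel]
      rw [this]
      exact Submodule.add_mem_sup ⟨y, rfl⟩
        (Submodule.smul_mem_smul (Ideal.mem_span_singleton_self π) trivial))
  obtain ⟨y, hy⟩ := h (x := 1) trivial
  exact isUnit_of_left_inverse hy

omit [IsDomain R] [IsDiscreteValuationRing R] [Module.Free R Ω] in
theorem finite_quotient_span [Finite (R ⧸ Ideal.span {π})] :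
    Finite (Ω ⧸ (Ideal.span {π} • ⊤ : Submodule R Ω)) := by
  have : Finite (Ω ⧸ (⊤ : Submodule R Ω)) := Finite.of_subsingleton
  exact Submodule.finite_quotient_smul _ Module.Finite.fg_top

omit [IsDomain R] [IsDiscreteValuationRing R] [Module.Finite R Ω] [Module.Free R Ω] in
theorem mk_eq_mk_iff (x y : Ω) :
    (Submodule.Quotient.mk x : Ω ⧸ (Ideal.span {π} • ⊤ : Submodule R Ω)) =
      Submodule.Quotient.mk y ↔ algebraMap R Ω π ∣ x - y := by
  rw [Submodule.Quotient.eq, Submodule.ideal_span_singleton_smul,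
    Submodule.mem_smul_pointwise_iff_exists]
  simp_rw [Algebra.smul_def]
  exact ⟨fun ⟨w, _, h⟩ => ⟨w, h.symm⟩, fun ⟨w, h⟩ => ⟨w, trivial, h.symm⟩⟩

/-- The powers of `x` repeat in the finite quotient by `π`: from the exponent `a` on they have
period `d + 1`. -/
theorem exists_pow_idempotent [Finite (R ⧸ Ideal.span {π})] (x : Ω) :
    ∃ N, 0 < N ∧ algebraMap R Ω π ∣ x ^ N * x ^ N - x ^ N := by
  have := finite_quotient_span (π := π) (Ω := Ω)
  obtain ⟨a, b, hab, h⟩ := Finite.exists_ne_map_eq_of_infinite fun k : ℕ =>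
    (Submodule.Quotient.mk (x ^ k) : Ω ⧸ (Ideal.span {π} • ⊤ : Submodule R Ω))
  wlog hlt : a < b generalizing a b
  · exact this b a hab.symm h.symm (by omega)
  obtain ⟨d, rfl⟩ := Nat.exists_eq_add_of_lt hlt
  rw [eq_comm, mk_eq_mk_iff] at h
  have h1 : ∀ k, a ≤ k → ∀ j, algebraMap R Ω π ∣ x ^ (k + j * (d + 1)) - x ^ k := by
    intro k hk j
    induction j with
    | zero => simp
    | succ j ih =>
      obtain ⟨l, rfl⟩ := Nat.exists_eq_add_of_le hk
      have h2 : algebraMap R Ω π ∣ x ^ (l + j * (d + 1)) * (x ^ (a + d + 1) - x ^ a) := by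
        obtain ⟨w, hw⟩ := h
        rw [hw, ← mul_assoc, ← Algebra.commutes, mul_assoc]
        exact dvd_mul_right _ _
      have h3 := dvd_add h2 ih
      convert h3 using 1
      rw [mul_sub, ← pow_add, ← pow_add, show l + j * (d + 1) + a = a + l + j * (d + 1) by ring,
        sub_add_sub_cancel]
      congr 2
      ring
  -- This exponent is positive, at least `a` and a multiple of the period, so doubling it does not
  -- change the power modulo `π`.
  refine ⟨(a + 1) * (d + 1), by positivity, ?_⟩
  rw [← pow_add]
  exact h1 _ (by nlinarith) (a + 1)

/-- In a complete order without zero divisors every element is a unit or topologically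
nilpotent. -/
theorem isUnit_or_dvd_pow [IsAdicComplete (Ideal.span {π}) R] [Finite (R ⧸ Ideal.span {π})]
    [NoZeroDivisors Ω] [Nontrivial Ω] (hπ : Irreducible π) (x : Ω) :
    IsUnit x ∨ ∃ N, algebraMap R Ω π ∣ x ^ N := by
  obtain ⟨N, hN0, hN⟩ := exists_pow_idempotent (π := π) x
  set p := algebraMap R Ω π with hp
  have hcomm : ∀ (k : ℕ) (a : Ω), a * p ^ k = p ^ k * a := fun k a => by
    rw [hp, ← map_pow, ← Algebra.commutes]
  -- The iteration `e ↦ 3 e² - 2 e³` lifts idempotents: the defect `e² - e` of the new term is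
  -- divisible by the square of the old one.
  let f : ℕ → Ω := fun k => Nat.rec (x ^ N) (fun _ e => 3 * e * e - 2 * e * e * e) k
  have hf : ∀ k, f (k + 1) = 3 * f k * f k - 2 * f k * f k * f k := fun k => rfl
  have h1 : ∀ k, p ^ (k + 1) ∣ f k * f k - f k := by
    intro k
    induction k with
    | zero => simpa [f] using hN
    | succ k ih =>
      have : f (k + 1) * f (k + 1) - f (k + 1) =
          (f k * f k - f k) * (f k * f k - f k) * (4 * f k * f k - 4 * f k - 3) := by
        rw [hf]
        noncomm_ring
      rw [this]
      obtain ⟨w, hw⟩ := ih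
      rw [hw]
      refine Dvd.dvd.mul_right ?_ _
      rw [mul_assoc, ← mul_assoc w, hcomm, mul_assoc, ← mul_assoc, ← pow_add]
      exact Dvd.dvd.mul_right (pow_dvd_pow _ (by omega)) _
  have h2 : ∀ k, p ^ (k + 1) ∣ f (k + 1) - f k := by
    intro k
    have : f (k + 1) - f k = (f k * f k - f k) * (1 - 2 * f k) := by
      rw [hf]
      noncomm_ring
    rw [this]
    exact Dvd.dvd.mul_right (h1 k) _
  obtain ⟨L, hL⟩ := exists_limit (π := π) f fun k =>
    (pow_dvd_pow _ (Nat.le_succ k)).trans (h2 k)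
  have hLL : L * L - L = 0 := by
    refine eq_zero_of_forall_pow_dvd (π := π) _ fun k => ?_
    obtain ⟨w, hw⟩ := hL k
    rw [← hp] at hw ⊢
    have hw' : L = f k + p ^ k * w := by rw [← hw]; abel
    have : L * L - L = (f k * f k - f k) + p ^ k * (f k * w + w * f k + w * p ^ k * w - w) := by
      rw [hw']
      have h3 := hcomm k (f k)
      calc _ = (f k * f k - f k) + (f k * p ^ k * w + p ^ k * w * f k + p ^ k * w * p ^ k * w -
            p ^ k * w) := by noncomm_ring
        _ = _ := by rw [h3]; noncomm_ring
    rw [this]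
    exact dvd_add ((pow_dvd_pow _ (Nat.le_succ k)).trans (h1 k)) (dvd_mul_right _ _)
  have h0 : p ∣ L - x ^ N := by
    have h3 := hL 1
    have h4 := h2 0
    rw [← hp] at h3
    rw [pow_one] at h3
    rw [zero_add, pow_one] at h4
    have h5 := dvd_add h3 h4
    rwa [sub_add_sub_cancel] at h5
  -- Without zero divisors the limiting idempotent is `0` or `1`. Accordingly `x ^ N` is congruent
  -- to `0` or to `1` modulo `π`, and in the latter case it is a unit.
  have : L * (L - 1) = 0 := by rw [mul_sub, mul_one, hLL]
  rcases mul_eq_zero.1 this with h | h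
  · right
    refine ⟨N, ?_⟩
    rw [h, zero_sub, dvd_neg] at h0
    exact h0
  · left
    rw [sub_eq_zero.1 h] at h0
    have h3 := isUnit_one_sub hπ h0
    rw [sub_sub_cancel] at h3
    exact (isUnit_pow_iff hN0.ne').1 h3

section Nonunits

variable [IsAdicComplete (Ideal.span {π}) R] [Finite (R ⧸ Ideal.span {π})]
    [NoZeroDivisors Ω] [Nontrivial Ω]

omit [IsDomain R] [IsDiscreteValuationRing R] [Algebra R Ω] [Module.Finite R Ω]
  [Module.Free R Ω] in
theorem not_isUnit_mul_left {x : Ω} (hx : ¬ IsUnit x) (a : Ω) : ¬ IsUnit (a * x) := by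
  rintro ⟨u, hu⟩
  refine hx (isUnit_of_left_inverse (y := ↑u⁻¹ * a) ?_)
  rw [mul_assoc, ← hu, Units.inv_mul]

/-- If `x + y` were a unit `u`, some power of `u⁻¹ x` would be divisible by `π`. The geometric
series would then left invert `1 - u⁻¹ x = u⁻¹ y`, against the assumption on `y`. -/
theorem not_isUnit_add (hπ : Irreducible π) {x y : Ω} (hx : ¬ IsUnit x) (hy : ¬ IsUnit y) :
    ¬ IsUnit (x + y) := by
  rintro ⟨u, hu⟩
  obtain ⟨N, hN⟩ := (isUnit_or_dvd_pow hπ (↑u⁻¹ * x)).resolve_left (not_isUnit_mul_left hx _)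
  have h1 := isUnit_one_sub hπ hN
  have h2 : 1 - ↑u⁻¹ * x = ↑u⁻¹ * y := by
    rw [← Units.inv_mul u, hu, mul_add, add_sub_cancel_left]
  obtain ⟨v, hv⟩ := h1
  rw [← geom_sum_mul_neg, h2] at hv
  refine not_isUnit_mul_left hy ↑u⁻¹ (isUnit_of_left_inverse
    (y := ↑v⁻¹ * ∑ i ∈ Finset.range N, (↑u⁻¹ * x) ^ i) ?_)
  rw [mul_assoc, ← hv, Units.inv_mul]

/-- The nonunits are closed under addition and left multiplication, so the order is local and its
radical consists of them. -/
theorem mem_jacobson_iff_not_isUnit (hπ : Irreducible π) (x : Ω) :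
    x ∈ Ring.jacobson Ω ↔ ¬ IsUnit x := by
  rw [← Ideal.jacobson_bot, Ideal.mem_jacobson_iff]
  simp_rw [Ideal.mem_bot]
  constructor
  · rintro h ⟨u, rfl⟩
    obtain ⟨z, hz⟩ := h (-↑u⁻¹)
    rw [mul_neg, neg_mul, mul_assoc, Units.inv_mul, mul_one, neg_add_cancel, zero_sub,
      neg_eq_zero] at hz
    exact one_ne_zero hz
  · intro hx y
    have h1 : IsUnit (y * x + 1) := by
      by_contra h
      have := not_isUnit_add hπ h (not_isUnit_mul_left hx (-y))
      rw [neg_mul, add_neg_cancel_comm] at this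
      exact this isUnit_one
    obtain ⟨u, hu⟩ := h1
    refine ⟨↑u⁻¹, ?_⟩
    rw [mul_assoc, ← mul_add_one, ← hu, Units.inv_mul, sub_self]

theorem not_isUnit_algebraMap :
    ¬ IsUnit (algebraMap R Ω π) := by
  rintro ⟨u, hu⟩
  refine one_ne_zero (α := Ω) (eq_zero_of_forall_pow_dvd (π := π) 1 fun k => ?_)
  rw [← hu, ← Units.val_pow_eq_pow_val]
  exact (u ^ k).isUnit.dvd

/-- An element that is not divisible by `π` and annihilates the radical modulo `π`. -/
theorem exists_socle (hπ : Irreducible π) : ∃ s : Ω, ¬ algebraMap R Ω π ∣ s ∧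
    ∀ x, ¬ IsUnit x → algebraMap R Ω π ∣ s * x := by
  have := finite_quotient_span (π := π) (Ω := Ω)
  let f : Ω → Set (Ω ⧸ (Ideal.span {π} • ⊤ : Submodule R Ω)) := fun s =>
    Set.range fun w => Submodule.Quotient.mk (s * w)
  -- Among the elements outside `π Ω`, `s` has the smallest right ideal modulo `π`. If `s x` with a
  -- nonunit `x` were also outside, minimality would give `s ≡ s x w`, so `π` would divide `s (1 - x
  -- w)` with `1 - x w` a unit, hence `s`.
  obtain ⟨s, hs, hmin⟩ := (measure fun s => (f s).ncard).wf.has_min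
    {s : Ω | ¬ algebraMap R Ω π ∣ s} ⟨1, fun h => not_isUnit_algebraMap (R := R) (π := π) (Ω := Ω)
      (by obtain ⟨w, hw⟩ := h; exact isUnit_of_left_inverse (y := w) (by
            rw [← Algebra.commutes, ← hw]))⟩
  refine ⟨s, hs, fun x hx => ?_⟩
  by_contra h
  refine hmin _ h (Set.ncard_lt_ncard ⟨?_, fun hle => ?_⟩ (Set.toFinite _))
  · rintro _ ⟨w, rfl⟩
    exact ⟨x * w, by simp only [mul_assoc]⟩
  · obtain ⟨w, hw⟩ := hle (show Submodule.Quotient.mk s ∈ f s from ⟨1, by simp only [mul_one]⟩)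
    have h1 : algebraMap R Ω π ∣ s * (1 - x * w) := by
      have := ((mk_eq_mk_iff _ _).1 hw.symm)
      rwa [mul_sub, mul_one, ← mul_assoc]
    have h2 : IsUnit (1 - x * w) := by
      by_contra h2
      have hxw : ¬ IsUnit (x * w) := by
        rintro ⟨u, hu⟩
        refine hx ?_
        have h3 : w * ↑u⁻¹ * x = 1 := by
          have h4 : x * (w * ↑u⁻¹) = 1 := by rw [← mul_assoc, ← hu, Units.mul_inv]
          exact mul_eq_one_comm.1 h4
        exact isUnit_of_left_inverse h3
      have := not_isUnit_add hπ h2 hxw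
      rw [sub_add_cancel] at this
      exact this isUnit_one
    obtain ⟨u, hu⟩ := h2
    rw [← hu] at h1
    refine hs ?_
    have := Dvd.dvd.mul_right h1 ↑u⁻¹
    rwa [mul_assoc, Units.mul_inv, mul_one] at this

end Nonunits

end CompleteOrder

end IyamaHall
end

/-! ### Uniformizers of maximal orders -/

noncomputable section

namespace IyamaHall

section MaximalOrder

variable {R : Type} [CommRing R] [IsDomain R] [IsDiscreteValuationRing R]
  {D : Type} [DivisionRing D] [Algebra R D] [Algebra (FractionRing R) D]
  [IsScalarTower R (FractionRing R) D] {Ω : Subalgebra R D}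

/-- A submodule of a finite free module over a discrete valuation ring is finite and torsion free,
hence projective. So an `R`-linear embedding into `Ω`, which need not respect products, shows that a
larger subalgebra is still an order. -/
theorem isOrderIn_of_le (hΩ : IsOrderIn R D Ω) {Ω' : Subalgebra R D} (h : Ω ≤ Ω')
    (φ : Ω' →ₗ[R] Ω) (hφ : Function.Injective φ) : IsOrderIn R D Ω' := by
  obtain ⟨h1, h2, h3⟩ := hΩ
  have hfin : Module.Finite R Ω' := Module.Finite.of_injective φ hφ
  have hfree : Module.Free R Ω := Module.free_of_flat_of_isLocalRing
  have htf : Module.IsTorsionFree R Ω' := hφ.moduleIsTorsionFree φ (map_smul φ)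
  refine ⟨hfin, inferInstance, ?_⟩
  rw [eq_top_iff, ← h3]
  exact Submodule.span_mono h

theorem algebraMap_ne_zero {π : R} (hπ : π ≠ 0) : algebraMap R D π ≠ 0 := by
  rw [IsScalarTower.algebraMap_apply R (FractionRing R) D]
  rw [Ne, map_eq_zero, FaithfulSMul.algebraMap_eq_zero_iff]
  exact hπ

/-- A maximal order in a division algebra over a complete discrete valuation ring with finite
residue field has a uniformizer. -/
theorem IsMaximalOrderIn.exists_uniformizer (hΩ : IsMaximalOrderIn R D Ω)
    [IsAdicComplete (IsLocalRing.maximalIdeal R) R] [Finite (IsLocalRing.ResidueField R)] :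
    ∃ ϖ : Ω, Uniformizer Ω ϖ := by
  obtain ⟨hord, hmax⟩ := hΩ
  have hfin := hord.1
  have hproj := hord.2.1
  have hfree : Module.Free R Ω := Module.free_of_flat_of_isLocalRing
  obtain ⟨π, hπ⟩ := IsDiscreteValuationRing.exists_irreducible R
  have hcomp : IsAdicComplete (Ideal.span {π}) R := by
    rw [← hπ.maximalIdeal_eq]
    infer_instance
  have hres : Finite (R ⧸ Ideal.span {π}) := by
    rw [← hπ.maximalIdeal_eq]
    exact ‹Finite (IsLocalRing.ResidueField R)›
  set p : Ω := algebraMap R Ω π with hp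
  set P : D := algebraMap R D π with hP
  have hpP : (p : D) = P := rfl
  have hP0 : P ≠ 0 := algebraMap_ne_zero hπ.ne_zero
  have hcP : ∀ x : D, P * x = x * P := fun x => Algebra.commutes π x
  have hcPi : ∀ x : D, P⁻¹ * x = x * P⁻¹ := fun x => by
    rw [inv_mul_eq_iff_eq_mul₀ hP0, ← mul_assoc, hcP, mul_assoc, mul_inv_cancel₀ hP0, mul_one]
  have hadd : ∀ x y : Ω, ¬ IsUnit x → ¬ IsUnit y → ¬ IsUnit (x + y) := fun x y hx hy =>
    not_isUnit_add hπ hx hy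
  have hpu : ¬ IsUnit p := not_isUnit_algebraMap (R := R)
  obtain ⟨s, hs, hsJ⟩ := exists_socle (Ω := Ω) hπ
  -- By the choice of `s`, the element `z = s / π` lies outside `Ω` but carries the radical into
  -- `Ω`.
  set z : D := P⁻¹ * s with hz
  have hzmem : ∀ x : Ω, ¬ IsUnit x → ∃ y : Ω, z * x = y := by
    intro x hx
    obtain ⟨y, hy⟩ := hsJ x hx
    refine ⟨y, ?_⟩
    have : (s : D) * x = P * y := congrArg Subtype.val hy
    rw [hz, mul_assoc, this, inv_mul_cancel_left₀ hP0]
  -- the left order of the radical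
  let L : Subalgebra R D :=
    { carrier := {x | ∀ j : Ω, ¬ IsUnit j → ∃ j' : Ω, ¬ IsUnit j' ∧ x * j = j'}
      mul_mem' := by
        intro x y hx hy j hj
        obtain ⟨j', hj', h1⟩ := hy j hj
        obtain ⟨j'', hj'', h2⟩ := hx j' hj'
        exact ⟨j'', hj'', by rw [mul_assoc, h1, h2]⟩
      add_mem' := by
        intro x y hx hy j hj
        obtain ⟨j', hj', h1⟩ := hx j hj
        obtain ⟨j'', hj'', h2⟩ := hy j hj
        exact ⟨j' + j'', hadd _ _ hj' hj'', by rw [add_mul, h1, h2]; rfl⟩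
      algebraMap_mem' := fun r j hj =>
        ⟨algebraMap R Ω r * j, not_isUnit_mul_left hj _, rfl⟩ }
  -- Right multiplication by `π`, itself a nonunit, embeds `L` into `Ω`. So `L` is an order
  -- containing `Ω`, and maximality applies.
  have hL : L = Ω := by
    refine hmax L (isOrderIn_of_le hord ?_
      (φ := { toFun := fun x => (x.2 p hpu).choose
              map_add' := fun x y => Subtype.ext ?_
              map_smul' := fun r x => Subtype.ext ?_ }) ?_) ?_
    · exact fun x hx j hj => ⟨⟨x, hx⟩ * j, not_isUnit_mul_left hj _, rfl⟩
    · rw [← ((x + y).2 p hpu).choose_spec.2]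
      change _ = ((x.2 p hpu).choose : D) + ((y.2 p hpu).choose : D)
      rw [← (x.2 p hpu).choose_spec.2, ← (y.2 p hpu).choose_spec.2, ← add_mul]
      rfl
    · rw [← ((r • x).2 p hpu).choose_spec.2]
      change _ = r • ((x.2 p hpu).choose : D)
      rw [← (x.2 p hpu).choose_spec.2, ← smul_mul_assoc]
      rfl
    · intro x y hxy
      have h1 := congrArg (Subtype.val : Ω → D) hxy
      change ((x.2 p hpu).choose : D) = ((y.2 p hpu).choose : D) at h1
      rw [← (x.2 p hpu).choose_spec.2, ← (y.2 p hpu).choose_spec.2] at h1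
      exact Subtype.ext (mul_right_cancel₀ hP0 h1)
    · exact fun x hx j hj => ⟨⟨x, hx⟩ * j, not_isUnit_mul_left hj _, rfl⟩
  have hzΩ : z ∉ Ω := by
    intro h
    refine hs ⟨⟨z, h⟩, Subtype.ext ?_⟩
    change (s : D) = P * z
    rw [hz, mul_inv_cancel_left₀ hP0]
  -- If `z` carried the radical into itself it would belong to `L = Ω`. Hence `z` maps some nonunit
  -- to a unit.
  obtain ⟨j, hj, hzj⟩ : ∃ j : Ω, ¬ IsUnit j ∧ ∃ v : Ωˣ, z * j = ((v : Ω) : D) := by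
    rw [← hL] at hzΩ
    by_contra hcon
    refine hzΩ fun j hj => ?_
    obtain ⟨y, hy⟩ := hzmem j hj
    refine ⟨y, fun hu => hcon ⟨j, hj, hu.unit, hy⟩, hy⟩
  obtain ⟨v, hv⟩ := hzj
  -- This normalisation makes `ϖ` the inverse of `z`. A nonunit `x` is then `ϖ (z x)` with `z x ∈
  -- Ω`.
  set ϖ : Ω := j * ↑v⁻¹ with hϖ
  have hzϖ : z * ϖ = 1 := by
    change z * (j * ((↑v⁻¹ : Ω) : D)) = 1
    rw [← mul_assoc, hv]
    exact congrArg Subtype.val (Units.mul_inv v)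
  have hϖz : (ϖ : D) * z = 1 := mul_eq_one_comm.1 hzϖ
  have hϖu : ¬ IsUnit ϖ := by
    rintro ⟨u, hu⟩
    refine hzΩ ?_
    have h1 : z * ((u : Ω) : D) = 1 := by rw [hu, hzϖ]
    have h2 : z = ((↑u⁻¹ : Ω) : D) := by
      have h3 : ((u : Ω) : D) * ((↑u⁻¹ : Ω) : D) = 1 := congrArg Subtype.val (Units.mul_inv u)
      rw [← mul_one z, ← h3, ← mul_assoc, h1, one_mul]
    rw [h2]
    exact Subtype.property _
  have hdvd : ∀ x : Ω, ¬ IsUnit x ↔ ϖ ∣ x := by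
    intro x
    constructor
    · intro hx
      obtain ⟨y, hy⟩ := hzmem x hx
      refine ⟨y, Subtype.ext ?_⟩
      change (x : D) = ϖ * y
      rw [← hy, ← mul_assoc, hϖz, one_mul]
    · rintro ⟨y, rfl⟩ hu
      obtain ⟨u, hu⟩ := hu
      refine hϖu (isUnit_of_left_inverse (y := y * ↑u⁻¹) (mul_eq_one_comm.1 ?_))
      rw [← mul_assoc, ← hu, Units.mul_inv]
  have hconj : ∀ x : Ω, ∃ y : Ω, z * x * ϖ = y := by
    intro x
    obtain ⟨y, hy⟩ := hzmem _ (not_isUnit_mul_left hϖu x)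
    exact ⟨y, by rw [← hy, mul_assoc]; rfl⟩
  -- `M` is the conjugate order `ϖ Ω ϖ⁻¹`. It contains `Ω` because `Ω ϖ` lies in the radical, and
  -- maximality gives equality, which is the normality of `ϖ`.
  let M : Subalgebra R D :=
    { carrier := {x | z * x * ϖ ∈ Ω}
      mul_mem' := by
        intro x y hx hy
        have h1 : z * (x * y) * ϖ = (z * x * ϖ) * (z * y * ϖ) := by
          calc _ = z * x * (1 * (y * ϖ)) := by simp only [mul_assoc, one_mul]
            _ = _ := by rw [← hϖz]; simp only [mul_assoc]
        change z * (x * y) * ϖ ∈ Ω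
        rw [h1]
        exact Ω.mul_mem hx hy
      add_mem' := by
        intro x y hx hy
        change z * (x + y) * ϖ ∈ Ω
        rw [mul_add, add_mul]
        exact Ω.add_mem hx hy
      algebraMap_mem' := fun r => by
        change z * algebraMap R D r * ϖ ∈ Ω
        rw [← Algebra.commutes, mul_assoc, hzϖ, mul_one]
        exact Ω.algebraMap_mem r }
  have hΩM : Ω ≤ M := fun x hx => by
    obtain ⟨y, hy⟩ := hconj ⟨x, hx⟩
    change z * x * ϖ ∈ Ω
    rw [show z * x * ϖ = y from hy]
    exact y.2
  have hMmem : ∀ x : M, π • (x : D) ∈ Ω := by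
    intro x
    -- This uses `π z = s` and the centrality of `π`; it shows that multiplication by `π` embeds `M`
    -- into `Ω`.
    have h1 : π • (x : D) = ϖ * (z * x * ϖ) * s := by
      rw [Algebra.smul_def, ← hP]
      calc P * (x : D) = P * (x * 1) := by rw [mul_one]
        _ = P * ((ϖ * z) * x * (ϖ * z)) := by rw [hϖz, one_mul]
        _ = P * (ϖ * (z * x * ϖ) * (P⁻¹ * s)) := by simp only [hz, mul_assoc]
        _ = P * ((ϖ * (z * x * ϖ) * P⁻¹) * s) := by simp only [mul_assoc]
        _ = _ := by rw [← hcPi, mul_assoc P⁻¹, mul_inv_cancel_left₀ hP0]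
    rw [h1]
    exact Ω.mul_mem (Ω.mul_mem ϖ.2 x.2) s.2
  have hM : M = Ω := by
    refine hmax M (isOrderIn_of_le hord hΩM
      (φ := { toFun := fun x => ⟨π • (x : D), hMmem x⟩
              map_add' := fun x y => Subtype.ext (smul_add π (x : D) y)
              map_smul' := fun r x => Subtype.ext (smul_comm π r (x : D)) }) ?_) hΩM
    intro x y hxy
    have h1 : π • (x : D) = π • (y : D) := congrArg (Subtype.val : Ω → D) hxy
    rw [Algebra.smul_def, Algebra.smul_def] at h1
    exact Subtype.ext (mul_left_cancel₀ hP0 h1)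
  have hϖ0 : ϖ ≠ 0 := by
    intro h
    rw [h] at hzϖ
    simp at hzϖ
  refine ⟨ϖ, ?_, ?_, ?_, ?_, ?_, ?_⟩
  · intro x
    rw [mem_jacobson_iff_not_isUnit hπ, hdvd]
  · intro x hx
    rw [mem_jacobson_iff_not_isUnit hπ, not_not] at hx
    obtain ⟨u, rfl⟩ := hx
    exact ⟨↑u⁻¹, Units.inv_mul u⟩
  · intro a
    have h1 : (ϖ : D) * a * z ∈ Ω := by
      apply hM.le
      change z * (ϖ * a * z) * ϖ ∈ Ω
      have : z * (ϖ * a * z) * ϖ = (z * ϖ) * a * (z * ϖ) := by simp only [mul_assoc]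
      rw [this, hzϖ, one_mul, mul_one]
      exact a.2
    refine ⟨⟨_, h1⟩, Subtype.ext ?_⟩
    change (ϖ : D) * a = ϖ * a * z * ϖ
    rw [mul_assoc _ z, hzϖ, mul_one]
  · intro a ha
    exact (mul_eq_zero.1 ha).resolve_right hϖ0
  · intro a ha
    -- Some power of `ϖ` is divisible by `π`, so divisibility by all powers of `ϖ` implies
    -- divisibility by all powers of `π`.
    obtain ⟨N, w, hw⟩ := (isUnit_or_dvd_pow hπ ϖ).resolve_left hϖu
    refine eq_zero_of_forall_pow_dvd (π := π) a fun k => ?_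
    refine dvd_trans ?_ (ha (N * k))
    rw [pow_mul, hw, (show Commute _ _ from Algebra.commutes π w).mul_pow]
    exact dvd_mul_right _ _
  · have hle : ∀ x : Ω, x ∈ (Ideal.span {π} • ⊤ : Submodule R Ω) →
        (Submodule.Quotient.mk x : Ω ⧸ Ring.jacobson Ω) = 0 := by
      intro x hx
      rw [Submodule.Quotient.mk_eq_zero, mem_jacobson_iff_not_isUnit hπ]
      rw [← Submodule.Quotient.mk_eq_zero, ← Submodule.Quotient.mk_zero, mk_eq_mk_iff,
        sub_zero] at hx
      obtain ⟨w, rfl⟩ := hx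
      rw [Algebra.commutes]
      exact not_isUnit_mul_left hpu w
    have h1 := finite_quotient_span (π := π) (Ω := Ω)
    have h2 : Finite (Ω ⧸ Ring.jacobson Ω) := by
      refine Finite.of_surjective (fun x : Ω ⧸ (Ideal.span {π} • ⊤ : Submodule R Ω) =>
        (Submodule.Quotient.mk (Quotient.out x) : Ω ⧸ Ring.jacobson Ω)) fun y => ?_
      obtain ⟨y, rfl⟩ := Submodule.Quotient.mk_surjective _ y
      refine ⟨Submodule.Quotient.mk y, ?_⟩
      rw [← sub_eq_zero, ← Submodule.Quotient.mk_sub]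
      refine hle _ ?_
      rw [← Submodule.Quotient.eq]
      exact Quotient.out_eq _
    have h3 : Nontrivial (Ω ⧸ Ring.jacobson Ω) := by
      refine ⟨⟨Submodule.Quotient.mk 1, 0, fun h => ?_⟩⟩
      rw [Submodule.Quotient.mk_eq_zero, mem_jacobson_iff_not_isUnit hπ] at h
      exact h isUnit_one
    exact Finite.one_lt_card

end MaximalOrder

end IyamaHall
end

/-! ### Identification of simple, indecomposable and projective modules with cyclic modules -/

noncomputable section

namespace IyamaHall

namespace CycRing

variable {n : ℕ} [NeZero n] {A : Type} [Ring A] {c : CycRing n A}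
  {Y Z : Type} [AddCommGroup Y] [Module A Y] [AddCommGroup Z] [Module A Z]

theorem submodule_C_total {p : ZMod n × ℕ∞} (S T : Submodule A (c.C p)) : S ≤ T ∨ T ≤ S := by
  rcases c.submodule_C S with rfl | ⟨k, rfl⟩
  · exact Or.inl bot_le
  rcases c.submodule_C T with rfl | ⟨l, rfl⟩
  · exact Or.inr bot_le
  rcases le_total k l with h | h
  · exact Or.inr (c.radN_anti h)
  · exact Or.inl (c.radN_anti h)

theorem eq_bot_of_isCompl_C {p : ZMod n × ℕ∞} {S T : Submodule A (c.C p)} (h : IsCompl S T) :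
    S = ⊥ ∨ T = ⊥ := by
  rcases submodule_C_total S T with h1 | h1
  · exact Or.inl (by rw [← inf_eq_left.2 h1, h.inf_eq_bot])
  · exact Or.inr (by rw [← inf_eq_right.2 h1, h.inf_eq_bot])

theorem radN_one_ne_top {p : ZMod n × ℕ∞} (hp : p.2 ≠ 0) : c.radN (c.C p) 1 ≠ ⊤ :=
  fun h => gen_notMem_radN_one hp (by rw [h]; trivial)

theorem le_radN_one {p : ZMod n × ℕ∞} {S : Submodule A (c.C p)} (hS : S ≠ ⊤) :
    S ≤ c.radN (c.C p) 1 := by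
  rcases c.submodule_C S with rfl | ⟨k, rfl⟩
  · exact bot_le
  · refine c.radN_anti (Nat.one_le_iff_ne_zero.2 ?_)
    rintro rfl
    exact hS c.radN_zero

theorem isCoatom_iff_C {p : ZMod n × ℕ∞} (hp : p.2 ≠ 0) (S : Submodule A (c.C p)) :
    IsCoatom S ↔ S = c.radN (c.C p) 1 := by
  have key : IsCoatom (c.radN (c.C p) 1) := by
    refine ⟨radN_one_ne_top hp, fun T hT => ?_⟩
    by_contra h
    exact not_lt_of_ge (le_radN_one h) hT
  constructor
  · intro h
    by_contra hne
    exact key.1 (h.2 _ (lt_of_le_of_ne (le_radN_one h.1) hne))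
  · rintro rfl
    exact key

theorem jacobson_C {p : ZMod n × ℕ∞} (hp : p.2 ≠ 0) :
    Module.jacobson A (c.C p) = c.radN (c.C p) 1 := by
  unfold Module.jacobson
  have : {m : Submodule A (c.C p) | IsCoatom m} = {c.radN (c.C p) 1} := by
    ext S
    rw [Set.mem_ofPred_eq, isCoatom_iff_C hp, Set.mem_singleton_iff]
  rw [this, sInf_singleton]

theorem length_C_top (k : ZMod n) : Module.length A (c.C (k, ⊤)) = ⊤ := by
  rw [ENat.eq_top_iff_forall_ge]
  intro N
  have h := Module.length_le_of_surjective (c.projHom (k, ⊤) N le_top)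
    (c.projHom_surjective (k, ⊤) N le_top)
  rwa [c.length_C] at h

/-- A module with a generator fixed by `e k` is a quotient of the projective module. -/
theorem surjective_lift_top {k : ZMod n} {x : Y} (hx : c.e k • x = x)
    (hgen : Submodule.span A {x} = ⊤) :
    Function.Surjective (c.lift (k, ⊤) x hx fun N hN => absurd hN (ENat.top_ne_natCast N)) := by
  intro y
  obtain ⟨a, rfl⟩ := Submodule.mem_span_singleton.1 (hgen.ge (Submodule.mem_top (x := y)))
  exact ⟨a • c.gen _, by rw [map_smul, lift_gen]⟩

/-- A lift of the generator of the top, made fixed by `e k`, lies in no maximal submodule and so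
generates `X`. Thus `X` is a quotient of the uniserial module `C (k, ⊤)`, and its length determines
the kernel. -/
theorem equiv_C_of_top {X : Type} [AddCommGroup X] [Module A X] {k : ZMod n} {j : ℕ}
    (htop : Nonempty ((X ⧸ Module.jacobson A X) ≃ₗ[A] c.C (k, 1)))
    (hlen : Module.length A X = j) : Nonempty (X ≃ₗ[A] c.C (k, (j : ℕ∞))) := by
  obtain ⟨f⟩ := htop
  have hfl : IsFiniteLength A X := Module.length_ne_top_iff.1 (by rw [hlen]; exact ENat.natCast_ne_top j)
  have hnoeth : IsNoetherian A X := (isFiniteLength_iff_isNoetherian_isArtinian.1 hfl).1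
  have hsimple : IsSimpleModule A (X ⧸ Module.jacobson A X) :=
    have := c.isSimpleModule_C_one k
    IsSimpleModule.congr f
  have hco : IsCoatom (Module.jacobson A X) := isSimpleModule_iff_isCoatom.1 hsimple
  obtain ⟨x, hx⟩ := Submodule.mkQ_surjective _ (f.symm (c.gen (k, 1)))
  have hx' : (Module.jacobson A X).mkQ (c.e k • x) = f.symm (c.gen (k, 1)) := by
    rw [map_smul, hx, ← map_smul]
    exact congrArg f.symm (c.e_smul_gen (k, 1))
  have hgen : Submodule.span A {c.e k • x} = ⊤ := by
    rcases eq_top_or_exists_le_coatom (Submodule.span A {c.e k • x}) with h | ⟨m, hm, hle⟩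
    · exact h
    · exfalso
      have h1 : c.e k • x ∈ Module.jacobson A X := by
        have h2 : Module.jacobson A X = m := by
          by_contra hne
          exact hm.1 (hco.2 m (lt_of_le_of_ne (sInf_le hm) hne))
        rw [h2]
        exact hle (Submodule.mem_span_singleton_self _)
      rw [← Submodule.Quotient.mk_eq_zero, ← Submodule.mkQ_apply, hx',
        LinearEquiv.map_eq_zero_iff] at h1
      refine gen_notMem_radN_one (c := c) (p := (k, 1)) one_ne_zero ?_
      rw [h1]
      exact Submodule.zero_mem _
  have hfix : c.e k • c.e k • x = c.e k • x := by rw [smul_smul, c.e_mul_self]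
  set φ := c.lift (k, ⊤) (c.e k • x) hfix fun N hN => absurd hN (ENat.top_ne_natCast N)
  have hφ : Function.Surjective φ := surjective_lift_top hfix hgen
  have e1 := φ.quotKerEquivOfSurjective hφ
  rcases c.submodule_C (LinearMap.ker φ) with h | ⟨m, h⟩
  · exfalso
    have h1 := (LinearEquiv.ofBijective φ ⟨LinearMap.ker_eq_bot.1 h, hφ⟩).length_eq
    rw [length_C_top, hlen] at h1
    exact ENat.top_ne_natCast j h1
  · have e2 := (Submodule.quotEquivOfEq _ _ h.symm).trans e1
    have e3 := e2.symm.trans (c.quotRadEquiv (k, ⊤) m le_top)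
    have h1 := e3.length_eq
    rw [hlen, c.length_C, Nat.cast_inj] at h1
    subst h1
    exact ⟨e3⟩

theorem isIndecomposableOf_C {S : ModuleCat.{0} A} {k : ZMod n}
    (hS : Nonempty (S ≃ₗ[A] c.C (k, 1))) (j : ℕ+) :
    IsIndecomposableOf S j (ModuleCat.of A (c.C (k, ((j : ℕ) : ℕ∞)))) := by
  obtain ⟨f⟩ := hS
  have hj : (((j : ℕ) : ℕ∞)) ≠ 0 := by exact_mod_cast j.2.ne'
  refine ⟨⟨?_, fun N N' h => eq_bot_of_isCompl_C h⟩, ?_, c.length_C _ _⟩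
  · exact ⟨⟨c.gen _, 0, fun h => gen_notMem_radN_one (c := c) (p := (k, ((j : ℕ) : ℕ∞))) hj
      (by rw [h]; exact Submodule.zero_mem _)⟩⟩
  · exact ⟨((Submodule.quotEquivOfEq _ _ (jacobson_C hj)).trans (c.topEquiv _ hj)).trans f.symm⟩

theorem IsIndecomposableOf.equiv_C {S X : ModuleCat.{0} A} {k : ZMod n} {j : ℕ+}
    (hS : Nonempty (S ≃ₗ[A] c.C (k, 1))) (h : IsIndecomposableOf S j X) :
    Nonempty (X ≃ₗ[A] c.C (k, ((j : ℕ) : ℕ∞))) :=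
  equiv_C_of_top (h.2.1.map fun g => g.trans hS.some) h.2.2

theorem projective_C_top (k : ZMod n) : Module.Projective A (c.C (k, ⊤)) := by
  refine Module.Projective.of_split
    (c.lift (k, ⊤) (c.e k) (by rw [smul_eq_mul, c.e_mul_self])
      fun N hN => absurd hN (ENat.top_ne_natCast N)) (c.I (k, ⊤)).mkQ (c.hom_ext ?_)
  rw [LinearMap.comp_apply, lift_gen, LinearMap.id_apply, Submodule.mkQ_apply, ← smul_gen]
  exact c.e_smul_gen (k, ⊤)

theorem isProjectiveCover_C {S : ModuleCat.{0} A} {k : ZMod n}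
    (hS : Nonempty (S ≃ₗ[A] c.C (k, 1))) :
    IsProjectiveCover S (ModuleCat.of A (c.C (k, ⊤))) := by
  obtain ⟨f⟩ := hS
  refine ⟨projective_C_top k, f.symm.toLinearMap.comp (c.projHom (k, ⊤) 1 le_top),
    f.symm.surjective.comp (c.projHom_surjective (k, ⊤) 1 le_top), fun N hN => ?_⟩
  by_contra h
  have h1 : LinearMap.ker (f.symm.toLinearMap.comp (c.projHom (k, ⊤) 1 le_top)) =
      c.radN (c.C (k, ⊤)) 1 := by
    rw [← c.ker_projHom (k, ⊤) 1 le_top]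
    ext x
    exact f.symm.map_eq_zero_iff
  rw [h1, sup_eq_right.2 (le_radN_one h)] at hN
  exact radN_one_ne_top (by simp) hN

/-- The superfluous kernel makes the map from `C (k, ⊤)` onto `P` surjective, and projectivity
splits it. As the uniserial source is indecomposable, either the kernel is zero or the splitting is
zero; the latter would kill the generator of the top. -/
theorem IsProjectiveCover.equiv_C {S P : ModuleCat.{0} A} {k : ZMod n}
    (hS : Nonempty (S ≃ₗ[A] c.C (k, 1))) (h : IsProjectiveCover S P) :
    Nonempty (P ≃ₗ[A] c.C (k, ⊤)) := by
  obtain ⟨g⟩ := hS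
  obtain ⟨hproj, f, hf, hsup⟩ := h
  obtain ⟨y, hy⟩ := hf (g.symm (c.gen (k, 1)))
  have hy' : f (c.e k • y) = g.symm (c.gen (k, 1)) := by
    rw [map_smul, hy, ← map_smul]
    exact congrArg g.symm (c.e_smul_gen (k, 1))
  have hfix : c.e k • c.e k • y = c.e k • y := by rw [smul_smul, c.e_mul_self]
  set φ := c.lift (k, ⊤) (c.e k • y) hfix fun N hN => absurd hN (ENat.top_ne_natCast N) with hφdef
  have hφ : Function.Surjective φ := by
    rw [← LinearMap.range_eq_top]
    refine hsup _ (eq_top_iff.2 fun z _ => ?_)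
    obtain ⟨a, ha⟩ := c.exists_smul_gen (g (f z))
    have h1 : φ (a • c.gen _) = a • c.e k • y := by rw [map_smul, hφdef, lift_gen]
    have h2 : z - a • c.e k • y ∈ LinearMap.ker f := by
      rw [LinearMap.mem_ker, map_sub, map_smul, hy', ← map_smul, ← ha]
      simp
    have h3 := Submodule.add_mem_sup (S := LinearMap.range φ) ⟨_, h1⟩ h2
    rwa [add_sub_cancel] at h3
  obtain ⟨s, hs⟩ := Module.projective_lifting_property φ LinearMap.id hφ
  have hcompl : IsCompl (LinearMap.ker φ) (LinearMap.range s) := by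
    constructor
    · rw [disjoint_iff, eq_bot_iff]
      rintro x ⟨hx1, z, rfl⟩
      have h1 : φ (s z) = z := LinearMap.congr_fun hs z
      have h2 : φ (s z) = 0 := hx1
      rw [Submodule.mem_bot, ← h1, h2, map_zero]
    · rw [codisjoint_iff, eq_top_iff]
      intro x _
      have h1 : φ (s (φ x)) = φ x := LinearMap.congr_fun hs (φ x)
      have h2 : x - s (φ x) ∈ LinearMap.ker φ := by
        rw [LinearMap.mem_ker, map_sub, h1, sub_self]
      have h3 := Submodule.add_mem_sup h2 (LinearMap.mem_range_self s (φ x))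
      rwa [sub_add_cancel] at h3
  rcases eq_bot_of_isCompl_C hcompl with h1 | h1
  · exact ⟨(LinearEquiv.ofBijective φ ⟨LinearMap.ker_eq_bot.1 h1, hφ⟩).symm⟩
  · exfalso
    have hgen0 : c.gen (k, 1) ≠ 0 := fun h => gen_notMem_radN_one (c := c) (p := (k, 1))
      one_ne_zero (by rw [h]; exact Submodule.zero_mem _)
    apply hgen0
    rw [← g.symm.map_eq_zero_iff, ← hy']
    have h2 : s (c.e k • y) = 0 := by
      rw [← Submodule.mem_bot A, ← h1]
      exact ⟨_, rfl⟩
    have h3 : φ (s (c.e k • y)) = c.e k • y := LinearMap.congr_fun hs _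
    rw [← h3, h2, map_zero, map_zero]

/-- The idempotents sum to `1`, so some `e k` is nonzero on `x`. The resulting surjection from `C
(k, ⊤)` has a maximal kernel, and the radical is the only maximal submodule. -/
theorem exists_equiv_C_one (c : CycRing n A) (X : Type) [AddCommGroup X] [Module A X]
    [IsSimpleModule A X] : ∃ k, Nonempty (X ≃ₗ[A] c.C (k, 1)) := by
  have := IsSimpleModule.nontrivial A X
  obtain ⟨x, hx⟩ := exists_ne (0 : X)
  obtain ⟨k, hk⟩ : ∃ k, c.e k • x ≠ 0 := by
    by_contra! h
    apply hx
    rw [← one_smul A x, ← c.sum_e, Finset.sum_smul, Finset.sum_eq_zero fun k _ => h k]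
  have hfix : c.e k • c.e k • x = c.e k • x := by rw [smul_smul, c.e_mul_self]
  set φ := c.lift (k, ⊤) (c.e k • x) hfix fun N hN => absurd hN (ENat.top_ne_natCast N)
  have hφ : Function.Surjective φ :=
    surjective_lift_top hfix (IsSimpleModule.span_singleton_eq_top A hk)
  have e1 := φ.quotKerEquivOfSurjective hφ
  have hco : IsCoatom (LinearMap.ker φ) := isSimpleModule_iff_isCoatom.1 (IsSimpleModule.congr e1)
  rw [isCoatom_iff_C (by simp)] at hco
  exact ⟨k, ⟨(((Submodule.quotEquivOfEq _ _ hco.symm).trans e1).symm).trans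
    (c.topEquiv (k, ⊤) (by simp))⟩⟩

theorem eq_of_e_smul_ne_zero {k l : ZMod n} {x : c.C (k, 1)} (h : c.e l • x ≠ 0) : l = k := by
  by_contra hne
  rw [← e_smul_C_one k x, smul_smul, c.e_mul_ne _ _ hne, zero_smul] at h
  exact h rfl

/-- Lift the generator of the quotient to `x` with `e k x = x`. If `u x = 0`, then `A x` is a
complement of `N`. Otherwise `u x` is a nonzero element of `N` fixed by `e (k + 1)`, which
identifies the top of `N`. -/
theorem eq_add_one_of_nonsplit {E : Type} [AddCommGroup E] [Module A E] {N : Submodule A E}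
    {k l : ZMod n} (f : N ≃ₗ[A] c.C (l, 1)) (g : (E ⧸ N) ≃ₗ[A] c.C (k, 1))
    (h : ¬ ∃ N', IsCompl N N') : l = k + 1 := by
  obtain ⟨x₀, hx₀⟩ := Submodule.mkQ_surjective _ (g.symm (c.gen (k, 1)))
  set x := c.e k • x₀ with hxdef
  have hx : N.mkQ x = g.symm (c.gen (k, 1)) := by
    rw [hxdef, map_smul, hx₀, ← map_smul]
    exact congrArg g.symm (c.e_smul_gen (k, 1))
  have hfix : c.e k • x = x := by rw [hxdef, smul_smul, c.e_mul_self]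
  have hmemN : ∀ a : A, a • x ∈ N ↔ a • c.gen (k, 1) = 0 := by
    intro a
    rw [← Submodule.Quotient.mk_eq_zero, ← Submodule.mkQ_apply, map_smul, hx, ← map_smul,
      LinearEquiv.map_eq_zero_iff]
  by_cases hu : c.u • x = 0
  · exfalso
    refine h ⟨Submodule.span A {x}, ?_, ?_⟩
    · rw [disjoint_iff, eq_bot_iff]
      rintro y ⟨hy1, hy2⟩
      obtain ⟨a, rfl⟩ := Submodule.mem_span_singleton.1 hy2
      have h1 := (hmemN a).1 hy1
      rw [smul_gen_eq_zero] at h1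
      obtain ⟨d, hd⟩ := h1 1 (by simp)
      obtain ⟨d', hd'⟩ := c.left_normal d
      rw [pow_one] at hd
      rw [Submodule.mem_bot, ← hfix, smul_smul]
      change (a * c.e k) • x = 0
      rw [hd, hd', mul_smul, hu, smul_zero]
    · rw [codisjoint_iff, eq_top_iff]
      intro y _
      obtain ⟨a, ha⟩ := c.exists_smul_gen (g (N.mkQ y))
      have h1 : y - a • x ∈ N := by
        rw [← Submodule.Quotient.mk_eq_zero, ← Submodule.mkQ_apply, map_sub, map_smul, hx,
          ← map_smul, ← ha]
        simp
      have h2 := Submodule.add_mem_sup h1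
        (Submodule.smul_mem _ a (Submodule.mem_span_singleton_self (R := A) x))
      rwa [sub_add_cancel] at h2
  · have h1 : c.u • x ∈ N := (hmemN _).2 (c.u_smul_C_one k _)
    have h2 : c.e (k + 1) • c.u • x = c.u • x := by
      rw [smul_smul, ← c.u_mul_e, mul_smul, hfix]
    have h3 : c.e (k + 1) • f ⟨c.u • x, h1⟩ ≠ 0 := by
      rw [← map_smul, Ne, LinearEquiv.map_eq_zero_iff]
      intro h4
      exact hu (h2.symm.trans (congrArg Subtype.val h4))
    exact (eq_of_e_smul_ne_zero h3).symm

/-- The nonsplit extensions force the labels to advance by one together, so two labellings differ by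
a rotation. -/
theorem IsCyclicLabelling.exists_shift {S : ZMod n → ModuleCat.{0} A} (c : CycRing n A)
    (h : IsCyclicLabelling S) : ∃ k, ∀ i, Nonempty (S i ≃ₗ[A] c.C (i + k, 1)) := by
  have h1 : ∀ i, ∃ k, Nonempty (S i ≃ₗ[A] c.C (k, 1)) := fun i =>
    have := h.simple i
    exists_equiv_C_one c (S i)
  choose σ hσ using h1
  have h2 : ∀ i, σ (i + 1) = σ i + 1 := by
    intro i
    obtain ⟨E, N, ⟨f⟩, ⟨g⟩, hN⟩ := h.arrow i
    obtain ⟨a⟩ := hσ (i + 1)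
    obtain ⟨b⟩ := hσ i
    exact eq_add_one_of_nonsplit (f.trans a) (g.trans b) hN
  have h3 : ∀ m : ℕ, σ m = m + σ 0 := by
    intro m
    induction m with
    | zero => simp
    | succ m ih =>
      rw [Nat.cast_succ, h2, ih]
      ring
  refine ⟨σ 0, fun i => ?_⟩
  have h4 := h3 i.val
  rw [ZMod.natCast_zmod_val] at h4
  rw [← h4]
  exact hσ i

/-- The nonsplit extension is `C (i, 2)`. The definition of the Hall polynomials quantifies over
labellings; this one makes it possible to evaluate them. -/
theorem isCyclicLabelling_C (c : CycRing n A) :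
    IsCyclicLabelling fun i : ZMod n => ModuleCat.of A (c.C (i, 1)) where
  simple i := c.isSimpleModule_C_one i
  injective i j := by
    rintro ⟨f⟩
    have h : c.e i • f (c.gen (i, 1)) ≠ 0 := by
      rw [← map_smul, Ne, LinearEquiv.map_eq_zero_iff]
      intro h
      rw [show c.e i • c.gen (i, 1) = c.gen (i, 1) from c.e_smul_gen (i, 1)] at h
      exact gen_notMem_radN_one (c := c) (p := (i, 1)) one_ne_zero
        (by rw [h]; exact Submodule.zero_mem _)
    exact eq_of_e_smul_ne_zero h
  exhaustive X hX := exists_equiv_C_one c X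
  arrow i := by
    have h2 : (((1 + 1 : ℕ) : ℕ∞)) ≠ 0 := by norm_num
    refine ⟨ModuleCat.of A (c.C (i, ((1 + 1 : ℕ) : ℕ∞))), c.radN _ 1,
      ⟨(c.radEquivNat i 1).trans (c.congrC (by simp))⟩, ⟨c.topEquiv _ h2⟩, ?_⟩
    rintro ⟨N', hN⟩
    rcases eq_bot_of_isCompl_C hN with h | h
    · have e1 := (c.radEquivNat i 1).toEquiv
      have := c.nontrivial_C_one (i + 1)
      have h3 : Nontrivial (c.radN (c.C (i, ((1 + 1 : ℕ) : ℕ∞))) 1) :=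
        ((c.radEquivNat i 1).trans (c.congrC (p' := (i + 1, 1)) (by simp))).toEquiv.nontrivial
      rw [Submodule.nontrivial_iff_ne_bot] at h3
      exact h3 h
    · rw [h] at hN
      exact radN_one_ne_top h2 (by simpa using hN.sup_eq_top)

/-- The same structure with the idempotents relabelled. -/
def rotate (c : CycRing n A) (k : ZMod n) : CycRing n A where
  e i := c.e (i + k)
  u := c.u
  q := c.q
  e_mul_self i := c.e_mul_self _
  e_mul_ne i j h := c.e_mul_ne _ _ fun h' => h (add_right_cancel h')
  sum_e := by
    rw [← c.sum_e]
    exact Equiv.sum_comp (Equiv.addRight k) c.e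
  u_mul_e i := by rw [c.u_mul_e, add_right_comm]
  left_normal := c.left_normal
  right_normal := c.right_normal
  eq_zero_of_mul_u := c.eq_zero_of_mul_u
  dvd_off i j a h := c.dvd_off _ _ a fun h' => h (add_right_cancel h')
  dvd_or i a := c.dvd_or _ a
  sep := c.sep
  one_lt_q := c.one_lt_q
  residue i := c.residue _

theorem IsCyclicLabelling.exists_cycRing {S : ZMod n → ModuleCat.{0} A} (c : CycRing n A)
    (h : IsCyclicLabelling S) :
    ∃ c' : CycRing n A, c'.q = c.q ∧ ∀ i, Nonempty (S i ≃ₗ[A] c'.C (i, 1)) := by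
  obtain ⟨k, hk⟩ := IsCyclicLabelling.exists_shift c h
  exact ⟨c.rotate k, rfl, hk⟩

theorem hasType_directSum {ι : Type} [Fintype ι] (f : ι → ZMod n × ℕ∞) (hf : ∀ i, (f i).2 ≠ 0)
    (N : ι → ModuleCat.{0} A) (hN : ∀ i, Nonempty (N i ≃ₗ[A] c.C (f i))) :
    c.HasType (Finset.univ.val.map f) (DirectSum ι fun i => N i) := by
  revert f N
  refine Fintype.induction_empty_option (P := fun ι _ => ∀ (f : ι → ZMod n × ℕ∞),
    (∀ i, (f i).2 ≠ 0) → ∀ (N : ι → ModuleCat.{0} A), (∀ i, Nonempty (N i ≃ₗ[A] c.C (f i))) →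
    c.HasType (Finset.univ.val.map f) (DirectSum ι fun i => N i)) ?_ ?_ ?_ ι
  · intro ι κ _ e ih f hf N hN
    have := Fintype.ofEquiv κ e.symm
    have h := ih (fun i => f (e i)) (fun i => hf _) (fun i => N (e i)) fun i => hN _
    have h1 : (Finset.univ : Finset κ).val.map f =
        (@Finset.univ ι (Fintype.ofEquiv κ e.symm)).val.map fun i => f (e i) := by
      let _ := Fintype.ofEquiv κ e.symm
      rw [← Multiset.map_univ_val_equiv e, Multiset.map_map]
      rfl
    rw [h1]
    exact h.congr (DirectSum.lequivCongrLeft A (M := fun i => N i) e.symm).symm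
  · intro f _ N _
    exact hasType_zero
  · intro ι _ ih f hf N hN
    classical
    have h := ih (fun i => f (some i)) (fun i => hf _) (fun i => N (some i)) fun i => hN _
    have h1 : (Finset.univ : Finset (Option ι)).val.map f =
        f none ::ₘ Finset.univ.val.map fun i => f (some i) := by
      change Multiset.map f (none ::ₘ Multiset.map _ _) = _
      rw [Multiset.map_cons, Multiset.map_map]
      rfl
    rw [h1]
    obtain ⟨g⟩ := hN none
    exact (HasType.cons (hf none) h).congr ((g.symm.prodCongr (LinearEquiv.refl A _)).trans
      (DirectSum.lequivProdDirectSum A (α := fun i => N i)).symm)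

theorem finite_sigma_fin {J : Type} (l : J →₀ ℕ) : Finite (Σ j : J, Fin (l j)) := by
  refine Finite.of_injective (β := Σ j : l.support, Fin (l j))
    (fun a => ⟨⟨a.1, Finsupp.mem_support_iff.2 (Nat.pos_iff_ne_zero.1 (Fin.pos a.2))⟩, a.2⟩) ?_
  rintro ⟨a, b⟩ ⟨a', b'⟩ h
  simp only [Sigma.mk.injEq, Subtype.mk.injEq] at h
  obtain ⟨rfl, h⟩ := h
  simpa using h

theorem hasType_directSum_finsupp {J : Type} (l : J →₀ ℕ) (f : J → ZMod n × ℕ∞)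
    (hf : ∀ j, (f j).2 ≠ 0) (N : J → ModuleCat.{0} A)
    (hN : ∀ j, Nonempty (N j ≃ₗ[A] c.C (f j))) :
    c.HasType (l.toMultiset.map f) (DirectSum (Σ j : J, Fin (l j)) fun a => N a.1) := by
  classical
  have := finite_sigma_fin l
  have := Fintype.ofFinite (Σ j : J, Fin (l j))
  have h1 : l.toMultiset = (Finset.univ : Finset (Σ j : J, Fin (l j))).val.map Sigma.fst := by
    ext j
    rw [Finsupp.count_toMultiset, Multiset.count_map]
    change _ = (Finset.univ.filter fun a : Σ j : J, Fin (l j) => j = a.1).card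
    rw [← Fintype.card_fin (l j), ← Finset.card_univ]
    refine Finset.card_bij (fun i _ => ⟨j, i⟩) (by simp) (by simp) ?_
    rintro ⟨j', i⟩ h
    obtain rfl : j = j' := by simpa using h
    exact ⟨i, Finset.mem_univ _, rfl⟩
  rw [h1, Multiset.map_map]
  exact hasType_directSum (fun a : Σ j : J, Fin (l j) => f a.1) (fun _ => hf _) (fun a => N a.1)
    fun _ => hN _

end CycRing

/-- The type of the finite length module given by a tuple of partitions. -/
def typeOfPartition {n : ℕ} (l : PartitionTuple n) : Multiset (ZMod n × ℕ∞) :=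
  (Finsupp.toMultiset l).map fun p => (p.1, ((p.2 : ℕ) : ℕ∞))

/-- The type of the projective module given by multiplicities. -/
def typeOfLattice {n : ℕ} [NeZero n] (μ : ZMod n → ℕ) : Multiset (ZMod n × ℕ∞) :=
  (Finsupp.toMultiset (Finsupp.equivFunOnFinite.symm μ)).map fun i => (i, ⊤)

namespace CycRing

variable {n : ℕ} [NeZero n] {A : Type} [Ring A] {c : CycRing n A} {S : ZMod n → ModuleCat.{0} A}

theorem hasType_of_isFinModule (hS : ∀ i, Nonempty (S i ≃ₗ[A] c.C (i, 1))) {l : PartitionTuple n}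
    {X : ModuleCat.{0} A} (h : IsFinModule S l X) : c.HasType (typeOfPartition l) X := by
  obtain ⟨N, hN, ⟨f⟩⟩ := h
  refine (hasType_directSum_finsupp l (fun p => (p.1, ((p.2 : ℕ) : ℕ∞))) ?_ N ?_).congr f.symm
  · intro p
    change ((p.2 : ℕ) : ℕ∞) ≠ 0
    exact_mod_cast p.2.ne_zero
  · exact fun p => IsIndecomposableOf.equiv_C (hS p.1) (hN p)

theorem isFinModule_of_hasType (hS : ∀ i, Nonempty (S i ≃ₗ[A] c.C (i, 1))) {l : PartitionTuple n}
    {X : ModuleCat.{0} A} (h : c.HasType (typeOfPartition l) X) : IsFinModule S l X := by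
  have h' : IsFinModule S l (ModuleCat.of A (DirectSum (Σ p : ZMod n × ℕ+, Fin (l p)) fun a =>
      ModuleCat.of A (c.C (a.1.1, ((a.1.2 : ℕ) : ℕ∞))))) :=
    ⟨fun p => ModuleCat.of A (c.C (p.1, ((p.2 : ℕ) : ℕ∞))), fun p => isIndecomposableOf_C (hS p.1) _,
      ⟨LinearEquiv.refl _ _⟩⟩
  obtain ⟨f⟩ := h.nonempty_equiv (hasType_of_isFinModule hS h')
  exact ⟨fun p => ModuleCat.of A (c.C (p.1, ((p.2 : ℕ) : ℕ∞))),
    fun p => isIndecomposableOf_C (hS p.1) _, ⟨f⟩⟩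

theorem hasType_of_isLattice (hS : ∀ i, Nonempty (S i ≃ₗ[A] c.C (i, 1))) {μ : ZMod n → ℕ}
    {X : ModuleCat.{0} A} (h : IsLattice S μ X) : c.HasType (typeOfLattice μ) X := by
  obtain ⟨N, hN, ⟨f⟩⟩ := h
  exact (hasType_directSum_finsupp (Finsupp.equivFunOnFinite.symm μ) (fun i => (i, ⊤)) (by simp) N
    fun i => IsProjectiveCover.equiv_C (hS i) (hN i)).congr f.symm

theorem isLattice_of_hasType (hS : ∀ i, Nonempty (S i ≃ₗ[A] c.C (i, 1))) {μ : ZMod n → ℕ}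
    {X : ModuleCat.{0} A} (h : c.HasType (typeOfLattice μ) X) : IsLattice S μ X := by
  have h' : IsLattice S μ (ModuleCat.of A (DirectSum (Σ i : ZMod n, Fin (μ i)) fun a =>
      ModuleCat.of A (c.C (a.1, ⊤)))) :=
    ⟨fun i => ModuleCat.of A (c.C (i, ⊤)), fun i => isProjectiveCover_C (hS i),
      ⟨LinearEquiv.refl _ _⟩⟩
  obtain ⟨f⟩ := h.nonempty_equiv (hasType_of_isLattice hS h')
  exact ⟨fun i => ModuleCat.of A (c.C (i, ⊤)), fun i => isProjectiveCover_C (hS i), ⟨f⟩⟩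

theorem hallSet_eq_hT {X Y Z : ModuleCat.{0} A} {s t : Multiset (ZMod n × ℕ∞)}
    (hX : c.HasType s X) (hZ : c.HasType t Z) : hallSet X Y Z = c.hT s Y t := by
  ext W
  exact ⟨fun h => ⟨hZ.congr h.1.some.symm, hX.congr h.2.some.symm⟩,
    fun h => ⟨h.1.nonempty_equiv hZ, h.2.nonempty_equiv hX⟩⟩

end CycRing

end IyamaHall
end

/-! ### Invariance of Hall numbers under Morita equivalence -/

noncomputable section

namespace IyamaHall

namespace Equivalence

open CategoryTheory

variable {Λ A : Type} [Ring Λ] [Ring A] (E : ModuleCat.{0} Λ ≌ ModuleCat.{0} A)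

/-- The action of an equivalence of module categories on linear maps. -/
def fm {X Y : ModuleCat.{0} Λ} (f : X →ₗ[Λ] Y) : E.functor.obj X →ₗ[A] E.functor.obj Y :=
  (E.functor.map (ModuleCat.ofHom f)).hom

theorem fm_id (X : ModuleCat.{0} Λ) : fm E (LinearMap.id : X →ₗ[Λ] X) = LinearMap.id := by
  change (E.functor.map (𝟙 X)).hom = _
  rw [E.functor.map_id]
  rfl

theorem fm_comp {X Y Z : ModuleCat.{0} Λ} (g : Y →ₗ[Λ] Z) (f : X →ₗ[Λ] Y) :
    fm E (g.comp f) = (fm E g).comp (fm E f) := by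
  change (E.functor.map (ModuleCat.ofHom f ≫ ModuleCat.ofHom g)).hom = _
  rw [E.functor.map_comp]
  rfl

theorem fm_inj {X Y : ModuleCat.{0} Λ} {f g : X →ₗ[Λ] Y} (h : fm E f = fm E g) : f = g := by
  have h1 := E.functor.map_injective (ModuleCat.hom_ext h)
  exact congrArg ModuleCat.Hom.hom h1

theorem exists_fm {X Y : ModuleCat.{0} Λ} (f : E.functor.obj X →ₗ[A] E.functor.obj Y) :
    ∃ g : X →ₗ[Λ] Y, fm E g = f := by
  obtain ⟨g, hg⟩ := E.functor.map_surjective (ModuleCat.ofHom f)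
  exact ⟨g.hom, by unfold fm; rw [ModuleCat.ofHom_hom, hg]; rfl⟩

theorem exists_obj (Y : ModuleCat.{0} A) :
    ∃ X : ModuleCat.{0} Λ, Nonempty (E.functor.obj X ≃ₗ[A] Y) :=
  ⟨E.functor.objPreimage Y, ⟨(E.functor.objObjPreimageIso Y).toLinearEquiv⟩⟩

/-- The action of an equivalence on linear isomorphisms. -/
def mapEquiv {X Y : ModuleCat.{0} Λ} (f : X ≃ₗ[Λ] Y) : E.functor.obj X ≃ₗ[A] E.functor.obj Y :=
  LinearEquiv.ofLinearMap (fm E f.toLinearMap) (fm E f.symm.toLinearMap)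
    (by rw [← fm_comp, LinearEquiv.comp_symm, fm_id])
    (by rw [← fm_comp, LinearEquiv.symm_comp, fm_id])

theorem nonempty_equiv_iff {X Y : ModuleCat.{0} Λ} :
    Nonempty (E.functor.obj X ≃ₗ[A] E.functor.obj Y) ↔ Nonempty (X ≃ₗ[Λ] Y) := by
  refine ⟨fun ⟨f⟩ => ?_, fun ⟨f⟩ => ⟨mapEquiv E f⟩⟩
  obtain ⟨g, hg⟩ := exists_fm E f.toLinearMap
  obtain ⟨g', hg'⟩ := exists_fm E f.symm.toLinearMap
  exact ⟨LinearEquiv.ofLinearMap g g'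
    (fm_inj E (by rw [fm_comp, hg, hg', LinearEquiv.comp_symm, fm_id]))
    (fm_inj E (by rw [fm_comp, hg, hg', LinearEquiv.symm_comp, fm_id]))⟩

theorem fm_injective {X Y : ModuleCat.{0} Λ} {f : X →ₗ[Λ] Y} (hf : Function.Injective f) :
    Function.Injective (fm E f) := by
  have : Mono (ModuleCat.ofHom f) := (ModuleCat.mono_iff_injective _).2 hf
  exact (ModuleCat.mono_iff_injective (E.functor.map (ModuleCat.ofHom f))).1 inferInstance

theorem fm_surjective {X Y : ModuleCat.{0} Λ} {f : X →ₗ[Λ] Y} (hf : Function.Surjective f) :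
    Function.Surjective (fm E f) := by
  have : Epi (ModuleCat.ofHom f) := (ModuleCat.epi_iff_surjective _).2 hf
  exact (ModuleCat.epi_iff_surjective (E.functor.map (ModuleCat.ofHom f))).1 inferInstance

/-- The image of a submodule. -/
def subFun {X : ModuleCat.{0} Λ} (N : Submodule Λ X) : Submodule A (E.functor.obj X) :=
  LinearMap.range (fm E (X := ModuleCat.of Λ N) N.subtype)

theorem subFun_range {X Y : ModuleCat.{0} Λ} (f : X →ₗ[Λ] Y) :
    subFun E (LinearMap.range f) = LinearMap.range (fm E f) := by
  have h : fm E f = (fm E (X := ModuleCat.of Λ (LinearMap.range f)) (LinearMap.range f).subtype).comp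
      (fm E (Y := ModuleCat.of Λ (LinearMap.range f)) f.rangeRestrict) := by
    rw [← fm_comp]
    rfl
  rw [h, LinearMap.range_comp_of_range_eq_top]
  · rfl
  · rw [LinearMap.range_eq_top]
    exact fm_surjective E f.surjective_rangeRestrict

/-- An inclusion between the images is a linear map over the inclusions, and fullness and
faithfulness lift it back to an inclusion of the original submodules. -/
theorem subFun_le_iff {X : ModuleCat.{0} Λ} {N N' : Submodule Λ X} :
    subFun E N ≤ subFun E N' ↔ N ≤ N' := by
  constructor
  · intro h
    let i := LinearEquiv.ofInjective _ (fm_injective E (X := ModuleCat.of Λ N')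
      N'.injective_subtype)
    obtain ⟨g, hg⟩ := exists_fm E (X := ModuleCat.of Λ N) (Y := ModuleCat.of Λ N')
      (i.symm.toLinearMap.comp ((Submodule.inclusion h).comp (LinearMap.rangeRestrict _)))
    have h1 : N'.subtype.comp g = N.subtype := by
      refine fm_inj E (X := ModuleCat.of Λ N) ?_
      rw [fm_comp (Y := ModuleCat.of Λ N'), hg]
      ext x
      have := congrArg Subtype.val (i.apply_symm_apply (Submodule.inclusion h
        (LinearMap.rangeRestrict (fm E (X := ModuleCat.of Λ N) N.subtype) x)))
      exact this
    intro x hx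
    have h2 := LinearMap.congr_fun h1 ⟨x, hx⟩
    change ((g ⟨x, hx⟩ : N') : X) = x at h2
    rw [← h2]
    exact (g ⟨x, hx⟩ : N').2
  · intro h
    have h1 : fm E (X := ModuleCat.of Λ N) N.subtype =
        (fm E (X := ModuleCat.of Λ N') N'.subtype).comp (fm E (X := ModuleCat.of Λ N)
          (Y := ModuleCat.of Λ N') (Submodule.inclusion h)) := by
      rw [← fm_comp]
      rfl
    unfold subFun
    rw [h1]
    exact LinearMap.range_comp_le_range _ _

theorem subFun_surjective {X : ModuleCat.{0} Λ} : Function.Surjective (subFun E (X := X)) := by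
  intro M
  obtain ⟨X', ⟨i⟩⟩ := exists_obj E (ModuleCat.of A M)
  obtain ⟨g, hg⟩ := exists_fm E (Y := X) (M.subtype.comp i.toLinearMap)
  refine ⟨LinearMap.range g, ?_⟩
  rw [subFun_range, hg, LinearMap.range_comp_of_range_eq_top]
  · exact M.range_subtype
  · exact LinearEquiv.range i

/-- An equivalence of module categories induces an isomorphism of submodule lattices. -/
def subIso (X : ModuleCat.{0} Λ) : Submodule Λ X ≃o Submodule A (E.functor.obj X) :=
  RelIso.ofSurjective (OrderEmbedding.ofMapLEIff (subFun E) fun _ _ => subFun_le_iff E)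
    (subFun_surjective E)

theorem subIso_apply {X : ModuleCat.{0} Λ} (N : Submodule Λ X) : subIso E X N = subFun E N := rfl

/-- The image of a submodule is isomorphic to its image as a module. -/
def subEquiv {X : ModuleCat.{0} Λ} (N : Submodule Λ X) :
    E.functor.obj (ModuleCat.of Λ N) ≃ₗ[A] subIso E X N :=
  LinearEquiv.ofInjective _ (fm_injective E (X := ModuleCat.of Λ N) N.injective_subtype)

variable [E.functor.Additive]

theorem fm_zero {X Y : ModuleCat.{0} Λ} : fm E (0 : X →ₗ[Λ] Y) = 0 := by
  change (E.functor.map (0 : X ⟶ Y)).hom = _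
  rw [Functor.map_zero]
  rfl

theorem fm_add {X Y : ModuleCat.{0} Λ} (f g : X →ₗ[Λ] Y) : fm E (f + g) = fm E f + fm E g := by
  change (E.functor.map (ModuleCat.ofHom f + ModuleCat.ofHom g)).hom = _
  rw [Functor.map_add]
  rfl

theorem fm_sum {X Y : ModuleCat.{0} Λ} {ι : Type} (s : Finset ι) (f : ι → X →ₗ[Λ] Y) :
    fm E (∑ i ∈ s, f i) = ∑ i ∈ s, fm E (f i) := by
  classical
  induction s using Finset.induction_on with
  | empty => exact fm_zero E
  | insert a s ha ih => rw [Finset.sum_insert ha, Finset.sum_insert ha, fm_add, ih]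

theorem subIso_ker {X Y : ModuleCat.{0} Λ} (f : X →ₗ[Λ] Y) :
    subIso E X (LinearMap.ker f) = LinearMap.ker (fm E f) := by
  rw [subIso_apply]
  apply le_antisymm
  · rintro _ ⟨y, rfl⟩
    have h1 : f.comp (LinearMap.ker f).subtype = 0 := by
      ext x
      exact x.2
    have h2 := congrArg (fm E (X := ModuleCat.of Λ (LinearMap.ker f))) h1
    rw [fm_comp, fm_zero] at h2
    exact LinearMap.congr_fun h2 y
  · obtain ⟨N, hN⟩ := subFun_surjective E (LinearMap.ker (fm E f))
    rw [← hN, subFun_le_iff]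
    have h1 : f.comp N.subtype = 0 := by
      refine fm_inj E (X := ModuleCat.of Λ N) ?_
      rw [fm_comp, fm_zero]
      ext y
      have : fm E (X := ModuleCat.of Λ N) N.subtype y ∈ LinearMap.ker (fm E f) := by
        rw [← hN]
        exact ⟨y, rfl⟩
      exact this
    intro x hx
    exact LinearMap.congr_fun h1 ⟨x, hx⟩

/-- The quotient by the image of a submodule. -/
def quotEquiv {X : ModuleCat.{0} Λ} (N : Submodule Λ X) :
    (E.functor.obj X ⧸ subIso E X N) ≃ₗ[A] E.functor.obj (ModuleCat.of Λ (X ⧸ N)) :=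
  (Submodule.quotEquivOfEq _ _ (by
    conv_lhs => rw [← N.ker_mkQ]
    exact subIso_ker E (Y := ModuleCat.of Λ (X ⧸ N)) N.mkQ)).trans
  ((fm E (Y := ModuleCat.of Λ (X ⧸ N)) N.mkQ).quotKerEquivOfSurjective
    (fm_surjective E (Y := ModuleCat.of Λ (X ⧸ N)) N.mkQ_surjective))

theorem image_hallSet (X Y Z : ModuleCat.{0} Λ) :
    hallSet (E.functor.obj X) (E.functor.obj Y) (E.functor.obj Z) =
      subIso E Y '' hallSet X Y Z := by
  have key : ∀ W : Submodule Λ Y, subIso E Y W ∈ hallSet (E.functor.obj X) (E.functor.obj Y)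
      (E.functor.obj Z) ↔ W ∈ hallSet X Y Z := by
    intro W
    have h1 := nonempty_equiv_iff E (X := ModuleCat.of Λ W) (Y := Z)
    have h2 := nonempty_equiv_iff E (X := ModuleCat.of Λ (Y ⧸ W)) (Y := X)
    refine and_congr (Iff.trans ?_ h1) (Iff.trans ?_ h2)
    · exact ⟨fun ⟨f⟩ => ⟨(subEquiv E W).trans f⟩, fun ⟨f⟩ => ⟨(subEquiv E W).symm.trans f⟩⟩
    · exact ⟨fun ⟨f⟩ => ⟨(quotEquiv E W).symm.trans f⟩, fun ⟨f⟩ => ⟨(quotEquiv E W).trans f⟩⟩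
  ext W
  obtain ⟨W, rfl⟩ := (subIso E Y).surjective W
  rw [key, (subIso E Y).injective.mem_set_image]

omit [E.functor.Additive] in
theorem isSimpleModule_iff (X : ModuleCat.{0} Λ) :
    IsSimpleModule A (E.functor.obj X) ↔ IsSimpleModule Λ X := by
  rw [_root_.isSimpleModule_iff, _root_.isSimpleModule_iff]
  exact (subIso E X).isSimpleOrder_iff.symm

theorem isCyclicLabelling {n : ℕ} {S : ZMod n → ModuleCat.{0} Λ} (h : IsCyclicLabelling S) :
    IsCyclicLabelling fun i => E.functor.obj (S i) where
  simple i := (isSimpleModule_iff E _).2 (h.simple i)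
  injective i j hij := h.injective i j ((nonempty_equiv_iff E).1 hij)
  exhaustive X hX := by
    obtain ⟨X', ⟨f⟩⟩ := exists_obj E X
    obtain ⟨i, hi⟩ := h.exhaustive X' ((isSimpleModule_iff E _).1 (IsSimpleModule.congr f))
    exact ⟨i, ⟨f.symm.trans ((nonempty_equiv_iff E).2 hi).some⟩⟩
  arrow i := by
    obtain ⟨M, N, ⟨f⟩, ⟨g⟩, hN⟩ := h.arrow i
    refine ⟨E.functor.obj M, subIso E M N,
      ⟨(subEquiv E N).symm.trans (mapEquiv E (X := ModuleCat.of Λ N) f)⟩,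
      ⟨(quotEquiv E N).trans (mapEquiv E (X := ModuleCat.of Λ (M ⧸ N)) g)⟩, ?_⟩
    rintro ⟨N', hN'⟩
    obtain ⟨N', rfl⟩ := (subIso E M).surjective N'
    exact hN ⟨N', (OrderIso.isCompl_iff (subIso E M)).2 hN'⟩

theorem subIso_jacobson (X : ModuleCat.{0} Λ) :
    subIso E X (Module.jacobson Λ X) = Module.jacobson A (E.functor.obj X) := by
  unfold Module.jacobson
  rw [OrderIso.map_sInf, ← sInf_image]
  congr 1
  ext N
  obtain ⟨N, rfl⟩ := (subIso E X).surjective N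
  rw [(subIso E X).injective.mem_set_image]
  exact ((subIso E X).isCoatom_iff N).symm

theorem isIndecomposableOf {S X : ModuleCat.{0} Λ} {j : ℕ+} (h : IsIndecomposableOf S j X) :
    IsIndecomposableOf (E.functor.obj S) j (E.functor.obj X) := by
  obtain ⟨⟨h1, h2⟩, ⟨f⟩, h4⟩ := h
  refine ⟨⟨?_, fun N N' hN => ?_⟩, ?_, ?_⟩
  · have : Nontrivial (Submodule Λ X) := (Submodule.nontrivial_iff Λ).2 h1
    exact (Submodule.nontrivial_iff A).1 (subIso E X).symm.toEquiv.nontrivial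
  · obtain ⟨N, rfl⟩ := (subIso E X).surjective N
    obtain ⟨N', rfl⟩ := (subIso E X).surjective N'
    rcases h2 N N' ((OrderIso.isCompl_iff (subIso E X)).2 hN) with rfl | rfl
    · exact Or.inl (OrderIso.map_bot _)
    · exact Or.inr (OrderIso.map_bot _)
  · exact ⟨((Submodule.quotEquivOfEq _ _ (subIso_jacobson E X).symm).trans (quotEquiv E _)).trans
      (mapEquiv E (X := ModuleCat.of Λ (X ⧸ Module.jacobson Λ X)) f)⟩
  · rw [← h4]
    -- Length is the Krull dimension of the lattice of submodules, so it is preserved by the lattice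
    -- isomorphism.
    have h5 := Order.krullDim_eq_of_orderIso (subIso E X)
    rw [← Module.coe_length, ← Module.coe_length] at h5
    exact (WithBot.coe_injective h5).symm

theorem isProjectiveCover {S P : ModuleCat.{0} Λ} (h : IsProjectiveCover S P) :
    IsProjectiveCover (E.functor.obj S) (E.functor.obj P) := by
  obtain ⟨h1, f, hf, hsup⟩ := h
  refine ⟨?_, fm E f, fm_surjective E hf, fun N hN => ?_⟩
  · rw [IsProjective.iff_projective] at h1 ⊢
    exact (E.map_projective_iff P).2 h1
  · obtain ⟨N, rfl⟩ := (subIso E P).surjective N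
    rw [← subIso_ker, ← OrderIso.map_sup, ← (subIso E P).map_top] at hN
    rw [hsup N ((subIso E P).injective hN), OrderIso.map_top]

/-- A finite direct sum is characterised by identities between its projections and injections, and
an additive functor preserves these. -/
theorem mapDirectSum {ι : Type} [Fintype ι] {X : ModuleCat.{0} Λ} (N : ι → ModuleCat.{0} Λ)
    (f : X ≃ₗ[Λ] DirectSum ι fun i => N i) :
    Nonempty (E.functor.obj X ≃ₗ[A] DirectSum ι fun i => E.functor.obj (N i)) := by
  classical
  let p : ∀ i, X →ₗ[Λ] N i := fun i => (DirectSum.component Λ ι (fun i => N i) i).comp f.toLinearMap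
  let s : ∀ i, N i →ₗ[Λ] X := fun i => f.symm.toLinearMap.comp (DirectSum.lof Λ ι (fun i => N i) i)
  have hps : ∀ i, (p i).comp (s i) = LinearMap.id := by
    intro i
    ext x
    simp [p, s]
  have hps' : ∀ i j, i ≠ j → (p i).comp (s j) = 0 := by
    intro i j hij
    ext x
    simp [p, s, DirectSum.component.of, hij.symm]
  have hsum : ∑ i, (s i).comp (p i) = LinearMap.id := by
    ext x
    apply f.injective
    rw [LinearMap.sum_apply, map_sum]
    refine DirectSum.ext_component Λ fun i => ?_
    rw [map_sum, Finset.sum_eq_single i]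
    · simp [p, s]
    · intro j _ hj
      simp [p, s, DirectSum.component.of, hj]
    · simp
  suffices H : Nonempty (E.functor.obj X ≃ₗ[A] ∀ i, E.functor.obj (N i)) from
    H.map fun g => g.trans (DirectSum.linearEquivFunOnFintype A ι fun i => E.functor.obj (N i)).symm
  refine ⟨LinearEquiv.ofLinearMap (LinearMap.pi fun i => fm E (p i))
    (∑ i, (fm E (s i)).comp (LinearMap.proj i)) ?_ ?_⟩
  · refine LinearMap.ext fun x => funext fun i => ?_
    rw [LinearMap.comp_apply, LinearMap.sum_apply, LinearMap.pi_apply, map_sum,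
      Finset.sum_eq_single i]
    · rw [LinearMap.comp_apply, ← LinearMap.comp_apply, ← fm_comp, hps, fm_id]
      rfl
    · intro j _ hj
      rw [LinearMap.comp_apply, ← LinearMap.comp_apply, ← fm_comp, hps' _ _ hj.symm, fm_zero]
      rfl
    · simp
  · refine Eq.trans ?_ (fm_id E X)
    rw [← hsum, fm_sum]
    ext x
    simp [fm_comp]

theorem isFinModule {n : ℕ} {S : ZMod n → ModuleCat.{0} Λ} {l : PartitionTuple n}
    {X : ModuleCat.{0} Λ} (h : IsFinModule S l X) :
    IsFinModule (fun i => E.functor.obj (S i)) l (E.functor.obj X) := by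
  obtain ⟨N, hN, ⟨f⟩⟩ := h
  have := CycRing.finite_sigma_fin l
  have := Fintype.ofFinite (Σ p : ZMod n × ℕ+, Fin (l p))
  exact ⟨fun p => E.functor.obj (N p), fun p => isIndecomposableOf E (hN p),
    mapDirectSum E (fun a : Σ p : ZMod n × ℕ+, Fin (l p) => N a.1) f⟩

theorem isLattice {n : ℕ} [NeZero n] {S : ZMod n → ModuleCat.{0} Λ} {μ : ZMod n → ℕ}
    {X : ModuleCat.{0} Λ} (h : IsLattice S μ X) :
    IsLattice (fun i => E.functor.obj (S i)) μ (E.functor.obj X) := by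
  obtain ⟨N, hN, ⟨f⟩⟩ := h
  exact ⟨fun p => E.functor.obj (N p), fun p => isProjectiveCover E (hN p),
    mapDirectSum E (fun a : Σ p : ZMod n, Fin (μ p) => N a.1) f⟩

end Equivalence

/-- The Hall numbers of an order of type `Δ` are those of a ring with the structure `CycRing`. -/
theorem CyclicOrder.exists_cycRing {n : ℕ} [NeZero n] (O : CyclicOrder n)
    {S : ZMod n → ModuleCat.{0} O.Λ} (hS : IsCyclicLabelling S) :
    ∃ (A : Type) (_ : Ring A) (c : CycRing n A) (F : ModuleCat.{0} O.Λ → ModuleCat.{0} A),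
      c.q = O.q ∧ (∀ l X, IsFinModule S l X → c.HasType (typeOfPartition l) (F X)) ∧
        (∀ μ X, IsLattice S μ X → c.HasType (typeOfLattice μ) (F X)) ∧
        ∀ X Y Z, ((hallSet (F X) (F Y) (F Z)).Finite ↔ (hallSet X Y Z).Finite) ∧
          (hallSet (F X) (F Y) (F Z)).ncard = (hallSet X Y Z).ncard := by
  let _ := O.commRing
  have := O.isDomain
  have := O.isDVR
  let _ := O.divisionRing
  let _ := O.algebraR
  let _ := O.algebraK
  have := O.isScalarTower
  have := O.complete
  have := O.finite_residueField
  obtain ⟨ϖ, hϖ⟩ := O.isMaximalOrder.exists_uniformizer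
  obtain ⟨c, hc⟩ := hϖ.exists_cycRing n
  obtain ⟨E⟩ := O.morita.cond
  obtain ⟨c', hc', hS'⟩ := CycRing.IsCyclicLabelling.exists_cycRing c
    (Equivalence.isCyclicLabelling E.eqv hS)
  refine ⟨_, inferInstance, c', E.eqv.functor.obj, hc'.trans hc,
    fun l X h => CycRing.hasType_of_isFinModule hS' (Equivalence.isFinModule E.eqv h),
    fun l X h => CycRing.hasType_of_isLattice hS' (Equivalence.isLattice E.eqv h),
    fun X Y Z => ?_⟩
  rw [Equivalence.image_hallSet]
  exact ⟨Set.finite_image_iff (Equivalence.subIso E.eqv Y).injective.injOn,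
    Set.ncard_image_of_injective _ (Equivalence.subIso E.eqv Y).injective⟩

end IyamaHall
end

/-! ### Test orders and the existence and uniqueness of the polynomials -/

noncomputable section

namespace IyamaHall

section TestOrder

variable (p : ℕ) [Fact p.Prime]

/-- The power series ring over the field with `p` elements inside its fraction field. -/
abbrev testSubalgebra :
    Subalgebra (PowerSeries (ZMod p)) (FractionRing (PowerSeries (ZMod p))) := ⊥

/-- The test order is the power series ring. -/
def testEquiv : testSubalgebra p ≃ₐ[PowerSeries (ZMod p)] PowerSeries (ZMod p) :=
  Algebra.botEquivOfInjective (IsFractionRing.injective _ _)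

theorem isOrderIn_testSubalgebra : IsOrderIn (PowerSeries (ZMod p))
    (FractionRing (PowerSeries (ZMod p))) (testSubalgebra p) := by
  have e := (testEquiv p).symm.toLinearEquiv
  refine ⟨Module.Finite.equiv e, Module.Projective.of_equiv e, ?_⟩
  rw [eq_top_iff]
  intro x _
  have := Submodule.smul_mem (Submodule.span (FractionRing (PowerSeries (ZMod p)))
    (testSubalgebra p : Set (FractionRing (PowerSeries (ZMod p))))) x
    (Submodule.subset_span (testSubalgebra p).one_mem)
  rwa [smul_eq_mul, mul_one] at this

/-- The elements of an order are integral, and the power series ring is integrally closed. -/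
theorem isMaximalOrderIn_testSubalgebra : IsMaximalOrderIn (PowerSeries (ZMod p))
    (FractionRing (PowerSeries (ZMod p))) (testSubalgebra p) := by
  refine ⟨isOrderIn_testSubalgebra p, fun Ω' hΩ' _ => ?_⟩
  rw [eq_bot_iff]
  intro x hx
  have h1 := hΩ'.1
  have h2 : IsIntegral (PowerSeries (ZMod p)) (⟨x, hx⟩ : Ω') := Algebra.IsIntegral.isIntegral _
  have h3 : IsIntegral (PowerSeries (ZMod p)) x := h2.map Ω'.val
  obtain ⟨y, hy⟩ := IsIntegrallyClosed.isIntegral_iff.1 h3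
  exact Algebra.mem_bot.2 ⟨y, hy⟩

theorem card_test : Nat.card (testSubalgebra p ⧸ Ring.jacobson (testSubalgebra p)) = p := by
  let f : testSubalgebra p →+* ZMod p :=
    (PowerSeries.constantCoeff (R := ZMod p)).comp (testEquiv p : _ →+* PowerSeries (ZMod p))
  have hf : Function.Surjective f := by
    intro a
    exact ⟨(testEquiv p).symm (PowerSeries.C a), by simp [f]⟩
  have hloc : IsLocalRing (testSubalgebra p) :=
    (testEquiv p).symm.toRingEquiv.isLocalRing
  have hmax : (RingHom.ker f).IsMaximal := RingHom.ker_isMaximal_of_surjective f hf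
  have h1 : Ring.jacobson (testSubalgebra p) = RingHom.ker f := by
    rw [← Ideal.jacobson_bot, IsLocalRing.jacobson_eq_maximalIdeal _ bot_ne_top,
      IsLocalRing.eq_maximalIdeal hmax]
  rw [h1, Nat.card_congr (RingHom.quotientKerEquivOfSurjective hf).toEquiv, Nat.card_zmod]

/-- Scalar matrices make the triangular ring an algebra. -/
@[reducible]
def triangularAlgebra (n : ℕ) (R Ω : Type) [CommRing R] [Ring Ω] [Algebra R Ω] :
    Algebra R (triangularSubring n Ω) :=
  RingHom.toAlgebra'
    { toFun r := ⟨algebraMap R (Matrix (Fin n) (Fin n) Ω) r, fun i j hij => by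
        rw [Matrix.algebraMap_matrix_apply, if_neg hij.ne]
        exact Submodule.zero_mem _⟩
      map_one' := Subtype.ext (map_one _)
      map_mul' := fun x y => Subtype.ext (map_mul _ x y)
      map_zero' := Subtype.ext (map_zero _)
      map_add' := fun x y => Subtype.ext (map_add _ x y) }
    fun r x => Subtype.ext (Algebra.commutes r x.1)

section

attribute [local instance] triangularAlgebra

/-- The inclusion of the triangular ring into the matrix ring. -/
def triangularVal (n : ℕ) (R Ω : Type) [CommRing R] [Ring Ω] [Algebra R Ω] :
    triangularSubring n Ω →ₗ[R] Matrix (Fin n) (Fin n) Ω where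
  toFun x := x.1
  map_add' _ _ := rfl
  map_smul' r x := by
    rw [Algebra.smul_def, Algebra.smul_def]
    rfl

theorem finite_triangular (n : ℕ) (R Ω : Type) [CommRing R] [IsDomain R] [IsPrincipalIdealRing R]
    [Ring Ω] [Algebra R Ω] [Module.Finite R Ω] : Module.Finite R (triangularSubring n Ω) :=
  have : IsNoetherian R (Matrix (Fin n) (Fin n) Ω) :=
    inferInstanceAs (IsNoetherian R (Fin n → Fin n → Ω))
  Module.Finite.of_injective (triangularVal n R Ω) Subtype.val_injective

theorem projective_triangular (n : ℕ) (R Ω : Type) [CommRing R] [IsDomain R]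
    [IsPrincipalIdealRing R] [Ring Ω] [Algebra R Ω] [Module.Finite R Ω] [Module.Free R Ω] :
    Module.Projective R (triangularSubring n Ω) := by
  have := finite_triangular n R Ω
  have h : Module.Free R (Matrix (Fin n) (Fin n) Ω) := inferInstance
  have htf : Module.IsTorsionFree R (triangularSubring n Ω) :=
    (Subtype.val_injective (p := fun x => x ∈ triangularSubring n Ω)).moduleIsTorsionFree
      (triangularVal n R Ω) (map_smul (triangularVal n R Ω))
  infer_instance

end

/-- The order `T_n(𝔽_p[[t]])`. -/
def testOrder (n : ℕ) : CyclicOrder n where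
  R := PowerSeries (ZMod p)
  complete := by
    rw [PowerSeries.maximalIdeal_eq_span_X]
    infer_instance
  finite_residueField :=
    Finite.of_equiv (ZMod p) (PowerSeries.residueFieldOfPowerSeries (k := ZMod p)).symm.toEquiv
  Λ := triangularSubring n (testSubalgebra p)
  algebra := triangularAlgebra n (PowerSeries (ZMod p)) (testSubalgebra p)
  finite :=
    have := (isOrderIn_testSubalgebra p).1
    finite_triangular n _ _
  projective :=
    have := (isOrderIn_testSubalgebra p).1
    have := Module.Free.of_equiv (testEquiv p).symm.toLinearEquiv
    projective_triangular n _ _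
  D := FractionRing (PowerSeries (ZMod p))
  finiteDimensional := inferInstance
  Ω := testSubalgebra p
  isMaximalOrder := isMaximalOrderIn_testSubalgebra p
  morita := IsMoritaEquivalent.refl (R := ℤ) _

theorem testOrder_q (n : ℕ) : (testOrder p n).q = p := card_test p

theorem testOrder_exists_cycRing (n : ℕ) [NeZero n] : ∃ c : CycRing n (testOrder p n).Λ, c.q = p := by
  have h1 : Finite (IsLocalRing.ResidueField (PowerSeries (ZMod p))) :=
    (testOrder p n).finite_residueField
  have h2 : IsAdicComplete (IsLocalRing.maximalIdeal (PowerSeries (ZMod p)))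
      (PowerSeries (ZMod p)) := (testOrder p n).complete
  obtain ⟨ϖ, hϖ⟩ := (isMaximalOrderIn_testSubalgebra p).exists_uniformizer
  obtain ⟨c, hc⟩ := hϖ.exists_cycRing n
  exact ⟨c, hc.trans (card_test p)⟩

/-- The units of the field `ZMod p` act on modules through this structure; they are the torus used
for the values at `T = 1`. -/
theorem testOrder_nonempty_algebra (n : ℕ) : Nonempty (Algebra (ZMod p) (testOrder p n).Λ) :=
  let _ := triangularAlgebra n (PowerSeries (ZMod p)) (testSubalgebra p)
  ⟨Algebra.compHom (triangularSubring n (testSubalgebra p)) (PowerSeries.C (R := ZMod p))⟩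

end TestOrder

/-! ### Hall polynomials -/

variable {n : ℕ} [NeZero n]

theorem typeOfPartition_ne_zero (l : PartitionTuple n) : ∀ p ∈ typeOfPartition l, p.2 ≠ 0 := by
  intro p hp
  obtain ⟨a, -, rfl⟩ := Multiset.mem_map.1 hp
  change ((a.2 : ℕ) : ℕ∞) ≠ 0
  exact_mod_cast a.2.ne_zero

theorem typeOfPartition_finiteType (l : PartitionTuple n) :
    CycRing.FiniteType (typeOfPartition l) := by
  intro p hp
  obtain ⟨a, -, rfl⟩ := Multiset.mem_map.1 hp
  exact ENat.natCast_ne_top _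

theorem typeOfLattice_ne_zero (μ : ZMod n → ℕ) : ∀ p ∈ typeOfLattice μ, p.2 ≠ 0 := by
  intro p hp
  obtain ⟨a, -, rfl⟩ := Multiset.mem_map.1 hp
  exact ENat.top_ne_zero

theorem exists_isHallPolynomial (lam mu nu : PartitionTuple n) :
    ∃ P, IsHallPolynomial n lam mu nu P := by
  obtain ⟨P, hP⟩ := CycRing.isPolynomialHall (typeOfPartition_finiteType lam)
    (typeOfPartition_ne_zero lam) (typeOfPartition mu) (typeOfPartition nu)
  refine ⟨P, fun O S hS X Y Z hX hY hZ => ?_⟩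
  obtain ⟨A, _, c, F, hq, h1, h2, h3⟩ := O.exists_cycRing hS
  have h4 := hP A c _ (h1 _ _ hY)
  rw [← CycRing.hallSet_eq_hT (h1 _ _ hX) (h1 _ _ hZ), (h3 X Y Z).1, (h3 X Y Z).2, hq] at h4
  exact h4

theorem exists_isHallModulePolynomial {m : ℕ} (lam : PartitionTuple n) (mu nu : LatticeIndex n m) :
    ∃ P, IsHallModulePolynomial n m lam mu nu P := by
  obtain ⟨P, hP⟩ := CycRing.isPolynomialHall (typeOfPartition_finiteType lam)
    (typeOfPartition_ne_zero lam) (typeOfLattice mu.1) (typeOfLattice nu.1)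
  refine ⟨P, fun O S hS X Y Z hX hY hZ => ?_⟩
  obtain ⟨A, _, c, F, hq, h1, h2, h3⟩ := O.exists_cycRing hS
  have h4 := hP A c _ (h2 _ _ hY)
  rw [← CycRing.hallSet_eq_hT (h1 _ _ hX) (h2 _ _ hZ), (h3 X Y Z).1, (h3 X Y Z).2, hq] at h4
  exact h4

/-- Every prime is the value of `q` for a test order, and two polynomials agreeing at infinitely
many points are equal. -/
theorem eq_of_eval_prime {P Q : ℤ[X]}
    (h : ∀ p : ℕ, p.Prime → P.eval (p : ℤ) = Q.eval (p : ℤ)) : P = Q := by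
  refine Polynomial.eq_of_infinite_eval_eq P Q ?_
  refine Set.Infinite.mono ?_ (Nat.infinite_setOfPred_prime.image
    (Nat.cast_injective (R := ℤ)).injOn)
  rintro _ ⟨p, hp, rfl⟩
  exact h p hp

theorem eval_hall {p : ℕ} [Fact p.Prime] {lam mu nu : PartitionTuple n} {P : ℤ[X]}
    (hP : IsHallPolynomial n lam mu nu P) {c : CycRing n (testOrder p n).Λ}
    {Y : Type} [AddCommGroup Y] [Module (testOrder p n).Λ Y]
    (hY : c.HasType (typeOfPartition mu) Y) :
    P.eval (p : ℤ) = (c.hT (typeOfPartition lam) Y (typeOfPartition nu)).ncard := by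
  obtain ⟨X, hX⟩ := CycRing.exists_hasType (c := c) _ (typeOfPartition_ne_zero lam)
  obtain ⟨Z, hZ⟩ := CycRing.exists_hasType (c := c) _ (typeOfPartition_ne_zero nu)
  have hS : ∀ i : ZMod n, Nonempty ((ModuleCat.of (testOrder p n).Λ (c.C (i, 1))) ≃ₗ[
    (testOrder p n).Λ] c.C (i, 1)) := fun i => ⟨LinearEquiv.refl _ _⟩
  have h := hP (testOrder p n) _ (CycRing.isCyclicLabelling_C c) X (ModuleCat.of _ Y) Z
    (CycRing.isFinModule_of_hasType hS hX) (CycRing.isFinModule_of_hasType hS hY)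
    (CycRing.isFinModule_of_hasType hS hZ)
  rw [CycRing.hallSet_eq_hT hX hZ, testOrder_q] at h
  exact h.2.symm

theorem eval_hallModule {p m : ℕ} [Fact p.Prime] {lam : PartitionTuple n}
    {mu nu : LatticeIndex n m} {P : ℤ[X]}
    (hP : IsHallModulePolynomial n m lam mu nu P) {c : CycRing n (testOrder p n).Λ}
    {Y : Type} [AddCommGroup Y] [Module (testOrder p n).Λ Y]
    (hY : c.HasType (typeOfLattice mu.1) Y) :
    P.eval (p : ℤ) = (c.hT (typeOfPartition lam) Y (typeOfLattice nu.1)).ncard := by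
  obtain ⟨X, hX⟩ := CycRing.exists_hasType (c := c) _ (typeOfPartition_ne_zero lam)
  obtain ⟨Z, hZ⟩ := CycRing.exists_hasType (c := c) _ (typeOfLattice_ne_zero nu.1)
  have hS : ∀ i : ZMod n, Nonempty ((ModuleCat.of (testOrder p n).Λ (c.C (i, 1))) ≃ₗ[
    (testOrder p n).Λ] c.C (i, 1)) := fun i => ⟨LinearEquiv.refl _ _⟩
  have h := hP (testOrder p n) _ (CycRing.isCyclicLabelling_C c) X (ModuleCat.of _ Y) Z
    (CycRing.isFinModule_of_hasType hS hX) (CycRing.isLattice_of_hasType hS hY)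
    (CycRing.isLattice_of_hasType hS hZ)
  rw [CycRing.hallSet_eq_hT hX hZ, testOrder_q] at h
  exact h.2.symm

theorem existsUnique_isHallPolynomial (lam mu nu : PartitionTuple n) :
    ∃! P, IsHallPolynomial n lam mu nu P := by
  obtain ⟨P, hP⟩ := exists_isHallPolynomial lam mu nu
  refine ⟨P, hP, fun Q hQ => eq_of_eval_prime fun p hp => ?_⟩
  have := Fact.mk hp
  obtain ⟨c, -⟩ := testOrder_exists_cycRing p n
  obtain ⟨Y, hY⟩ := CycRing.exists_hasType (c := c) _ (typeOfPartition_ne_zero mu)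
  rw [eval_hall hP hY, eval_hall hQ hY]

theorem existsUnique_isHallModulePolynomial {m : ℕ} (lam : PartitionTuple n)
    (mu nu : LatticeIndex n m) : ∃! P, IsHallModulePolynomial n m lam mu nu P := by
  obtain ⟨P, hP⟩ := exists_isHallModulePolynomial lam mu nu
  refine ⟨P, hP, fun Q hQ => eq_of_eval_prime fun p hp => ?_⟩
  have := Fact.mk hp
  obtain ⟨c, -⟩ := testOrder_exists_cycRing p n
  obtain ⟨Y, hY⟩ := CycRing.exists_hasType (c := c) _ (typeOfLattice_ne_zero mu.1)
  rw [eval_hallModule hP hY, eval_hallModule hQ hY]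

theorem eval_hallPolynomial {p : ℕ} [Fact p.Prime] {lam mu nu : PartitionTuple n}
    {c : CycRing n (testOrder p n).Λ} {Y : Type} [AddCommGroup Y] [Module (testOrder p n).Λ Y]
    (hY : c.HasType (typeOfPartition mu) Y) : (hallPolynomial n lam mu nu).eval (p : ℤ) =
      (c.hT (typeOfPartition lam) Y (typeOfPartition nu)).ncard :=
  eval_hall (Classical.epsilon_spec (exists_isHallPolynomial lam mu nu)) hY

theorem eval_hallModulePolynomial {p m : ℕ} [Fact p.Prime] {lam : PartitionTuple n}
    {mu nu : LatticeIndex n m} {c : CycRing n (testOrder p n).Λ} {Y : Type} [AddCommGroup Y]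
    [Module (testOrder p n).Λ Y] (hY : c.HasType (typeOfLattice mu.1) Y) :
    (hallModulePolynomial n m lam mu nu).eval (p : ℤ) =
      (c.hT (typeOfPartition lam) Y (typeOfLattice nu.1)).ncard :=
  eval_hallModule (Classical.epsilon_spec (exists_isHallModulePolynomial lam mu nu)) hY

end IyamaHall
end

/-! ### Hall numbers: chains, torsion-free modules and unit laws -/

noncomputable section

namespace IyamaHall

namespace CycRing

variable {n : ℕ} [NeZero n] {A : Type} [Ring A] {c : CycRing n A}
variable {Y Z : Type} [AddCommGroup Y] [Module A Y] [AddCommGroup Z] [Module A Z]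
  {t s r s₁ s₂ : Multiset (ZMod n × ℕ∞)}

variable (c) in
/-- The number of submodules of type `t` with quotient of type `s` in a module of type `r`. -/
def hallNumber (s r t : Multiset (ZMod n × ℕ∞)) : ℕ := (c.hT s (c.Md r.toList) t).ncard

theorem hasType_Md_toList (hr : ∀ p ∈ r, p.2 ≠ 0) : c.HasType r (c.Md r.toList) := by
  have := c.hasType_Md r.toList (by rwa [Multiset.coe_toList])
  rwa [Multiset.coe_toList] at this

theorem HasType.ncard_hT (h : c.HasType r Y) : (c.hT s Y t).ncard = c.hallNumber s r t := by
  obtain ⟨f⟩ := (hasType_Md_toList (c := c) h.ne_zero).nonempty_equiv h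
  exact ncard_hT_congr f

/-- Counting chains in two ways. -/
theorem HasType.sum_hallNumber (h : c.HasType r Y) (h₁ : FiniteType s₁) (h₂ : FiniteType s₂)
    {S S' : Finset (Multiset (ZMod n × ℕ∞))}
    (hS : ∀ W : Submodule A Y, c.HasType s₁ (Y ⧸ W) → ∃ v ∈ S, c.HasType v W)
    (hS' : ∀ v, FiniteType v → (∀ p ∈ v, p.2 ≠ 0) → len v = len s₁ + len s₂ → v ∈ S')
    (hf : ∀ v ∈ S', FiniteType v) :
    ∑ v ∈ S, c.hallNumber s₁ r v * c.hallNumber s₂ v t =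
      ∑ v ∈ S', c.hallNumber s₁ v s₂ * c.hallNumber v r t := by
  have e1 := card_chains_left (c := c) (Y := Y) (s₁ := s₁) (s₂ := s₂) (t := t) (S := S)
    (f := fun v => c.hallNumber s₂ v t) hS (fun v _ => h.finite_hT h₁)
    (fun v _ W hW => ⟨hW.finite_hT h₂, hW.ncard_hT⟩)
  have e2 := card_chains_right (c := c) (Y := Y) (s₁ := s₁) (s₂ := s₂) (t := t) (S := S')
    (f := fun v => c.hallNumber s₁ v s₂)
    (fun L hL => by
      obtain ⟨v, h1, h3, h4⟩ := exists_hasType_extension h₁ h₂ hL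
      exact ⟨v, hS' v h1 h4.ne_zero h3, h4⟩)
    (fun v hv => h.finite_hT (hf v hv)) (fun v _ L hL => ⟨hL.finite_hT h₁, hL.ncard_hT⟩)
  simp_rw [h.ncard_hT] at e1 e2
  rw [← e1, e2]

/-- If `u` kills `y`, normality shows that it kills the submodule generated by `y`. A nonzero
submodule is again cyclic of infinite length, and `u` does not kill its generator. -/
theorem u_smul_C_top {p : ZMod n × ℕ∞} (hp : p.2 = ⊤) {y : c.C p} (h : c.u • y = 0) : y = 0 := by
  have h1 : ∀ x ∈ Submodule.span A {y}, c.u • x = 0 := by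
    intro x hx
    obtain ⟨a, rfl⟩ := Submodule.mem_span_singleton.1 hx
    obtain ⟨b, hb⟩ := c.left_normal a
    rw [smul_smul, hb, mul_smul, h, smul_zero]
  rcases c.submodule_C (Submodule.span A {y}) with h2 | ⟨m, h2⟩
  · rw [← Submodule.mem_bot A, ← h2]
    exact Submodule.mem_span_singleton_self y
  · exfalso
    rw [h2] at h1
    have h3 := h1 _ ((c.radEquiv p m).symm (c.gen _)).2
    have h4 : c.u • (c.radEquiv p m).symm (c.gen _) = 0 := Subtype.ext h3
    rw [← map_smul, LinearEquiv.map_eq_zero_iff] at h4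
    refine u_smul_gen_ne_zero ?_ h4
    change ((2 : ℕ) : ℕ∞) ≤ p.2 - m
    rw [hp, ENat.top_sub_natCast]
    exact le_top

theorem HasType.u_smul_injective (h : c.HasType r Y) (hr : ∀ p ∈ r, p.2 = ⊤) {y : Y}
    (hy : c.u • y = 0) : y = 0 := by
  induction r using Multiset.induction generalizing Y with
  | empty =>
    have := h.subsingleton
    exact Subsingleton.elim _ _
  | cons p r ih =>
    obtain ⟨Y', hY', ⟨f⟩⟩ := h.exists_cons
    have h1 : c.u • f y = 0 := by rw [← map_smul, hy, map_zero]
    rw [← f.map_eq_zero_iff]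
    exact Prod.ext (u_smul_C_top (hr p (Multiset.mem_cons_self _ _)) (congrArg Prod.fst h1))
      (ih hY' (fun p hp => hr p (Multiset.mem_cons_of_mem hp)) (congrArg Prod.snd h1))

/-- A submodule of finite index in a module whose type is torsion free has a torsion free type of
the same rank. -/
theorem HasType.exists_hasType_sub (h : c.HasType r Y) (hr : ∀ p ∈ r, p.2 = ⊤)
    (hs : FiniteType s) {W : Submodule A Y} (hW : c.HasType s (Y ⧸ W)) :
    ∃ v, (∀ p ∈ v, p.2 = ⊤) ∧ v.card = r.card ∧ c.HasType v W := by
  obtain ⟨N, hN⟩ := exists_bound hs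
  obtain ⟨S, hS⟩ := exists_types_of_submodules r N
  obtain ⟨v, -, hv⟩ := hS A c Y h W (radN_le_of_quotient (hW.pow_smul_eq_zero hN))
  have hinj : ∀ w : W, c.u • w = 0 → w = 0 := fun w hw =>
    Subtype.ext (h.u_smul_injective hr (congrArg Subtype.val hw))
  have hpow : ∀ (k : ℕ) (w : W), c.u ^ k • w = 0 → w = 0 := by
    intro k
    induction k with
    | zero => simp
    | succ k ih =>
      intro w hw
      rw [pow_succ', mul_smul] at hw
      exact ih w (hinj _ hw)
  refine ⟨v, fun p hp => ?_, ?_, hv⟩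
  -- The generator of a summand of finite length is killed by a power of `u`, whereas `u` is
  -- injective on `W`.
  · by_contra hne
    obtain ⟨Y', -, ⟨f⟩⟩ := HasType.exists_cons (p := p) (t := v.erase p)
      (by rwa [Multiset.cons_erase hp])
    have h1 := hpow p.2.toNat (f.symm (c.gen p, 0)) (by
      rw [← map_smul, Prod.smul_mk, smul_zero, c.pow_smul_gen_eq_zero
        (by rw [ENat.natCast_toNat hne])]
      exact map_zero _)
    rw [LinearEquiv.map_eq_zero_iff] at h1
    have h2 : c.gen p = 0 := congrArg Prod.fst h1
    exact gen_notMem_radN_one (c := c) (hv.ne_zero p hp)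
      (by rw [h2]; exact Submodule.zero_mem _)
  -- The rank is read off from the index of `u W` in `Y`, computed through `W` and through `u Y`.
  -- Because `u` is injective, the index of `u W` in `u Y` equals that of `W` in `Y`; cancelling it
  -- leaves the equality of the indices of `u W` in `W` and of `u Y` in `Y`, which are `q` to the
  -- ranks.
  · let f : Y →+ Y := DistribSMul.toAddMonoidHom Y c.u
    have hf : Function.Injective f := (injective_iff_map_eq_zero f).2 fun y hy =>
      h.u_smul_injective hr hy
    have htop : ∀ {X : Type} [AddCommGroup X] [Module A X] {t : Multiset (ZMod n × ℕ∞)},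
        c.HasType t X → (c.radN X 1).toAddSubgroup.index = c.q ^ t.card := by
      intro X _ _ t ht
      rw [← len_map_top, ← ht.top.card (semisimple_map_top t).finiteType]
      rfl
    have h1 : (c.radN Y 1).toAddSubgroup = AddSubgroup.map f ⊤ := by
      ext y
      simp only [Submodule.mem_toAddSubgroup, mem_radN, pow_one, AddSubgroup.mem_map]
      exact ⟨fun ⟨x, hx⟩ => ⟨x, trivial, hx.symm⟩, fun ⟨x, _, hx⟩ => ⟨x, hx.symm⟩⟩
    have h2 : (c.radN W 1).toAddSubgroup =
        (AddSubgroup.map f W.toAddSubgroup).addSubgroupOf W.toAddSubgroup := by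
      ext w
      simp only [Submodule.mem_toAddSubgroup, mem_radN, pow_one]
      exact ⟨fun ⟨x, hx⟩ => ⟨x, x.2, (congrArg Subtype.val hx).symm⟩,
        fun ⟨x, hx, hxw⟩ => ⟨⟨x, hx⟩, Subtype.ext hxw.symm⟩⟩
    have hfin := hW.finite hs
    have hidx : W.toAddSubgroup.index ≠ 0 := by
      have : Nat.card (Y ⧸ W) ≠ 0 := Nat.card_pos.ne'
      exact this
    have h3 := AddSubgroup.relIndex_map_map_of_injective W.toAddSubgroup ⊤ hf
    have h4 := AddSubgroup.relIndex_mul_index (H := AddSubgroup.map f W.toAddSubgroup)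
      (K := AddSubgroup.map f ⊤) (AddSubgroup.map_mono le_top)
    have h5 := AddSubgroup.relIndex_mul_index (H := AddSubgroup.map f W.toAddSubgroup)
      (K := W.toAddSubgroup) (by
        rintro _ ⟨w, hw, rfl⟩
        exact W.smul_mem c.u hw)
    rw [h3, AddSubgroup.relIndex_top_right, ← h5, ← h1, htop h, mul_comm] at h4
    have h6 : (AddSubgroup.map f W.toAddSubgroup).relIndex W.toAddSubgroup = c.q ^ v.card := by
      rw [← htop hv, h2]
      rfl
    rw [h6] at h4
    exact (Nat.pow_right_injective c.one_lt_q (mul_right_cancel₀ hidx h4)).symm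

theorem hallNumber_zero_left (hr : ∀ p ∈ r, p.2 ≠ 0) :
    c.hallNumber 0 r t = if r = t then 1 else 0 := by
  have h := hasType_Md_toList (c := c) hr
  have h1 : c.hT 0 (c.Md r.toList) t = if r = t then {⊤} else ∅ := by
    ext W
    constructor
    · rintro ⟨h1, h2⟩
      have := h2.subsingleton
      rw [Submodule.Quotient.subsingleton_iff] at this
      subst this
      rw [if_pos (h.unique (h1.congr Submodule.topEquiv))]
      rfl
    · split_ifs with hrt
      · rintro rfl
        subst hrt
        exact ⟨h.congr Submodule.topEquiv.symm, hasType_zero⟩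
      · exact False.elim
  rw [hallNumber, h1]
  split_ifs <;> simp

theorem hallNumber_zero_right (hr : ∀ p ∈ r, p.2 ≠ 0) :
    c.hallNumber s r 0 = if r = s then 1 else 0 := by
  have h := hasType_Md_toList (c := c) hr
  have h1 : c.hT s (c.Md r.toList) 0 = if r = s then {⊥} else ∅ := by
    ext W
    constructor
    · rintro ⟨h1, h2⟩
      have := h1.subsingleton
      rw [Submodule.subsingleton_iff_eq_bot] at this
      subst this
      rw [if_pos (h.unique (h2.congr (Submodule.quotEquivOfEqBot _ rfl)))]
      rfl
    · split_ifs with hrs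
      · rintro rfl
        subst hrs
        exact ⟨hasType_zero, h.congr (Submodule.quotEquivOfEqBot _ rfl).symm⟩
      · exact False.elim
  rw [hallNumber, h1]
  split_ifs <;> simp

theorem len_eq_of_hallNumber_ne_zero (hs : FiniteType s) (ht : FiniteType t)
    (hr : ∀ p ∈ r, p.2 ≠ 0) (h : c.hallNumber s r t ≠ 0) : len r = len s + len t := by
  have h1 : (c.hT s (c.Md r.toList) t).Nonempty := by
    rw [Set.nonempty_iff_ne_empty]
    intro h2
    rw [hallNumber, h2, Set.ncard_empty] at h
    exact h rfl
  obtain ⟨v, -, h2, h3⟩ := exists_hasType_extension hs ht h1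
  rw [(hasType_Md_toList (c := c) hr).unique h3, h2]

end CycRing

/-! ### Identities between the structure polynomials -/

open CycRing

variable {n : ℕ} [NeZero n]

theorem typeOfPartition_injective : Function.Injective (typeOfPartition (n := n)) := by
  intro l l' h
  have h1 : Function.Injective fun p : ZMod n × ℕ+ => (p.1, ((p.2 : ℕ) : ℕ∞)) := by
    rintro ⟨i, j⟩ ⟨i', j'⟩ h
    simp only [Prod.mk.injEq, Nat.cast_inj] at h
    exact Prod.ext h.1 (PNat.coe_injective h.2)
  exact Multiset.toFinsupp.symm.injective (Multiset.map_injective h1 h)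

theorem exists_typeOfPartition {v : Multiset (ZMod n × ℕ∞)} (h : FiniteType v)
    (h0 : ∀ p ∈ v, p.2 ≠ 0) : ∃ l, typeOfPartition l = v := by
  refine ⟨Multiset.toFinsupp (v.map fun p => (p.1, p.2.toNat.toPNat')), ?_⟩
  rw [typeOfPartition, Multiset.toFinsupp_toMultiset, Multiset.map_map]
  conv_rhs => rw [← Multiset.map_id v]
  refine Multiset.map_congr rfl fun p hp => Prod.ext rfl ?_
  change ((p.2.toNat.toPNat' : ℕ) : ℕ∞) = p.2
  have h1 : 0 < p.2.toNat := by
    rw [Nat.pos_iff_ne_zero, Ne, ENat.toNat_eq_zero]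
    exact fun h' => h'.elim (h0 p hp) (h p hp)
  rw [Nat.toPNat'_coe, if_pos h1, ENat.natCast_toNat (h p hp)]

theorem typeOfLattice_injective : Function.Injective (typeOfLattice (n := n)) := by
  intro l l' h
  have h1 : Function.Injective fun i : ZMod n => (i, (⊤ : ℕ∞)) := fun i j h => congrArg Prod.fst h
  exact Finsupp.equivFunOnFinite.symm.injective
    (Multiset.toFinsupp.symm.injective (Multiset.map_injective h1 h))

theorem exists_typeOfLattice {v : Multiset (ZMod n × ℕ∞)} (h : ∀ p ∈ v, p.2 = ⊤) :
    ∃ μ : LatticeIndex n v.card, typeOfLattice μ.1 = v := by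
  have h1 : typeOfLattice (Finsupp.equivFunOnFinite (Multiset.toFinsupp (v.map Prod.fst))) = v := by
    rw [typeOfLattice, Equiv.symm_apply_apply, Multiset.toFinsupp_toMultiset, Multiset.map_map]
    conv_rhs => rw [← Multiset.map_id v]
    exact Multiset.map_congr rfl fun p hp => Prod.ext rfl (h p hp).symm
  refine ⟨⟨_, ?_⟩, h1⟩
  have := congrArg Multiset.card h1
  rw [typeOfLattice, Equiv.symm_apply_apply, Multiset.card_map, Finsupp.card_toMultiset,
    Finsupp.sum_fintype _ _ fun _ => rfl] at this
  exact this

theorem card_typeOfLattice {m : ℕ} (μ : LatticeIndex n m) : (typeOfLattice μ.1).card = m := by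
  rw [typeOfLattice, Multiset.card_map, Finsupp.card_toMultiset,
    Finsupp.sum_fintype _ _ fun _ => rfl]
  exact μ.2

theorem typeOfLattice_eq_top (μ : ZMod n → ℕ) : ∀ p ∈ typeOfLattice μ, p.2 = ⊤ := by
  intro p hp
  obtain ⟨a, -, rfl⟩ := Multiset.mem_map.1 hp
  rfl

/-- The finite set of tuples of partitions of given total size. -/
def partsOfLen (n : ℕ) [NeZero n] (L : ℕ) : Finset (PartitionTuple n) :=
  ((finite_typesOfLen (n := n) L).preimage typeOfPartition_injective.injOn).toFinset

theorem mem_partsOfLen {L : ℕ} {l : PartitionTuple n} :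
    l ∈ partsOfLen n L ↔ len (typeOfPartition l) = L := by
  rw [partsOfLen, Set.Finite.mem_toFinset]
  exact ⟨fun h => h.2.2, fun h => ⟨typeOfPartition_finiteType l, typeOfPartition_ne_zero l, h⟩⟩

section Eval

variable {p : ℕ} [Fact p.Prime] (c : CycRing n (testOrder p n).Λ)

theorem eval_hallPolynomial_eq (lam mu nu : PartitionTuple n) :
    (hallPolynomial n lam mu nu).eval (p : ℤ) =
      c.hallNumber (typeOfPartition lam) (typeOfPartition mu) (typeOfPartition nu) :=
  eval_hallPolynomial (hasType_Md_toList (typeOfPartition_ne_zero mu))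

theorem eval_hallModulePolynomial_eq {m : ℕ} (lam : PartitionTuple n) (mu nu : LatticeIndex n m) :
    (hallModulePolynomial n m lam mu nu).eval (p : ℤ) =
      c.hallNumber (typeOfPartition lam) (typeOfLattice mu.1) (typeOfLattice nu.1) :=
  eval_hallModulePolynomial (hasType_Md_toList (typeOfLattice_ne_zero mu.1))

end Eval

theorem hallPolynomial_eq_zero {lam mu nu : PartitionTuple n} (h : len (typeOfPartition mu) ≠
    len (typeOfPartition lam) + len (typeOfPartition nu)) : hallPolynomial n lam mu nu = 0 := by
  refine eq_of_eval_prime fun p hp => ?_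
  have := Fact.mk hp
  obtain ⟨c, -⟩ := testOrder_exists_cycRing p n
  rw [eval_hallPolynomial_eq c, eval_zero, Nat.cast_eq_zero]
  by_contra hne
  exact h (len_eq_of_hallNumber_ne_zero (typeOfPartition_finiteType _)
    (typeOfPartition_finiteType _) (typeOfPartition_ne_zero _) hne)

theorem finite_hallPolynomial (lam nu : PartitionTuple n) :
    {mu | hallPolynomial n lam mu nu ≠ 0}.Finite := by
  refine (partsOfLen n (len (typeOfPartition lam) + len (typeOfPartition nu))).finite_toSet.subset
    fun mu hmu => ?_
  rw [SetLike.mem_coe, mem_partsOfLen]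
  by_contra h
  exact hmu (hallPolynomial_eq_zero h)

theorem hallPolynomial_zero_left (mu nu : PartitionTuple n) :
    hallPolynomial n 0 mu nu = if mu = nu then 1 else 0 := by
  refine eq_of_eval_prime fun p hp => ?_
  have := Fact.mk hp
  obtain ⟨c, -⟩ := testOrder_exists_cycRing p n
  have h0 : typeOfPartition (0 : PartitionTuple n) = 0 := by simp [typeOfPartition]
  rw [eval_hallPolynomial_eq c, h0, hallNumber_zero_left (typeOfPartition_ne_zero mu)]
  simp only [typeOfPartition_injective.eq_iff]
  split_ifs <;> simp

theorem hallPolynomial_zero_right (lam mu : PartitionTuple n) :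
    hallPolynomial n lam mu 0 = if mu = lam then 1 else 0 := by
  refine eq_of_eval_prime fun p hp => ?_
  have := Fact.mk hp
  obtain ⟨c, -⟩ := testOrder_exists_cycRing p n
  have h0 : typeOfPartition (0 : PartitionTuple n) = 0 := by simp [typeOfPartition]
  rw [eval_hallPolynomial_eq c, h0, hallNumber_zero_right (typeOfPartition_ne_zero mu)]
  simp only [typeOfPartition_injective.eq_iff]
  split_ifs <;> simp

theorem hallModulePolynomial_zero_left {m : ℕ} (mu nu : LatticeIndex n m) :
    hallModulePolynomial n m 0 mu nu = if mu = nu then 1 else 0 := by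
  refine eq_of_eval_prime fun p hp => ?_
  have := Fact.mk hp
  obtain ⟨c, -⟩ := testOrder_exists_cycRing p n
  have h0 : typeOfPartition (0 : PartitionTuple n) = 0 := by simp [typeOfPartition]
  rw [eval_hallModulePolynomial_eq c, h0, hallNumber_zero_left (typeOfLattice_ne_zero mu.1)]
  simp only [typeOfLattice_injective.eq_iff, Subtype.val_injective.eq_iff]
  split_ifs <;> simp

theorem typeOfPartition_mem_image {L : ℕ} (v : Multiset (ZMod n × ℕ∞)) (hv : FiniteType v)
    (h0 : ∀ p ∈ v, p.2 ≠ 0) (h : len v = L) :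
    v ∈ (partsOfLen n L).map ⟨typeOfPartition, typeOfPartition_injective⟩ := by
  obtain ⟨l, rfl⟩ := exists_typeOfPartition hv h0
  exact Finset.mem_map.2 ⟨l, mem_partsOfLen.2 h, rfl⟩

/-- At every prime both sides count the chains in `M(ρ)` with subquotients `M(x)`, `M(y)`, `M(z)`.
-/
theorem sum_hallPolynomial (x y z rho : PartitionTuple n) :
    ∑ mu ∈ partsOfLen n (len (typeOfPartition x) + len (typeOfPartition y)),
        hallPolynomial n x mu y * hallPolynomial n mu rho z =
      ∑ tau ∈ partsOfLen n (len (typeOfPartition y) + len (typeOfPartition z)),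
        hallPolynomial n x rho tau * hallPolynomial n y tau z := by
  classical
  refine eq_of_eval_prime fun p hp => ?_
  have := Fact.mk hp
  obtain ⟨c, -⟩ := testOrder_exists_cycRing p n
  -- A submodule with quotient of type `x` has length `L`. The double count needs all such types in
  -- the index set, and the additional terms vanish because lengths are additive.
  let L := len (typeOfPartition rho) - len (typeOfPartition x)
  have h1 : ∑ tau ∈ partsOfLen n (len (typeOfPartition y) + len (typeOfPartition z)),
        hallPolynomial n x rho tau * hallPolynomial n y tau z =
      ∑ tau ∈ partsOfLen n L ∪ partsOfLen n (len (typeOfPartition y) + len (typeOfPartition z)),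
        hallPolynomial n x rho tau * hallPolynomial n y tau z := by
    refine Finset.sum_subset Finset.subset_union_right fun tau _ htau => ?_
    rw [mem_partsOfLen] at htau
    rw [hallPolynomial_eq_zero htau, mul_zero]
  rw [h1, eval_finsetSum, eval_finsetSum]
  simp_rw [eval_mul, eval_hallPolynomial_eq c]
  have hY := hasType_Md_toList (c := c) (typeOfPartition_ne_zero rho)
  have h2 := hY.sum_hallNumber (t := typeOfPartition z)
    (S := (partsOfLen n L ∪ partsOfLen n (len (typeOfPartition y) + len (typeOfPartition z))).map
      ⟨typeOfPartition, typeOfPartition_injective⟩) (typeOfPartition_finiteType x)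
    (typeOfPartition_finiteType y) (fun W hW => by
      have hf := hY.finite (typeOfPartition_finiteType rho)
      obtain ⟨N, hN⟩ := exists_bound (typeOfPartition_finiteType rho)
      obtain ⟨v, hv, hWv⟩ := exists_hasType_of_finite (c := c) (Y := W) (N := N) fun w =>
        Subtype.ext (hY.pow_smul_eq_zero hN w.1)
      have h3 := Submodule.card_eq_card_quotient_mul_card W
      rw [hY.card (typeOfPartition_finiteType rho), hWv.card hv,
        hW.card (typeOfPartition_finiteType x), ← pow_add] at h3
      have h4 := Nat.pow_right_injective c.one_lt_q h3
      have h5 := typeOfPartition_mem_image (L := L) v hv hWv.ne_zero (by simp only [L]; omega)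
      rw [Finset.map_union]
      exact ⟨v, Finset.mem_union_left _ h5, hWv⟩)
    (fun v h3 h4 h5 => typeOfPartition_mem_image v h3 h4 h5) (fun v hv => by
      obtain ⟨l, -, rfl⟩ := Finset.mem_map.1 hv
      exact typeOfPartition_finiteType l)
  rw [Finset.sum_map, Finset.sum_map] at h2
  exact_mod_cast h2.symm

instance fintypeLatticeIndex (n m : ℕ) [NeZero n] : Fintype (LatticeIndex n m) :=
  Fintype.subtype (Finset.piAntidiag Finset.univ m) fun f => by
    simp [Finset.mem_piAntidiag]

/-- The same count inside a lattice. A submodule of finite index is again a lattice of rank `m` by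
`HasType.exists_hasType_sub`, so the middle index runs over all of `LatticeIndex n m`. -/
theorem sum_hallModulePolynomial {m : ℕ} (x y : PartitionTuple n) (z rho : LatticeIndex n m) :
    ∑ mu ∈ partsOfLen n (len (typeOfPartition x) + len (typeOfPartition y)),
        hallPolynomial n x mu y * hallModulePolynomial n m mu rho z =
      ∑ tau, hallModulePolynomial n m x rho tau * hallModulePolynomial n m y tau z := by
  classical
  refine eq_of_eval_prime fun p hp => ?_
  have := Fact.mk hp
  obtain ⟨c, -⟩ := testOrder_exists_cycRing p n
  rw [eval_finsetSum, eval_finsetSum]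
  simp_rw [eval_mul, eval_hallPolynomial_eq c, eval_hallModulePolynomial_eq c]
  have hY := hasType_Md_toList (c := c) (typeOfLattice_ne_zero rho.1)
  have hinj : Function.Injective fun tau : LatticeIndex n m => typeOfLattice tau.1 :=
    typeOfLattice_injective.comp Subtype.val_injective
  have h2 := hY.sum_hallNumber (t := typeOfLattice z.1)
    (S := Finset.univ.map ⟨_, hinj⟩) (typeOfPartition_finiteType x)
    (typeOfPartition_finiteType y) (fun W hW => by
      obtain ⟨v, h3, h4, h5⟩ := hY.exists_hasType_sub (typeOfLattice_eq_top rho.1)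
        (typeOfPartition_finiteType x) hW
      rw [card_typeOfLattice] at h4
      subst h4
      obtain ⟨μ, hμ⟩ := exists_typeOfLattice h3
      exact ⟨v, Finset.mem_map.2 ⟨μ, Finset.mem_univ _, hμ⟩, h5⟩)
    (fun v h3 h4 h5 => typeOfPartition_mem_image v h3 h4 h5) (fun v hv => by
      obtain ⟨l, -, rfl⟩ := Finset.mem_map.1 hv
      exact typeOfPartition_finiteType l)
  rw [Finset.sum_map, Finset.sum_map] at h2
  exact_mod_cast h2.symm

end IyamaHall
end

/-! ### Associativity, unit and module laws of the generic Hall algebra -/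

noncomputable section

namespace IyamaHall

open CycRing

variable {n : ℕ} [NeZero n]

theorem GenericHallAlgebra.induction_on {P : GenericHallAlgebra n → Prop} (x : GenericHallAlgebra n)
    (add : ∀ x y, P x → P y → P (x + y)) (smul : ∀ (a : ℤ[X]) x, P x → P (a • x))
    (basis : ∀ lam, P (GenericHallAlgebra.u lam)) : P x := by
  refine Finsupp.induction_linear (motive := P) x ?_ add fun lam a => ?_
  · have := smul 0 _ (basis 0)
    rwa [zero_smul] at this
  · have h1 : (Finsupp.single lam a : PartitionTuple n →₀ ℤ[X]) = a • Finsupp.single lam 1 := by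
      rw [Finsupp.smul_single, smul_eq_mul, mul_one]
    have h2 := smul a _ (basis lam)
    rw [GenericHallAlgebra.u] at h2
    rw [h1]
    exact h2

theorem GenericHallModule.induction_on {m : ℕ} {P : GenericHallModule n m → Prop}
    (x : GenericHallModule n m)
    (zero : P 0) (add : ∀ x y, P x → P y → P (x + y)) (smul : ∀ (a : ℤ[X]) x, P x → P (a • x))
    (basis : ∀ mu, P (GenericHallModule.u mu)) : P x := by
  refine Finsupp.induction_linear (motive := P) x zero add fun lam a => ?_
  have h1 : (Finsupp.single lam a : LatticeIndex n m →₀ ℤ[X]) = a • Finsupp.single lam 1 := by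
    rw [Finsupp.smul_single, smul_eq_mul, mul_one]
  have h2 := smul a _ (basis lam)
  rw [GenericHallModule.u] at h2
  rw [h1]
  exact h2

theorem genericMul_u_eq_sum (lam nu : PartitionTuple n) :
    genericMul n (GenericHallAlgebra.u lam) (GenericHallAlgebra.u nu) =
      ∑ mu ∈ partsOfLen n (len (typeOfPartition lam) + len (typeOfPartition nu)),
        hallPolynomial n lam mu nu • GenericHallAlgebra.u mu := by
  rw [genericMul_u]
  refine finsum_eq_sum_of_support_subset _ fun mu hmu => ?_
  rw [SetLike.mem_coe, mem_partsOfLen]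
  by_contra h
  exact hmu (by simp only [hallPolynomial_eq_zero h, zero_smul])

theorem genericAct_u_eq_sum {m : ℕ} (lam : PartitionTuple n) (nu : LatticeIndex n m) :
    genericAct n m (GenericHallAlgebra.u lam) (GenericHallModule.u nu) =
      ∑ mu, hallModulePolynomial n m lam mu nu • GenericHallModule.u mu := by
  rw [genericAct_u, finsum_eq_sum_of_fintype]

theorem len_typeOfPartition_zero : len (typeOfPartition (0 : PartitionTuple n)) = 0 := by
  simp [typeOfPartition, len]

theorem genericMul_assoc (x y z : GenericHallAlgebra n) :
    genericMul n (genericMul n x y) z = genericMul n x (genericMul n y z) := by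
  induction x using GenericHallAlgebra.induction_on with
  | add _ _ h1 h2 => simp only [map_add, LinearMap.add_apply, h1, h2]
  | smul _ _ h => simp only [map_smul, LinearMap.smul_apply, h]
  | basis x =>
    induction y using GenericHallAlgebra.induction_on with
    | add _ _ h1 h2 => simp only [map_add, LinearMap.add_apply, h1, h2]
    | smul _ _ h => simp only [map_smul, LinearMap.smul_apply, h]
    | basis y =>
      induction z using GenericHallAlgebra.induction_on with
      | add _ _ h1 h2 => simp only [map_add, h1, h2]
      | smul _ _ h => simp only [map_smul, h]
      | basis z =>
        let L := len (typeOfPartition x) + len (typeOfPartition y) + len (typeOfPartition z)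
        have h1 : genericMul n (genericMul n (.u x) (.u y)) (.u z) = ∑ rho ∈ partsOfLen n L,
            (∑ mu ∈ partsOfLen n (len (typeOfPartition x) + len (typeOfPartition y)),
              hallPolynomial n x mu y * hallPolynomial n mu rho z) • GenericHallAlgebra.u rho := by
          simp_rw [genericMul_u_eq_sum x y, map_sum, LinearMap.sum_apply, map_smul, LinearMap.smul_apply,
            genericMul_u_eq_sum, Finset.sum_smul, mul_smul]
          rw [Finset.sum_comm]
          refine Finset.sum_congr rfl fun mu hmu => ?_
          rw [mem_partsOfLen] at hmu
          rw [Finset.smul_sum, hmu]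
        have h2 : genericMul n (.u x) (genericMul n (.u y) (.u z)) = ∑ rho ∈ partsOfLen n L,
            (∑ tau ∈ partsOfLen n (len (typeOfPartition y) + len (typeOfPartition z)),
              hallPolynomial n x rho tau * hallPolynomial n y tau z) • GenericHallAlgebra.u rho := by
          simp_rw [genericMul_u_eq_sum y z, map_sum, map_smul,
            genericMul_u_eq_sum, Finset.sum_smul]
          rw [Finset.sum_comm]
          refine Finset.sum_congr rfl fun mu hmu => ?_
          rw [mem_partsOfLen] at hmu
          rw [Finset.smul_sum, hmu, ← add_assoc]
          refine Finset.sum_congr rfl fun _ _ => ?_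
          rw [smul_smul, mul_comm]
        rw [h1, h2]
        exact Finset.sum_congr rfl fun rho _ => by rw [sum_hallPolynomial]

theorem genericMul_zero_left (x : GenericHallAlgebra n) :
    genericMul n (GenericHallAlgebra.u 0) x = x := by
  classical
  induction x using GenericHallAlgebra.induction_on with
  | add _ _ h1 h2 => simp only [map_add, h1, h2]
  | smul _ _ h => simp only [map_smul, h]
  | basis x =>
    rw [genericMul_u_eq_sum]
    simp_rw [hallPolynomial_zero_left, ite_smul, one_smul, zero_smul]
    rw [Finset.sum_ite_eq' _ x, if_pos]
    rw [mem_partsOfLen, len_typeOfPartition_zero, zero_add]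

theorem genericMul_zero_right (x : GenericHallAlgebra n) :
    genericMul n x (GenericHallAlgebra.u 0) = x := by
  classical
  induction x using GenericHallAlgebra.induction_on with
  | add _ _ h1 h2 => simp only [map_add, LinearMap.add_apply, h1, h2]
  | smul _ _ h => simp only [map_smul, LinearMap.smul_apply, h]
  | basis x =>
    rw [genericMul_u_eq_sum]
    simp_rw [hallPolynomial_zero_right, ite_smul, one_smul, zero_smul]
    rw [Finset.sum_ite_eq' _ x, if_pos]
    rw [mem_partsOfLen, len_typeOfPartition_zero, add_zero]

theorem genericAct_zero {m : ℕ} (v : GenericHallModule n m) :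
    genericAct n m (GenericHallAlgebra.u 0) v = v := by
  classical
  induction v using GenericHallModule.induction_on with
  | zero => simp only [map_zero]
  | add _ _ h1 h2 => simp only [map_add, h1, h2]
  | smul _ _ h => simp only [map_smul, h]
  | basis x =>
    rw [genericAct_u_eq_sum]
    simp_rw [hallModulePolynomial_zero_left, ite_smul, one_smul, zero_smul]
    rw [Finset.sum_ite_eq' _ x, if_pos (Finset.mem_univ _)]

theorem genericAct_genericMul {m : ℕ} (x y : GenericHallAlgebra n) (v : GenericHallModule n m) :
    genericAct n m (genericMul n x y) v = genericAct n m x (genericAct n m y v) := by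
  induction x using GenericHallAlgebra.induction_on with
  | add _ _ h1 h2 => simp only [map_add, LinearMap.add_apply, h1, h2]
  | smul _ _ h => simp only [map_smul, LinearMap.smul_apply, h]
  | basis x =>
    induction y using GenericHallAlgebra.induction_on with
    | add _ _ h1 h2 => simp only [map_add, LinearMap.add_apply, h1, h2]
    | smul _ _ h => simp only [map_smul, LinearMap.smul_apply, h]
    | basis y =>
      induction v using GenericHallModule.induction_on with
      | zero => simp only [map_zero]
      | add _ _ h1 h2 => simp only [map_add, h1, h2]
      | smul _ _ h => simp only [map_smul, h]
      | basis z =>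
        have h1 : genericAct n m (genericMul n (.u x) (.u y)) (.u z) = ∑ rho,
            (∑ mu ∈ partsOfLen n (len (typeOfPartition x) + len (typeOfPartition y)),
              hallPolynomial n x mu y * hallModulePolynomial n m mu rho z) •
                GenericHallModule.u rho := by
          simp_rw [genericMul_u_eq_sum x y, map_sum, LinearMap.sum_apply, map_smul, LinearMap.smul_apply,
            genericAct_u_eq_sum, Finset.sum_smul, mul_smul]
          rw [Finset.sum_comm]
          refine Finset.sum_congr rfl fun mu hmu => ?_
          rw [Finset.smul_sum]
        have h2 : genericAct n m (.u x) (genericAct n m (.u y) (.u z)) = ∑ rho,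
            (∑ tau, hallModulePolynomial n m x rho tau * hallModulePolynomial n m y tau z) •
              GenericHallModule.u rho := by
          simp_rw [genericAct_u_eq_sum y z, map_sum, map_smul,
            genericAct_u_eq_sum, Finset.sum_smul]
          rw [Finset.sum_comm]
          refine Finset.sum_congr rfl fun mu hmu => ?_
          rw [Finset.smul_sum]
          refine Finset.sum_congr rfl fun _ _ => ?_
          rw [smul_smul, mul_comm]
        rw [h1, h2]
        exact Finset.sum_congr rfl fun rho _ => by rw [sum_hallModulePolynomial]

end IyamaHall
end

/-! ### Hall numbers modulo the order of a torus -/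

noncomputable section

namespace IyamaHall

/-- A finite invariant set on which a group acts freely has cardinality divisible by the order of
the group. -/
theorem card_dvd_ncard_of_free {G X : Type} [Group G] [MulAction G X] (S : Set X)
    (hS : ∀ g : G, ∀ x ∈ S, g • x ∈ S) (hfree : ∀ x ∈ S, ∀ g : G, g • x = x → g = 1) :
    Nat.card G ∣ S.ncard := by
  let X' : SubMulAction G X := ⟨S, fun g {x} hx => hS g x hx⟩
  have h : ∀ b : X', MulAction.stabilizer G b = ⊥ := by
    intro b
    rw [eq_bot_iff]
    intro g hg
    exact Subgroup.mem_bot.2 (hfree b.1 b.2 g (congrArg Subtype.val (MulAction.mem_stabilizer_iff.1 hg)))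
  have h1 := Nat.card_congr (MulAction.selfEquivOrbitsQuotientProd h)
  rw [Nat.card_prod] at h1
  exact ⟨_, (h1.trans (mul_comm _ _))⟩

namespace CycRing

variable {n : ℕ} [NeZero n] {A : Type} [Ring A] {c : CycRing n A}
variable {Y Z : Type} [AddCommGroup Y] [Module A Y] [AddCommGroup Z] [Module A Z]
  {t s r : Multiset (ZMod n × ℕ∞)}

section Torus

variable {k : Type} [Field k] [Algebra k A]

variable (A Y Z) in
/-- Multiplication of the first factor by a scalar. -/
def scaleFst (ζ : k) : Y × Z →ₗ[A] Y × Z where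
  toFun x := (algebraMap k A ζ • x.1, x.2)
  map_add' x y := by simp
  map_smul' a x := by simp [smul_smul, Algebra.commutes]

theorem scaleFst_scaleFst (ζ ξ : k) (x : Y × Z) :
    scaleFst A Y Z ζ (scaleFst A Y Z ξ x) = scaleFst A Y Z (ζ * ξ) x := by
  simp [scaleFst, smul_smul]

theorem scaleFst_one (x : Y × Z) : scaleFst A Y Z (1 : k) x = x := by simp [scaleFst]

variable (A Y Z k) in
/-- The action of the torus on submodules of a product by multiplication of the first factor. -/
@[reducible] def torusAction : MulAction kˣ (Submodule A (Y × Z)) where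
  smul ζ W := W.comap (scaleFst A Y Z ((ζ⁻¹ : kˣ) : k))
  one_smul W := by
    ext x
    change scaleFst A Y Z (((1 : kˣ)⁻¹ : kˣ) : k) x ∈ W ↔ x ∈ W
    rw [inv_one, Units.val_one, scaleFst_one]
  mul_smul ζ ξ W := by
    ext x
    change scaleFst A Y Z (((ζ * ξ)⁻¹ : kˣ) : k) x ∈ W ↔
      scaleFst A Y Z ((ξ⁻¹ : kˣ) : k) (scaleFst A Y Z ((ζ⁻¹ : kˣ) : k) x) ∈ W
    rw [scaleFst_scaleFst, mul_inv_rev, Units.val_mul]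

variable (A Y Z) in
/-- Multiplication of the first factor by an invertible scalar. -/
def scaleEquiv (ζ : kˣ) : (Y × Z) ≃ₗ[A] Y × Z :=
  LinearEquiv.ofLinearMap (scaleFst A Y Z (ζ : k)) (scaleFst A Y Z ((ζ⁻¹ : kˣ) : k))
    (LinearMap.ext fun x => by simp [scaleFst_scaleFst, scaleFst_one])
    (LinearMap.ext fun x => by simp [scaleFst_scaleFst, scaleFst_one])

/-- The number of submodules of a product which are not products of submodules is divisible by the
order of the torus. -/
theorem card_dvd_ncard_diff (S : Set (Submodule A (Y × Z)))
    (hS : ∀ (f : (Y × Z) ≃ₗ[A] Y × Z), ∀ W ∈ S, W.map (f : Y × Z →ₗ[A] Y × Z) ∈ S) :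
    Nat.card kˣ ∣ (S \ {W | ∃ W₁ W₂, W = Submodule.prod W₁ W₂}).ncard := by
  let _ := torusAction A Y Z k
  have key : ∀ (ζ : kˣ) (W : Submodule A (Y × Z)), ζ • W = W.map (scaleEquiv A Y Z ζ : _ →ₗ[A] _) := by
    intro ζ W
    rw [Submodule.map_equiv_eq_comap_symm]
    rfl
  refine card_dvd_ncard_of_free _ (fun ζ W hW => ⟨?_, ?_⟩) fun W hW ζ hζ => ?_
  · rw [key]
    exact hS _ _ hW.1
  -- Scaling a product submodule gives the same product, so it cannot lead out of the complement of
  -- the products.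
  · rintro ⟨W₁, W₂, h⟩
    refine hW.2 ⟨W₁, W₂, ?_⟩
    rw [← inv_smul_smul ζ W, h]
    ext x
    change algebraMap k A _ • x.1 ∈ W₁ ∧ _ ↔ _
    rw [Submodule.mem_prod]
    refine and_congr_left fun _ => ⟨fun h1 => ?_, fun h1 => W₁.smul_mem _ h1⟩
    have := W₁.smul_mem (algebraMap k A (ζ⁻¹ : kˣ)) h1
    rwa [smul_smul, ← map_mul, ← Units.val_mul, mul_inv_cancel, Units.val_one, map_one,
      one_smul] at this
  -- If `ζ ≠ 1` fixes `W`, then subtracting `x` from its scaled version leaves `(ζ⁻¹ - 1)` times the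
  -- first component. Division by this scalar shows that both components of `x` lie in `W`, so `W`
  -- is a product.
  · by_contra hne
    refine hW.2 ⟨W.comap (LinearMap.inl A Y Z), W.comap (LinearMap.inr A Y Z), ?_⟩
    have h1 : ∀ x ∈ W, (x.1, (0 : Z)) ∈ W := by
      intro x hx
      have h2 : scaleFst A Y Z ((ζ⁻¹ : kˣ) : k) x ∈ W := by
        have : x ∈ ζ • W := by rwa [hζ]
        exact this
      have h3 : (((ζ⁻¹ : kˣ) : k) - 1) ≠ 0 := by
        rw [sub_ne_zero]
        intro h
        exact hne (inv_eq_one.1 (Units.ext h))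
      have h4 := W.smul_mem (algebraMap k A (((ζ⁻¹ : kˣ) : k) - 1)⁻¹) (W.sub_mem h2 hx)
      have h5 : algebraMap k A (((ζ⁻¹ : kˣ) : k) - 1)⁻¹ •
          (scaleFst A Y Z ((ζ⁻¹ : kˣ) : k) x - x) = (x.1, (0 : Z)) := by
        refine Prod.ext ?_ ?_
        · change algebraMap k A _ • (algebraMap k A _ • x.1 - x.1) = x.1
          rw [smul_sub, smul_smul, ← sub_smul, ← map_mul, ← map_sub]
          nth_rewrite 2 [← mul_one (((ζ⁻¹ : kˣ) : k) - 1)⁻¹]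
          rw [← mul_sub, inv_mul_cancel₀ h3, map_one, one_smul]
        · change algebraMap k A _ • (x.2 - x.2) = 0
          rw [sub_self, smul_zero]
      rwa [h5] at h4
    ext x
    rw [Submodule.mem_prod, Submodule.mem_comap, Submodule.mem_comap]
    constructor
    · intro hx
      refine ⟨h1 x hx, ?_⟩
      have := W.sub_mem hx (h1 x hx)
      rwa [show x - (x.1, 0) = LinearMap.inr A Y Z x.2 from Prod.ext (by simp) (by simp)] at this
    · rintro ⟨h2, h3⟩
      have := W.add_mem h2 h3
      rwa [show LinearMap.inl A Y Z x.1 + LinearMap.inr A Y Z x.2 = x from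
        Prod.ext (by simp) (by simp)] at this

end Torus

open Classical in
/-- The number of indecomposable summands of a module of type `r` from which a quotient
`C(i, j)` can be removed so that a module of type `t` is left. -/
def summandCount (i : ZMod n) (j : ℕ) (r t : Multiset (ZMod n × ℕ∞)) : ℕ :=
  r.countP fun x => x.1 = i ∧ (j : ℕ∞) ≤ x.2 ∧ t = r.erase x + sh j x

-- The recursion matches that of `ncard_hT_inter_prod`: the shortened summand lies in `r` and `p`
-- survives in `t`, or it is `p` itself.
open Classical in
theorem summandCount_cons (i : ZMod n) (j : ℕ) (p : ZMod n × ℕ∞) (r t : Multiset (ZMod n × ℕ∞)) :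
    summandCount i j (p ::ₘ r) t = (if p ∈ t then summandCount i j r (t.erase p) else 0) +
      if p.1 = i ∧ (j : ℕ∞) ≤ p.2 ∧ t = sh j p + r then 1 else 0 := by
  unfold summandCount
  rw [Multiset.countP_cons, Multiset.erase_cons_head, add_comm r]
  congr 1
  have h : ∀ x ∈ r, (t = (p ::ₘ r).erase x + sh j x ↔
      p ∈ t ∧ t.erase p = r.erase x + sh j x) := by
    intro x hx
    have h1 : (p ::ₘ r).erase x = p ::ₘ r.erase x := by
      conv_lhs => rw [← Multiset.cons_erase hx, Multiset.cons_swap, Multiset.erase_cons_head]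
    rw [h1, Multiset.cons_add]
    constructor
    · rintro rfl
      exact ⟨Multiset.mem_cons_self _ _, Multiset.erase_cons_head _ _⟩
    · rintro ⟨h2, h3⟩
      rw [← h3, Multiset.cons_erase h2]
  split_ifs with hp
  · refine Multiset.countP_congr rfl fun x hx => ?_
    rw [h x hx]
    simp [hp]
  · rw [Multiset.countP_eq_zero]
    intro x hx h'
    exact hp ((h x hx).1 h'.2.2).1

theorem hasType_unique_quotient_C {p : ZMod n × ℕ∞} (hp : p.2 ≠ 0) {i : ZMod n} {j : ℕ}
    {W : Submodule A (c.C p)} (hW : c.HasType {(i, (j : ℕ∞))} (c.C p ⧸ W)) :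
    p.1 = i ∧ (j : ℕ∞) ≤ p.2 ∧ W = c.radN (c.C p) j := by
  have hbot : W = ⊥ → p.1 = i ∧ (j : ℕ∞) ≤ p.2 ∧ W = c.radN (c.C p) j := by
    rintro rfl
    have h1 := (hasType_C (c := c) hp).unique (hW.congr (Submodule.quotEquivOfEqBot _ rfl))
    rw [Multiset.singleton_inj] at h1
    subst h1
    exact ⟨rfl, le_rfl, (c.radN_C_eq_bot le_rfl).symm⟩
  rcases c.submodule_C W with h | ⟨m, h⟩
  · exact hbot h
  rcases le_or_gt (m : ℕ∞) p.2 with h1 | h1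
  · subst h
    by_cases hm : m = 0
    · subst hm
      have : Subsingleton (c.C p ⧸ c.radN (c.C p) 0) := by
        rw [Submodule.Quotient.subsingleton_iff, radN_zero]
      have h2 := hasType_zero.unique hW
      exact absurd h2.symm (Multiset.singleton_ne_zero _)
    · have h2 := (hasType_C (c := c) (p := (p.1, (m : ℕ∞))) (Nat.cast_ne_zero.2 hm)).unique
        (hW.congr (c.quotRadEquiv p m h1))
      rw [Multiset.singleton_inj, Prod.mk.injEq, Nat.cast_inj] at h2
      obtain ⟨rfl, rfl⟩ := h2
      exact ⟨rfl, h1, rfl⟩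
  · exact hbot (h.trans (c.radN_C_eq_bot h1.le))

-- The quotient by a product is a product of quotients, and it has only one indecomposable summand.
-- So one factor of the submodule is everything: either the problem passes to `Y`, or the other
-- factor is `u ^ j C p` by uniseriality.
open Classical in
theorem ncard_hT_inter_prod {p : ZMod n × ℕ∞} (hp : p.2 ≠ 0) (hY : c.HasType r Y) {i : ZMod n}
    {j : ℕ} (hj : j ≠ 0) :
    (c.hT {(i, (j : ℕ∞))} (c.C p × Y) t ∩ {W | ∃ W₁ W₂, W = Submodule.prod W₁ W₂}).ncard =
      (if p ∈ t then (c.hT {(i, (j : ℕ∞))} Y (t.erase p)).ncard else 0) +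
      if p.1 = i ∧ (j : ℕ∞) ≤ p.2 ∧ t = sh j p + r then 1 else 0 := by
  have hfs : FiniteType ({(i, (j : ℕ∞))} : Multiset (ZMod n × ℕ∞)) := by
    intro x hx
    rw [Multiset.mem_singleton] at hx
    subst hx
    exact ENat.natCast_ne_top j
  have hs0 : ∀ x ∈ ({(i, (j : ℕ∞))} : Multiset (ZMod n × ℕ∞)), x.2 ≠ 0 := by
    intro x hx
    rw [Multiset.mem_singleton] at hx
    subst hx
    exact Nat.cast_ne_zero.2 hj
  obtain ⟨N, hN⟩ := exists_bound hfs
  set S₁ : Set (Submodule A (c.C p × Y)) :=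
    if p ∈ t then Submodule.prod ⊤ '' c.hT {(i, (j : ℕ∞))} Y (t.erase p) else ∅ with hS₁
  set S₂ : Set (Submodule A (c.C p × Y)) :=
    if p.1 = i ∧ (j : ℕ∞) ≤ p.2 ∧ t = sh j p + r then {Submodule.prod (c.radN (c.C p) j) ⊤}
      else ∅ with hS₂
  have hunion : c.hT {(i, (j : ℕ∞))} (c.C p × Y) t ∩
      {W | ∃ W₁ W₂, W = Submodule.prod W₁ W₂} = S₁ ∪ S₂ := by
    ext W
    constructor
    · rintro ⟨⟨hW, hW'⟩, W₁, W₂, rfl⟩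
      have h1 := hW'.congr (prodQuotEquiv W₁ W₂)
      have hfin := h1.finite hfs
      have hk : ∀ x : (c.C p ⧸ W₁) × (Y ⧸ W₂), c.u ^ N • x = 0 := h1.pow_smul_eq_zero hN
      have : Finite (c.C p ⧸ W₁) := Finite.of_surjective (Prod.fst : _ × (Y ⧸ W₂) → _)
        Prod.fst_surjective
      have : Finite (Y ⧸ W₂) := Finite.of_surjective (Prod.snd : (c.C p ⧸ W₁) × _ → _)
        Prod.snd_surjective
      obtain ⟨a, -, ha⟩ := exists_hasType_of_finite (c := c) (N := N)
        fun x : c.C p ⧸ W₁ => congrArg Prod.fst (hk (x, 0))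
      obtain ⟨b, -, hb⟩ := exists_hasType_of_finite (c := c) (N := N)
        fun x : Y ⧸ W₂ => congrArg Prod.snd (hk (0, x))
      have hab := (ha.prod hb).unique h1
      have hcard := congrArg Multiset.card hab
      rw [Multiset.card_add, Multiset.card_singleton] at hcard
      rcases Nat.eq_zero_or_pos a.card with h0 | h0
      · rw [Multiset.card_eq_zero] at h0
        subst h0
        rw [zero_add] at hab
        subst hab
        have h2 := ha.subsingleton
        rw [Submodule.Quotient.subsingleton_iff] at h2
        subst h2
        left
        obtain ⟨S, hS⟩ := exists_types_of_submodules r N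
        obtain ⟨v, -, hv⟩ := hS A c Y hY W₂ (radN_le_of_quotient (hb.pow_smul_eq_zero hN))
        have h3 := (HasType.cons hp hv).unique (hW.congr ((prodSubEquiv ⊤ W₂).trans
          (Submodule.topEquiv.prodCongr (LinearEquiv.refl A W₂))))
        have h4 : p ∈ t := h3 ▸ Multiset.mem_cons_self _ _
        rw [hS₁, if_pos h4]
        refine ⟨W₂, ⟨?_, hb⟩, rfl⟩
        rwa [← h3, Multiset.erase_cons_head]
      · have h0 : b = 0 := by
          rw [← Multiset.card_eq_zero]
          omega
        subst h0
        rw [add_zero] at hab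
        subst hab
        have h2 := hb.subsingleton
        rw [Submodule.Quotient.subsingleton_iff] at h2
        subst h2
        right
        obtain ⟨h3, h4, rfl⟩ := hasType_unique_quotient_C hp ha
        have h5 := ((hasType_sh (c := c) j p).prod hY).unique (hW.congr ((prodSubEquiv _ ⊤).trans
          ((LinearEquiv.refl A _).prodCongr Submodule.topEquiv)))
        rw [hS₂, if_pos ⟨h3, h4, h5.symm⟩]
        rfl
    · rintro (hW | hW)
      · rw [hS₁] at hW
        split_ifs at hW with hpt
        · obtain ⟨W₂, ⟨h1, h2⟩, rfl⟩ := hW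
          refine ⟨⟨?_, ?_⟩, ⊤, W₂, rfl⟩
          · have := (HasType.cons hp h1).congr ((prodSubEquiv ⊤ W₂).trans
              (Submodule.topEquiv.prodCongr (LinearEquiv.refl A W₂))).symm
            rwa [Multiset.cons_erase hpt] at this
          · have : Subsingleton (c.C p ⧸ (⊤ : Submodule A (c.C p))) :=
              Submodule.Quotient.subsingleton_iff.2 rfl
            have := ((hasType_zero (c := c) (Y := c.C p ⧸ (⊤ : Submodule A (c.C p)))).prod h2).congr (prodQuotEquiv ⊤ W₂).symm
            rwa [zero_add] at this
        · exact hW.elim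
      · rw [hS₂] at hW
        split_ifs at hW with hpt
        · obtain ⟨rfl, h2, rfl⟩ := hpt
          rw [Set.mem_singleton_iff] at hW
          subst hW
          refine ⟨⟨?_, ?_⟩, _, ⊤, rfl⟩
          · exact ((hasType_sh (c := c) j p).prod hY).congr ((prodSubEquiv _ ⊤).trans
              ((LinearEquiv.refl A _).prodCongr Submodule.topEquiv)).symm
          · have : Subsingleton (Y ⧸ (⊤ : Submodule A Y)) :=
              Submodule.Quotient.subsingleton_iff.2 rfl
            have h3 := (hasType_C (c := c) (p := (p.1, (j : ℕ∞))) (Nat.cast_ne_zero.2 hj)).congr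
              (c.quotRadEquiv p j h2).symm
            have := (h3.prod (hasType_zero (c := c) (Y := Y ⧸ (⊤ : Submodule A Y)))).congr (prodQuotEquiv _ ⊤).symm
            rwa [add_zero] at this
        · exact hW.elim
  have hdisj : Disjoint S₁ S₂ := by
    rw [Set.disjoint_left]
    intro W h1 h2
    rw [hS₁] at h1
    rw [hS₂] at h2
    split_ifs at h1 with hpt
    · split_ifs at h2 with hpt'
      · obtain ⟨W₂, -, rfl⟩ := h1
        rw [Set.mem_singleton_iff] at h2
        have h3 : (c.gen p, (0 : Y)) ∈ Submodule.prod (⊤ : Submodule A (c.C p)) W₂ :=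
          ⟨trivial, W₂.zero_mem⟩
        rw [h2] at h3
        exact gen_notMem_radN_one hp (c.radN_anti (Nat.one_le_iff_ne_zero.2 hj) h3.1)
      · exact h2.elim
    · exact h1.elim
  have hfin₁ : S₁.Finite := by
    rw [hS₁]
    split_ifs
    · exact (hY.finite_hT hfs).image _
    · exact Set.finite_empty
  have hfin₂ : S₂.Finite := by
    rw [hS₂]
    split_ifs
    · exact Set.finite_singleton _
    · exact Set.finite_empty
  rw [hunion, Set.ncard_union_eq hdisj hfin₁ hfin₂, hS₁, hS₂]
  congr 1
  · split_ifs
    · refine Set.ncard_image_of_injective _ fun W W' h => ?_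
      have := congrArg (Submodule.comap (LinearMap.inr A (c.C p) Y)) h
      ext y
      have h1 := SetLike.ext_iff.1 this y
      simpa [Submodule.mem_prod] using h1
    · exact Set.ncard_empty _
  · split_ifs
    · exact Set.ncard_singleton _
    · exact Set.ncard_empty _

/-- The Hall numbers for a cyclic quotient, modulo the order of the torus. -/
theorem ncard_hT_modEq (k : Type) [Field k] [Algebra k A] (hY : c.HasType r Y) (i : ZMod n) {j : ℕ}
    (hj : j ≠ 0) :
    (c.hT {(i, (j : ℕ∞))} Y t).ncard ≡ summandCount i j r t [MOD Nat.card kˣ] := by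
  classical
  have hfs : FiniteType ({(i, (j : ℕ∞))} : Multiset (ZMod n × ℕ∞)) := by
    intro x hx
    rw [Multiset.mem_singleton] at hx
    subst hx
    exact ENat.natCast_ne_top j
  induction r using Multiset.induction generalizing Y t with
  | empty =>
    have := hY.subsingleton
    have h : c.hT {(i, (j : ℕ∞))} Y t = ∅ := by
      rw [Set.eq_empty_iff_forall_notMem]
      rintro W ⟨-, h1⟩
      have : Subsingleton (Y ⧸ W) := W.mkQ_surjective.subsingleton
      exact absurd (hasType_zero.unique h1).symm (Multiset.singleton_ne_zero _)
    rw [h, Set.ncard_empty, summandCount, Multiset.countP_zero]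
  | cons p r ih =>
    obtain ⟨Y', hY', ⟨f⟩⟩ := hY.exists_cons
    have hp := hY.ne_zero p (Multiset.mem_cons_self _ _)
    have hfin : (c.hT {(i, (j : ℕ∞))} (c.C p × Y') t).Finite :=
      finite_hT_congr f (hY.finite_hT hfs)
    -- Product submodules reproduce the recursion of `summandCount`; the remaining ones contribute a
    -- multiple of the order of the torus.
    rw [← ncard_hT_congr f, summandCount_cons, ← Set.ncard_inter_add_ncard_sdiff_eq_ncard _
      {W | ∃ W₁ W₂, W = Submodule.prod W₁ W₂} hfin, ncard_hT_inter_prod hp hY' hj]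
    have h1 := card_dvd_ncard_diff (k := k) (c.hT {(i, (j : ℕ∞))} (c.C p × Y') t) (fun g W hW => by
      rw [hT_congr g]
      exact ⟨W, hW, rfl⟩)
    have h2 : (if p ∈ t then (c.hT {(i, (j : ℕ∞))} Y' (t.erase p)).ncard else 0) ≡
        (if p ∈ t then summandCount i j r (t.erase p) else 0) [MOD Nat.card kˣ] := by
      split_ifs
      · exact ih hY'
      · rfl
    exact (h2.add_right _).add ((Nat.modEq_zero_iff_dvd).2 h1)

end CycRing

/-! ### Hall polynomials with indecomposable quotient at `T = 1` -/

open CycRing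

variable {n : ℕ} [NeZero n]

/-- As `p - 1` divides `P(p) - P(1)`, it divides `P(1) - N` for every prime `p`. A prime with `p - 1
> |P(1) - N|` forces equality. -/
theorem eval_one_eq_of_modEq {P : ℤ[X]} {N : ℕ}
    (h : ∀ p : ℕ, p.Prime → ∃ a : ℕ, P.eval (p : ℤ) = a ∧ a ≡ N [MOD (p - 1)]) :
    P.eval 1 = N := by
  obtain ⟨p, hp1, hp⟩ := Nat.exists_infinite_primes ((P.eval 1 - N).natAbs + 2)
  obtain ⟨a, ha, hN⟩ := h p hp
  have h1 : ((p : ℤ) - 1) ∣ P.eval (p : ℤ) - P.eval 1 := Polynomial.sub_dvd_eval_sub _ _ _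
  have h2 : ((p : ℤ) - 1) ∣ (N : ℤ) - a := by
    have := hN.dvd
    rwa [Nat.cast_sub hp.one_le, Nat.cast_one] at this
  rw [ha] at h1
  have h3 : ((p : ℤ) - 1) ∣ P.eval 1 - N := by
    have := (h1.add h2).neg_right
    rwa [show -((a : ℤ) - P.eval 1 + (N - a)) = P.eval 1 - N by ring] at this
  rw [← sub_eq_zero]
  by_contra hne
  have h4 := Int.natAbs_dvd_natAbs.2 h3
  have h5 := Nat.le_of_dvd (Int.natAbs_pos.2 hne) h4
  omega

theorem typeOfPartition_single (s : ZMod n × ℕ+) :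
    typeOfPartition (Finsupp.single s 1) = {(s.1, ((s.2 : ℕ) : ℕ∞))} := by
  simp [typeOfPartition]

/-- The Hall polynomials for an indecomposable quotient at `T = 1`. -/
theorem eval_one_hallPolynomial (s : ZMod n × ℕ+) (mu nu : PartitionTuple n) :
    (hallPolynomial n (Finsupp.single s 1) mu nu).eval 1 =
      summandCount s.1 s.2 (typeOfPartition mu) (typeOfPartition nu) := by
  refine eval_one_eq_of_modEq fun p hp => ?_
  have := Fact.mk hp
  obtain ⟨c, -⟩ := testOrder_exists_cycRing p n
  obtain ⟨_⟩ := testOrder_nonempty_algebra p n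
  refine ⟨_, eval_hallPolynomial_eq c _ _ _, ?_⟩
  have := ncard_hT_modEq (ZMod p) (hasType_Md_toList (c := c) (typeOfPartition_ne_zero mu)) s.1
    (t := typeOfPartition nu) s.2.ne_zero
  rwa [Nat.card_eq_fintype_card, ZMod.card_units_eq_totient, Nat.totient_prime hp,
    ← typeOfPartition_single] at this

theorem eval_one_hallModulePolynomial {m : ℕ} (s : ZMod n × ℕ+) (mu nu : LatticeIndex n m) :
    (hallModulePolynomial n m (Finsupp.single s 1) mu nu).eval 1 =
      summandCount s.1 s.2 (typeOfLattice mu.1) (typeOfLattice nu.1) := by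
  refine eval_one_eq_of_modEq fun p hp => ?_
  have := Fact.mk hp
  obtain ⟨c, -⟩ := testOrder_exists_cycRing p n
  obtain ⟨_⟩ := testOrder_nonempty_algebra p n
  refine ⟨_, eval_hallModulePolynomial_eq c _ _ _, ?_⟩
  have := ncard_hT_modEq (ZMod p) (hasType_Md_toList (c := c) (typeOfLattice_ne_zero mu.1)) s.1
    (t := typeOfLattice nu.1) s.2.ne_zero
  rwa [Nat.card_eq_fintype_card, ZMod.card_units_eq_totient, Nat.totient_prime hp,
    ← typeOfPartition_single] at this

end IyamaHall
end

noncomputable section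

namespace IyamaHall

open CycRing

variable {n : ℕ} [NeZero n]

/-! ### The specialized Hall algebra as a ring -/

theorem HallAlgebraOne.induction_on {P : HallAlgebraOne n → Prop} (x : HallAlgebraOne n)
    (zero : P 0) (tmul : ∀ (a : ℂ) (x : GenericHallAlgebra n), P (a ⊗ₜ[ℤ[X]] x))
    (add : ∀ x y, P x → P y → P (x + y)) : P x :=
  TensorProduct.induction_on (motive := P) x zero tmul add

theorem mulOne_tmul (a b : ℂ) (x y : GenericHallAlgebra n) :
    mulOne n (a ⊗ₜ[ℤ[X]] x : ℂ ⊗[ℤ[X]] GenericHallAlgebra n)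
      (b ⊗ₜ[ℤ[X]] y : ℂ ⊗[ℤ[X]] GenericHallAlgebra n) = (a * b) ⊗ₜ[ℤ[X]] genericMul n x y :=
  specialize_tmul _ _ _ _ _

theorem actOne_tmul {m : ℕ} (a b : ℂ) (x : GenericHallAlgebra n) (v : GenericHallModule n m) :
    actOne n m (a ⊗ₜ[ℤ[X]] x : ℂ ⊗[ℤ[X]] GenericHallAlgebra n) (b ⊗ₜ[ℤ[X]] v) =
      (a * b) ⊗ₜ[ℤ[X]] genericAct n m x v :=
  specialize_tmul _ _ _ _ _

/-- The basis element `u_λ` at `T = 1`. -/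
def HallAlgebraOne.u (lam : PartitionTuple n) : HallAlgebraOne n :=
  ((1 : ℂ) ⊗ₜ[ℤ[X]] GenericHallAlgebra.u lam : ℂ ⊗[ℤ[X]] GenericHallAlgebra n)

theorem mulOne_assoc (x y z : HallAlgebraOne n) :
    mulOne n (mulOne n x y) z = mulOne n x (mulOne n y z) := by
  induction x using HallAlgebraOne.induction_on with
  | zero => simp only [map_zero, LinearMap.zero_apply]
  | add _ _ h1 h2 => simp only [map_add, LinearMap.add_apply, h1, h2]
  | tmul a x =>
    induction y using HallAlgebraOne.induction_on with
    | zero => simp only [map_zero, LinearMap.zero_apply]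
    | add _ _ h1 h2 => simp only [map_add, LinearMap.add_apply, h1, h2]
    | tmul b y =>
      induction z using HallAlgebraOne.induction_on with
      | zero => simp only [map_zero]
      | add _ _ h1 h2 => simp only [map_add, h1, h2]
      | tmul d z =>
        rw [mulOne_tmul, mulOne_tmul, mulOne_tmul, mulOne_tmul, genericMul_assoc, mul_assoc]

theorem mulOne_one_left (x : HallAlgebraOne n) : mulOne n (HallAlgebraOne.u 0) x = x := by
  induction x using HallAlgebraOne.induction_on with
  | zero => simp only [map_zero]
  | add _ _ h1 h2 => simp only [map_add, h1, h2]
  | tmul a x => rw [HallAlgebraOne.u, mulOne_tmul, genericMul_zero_left, one_mul]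

theorem mulOne_one_right (x : HallAlgebraOne n) : mulOne n x (HallAlgebraOne.u 0) = x := by
  induction x using HallAlgebraOne.induction_on with
  | zero => simp only [map_zero, LinearMap.zero_apply]
  | add _ _ h1 h2 => simp only [map_add, LinearMap.add_apply, h1, h2]
  | tmul a x => rw [HallAlgebraOne.u, mulOne_tmul, genericMul_zero_right, mul_one]

/-- The ring structure of the specialized Hall algebra. -/
@[reducible] def hallAlgebraOneRing (n : ℕ) [NeZero n] : Ring (HallAlgebraOne n) :=
  { (inferInstance : NonUnitalNonAssocRing (HallAlgebraOne n)) with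
    mul_assoc := mulOne_assoc
    one := HallAlgebraOne.u 0
    one_mul := mulOne_one_left
    mul_one := mulOne_one_right }

attribute [local instance] hallAlgebraOneRing

/-- The algebra structure of the specialized Hall algebra. -/
@[reducible] def hallAlgebraOneAlgebra (n : ℕ) [NeZero n] : Algebra ℂ (HallAlgebraOne n) :=
  Algebra.ofModule (fun a x y => LinearMap.map_smul₂ (mulOne n) a x y)
    fun a x y => (mulOne n x).map_smul a y

attribute [local instance] hallAlgebraOneAlgebra

/-- The action of the specialized Hall algebra as an algebra homomorphism. -/
def actOneHom (n m : ℕ) [NeZero n] : HallAlgebraOne n →ₐ[ℂ] Module.End ℂ (HallModuleOne n m) :=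
  AlgHom.ofLinearMap (actOne n m)
    (by
      ext v
      change actOne n m (HallAlgebraOne.u 0) (1 ⊗ₜ v) = 1 ⊗ₜ v
      rw [HallAlgebraOne.u, actOne_tmul, genericAct_zero, one_mul])
    (by
      intro x y
      change actOne n m (mulOne n x y) = _
      refine LinearMap.ext fun v => ?_
      rw [Module.End.mul_apply]
      induction x using HallAlgebraOne.induction_on with
      | zero => simp only [map_zero, LinearMap.zero_apply]
      | add _ _ h1 h2 => simp only [map_add, LinearMap.add_apply, h1, h2]
      | tmul a x =>
        induction y using HallAlgebraOne.induction_on with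
        | zero => simp only [map_zero, LinearMap.zero_apply]
        | add _ _ h1 h2 => simp only [map_add, LinearMap.add_apply, h1, h2]
        | tmul b y =>
          induction v using TensorProduct.induction_on with
          | zero => simp only [map_zero]
          | add _ _ h1 h2 => simp only [map_add, h1, h2]
          | tmul d z =>
            rw [mulOne_tmul, actOne_tmul, actOne_tmul, actOne_tmul, genericAct_genericMul,
              mul_assoc])

theorem actOneHom_apply {m : ℕ} (x : HallAlgebraOne n) : actOneHom n m x = actOne n m x := rfl

/-- The basis of the specialized Hall algebra. -/
def hallBasis (n : ℕ) : Module.Basis (PartitionTuple n) ℂ (HallAlgebraOne n) :=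
  (Algebra.TensorProduct.basis ℂ
    (Finsupp.basisSingleOne : Module.Basis (PartitionTuple n) ℤ[X] (PartitionTuple n →₀ ℤ[X])) :
      Module.Basis (PartitionTuple n) ℂ (ℂ ⊗[ℤ[X]] (PartitionTuple n →₀ ℤ[X])))

theorem hallBasis_apply (lam : PartitionTuple n) : hallBasis n lam = HallAlgebraOne.u lam := by
  refine (Algebra.TensorProduct.basis_apply _ _).trans ?_
  rw [Finsupp.coe_basisSingleOne]
  rfl

theorem complexAtOne_smul (P : ℤ[X]) (a : ℂ) : P • a = ((P.eval 1 : ℤ) : ℂ) * a := by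
  rw [Algebra.smul_def]
  congr 1
  change Polynomial.eval₂ (Int.castRingHom ℂ) 1 P = _
  rw [← Int.cast_one, ← eq_intCast (Int.castRingHom ℂ) 1, Polynomial.eval₂_at_apply]
  rfl

theorem u_single_mul_u (s : ZMod n × ℕ+) (nu : PartitionTuple n) :
    HallAlgebraOne.u (Finsupp.single s 1) * HallAlgebraOne.u nu =
      ∑ mu ∈ partsOfLen n (len (typeOfPartition (Finsupp.single s 1)) + len (typeOfPartition nu)),
        ((summandCount s.1 s.2 (typeOfPartition mu) (typeOfPartition nu) : ℕ) : ℂ) •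
          HallAlgebraOne.u mu := by
  change mulOne n _ _ = _
  rw [HallAlgebraOne.u, HallAlgebraOne.u, mulOne_tmul, genericMul_u_eq_sum, TensorProduct.tmul_sum]
  refine Finset.sum_congr rfl fun mu _ => ?_
  rw [TensorProduct.tmul_smul, TensorProduct.smul_tmul', complexAtOne_smul, HallAlgebraOne.u,
    eval_one_hallPolynomial]
  change _ = ((_ : ℂ) • (1 : ℂ)) ⊗ₜ[ℤ[X]] GenericHallAlgebra.u mu
  simp

theorem repr_u_single_mul_u (s : ZMod n × ℕ+) (mu nu : PartitionTuple n) :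
    (hallBasis n).repr (HallAlgebraOne.u (Finsupp.single s 1) * HallAlgebraOne.u nu) mu =
      (summandCount s.1 s.2 (typeOfPartition mu) (typeOfPartition nu) : ℕ) := by
  classical
  rw [u_single_mul_u, map_sum, Finsupp.finsetSum_apply]
  simp_rw [map_smul, ← hallBasis_apply, Module.Basis.repr_self, Finsupp.smul_apply,
    Finsupp.single_apply, smul_eq_mul, mul_ite, mul_one, mul_zero]
  rw [Finset.sum_ite_eq']
  split_ifs with h
  · rfl
  · rw [mem_partsOfLen] at h
    rw [← Int.cast_natCast, ← eval_one_hallPolynomial, hallPolynomial_eq_zero h, eval_zero,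
      Int.cast_zero]

/-! ### Structure constants at `T = 1` -/

/-- The number of indecomposable summands. -/
def partCount (mu : PartitionTuple n) : ℕ := (typeOfPartition mu).card

theorem typeOfPartition_add (mu nu : PartitionTuple n) :
    typeOfPartition (mu + nu) = typeOfPartition mu + typeOfPartition nu := by
  simp [typeOfPartition]

theorem partCount_add (mu nu : PartitionTuple n) :
    partCount (mu + nu) = partCount mu + partCount nu := by
  rw [partCount, typeOfPartition_add, Multiset.card_add]
  rfl

theorem partCount_single (s : ZMod n × ℕ+) : partCount (Finsupp.single s 1) = 1 := by
  rw [partCount, typeOfPartition_single, Multiset.card_singleton]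

theorem count_typeOfPartition [DecidableEq (ZMod n × ℕ∞)] (mu : PartitionTuple n)
    (s : ZMod n × ℕ+) : (typeOfPartition mu).count (s.1, ((s.2 : ℕ) : ℕ∞)) = mu s := by
  classical
  have h1 : Function.Injective fun p : ZMod n × ℕ+ => (p.1, ((p.2 : ℕ) : ℕ∞)) := by
    rintro ⟨i, j⟩ ⟨i', j'⟩ h
    simp only [Prod.mk.injEq, Nat.cast_inj] at h
    exact Prod.ext h.1 (PNat.coe_injective h.2)
  rw [← Finsupp.count_toMultiset]
  exact Multiset.count_map_eq_count' _ _ h1 s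

-- The number of summands drops only when a summand is removed completely. This summand must be the
-- indecomposable `s` itself, and all `ν s + 1` copies of it in `μ` qualify.
open Classical in
theorem summandCount_of_partCount_lt (s : ZMod n × ℕ+) {mu nu : PartitionTuple n}
    (h : partCount nu < partCount mu) :
    summandCount s.1 s.2 (typeOfPartition mu) (typeOfPartition nu) =
      if mu = nu + Finsupp.single s 1 then nu s + 1 else 0 := by
  have key : ∀ x ∈ typeOfPartition mu, (x.1 = s.1 ∧ ((s.2 : ℕ) : ℕ∞) ≤ x.2 ∧
      typeOfPartition nu = (typeOfPartition mu).erase x + sh s.2 x) →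
      x = (s.1, ((s.2 : ℕ) : ℕ∞)) ∧ mu = nu + Finsupp.single s 1 := by
    rintro x hx ⟨h1, h2, h3⟩
    have h4 := congrArg Multiset.card h3
    rw [Multiset.card_add, Multiset.card_erase_of_mem hx] at h4
    unfold partCount at h
    have h5 : sh (s.2 : ℕ) x = 0 := by
      rw [← Multiset.card_eq_zero, Nat.pred_eq_sub_one] at *
      omega
    have h6 : x.2 ≤ ((s.2 : ℕ) : ℕ∞) := by
      by_contra h7
      rw [sh, if_neg h7] at h5
      exact Multiset.singleton_ne_zero _ h5
    have h7 : x = (s.1, ((s.2 : ℕ) : ℕ∞)) := Prod.ext h1 (le_antisymm h6 h2)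
    refine ⟨h7, typeOfPartition_injective ?_⟩
    rw [typeOfPartition_add, h3, h5, add_zero, typeOfPartition_single, ← h7, add_comm,
      Multiset.singleton_add, Multiset.cons_erase hx]
  rw [summandCount]
  split_ifs with hmu
  · have h1 : mu s = nu s + 1 := by rw [hmu]; simp
    rw [← h1, ← count_typeOfPartition, Multiset.count]
    refine Multiset.countP_congr rfl fun x hx => ?_
    refine propext ⟨fun hc => (key x hx hc).1.symm, ?_⟩
    rintro rfl
    refine ⟨rfl, le_rfl, ?_⟩
    rw [hmu, typeOfPartition_add, typeOfPartition_single, add_comm (typeOfPartition nu), Multiset.singleton_add,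
      Multiset.erase_cons_head, sh, if_pos le_rfl, add_zero]
  · rw [Multiset.countP_eq_zero]
    exact fun x hx hc => hmu (key x hx hc).2

theorem exists_eq_single_of_partCount_eq_one {mu : PartitionTuple n} (h : partCount mu = 1) :
    ∃ s, mu = Finsupp.single s 1 := by
  rw [partCount, typeOfPartition, Multiset.card_map, Multiset.card_eq_one] at h
  obtain ⟨s, hs⟩ := h
  exact ⟨s, Multiset.toFinsupp.symm.injective (hs.trans (Finsupp.toMultiset_single s 1 ▸ by simp))⟩

-- A uniserial module has exactly one submodule of each smaller length. The one with quotient `C (i,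
-- j)` has top `i + j`, which is where the condition on the end point comes from.
open Classical in
theorem summandCount_single_of_partCount_le (s s' : ZMod n × ℕ+) {mu : PartitionTuple n}
    (h : partCount mu ≤ 1) :
    summandCount s.1 s.2 (typeOfPartition mu) (typeOfPartition (Finsupp.single s' 1)) =
      if s.1 + (s.2 : ℕ) = s'.1 ∧ mu = Finsupp.single (s.1, s.2 + s'.2) 1 then 1 else 0 := by
  rcases Nat.eq_zero_or_pos (partCount mu) with h0 | h0
  · have h1 : typeOfPartition mu = 0 := Multiset.card_eq_zero.1 h0
    rw [h1, summandCount, Multiset.countP_zero, if_neg]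
    rintro ⟨-, rfl⟩
    rw [partCount_single] at h0
    exact one_ne_zero h0
  · obtain ⟨x, rfl⟩ := exists_eq_single_of_partCount_eq_one (le_antisymm h h0)
    rw [typeOfPartition_single, typeOfPartition_single, summandCount,
      ← Multiset.cons_zero (x.1, ((x.2 : ℕ) : ℕ∞)), Multiset.countP_cons, Multiset.countP_zero, zero_add]
    refine if_congr ?_ rfl rfl
    rw [Multiset.erase_cons_head, zero_add, Finsupp.single_left_inj one_ne_zero, sh]
    dsimp only
    constructor
    · rintro ⟨h1, h2, h3⟩
      split_ifs at h3 with h4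
      · exact absurd h3 (Multiset.singleton_ne_zero _)
      · rw [Multiset.singleton_inj, Prod.mk.injEq] at h3
        refine ⟨by rw [h3.1, h1], Prod.ext h1 (PNat.eq ?_)⟩
        have h5 := h3.2
        rw [← ENat.natCast_sub, Nat.cast_inj] at h5
        rw [Nat.cast_le] at h2 h4
        change (x.2 : ℕ) = s.2 + s'.2
        omega
    · rintro ⟨h1, rfl⟩
      have h2 := s'.2.pos
      refine ⟨rfl, ?_, ?_⟩
      · rw [Nat.cast_le, PNat.add_coe]
        omega
      · rw [if_neg, Multiset.singleton_inj]
        · refine Prod.ext h1.symm ?_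
          dsimp only
          rw [← ENat.natCast_sub, Nat.cast_inj, PNat.add_coe]
          omega
        · rw [Nat.cast_le, PNat.add_coe]
          omega

/-- Terms with two summands are symmetric in `s` and `s'` and cancel. What remains are the two ways
of gluing the uniserial modules end to end, and this is the bracket of the matrix units `E_(i,i+j)`.
-/
theorem commutator_u_single (s s' : ZMod n × ℕ+) :
    HallAlgebraOne.u (Finsupp.single s 1) * HallAlgebraOne.u (Finsupp.single s' 1) -
      HallAlgebraOne.u (Finsupp.single s' 1) * HallAlgebraOne.u (Finsupp.single s 1) =
    (if s.1 + (s.2 : ℕ) = s'.1 then HallAlgebraOne.u (Finsupp.single (s.1, s.2 + s'.2) 1) else 0) -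
      if s'.1 + (s'.2 : ℕ) = s.1 then HallAlgebraOne.u (Finsupp.single (s'.1, s.2 + s'.2) 1)
        else 0 := by
  classical
  refine (hallBasis n).ext_elem fun mu => ?_
  have hu : ∀ lam : PartitionTuple n, (hallBasis n).repr (HallAlgebraOne.u lam) mu =
      if mu = lam then 1 else 0 := by
    intro lam
    rw [← hallBasis_apply, Module.Basis.repr_self, Finsupp.single_apply]
    simp only [eq_comm]
  rw [map_sub, map_sub, Finsupp.sub_apply, Finsupp.sub_apply, repr_u_single_mul_u,
    repr_u_single_mul_u]
  rcases le_or_gt (partCount mu) 1 with h | h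
  · rw [summandCount_single_of_partCount_le s s' h, summandCount_single_of_partCount_le s' s h,
      add_comm s'.2 s.2]
    split_ifs <;> simp_all
  · have h1 : ∀ x, mu ≠ Finsupp.single x 1 := by
      rintro x rfl
      rw [partCount_single] at h
      exact lt_irrefl _ h
    rw [summandCount_of_partCount_lt s (by rwa [partCount_single]),
      summandCount_of_partCount_lt s' (by rwa [partCount_single]),
      add_comm (Finsupp.single s' 1) (Finsupp.single s 1)]
    have h2 : Finsupp.single s' 1 s = Finsupp.single s 1 s' := by
      simp only [Finsupp.single_apply, eq_comm]
    rw [h2, sub_self]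
    split_ifs <;> simp [hu, h1]

end IyamaHall
end

noncomputable section

namespace IyamaHall

attribute [local instance] hallAlgebraOneRing hallAlgebraOneAlgebra

open CycRing

/-! ### Words in a free algebra modulo commutators -/

section Words

variable {X : Type}

/-- The monomial given by a list of letters. -/
def word (l : List X) : FreeAlgebra ℂ X := (l.map (FreeAlgebra.ι ℂ)).prod

theorem word_cons (a : X) (l : List X) : word (a :: l) = FreeAlgebra.ι ℂ a * word l := by
  simp [word]

/-- The linear combinations of words of length less than `d`. -/
def shortWords (X : Type) (d : ℕ) : Submodule ℂ (FreeAlgebra ℂ X) :=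
  Submodule.span ℂ (word '' {l : List X | l.length < d})

theorem word_mem_shortWords {l : List X} {d : ℕ} (h : l.length < d) : word l ∈ shortWords X d :=
  Submodule.subset_span ⟨l, h, rfl⟩

theorem shortWords_mono {d e : ℕ} (h : d ≤ e) : shortWords X d ≤ shortWords X e :=
  Submodule.span_mono (Set.image_mono fun _ hl => lt_of_lt_of_le hl h)

theorem mul_mem_shortWords {d e : ℕ} {x y : FreeAlgebra ℂ X} (hx : x ∈ shortWords X d)
    (hy : y ∈ shortWords X e) : x * y ∈ shortWords X (d + e) := by
  have h := Submodule.mul_mem_mul hx hy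
  rw [shortWords, shortWords, Submodule.span_mul_span] at h
  refine Submodule.span_mono ?_ h
  rintro _ ⟨_, ⟨l, hl, rfl⟩, _, ⟨l', hl', rfl⟩, rfl⟩
  refine ⟨l ++ l', ?_, by simp [word]⟩
  simp only [Set.mem_ofPred_eq, List.length_append] at *
  omega

theorem ι_mul_mem_shortWords (a : X) {d : ℕ} {x : FreeAlgebra ℂ X} (hx : x ∈ shortWords X d) :
    FreeAlgebra.ι ℂ a * x ∈ shortWords X (d + 1) := by
  refine Submodule.span_induction (p := fun x _ => FreeAlgebra.ι ℂ a * x ∈ shortWords X (d + 1))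
    ?_ ?_ ?_ ?_ hx
  · rintro _ ⟨l, hl, rfl⟩
    rw [← word_cons]
    exact word_mem_shortWords (by simpa using hl)
  · rw [mul_zero]
    exact Submodule.zero_mem _
  · intro x y _ _ h1 h2
    rw [mul_add]
    exact Submodule.add_mem _ h1 h2
  · intro r x _ h
    rw [mul_smul_comm]
    exact Submodule.smul_mem _ _ h

theorem exists_mem_shortWords (x : FreeAlgebra ℂ X) : ∃ d, x ∈ shortWords X d := by
  induction x using FreeAlgebra.induction with
  | grade0 r =>
    refine ⟨1, ?_⟩
    rw [Algebra.algebraMap_eq_smul_one]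
    exact Submodule.smul_mem _ _ (word_mem_shortWords (l := []) (by simp))
  | grade1 a =>
    refine ⟨2, ?_⟩
    have := word_mem_shortWords (l := [a]) (d := 2) (by simp)
    rwa [word_cons, word, List.map_nil, List.prod_nil, mul_one] at this
  | mul x y hx hy =>
    obtain ⟨d, hd⟩ := hx
    obtain ⟨e, he⟩ := hy
    exact ⟨d + e, mul_mem_shortWords hd he⟩
  | add x y hx hy =>
    obtain ⟨d, hd⟩ := hx
    obtain ⟨e, he⟩ := hy
    exact ⟨max d e, Submodule.add_mem _ (shortWords_mono (le_max_left _ _) hd)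
      (shortWords_mono (le_max_right _ _) he)⟩

/-- If the commutators of letters are linear combinations of letters modulo a left and right ideal
`K`, then words may be reordered modulo shorter words and `K`. -/
theorem word_sub_word_mem {K : Submodule ℂ (FreeAlgebra ℂ X)}
    (hl : ∀ x, ∀ k ∈ K, x * k ∈ K) (hr : ∀ k ∈ K, ∀ x, k * x ∈ K)
    (hK : ∀ a b : X, ∃ z ∈ Submodule.span ℂ (Set.range (FreeAlgebra.ι ℂ)),
      FreeAlgebra.ι ℂ a * FreeAlgebra.ι ℂ b - FreeAlgebra.ι ℂ b * FreeAlgebra.ι ℂ a - z ∈ K)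
    {l l' : List X} (h : l.Perm l') : word l - word l' ∈ shortWords X l.length ⊔ K := by
  induction h with
  | nil =>
    rw [sub_self]
    exact Submodule.zero_mem _
  | cons a _ ih =>
    obtain ⟨f, hf, k, hk, h⟩ := Submodule.mem_sup.1 ih
    rw [word_cons, word_cons, ← mul_sub, ← h, mul_add]
    exact Submodule.add_mem_sup (ι_mul_mem_shortWords a hf) (hl _ k hk)
  | swap a b l =>
    obtain ⟨z, hz, hk⟩ := hK b a
    have h1 : word (b :: a :: l) - word (a :: b :: l) = z * word l +
        (FreeAlgebra.ι ℂ b * FreeAlgebra.ι ℂ a - FreeAlgebra.ι ℂ a * FreeAlgebra.ι ℂ b - z) *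
          word l := by
      simp only [word_cons]
      noncomm_ring
    rw [h1]
    refine Submodule.add_mem_sup ?_ (hr _ hk _)
    refine Submodule.span_induction (p := fun z _ => z * word l ∈ shortWords X _) ?_ ?_ ?_ ?_ hz
    · rintro _ ⟨c, rfl⟩
      rw [← word_cons]
      exact word_mem_shortWords (by simp)
    · rw [zero_mul]
      exact Submodule.zero_mem _
    · intro x y _ _ h1 h2
      rw [add_mul]
      exact Submodule.add_mem _ h1 h2
    · intro r x _ h
      rw [smul_mul_assoc]
      exact Submodule.smul_mem _ _ h
  | trans h1 _ ih1 ih2 =>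
    rw [← h1.length_eq] at ih2
    have := Submodule.add_mem _ ih1 ih2
    rwa [sub_add_sub_cancel] at this

end Words

variable {n : ℕ} [NeZero n]

/-! ### Triangularity -/

/-- The span of the basis elements with less than `d` indecomposable summands. -/
def lowPart (n : ℕ) [NeZero n] (d : ℕ) : Submodule ℂ (HallAlgebraOne n) where
  carrier := {x | ∀ mu, d ≤ partCount mu → (hallBasis n).repr x mu = 0}
  add_mem' := by
    intro x y hx hy mu h
    rw [map_add, Finsupp.add_apply, hx mu h, hy mu h, add_zero]
  zero_mem' := by
    intro mu _
    rw [map_zero, Finsupp.zero_apply]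
  smul_mem' := by
    intro r x hx mu h
    rw [map_smul, Finsupp.smul_apply, hx mu h, smul_zero]

theorem lowPart_mono {d e : ℕ} (h : d ≤ e) : lowPart n d ≤ lowPart n e :=
  fun _ hx mu hmu => hx mu (h.trans hmu)

theorem eq_sum_of_mem_lowPart (x : HallAlgebraOne n) :
    x = ∑ nu ∈ ((hallBasis n).repr x).support, (hallBasis n).repr x nu • HallAlgebraOne.u nu := by
  conv_lhs => rw [← (hallBasis n).linearCombination_repr x, Finsupp.linearCombination_apply,
    Finsupp.sum]
  simp only [hallBasis_apply]

/-- Multiplication by an indecomposable raises the number of summands by at most one, so it respects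
the filtration by that number. -/
theorem u_single_mul_mem_lowPart (s : ZMod n × ℕ+) {d : ℕ} {x : HallAlgebraOne n}
    (hx : x ∈ lowPart n d) : HallAlgebraOne.u (Finsupp.single s 1) * x ∈ lowPart n (d + 1) := by
  classical
  intro mu hmu
  rw [eq_sum_of_mem_lowPart x, Finset.mul_sum, map_sum, Finsupp.finsetSum_apply]
  refine Finset.sum_eq_zero fun nu hnu => ?_
  rw [mul_smul_comm, map_smul, Finsupp.smul_apply, repr_u_single_mul_u]
  have h1 : partCount nu < d := by
    by_contra h
    exact Finsupp.mem_support_iff.1 hnu (hx nu (not_lt.1 h))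
  rw [summandCount_of_partCount_lt s (by omega), if_neg, Nat.cast_zero, smul_zero]
  rintro rfl
  rw [partCount_add, partCount_single] at hmu
  omega

theorem repr_u_self (lam : PartitionTuple n) :
    (hallBasis n).repr (HallAlgebraOne.u lam) lam = 1 := by
  rw [← hallBasis_apply, Module.Basis.repr_self, Finsupp.single_eq_same]

theorem repr_u_ne {lam mu : PartitionTuple n} (h : mu ≠ lam) :
    (hallBasis n).repr (HallAlgebraOne.u lam) mu = 0 := by
  rw [← hallBasis_apply, Module.Basis.repr_self, Finsupp.single_eq_of_ne h]

/-- The leading term of the product adds the summand `s` to `ν`, with coefficient the new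
multiplicity. This is nonzero over `ℂ`, and the associated graded algebra behaves like a polynomial
ring. -/
theorem u_single_mul_u_sub_mem_lowPart (s : ZMod n × ℕ+) (nu : PartitionTuple n) :
    HallAlgebraOne.u (Finsupp.single s 1) * HallAlgebraOne.u nu -
      ((nu s + 1 : ℕ) : ℂ) • HallAlgebraOne.u (nu + Finsupp.single s 1) ∈
        lowPart n (partCount nu + 1) := by
  classical
  intro mu hmu
  rw [map_sub, map_smul, Finsupp.sub_apply, Finsupp.smul_apply, repr_u_single_mul_u,
    summandCount_of_partCount_lt s (by omega)]
  split_ifs with h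
  · rw [← h, repr_u_self]
    simp
  · rw [repr_u_ne h]
    simp

/-- The homomorphism from the free algebra given by the indecomposable basis elements. -/
def freeToHall (n : ℕ) [NeZero n] : FreeAlgebra ℂ (ZMod n × ℕ+) →ₐ[ℂ] HallAlgebraOne n :=
  FreeAlgebra.lift ℂ fun s => HallAlgebraOne.u (Finsupp.single s 1)

theorem freeToHall_ι (s : ZMod n × ℕ+) :
    freeToHall n (FreeAlgebra.ι ℂ s) = HallAlgebraOne.u (Finsupp.single s 1) :=
  FreeAlgebra.lift_ι_apply _ _

open Classical in
/-- The tuple of partitions whose parts are given by a list. -/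
def partsOfList (l : List (ZMod n × ℕ+)) : PartitionTuple n :=
  Multiset.toFinsupp (l : Multiset (ZMod n × ℕ+))

theorem partsOfList_cons (s : ZMod n × ℕ+) (l : List (ZMod n × ℕ+)) :
    partsOfList (s :: l) = partsOfList l + Finsupp.single s 1 := by
  classical
  rw [partsOfList, ← Multiset.cons_coe, ← Multiset.singleton_add, map_add,
    Multiset.toFinsupp_singleton, add_comm]
  rfl

theorem partCount_partsOfList (l : List (ZMod n × ℕ+)) : partCount (partsOfList l) = l.length := by
  classical
  rw [partCount, typeOfPartition, Multiset.card_map, partsOfList, Multiset.toFinsupp_toMultiset,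
    Multiset.coe_card]

theorem exists_freeToHall_word (l : List (ZMod n × ℕ+)) :
    ∃ a : ℂ, a ≠ 0 ∧
      freeToHall n (word l) - a • HallAlgebraOne.u (partsOfList l) ∈ lowPart n l.length := by
  induction l with
  | nil =>
    refine ⟨1, one_ne_zero, ?_⟩
    have h1 : partsOfList ([] : List (ZMod n × ℕ+)) = 0 := by simp [partsOfList]
    have h2 : freeToHall n (word []) = HallAlgebraOne.u 0 := by
      rw [word, List.map_nil, List.prod_nil, map_one]
      rfl
    rw [h1, h2, one_smul, sub_self]
    exact Submodule.zero_mem _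
  | cons s l ih =>
    obtain ⟨a, ha, h⟩ := ih
    refine ⟨a * ((partsOfList l s + 1 : ℕ) : ℂ), mul_ne_zero ha (Nat.cast_ne_zero.2 (by omega)), ?_⟩
    have h1 := u_single_mul_mem_lowPart s h
    have h2 := Submodule.smul_mem _ a (u_single_mul_u_sub_mem_lowPart s (partsOfList l))
    rw [partCount_partsOfList] at h2
    have h3 := Submodule.add_mem _ h1 h2
    rw [word_cons, map_mul, freeToHall_ι, partsOfList_cons]
    rwa [mul_sub, mul_smul_comm, smul_sub, sub_add_sub_cancel, smul_smul] at h3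

theorem freeToHall_mem_lowPart {d : ℕ} {x : FreeAlgebra ℂ (ZMod n × ℕ+)}
    (hx : x ∈ shortWords (ZMod n × ℕ+) d) : freeToHall n x ∈ lowPart n d := by
  refine Submodule.span_induction (p := fun x _ => freeToHall n x ∈ lowPart n d) ?_ ?_ ?_ ?_ hx
  · rintro _ ⟨l, hl, rfl⟩
    obtain ⟨a, -, h⟩ := exists_freeToHall_word l
    rw [← sub_add_cancel (freeToHall n (word l)) (a • HallAlgebraOne.u (partsOfList l))]
    refine Submodule.add_mem _ (lowPart_mono (le_of_lt hl) h) (Submodule.smul_mem _ _ ?_)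
    intro mu hmu
    refine repr_u_ne ?_
    rintro rfl
    rw [partCount_partsOfList] at hmu
    exact absurd hl (not_lt.2 hmu)
  · rw [map_zero]
    exact Submodule.zero_mem _
  · intro x y _ _ h1 h2
    rw [map_add]
    exact Submodule.add_mem _ h1 h2
  · intro r x _ h
    rw [map_smul]
    exact Submodule.smul_mem _ _ h

/-- A list of the parts. -/
def listOfParts (lam : PartitionTuple n) : List (ZMod n × ℕ+) := (Finsupp.toMultiset lam).toList

theorem partsOfList_listOfParts (lam : PartitionTuple n) : partsOfList (listOfParts lam) = lam := by
  classical
  rw [partsOfList, listOfParts, Multiset.coe_toList, Finsupp.toMultiset_toFinsupp]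

theorem listOfParts_perm (l : List (ZMod n × ℕ+)) : l.Perm (listOfParts (partsOfList l)) := by
  classical
  rw [← Multiset.coe_eq_coe, listOfParts, Multiset.coe_toList, partsOfList,
    Multiset.toFinsupp_toMultiset]

theorem length_listOfParts (lam : PartitionTuple n) :
    (listOfParts lam).length = partCount lam := by
  rw [← partCount_partsOfList, partsOfList_listOfParts]

/-- The word in the parts of `λ` equals a nonzero multiple of `u_λ` plus basis elements with fewer
summands, which are reached by induction. -/
theorem freeToHall_surjective : Function.Surjective (freeToHall n) := by
  have key : ∀ (d : ℕ) (lam : PartitionTuple n), partCount lam = d →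
      HallAlgebraOne.u lam ∈ LinearMap.range (freeToHall n).toLinearMap := by
    intro d
    induction d using Nat.strong_induction_on with
    | _ d ih =>
      intro lam hlam
      obtain ⟨a, ha, h⟩ := exists_freeToHall_word (listOfParts lam)
      rw [partsOfList_listOfParts, length_listOfParts] at h
      have h1 : freeToHall n (word (listOfParts lam)) - a • HallAlgebraOne.u lam ∈
          LinearMap.range (freeToHall n).toLinearMap := by
        rw [eq_sum_of_mem_lowPart (freeToHall n (word (listOfParts lam)) - _)]
        refine Submodule.sum_mem _ fun nu hnu => Submodule.smul_mem _ _ (ih _ ?_ nu rfl)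
        by_contra h'
        exact Finsupp.mem_support_iff.1 hnu (h nu (by omega))
      have h2 := Submodule.smul_mem _ a⁻¹ (Submodule.sub_mem _
        (LinearMap.mem_range_self (freeToHall n).toLinearMap (word (listOfParts lam))) h1)
      rwa [AlgHom.toLinearMap_apply, sub_sub_cancel, smul_smul, inv_mul_cancel₀ ha, one_smul] at h2
  intro x
  have : x ∈ LinearMap.range (freeToHall n).toLinearMap := by
    rw [eq_sum_of_mem_lowPart x]
    exact Submodule.sum_mem _ fun nu _ => Submodule.smul_mem _ _ (key _ nu rfl)
  exact this

/-- A homomorphism from the free algebra under which the letters satisfy the commutation relations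
of the indecomposable basis elements factors through the Hall algebra. -/
theorem ker_freeToHall_le {U : Type} [Ring U] [Algebra ℂ U]
    (Θ : FreeAlgebra ℂ (ZMod n × ℕ+) →ₐ[ℂ] U)
    (hΘ : ∀ a b : ZMod n × ℕ+, ∃ z ∈ Submodule.span ℂ (Set.range (FreeAlgebra.ι ℂ)),
      freeToHall n (FreeAlgebra.ι ℂ a * FreeAlgebra.ι ℂ b -
        FreeAlgebra.ι ℂ b * FreeAlgebra.ι ℂ a - z) = 0 ∧
      Θ (FreeAlgebra.ι ℂ a * FreeAlgebra.ι ℂ b -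
        FreeAlgebra.ι ℂ b * FreeAlgebra.ι ℂ a - z) = 0)
    (x : FreeAlgebra ℂ (ZMod n × ℕ+)) (hx : freeToHall n x = 0) : Θ x = 0 := by
  classical
  -- `K` consists of the relations valid in both targets. It is stable under multiplication from
  -- both sides, so words may be reordered at the cost of shorter words and elements of `K`.
  let K : Submodule ℂ (FreeAlgebra ℂ (ZMod n × ℕ+)) :=
    LinearMap.ker (freeToHall n).toLinearMap ⊓ LinearMap.ker Θ.toLinearMap
  have hKmem : ∀ k, k ∈ K ↔ freeToHall n k = 0 ∧ Θ k = 0 := fun k => Iff.rfl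
  have hperm : ∀ {l l' : List (ZMod n × ℕ+)}, l.Perm l' →
      word l - word l' ∈ shortWords (ZMod n × ℕ+) l.length ⊔ K := by
    refine word_sub_word_mem (fun x k hk => ?_) (fun k hk x => ?_) hΘ
    · rw [hKmem] at hk ⊢
      simp only [map_mul, hk.1, hk.2, mul_zero, and_self]
    · rw [hKmem] at hk ⊢
      simp only [map_mul, hk.1, hk.2, zero_mul, and_self]
  obtain ⟨d, hd⟩ := exists_mem_shortWords x
  induction d generalizing x with
  | zero =>
    have h1 : shortWords (ZMod n × ℕ+) 0 = ⊥ := by simp [shortWords]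
    rw [h1, Submodule.mem_bot] at hd
    rw [hd, map_zero]
  | succ d ih =>
    let M : (PartitionTuple n →₀ ℂ) →ₗ[ℂ] FreeAlgebra ℂ (ZMod n × ℕ+) :=
      Finsupp.linearCombination ℂ fun lam => word (listOfParts lam)
    -- Modulo shorter words and `K`, a word of length `d` is the chosen word of its multiset of
    -- letters.
    have h1 : shortWords (ZMod n × ℕ+) (d + 1) ≤
        (Finsupp.supported ℂ ℂ {lam | partCount lam = d}).map M ⊔
          (shortWords (ZMod n × ℕ+) d ⊔ K) := by
      rw [shortWords, Submodule.span_le]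
      rintro _ ⟨l, hl, rfl⟩
      rcases Nat.lt_succ_iff_lt_or_eq.1 hl with hl' | hl'
      · exact Submodule.mem_sup_right (Submodule.mem_sup_left (word_mem_shortWords hl'))
      · have h2 := hperm (listOfParts_perm l)
        rw [hl'] at h2
        rw [← add_sub_cancel (word (listOfParts (partsOfList l))) (word l)]
        refine Submodule.add_mem_sup ⟨Finsupp.single (partsOfList l) 1, ?_, ?_⟩ h2
        · refine Finsupp.single_mem_supported _ _ ?_
          rw [Set.mem_ofPred_eq, partCount_partsOfList, hl']
        · simp only [M, Finsupp.linearCombination_single, one_smul]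
    obtain ⟨_, ⟨a, ha, rfl⟩, g, hg, h2⟩ := Submodule.mem_sup.1 (h1 hd)
    obtain ⟨f, hf, k, hk, h3⟩ := Submodule.mem_sup.1 hg
    rw [hKmem] at hk
    -- The chosen words of length `d` have linearly independent leading terms in the Hall algebra.
    -- Since the image of `x` vanishes, so do their coefficients; what is left of `x` is shorter
    -- modulo `K`.
    have ha0 : a = 0 := by
      ext lam
      by_contra hne
      have hlam : partCount lam = d := (Finsupp.mem_supported ℂ a).1 ha
        (Finsupp.mem_support_iff.2 hne)
      have h4 : (hallBasis n).repr (freeToHall n (M a)) lam = 0 := by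
        have h5 : freeToHall n (M a) = -freeToHall n f := by
          rw [eq_neg_iff_add_eq_zero, ← hx, ← h2, ← h3]
          simp only [map_add, hk.1, add_zero]
        rw [h5, map_neg, Finsupp.neg_apply, freeToHall_mem_lowPart hf lam hlam.ge, neg_zero]
      rw [Finsupp.linearCombination_apply, Finsupp.sum, map_sum, map_sum, Finsupp.finsetSum_apply,
        Finset.sum_eq_single lam] at h4
      · obtain ⟨b, hb, h6⟩ := exists_freeToHall_word (listOfParts lam)
        rw [partsOfList_listOfParts, length_listOfParts] at h6
        have h7 := h6 lam le_rfl
        rw [map_sub, map_smul, Finsupp.sub_apply, Finsupp.smul_apply, repr_u_self, smul_eq_mul,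
          mul_one, sub_eq_zero] at h7
        rw [map_smul, map_smul, Finsupp.smul_apply, h7, smul_eq_mul] at h4
        exact (mul_ne_zero hne hb) h4
      · intro nu hnu hne'
        obtain ⟨b, hb, h6⟩ := exists_freeToHall_word (listOfParts nu)
        have hnu' : partCount nu = d := (Finsupp.mem_supported ℂ a).1 ha hnu
        rw [partsOfList_listOfParts, length_listOfParts] at h6
        have h7 := h6 lam (by omega)
        rw [map_sub, map_smul, Finsupp.sub_apply, Finsupp.smul_apply, repr_u_ne hne'.symm,
          smul_zero, sub_zero] at h7
        rw [map_smul, map_smul, Finsupp.smul_apply, h7, smul_zero]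
      · intro h
        exact absurd (Finsupp.mem_support_iff.2 hne) h
    rw [ha0, map_zero, zero_add] at h2
    rw [← h2, ← h3, map_add, hk.2, add_zero]
    refine ih f ?_ hf
    rw [← hx, ← h2, ← h3, map_add, hk.1, add_zero]

end IyamaHall
end

noncomputable section

namespace IyamaHall

attribute [local instance] hallAlgebraOneRing hallAlgebraOneAlgebra

open CycRing

/-! ### Representations of `gl_n` by generators and relations -/

section GlLift

variable {n : ℕ} {R : Type} [Ring R] [Algebra ℂ R]

/-- The relations of the matrix units of `gl_n`. -/
def GlRelations (D : Fin n → Fin n → R) : Prop :=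
  ∀ i k i' k', D i k * D i' k' - D i' k' * D i k =
    (if k = i' then D i k' else 0) - if k' = i then D i' k else 0

theorem single_mul_single_eq_ite (i k i' k' : Fin n) :
    Matrix.single i k (1 : ℂ) * Matrix.single i' k' 1 =
      if k = i' then Matrix.single i k' 1 else 0 := by
  split_ifs with h
  · subst h
    rw [Matrix.single_mul_single_same, one_mul]
  · rw [Matrix.single_mul_single_of_ne _ _ _ _ h]

/-- The linear map given by the images of the matrix units. -/
def glLinear (D : Fin n → Fin n → R) : Matrix (Fin n) (Fin n) ℂ →ₗ[ℂ] R :=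
  (Matrix.stdBasis ℂ (Fin n) (Fin n)).constr ℂ fun x => D x.1 x.2

theorem glLinear_single (D : Fin n → Fin n → R) (i k : Fin n) :
    glLinear D (Matrix.single i k 1) = D i k := by
  rw [← Matrix.stdBasis_eq_single, glLinear, Module.Basis.constr_basis]

/-- The homomorphism of Lie algebras given by the images of the matrix units. -/
def glLift (D : Fin n → Fin n → R) (hD : GlRelations D) : Matrix (Fin n) (Fin n) ℂ →ₗ⁅ℂ⁆ R :=
  { glLinear D with
    map_lie' := by
      intro X Y
      change glLinear D ⁅X, Y⁆ = ⁅glLinear D X, glLinear D Y⁆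
      induction X using Matrix.induction_on' with
      | h_zero => simp only [zero_lie, map_zero]
      | h_add _ _ h1 h2 => simp only [add_lie, map_add, h1, h2]
      | h_std_basis i k x =>
        induction Y using Matrix.induction_on' with
        | h_zero => simp only [lie_zero, map_zero]
        | h_add _ _ h1 h2 => simp only [lie_add, map_add, h1, h2]
        | h_std_basis i' k' y =>
          have h : ∀ (i k : Fin n) (x : ℂ), Matrix.single i k x = x • Matrix.single i k 1 := by
            intro i k x
            rw [Matrix.smul_single, smul_eq_mul, mul_one]
          rw [h i k x, h i' k' y, map_smul, map_smul, smul_lie, smul_lie, lie_smul, lie_smul,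
            map_smul, map_smul, glLinear_single, glLinear_single]
          congr 2
          rw [LieRing.of_associative_ring_bracket, LieRing.of_associative_ring_bracket,
            hD i k i' k', single_mul_single_eq_ite, single_mul_single_eq_ite, map_sub]
          split_ifs <;> simp only [glLinear_single, map_zero] }

theorem glLift_single (D : Fin n → Fin n → R) (hD : GlRelations D) (i k : Fin n) :
    glLift D hD (Matrix.single i k 1) = D i k := glLinear_single D i k

end GlLift

/-- A matrix unit in `U(gl_n)`. -/
def matrixUnit {n : ℕ} (i k : Fin n) : Ugl n :=
  UniversalEnvelopingAlgebra.ι ℂ (Matrix.single i k (1 : ℂ))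

theorem matrixUnit_relations (n : ℕ) : GlRelations (matrixUnit (n := n)) := by
  intro i k i' k'
  rw [← LieRing.of_associative_ring_bracket, matrixUnit, matrixUnit, ← LieHom.map_lie,
    LieRing.of_associative_ring_bracket, single_mul_single_eq_ite, single_mul_single_eq_ite,
    map_sub]
  split_ifs <;> simp [matrixUnit]

/-- The universal property gives a homomorphism from `U(gl_n)` to `S` whose composition with the
inclusion is the identity. -/
theorem eq_top_of_matrixUnit_mem {n : ℕ} (S : Subalgebra ℂ (Ugl n))
    (hS : ∀ i k, matrixUnit i k ∈ S) : S = ⊤ := by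
  have h1 : ∀ X, (UniversalEnvelopingAlgebra.ι ℂ : Matrix (Fin n) (Fin n) ℂ →ₗ⁅ℂ⁆ Ugl n) X ∈ S := by
    intro X
    induction X using Matrix.induction_on' with
    | h_zero =>
      rw [map_zero]
      exact S.zero_mem
    | h_add _ _ h1 h2 =>
      rw [map_add]
      exact S.add_mem h1 h2
    | h_std_basis i k x =>
      rw [← mul_one x, ← smul_eq_mul, ← Matrix.smul_single, map_smul]
      exact S.smul_mem (hS i k) x
  let f : Matrix (Fin n) (Fin n) ℂ →ₗ⁅ℂ⁆ S :=
    { toFun := fun X => ⟨UniversalEnvelopingAlgebra.ι ℂ X, h1 X⟩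
      map_add' := fun X Y => Subtype.ext (map_add _ X Y)
      map_smul' := fun a X => Subtype.ext (map_smul _ a X)
      map_lie' := fun {X Y} => Subtype.ext (LieHom.map_lie _ X Y) }
  have h2 : S.val.comp (UniversalEnvelopingAlgebra.lift ℂ f) = AlgHom.id ℂ (Ugl n) := by
    refine UniversalEnvelopingAlgebra.hom_ext ℂ (LieHom.ext fun X => ?_)
    change S.val (UniversalEnvelopingAlgebra.lift ℂ f (UniversalEnvelopingAlgebra.ι ℂ X)) = _
    rw [UniversalEnvelopingAlgebra.lift_ι_apply]
    rfl
  rw [eq_top_iff]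
  intro x _
  have h3 := DFunLike.congr_fun h2 x
  rw [AlgHom.id_apply] at h3
  rw [← h3]
  exact (UniversalEnvelopingAlgebra.lift ℂ f x).2

variable {n : ℕ} [NeZero n]

/-! ### The homomorphism to `U(gl_n)` -/

/-- The numbering of the vertices by the rows of the matrices. -/
def vertexEquiv (n : ℕ) [NeZero n] : ZMod n ≃ Fin n := (ZMod.finEquiv n).symm.toEquiv

/-- An indecomposable with top `i` which can be moved along a path from `i` to `k`. -/
def pathIndex (i k : ZMod n) : ZMod n × ℕ+ :=
  -- Adding `n` keeps the length positive when `i = k` and does not move the end point modulo `n`.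
  (i, ⟨(k - i).val + n, Nat.add_pos_right _ (NeZero.pos n)⟩)

theorem pathIndex_end (i k : ZMod n) : (pathIndex i k).1 + ((pathIndex i k).2 : ℕ) = k := by
  change i + (((k - i).val + n : ℕ) : ZMod n) = k
  rw [Nat.cast_add, ZMod.natCast_self, add_zero, ZMod.natCast_val, ZMod.cast_id, add_sub_cancel]

/-- The homomorphism from the free algebra to `U(gl_n)`. -/
def freeToUgl (n : ℕ) [NeZero n] : FreeAlgebra ℂ (ZMod n × ℕ+) →ₐ[ℂ] Ugl n :=
  FreeAlgebra.lift ℂ fun s => matrixUnit (vertexEquiv n s.1) (vertexEquiv n (s.1 + (s.2 : ℕ)))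

theorem freeToUgl_ι (s : ZMod n × ℕ+) : freeToUgl n (FreeAlgebra.ι ℂ s) =
    matrixUnit (vertexEquiv n s.1) (vertexEquiv n (s.1 + (s.2 : ℕ))) :=
  FreeAlgebra.lift_ι_apply _ _

theorem freeToUgl_surjective : Function.Surjective (freeToUgl n) := by
  rw [← AlgHom.range_eq_top]
  refine eq_top_of_matrixUnit_mem _ fun i k => ?_
  refine ⟨FreeAlgebra.ι ℂ (pathIndex ((vertexEquiv n).symm i) ((vertexEquiv n).symm k)), ?_⟩
  refine (freeToUgl_ι _).trans ?_
  rw [pathIndex_end, Equiv.apply_symm_apply]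
  change matrixUnit (vertexEquiv n ((vertexEquiv n).symm i)) k = _
  rw [Equiv.apply_symm_apply]

/-- The matrix units `E_(i,i+j)` satisfy the same commutator formula as the indecomposable basis
elements, so `ker_freeToHall_le` applies with the same linear combination of letters on both sides.
-/
theorem freeToUgl_eq_zero (x : FreeAlgebra ℂ (ZMod n × ℕ+)) (hx : freeToHall n x = 0) :
    freeToUgl n x = 0 := by
  refine ker_freeToHall_le (n := n) _ (fun a b => ⟨(if a.1 + (a.2 : ℕ) = b.1 then
    FreeAlgebra.ι ℂ (a.1, a.2 + b.2) else 0) - (if b.1 + (b.2 : ℕ) = a.1 then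
    FreeAlgebra.ι ℂ (b.1, a.2 + b.2) else 0), Submodule.sub_mem _ ?_ ?_, ?_, ?_⟩) x hx
  · split_ifs
    · exact Submodule.subset_span ⟨_, rfl⟩
    · exact Submodule.zero_mem _
  · split_ifs
    · exact Submodule.subset_span ⟨_, rfl⟩
    · exact Submodule.zero_mem _
  · rw [map_sub, map_sub, map_mul, map_mul, freeToHall_ι, freeToHall_ι, commutator_u_single,
      sub_eq_zero, map_sub]
    split_ifs <;> simp only [freeToHall_ι, map_zero]
  · rw [map_sub, map_sub, map_mul, map_mul, freeToUgl_ι, freeToUgl_ι, matrixUnit_relations,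
      sub_eq_zero, map_sub]
    simp only [(vertexEquiv n).injective.eq_iff]
    congr 1
    · split_ifs with h
      · rw [freeToUgl_ι]
        simp only [PNat.add_coe, Nat.cast_add, ← h, add_assoc]
      · rw [map_zero]
    · split_ifs with h
      · rw [freeToUgl_ι]
        simp only [PNat.add_coe, Nat.cast_add, ← h]
        rw [add_assoc, add_comm ((b.2 : ℕ) : ZMod n)]
      · rw [map_zero]

/-- The homomorphism from the specialized Hall algebra to `U(gl_n)`. -/
def hallToUgl (n : ℕ) [NeZero n] : HallAlgebraOne n →+* Ugl n :=
  (freeToHall n : FreeAlgebra ℂ (ZMod n × ℕ+) →+* HallAlgebraOne n).liftOfSurjective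
    freeToHall_surjective ⟨(freeToUgl n : FreeAlgebra ℂ (ZMod n × ℕ+) →+* Ugl n),
      fun x hx => freeToUgl_eq_zero x hx⟩

theorem hallToUgl_freeToHall (x : FreeAlgebra ℂ (ZMod n × ℕ+)) :
    hallToUgl n (freeToHall n x) = freeToUgl n x :=
  RingHom.liftOfSurjective_comp_apply _ freeToHall_surjective _ x

theorem hallToUgl_surjective : Function.Surjective (hallToUgl n) := by
  intro y
  obtain ⟨x, rfl⟩ := freeToUgl_surjective y
  exact ⟨_, hallToUgl_freeToHall x⟩

theorem hallToUgl_smul (a : ℂ) (x : HallAlgebraOne n) :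
    hallToUgl n (a • x) = a • hallToUgl n x := by
  obtain ⟨x, rfl⟩ := freeToHall_surjective x
  rw [← map_smul, hallToUgl_freeToHall, hallToUgl_freeToHall, map_smul]

/-! ### The action on the Hall modules -/

variable {m : ℕ}

/-- The basis of the specialized Hall module. -/
def hallModuleBasis (n m : ℕ) [NeZero n] :
    Module.Basis (LatticeIndex n m) ℂ (HallModuleOne n m) :=
  (Algebra.TensorProduct.basis ℂ
    (Finsupp.basisSingleOne : Module.Basis (LatticeIndex n m) ℤ[X] (LatticeIndex n m →₀ ℤ[X])) :
      Module.Basis (LatticeIndex n m) ℂ (ℂ ⊗[ℤ[X]] (LatticeIndex n m →₀ ℤ[X])))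

theorem hallModuleBasis_apply (mu : LatticeIndex n m) :
    hallModuleBasis n m mu = (1 : ℂ) ⊗ₜ[ℤ[X]] GenericHallModule.u mu := by
  refine (Algebra.TensorProduct.basis_apply _ _).trans ?_
  rw [Finsupp.coe_basisSingleOne]
  rfl

theorem finrank_hallModuleOne :
    Module.finrank ℂ (HallModuleOne n m) = (m + n - 1).choose (n - 1) := by
  classical
  rw [Module.finrank_eq_card_basis (hallModuleBasis n m),
    ← Fintype.card_congr (Sym.equivNatSumOfFintype (ZMod n) m), Sym.card_sym_eq_choose, ZMod.card,
    add_comm n m]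
  have := NeZero.pos n
  exact Nat.choose_symm_of_eq_add (by omega)

theorem typeOfLattice_add_single (mu : ZMod n → ℕ) (i : ZMod n) :
    typeOfLattice (mu + Pi.single i 1) = (i, ⊤) ::ₘ typeOfLattice mu := by
  classical
  have h : Finsupp.equivFunOnFinite.symm (mu + Pi.single i 1) =
      Finsupp.single i 1 + Finsupp.equivFunOnFinite.symm mu := by
    ext x
    simp [Finsupp.single_apply, Pi.single_apply, add_comm, eq_comm]
  rw [typeOfLattice, h, map_add, Finsupp.toMultiset_single, one_smul, Multiset.singleton_add,
    Multiset.map_cons]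
  rfl

theorem count_typeOfLattice [DecidableEq (ZMod n × ℕ∞)] (mu : ZMod n → ℕ) (i : ZMod n) :
    (typeOfLattice mu).count (i, ⊤) = mu i := by
  classical
  have h1 : Function.Injective fun i : ZMod n => (i, (⊤ : ℕ∞)) := fun i j h => congrArg Prod.fst h
  have h2 := Finsupp.count_toMultiset (Finsupp.equivFunOnFinite.symm mu) i
  exact (Multiset.count_map_eq_count' _ _ h1 i).trans h2

-- Removing `C (i, j)` from a summand `P_i` leaves `P_(i+j)`. Either every one of the `μ_i` copies
-- of `P_i` leads to `ν` or none does; the condition is written additively to avoid subtraction.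
open Classical in
theorem summandCount_typeOfLattice (s : ZMod n × ℕ+) (mu nu : ZMod n → ℕ) :
    summandCount s.1 s.2 (typeOfLattice mu) (typeOfLattice nu) =
      if nu + Pi.single s.1 1 = mu + Pi.single (s.1 + (s.2 : ℕ)) 1 then mu s.1 else 0 := by
  have key : ∀ x ∈ typeOfLattice mu, (x.1 = s.1 ∧ ((s.2 : ℕ) : ℕ∞) ≤ x.2 ∧
      typeOfLattice nu = (typeOfLattice mu).erase x + sh s.2 x) ↔
      (s.1, ⊤) = x ∧ nu + Pi.single s.1 1 = mu + Pi.single (s.1 + (s.2 : ℕ)) 1 := by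
    rintro ⟨i, j⟩ hx
    obtain rfl : j = ⊤ := typeOfLattice_eq_top mu _ hx
    have h1 : sh (s.2 : ℕ) (i, (⊤ : ℕ∞)) = {(i + (s.2 : ℕ), ⊤)} := by
      rw [sh, if_neg (by simp)]
      simp [ENat.top_sub_natCast]
    rw [h1, ← typeOfLattice_injective.eq_iff, typeOfLattice_add_single, typeOfLattice_add_single,
      Prod.mk.injEq]
    constructor
    · rintro ⟨rfl, -, h⟩
      refine ⟨⟨rfl, rfl⟩, ?_⟩
      rw [h, ← Multiset.cons_add, Multiset.cons_erase hx, add_comm, Multiset.singleton_add]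
    · rintro ⟨⟨rfl, -⟩, h⟩
      refine ⟨rfl, le_top, ?_⟩
      rw [← Multiset.cons_inj_right (s.1, (⊤ : ℕ∞)), h, ← Multiset.cons_add,
        Multiset.cons_erase hx]
      exact ((add_comm _ _).trans (Multiset.singleton_add _ _)).symm
  rw [summandCount, Multiset.countP_congr rfl fun x hx => propext (key x hx)]
  split_ifs with h
  · simp only [h, and_true]
    exact count_typeOfLattice mu s.1
  · simp [h]

-- If `u_ν` is read as the divided power monomial of exponent `ν`, the coefficients are those of
-- `x_i ∂/∂x_k` with `k = i + j`.
open Classical in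
theorem repr_actOne_basis (s : ZMod n × ℕ+) (mu nu : LatticeIndex n m) :
    (hallModuleBasis n m).repr (actOne n m (HallAlgebraOne.u (Finsupp.single s 1))
      (hallModuleBasis n m nu)) mu =
      if nu.1 + Pi.single s.1 1 = mu.1 + Pi.single (s.1 + (s.2 : ℕ)) 1 then (mu.1 s.1 : ℂ) else 0 := by
  have h1 : actOne n m (HallAlgebraOne.u (Finsupp.single s 1)) (hallModuleBasis n m nu) =
      ∑ mu, ((summandCount s.1 s.2 (typeOfLattice mu.1) (typeOfLattice nu.1) : ℕ) : ℂ) •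
        hallModuleBasis n m mu := by
    rw [hallModuleBasis_apply, HallAlgebraOne.u, actOne_tmul, genericAct_u_eq_sum,
      TensorProduct.tmul_sum]
    refine Finset.sum_congr rfl fun mu _ => ?_
    rw [TensorProduct.tmul_smul, TensorProduct.smul_tmul', complexAtOne_smul,
      eval_one_hallModulePolynomial, hallModuleBasis_apply, TensorProduct.smul_tmul']
    simp
  rw [h1, map_sum, Finsupp.finsetSum_apply]
  simp_rw [map_smul, Module.Basis.repr_self, Finsupp.smul_apply, Finsupp.single_apply, smul_eq_mul,
    mul_ite, mul_one, mul_zero]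
  rw [Finset.sum_ite_eq' _ mu, if_pos (Finset.mem_univ _), summandCount_typeOfLattice,
    Nat.cast_ite, Nat.cast_zero]

/-- Only the top and the end point modulo `n` enter the matrix coefficients; longer paths between
the same vertices act identically. This allows the action to factor through the finite-dimensional
`gl_n`. -/
theorem actOne_congr {s s' : ZMod n × ℕ+} (h1 : s.1 = s'.1)
    (h2 : s.1 + (s.2 : ℕ) = s'.1 + (s'.2 : ℕ)) :
    actOne n m (HallAlgebraOne.u (Finsupp.single s 1)) =
      actOne n m (HallAlgebraOne.u (Finsupp.single s' 1)) := by
  classical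
  refine (hallModuleBasis n m).ext fun nu => (hallModuleBasis n m).ext_elem fun mu => ?_
  rw [repr_actOne_basis, repr_actOne_basis, h2, h1]

/-- The action of the matrix units on the Hall module. -/
def unitAct (n m : ℕ) [NeZero n] (i k : Fin n) : Module.End ℂ (HallModuleOne n m) :=
  actOneHom n m (HallAlgebraOne.u
    (Finsupp.single (pathIndex ((vertexEquiv n).symm i) ((vertexEquiv n).symm k)) 1))

theorem actOne_eq_unitAct (s : ZMod n × ℕ+) :
    actOne n m (HallAlgebraOne.u (Finsupp.single s 1)) =
      unitAct n m (vertexEquiv n s.1) (vertexEquiv n (s.1 + (s.2 : ℕ))) := by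
  rw [unitAct, actOneHom_apply, Equiv.symm_apply_apply, Equiv.symm_apply_apply]
  exact actOne_congr rfl (pathIndex_end _ _).symm

/-- The commutators of the Hall algebra are transported by the action; the glued indecomposables may
be replaced by the standard paths with the same end points. -/
theorem unitAct_relations : GlRelations (unitAct n m) := by
  intro i k i' k'
  obtain ⟨i, rfl⟩ := (vertexEquiv n).surjective i
  obtain ⟨i', rfl⟩ := (vertexEquiv n).surjective i'
  obtain ⟨k, rfl⟩ := (vertexEquiv n).surjective k
  obtain ⟨k', rfl⟩ := (vertexEquiv n).surjective k'
  have h := congrArg (actOneHom n m) (commutator_u_single (pathIndex i k) (pathIndex i' k'))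
  rw [map_sub, map_sub, map_mul, map_mul, pathIndex_end, pathIndex_end] at h
  simp only [(vertexEquiv n).injective.eq_iff]
  have h1 : ∀ i k, actOneHom n m (HallAlgebraOne.u (Finsupp.single (pathIndex i k) 1)) =
      unitAct n m (vertexEquiv n i) (vertexEquiv n k) := by
    intro i k
    rw [unitAct, Equiv.symm_apply_apply, Equiv.symm_apply_apply]
  rw [h1, h1] at h
  rw [h]
  congr 1
  · change actOneHom n m (if k = i' then _ else _) = _
    split_ifs with hk
    · rw [actOneHom_apply, actOne_eq_unitAct]
      have h2 := pathIndex_end i k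
      have h3 := pathIndex_end i' k'
      rw [PNat.add_coe, Nat.cast_add, ← add_assoc, h2, hk]
      exact congrArg (unitAct n m _) (congrArg _ h3)
    · rw [map_zero]
  · change actOneHom n m (if k' = i then _ else _) = _
    split_ifs with hk
    · rw [actOneHom_apply, actOne_eq_unitAct]
      have h2 := pathIndex_end i k
      have h3 := pathIndex_end i' k'
      rw [PNat.add_coe, Nat.cast_add, add_comm ((pathIndex i k).2 : ZMod n), ← add_assoc, h3, hk]
      exact congrArg (unitAct n m _) (congrArg _ h2)
    · rw [map_zero]

/-- The representation of `U(gl_n)` on the Hall module. -/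
def uglAct (n m : ℕ) [NeZero n] : Ugl n →ₐ[ℂ] Module.End ℂ (HallModuleOne n m) :=
  UniversalEnvelopingAlgebra.lift ℂ (glLift (unitAct n m) unitAct_relations)

theorem uglAct_matrixUnit (i k : Fin n) : uglAct n m (matrixUnit i k) = unitAct n m i k :=
  (UniversalEnvelopingAlgebra.lift_ι_apply _ _ _).trans (glLift_single _ _ _ _)

theorem uglAct_hallToUgl (x : HallAlgebraOne n) : uglAct n m (hallToUgl n x) = actOne n m x := by
  obtain ⟨x, rfl⟩ := freeToHall_surjective x
  rw [hallToUgl_freeToHall, ← actOneHom_apply]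
  have h : (uglAct n m).comp (freeToUgl n) = (actOneHom n m).comp (freeToHall n) := by
    refine FreeAlgebra.hom_ext (funext fun s => ?_)
    change uglAct n m (freeToUgl n (FreeAlgebra.ι ℂ s)) =
      actOneHom n m (freeToHall n (FreeAlgebra.ι ℂ s))
    rw [freeToUgl_ι, freeToHall_ι, uglAct_matrixUnit, actOneHom_apply, actOne_eq_unitAct]
  exact DFunLike.congr_fun h x

end IyamaHall
end

noncomputable section

namespace IyamaHall

attribute [local instance] hallAlgebraOneRing hallAlgebraOneAlgebra

variable {n : ℕ} [NeZero n] {m : ℕ}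

/-! ### Irreducibility and the highest weight -/

open Classical in
theorem repr_unitAct_basis (i k : ZMod n) (mu nu : LatticeIndex n m) :
    (hallModuleBasis n m).repr (unitAct n m (vertexEquiv n i) (vertexEquiv n k)
      (hallModuleBasis n m nu)) mu =
      if nu.1 + Pi.single i 1 = mu.1 + Pi.single k 1 then (mu.1 i : ℂ) else 0 := by
  rw [unitAct, actOneHom_apply, repr_actOne_basis, Equiv.symm_apply_apply, Equiv.symm_apply_apply,
    pathIndex_end]
  rfl

theorem repr_unitAct_of_eq {i k : ZMod n} {mu nu : LatticeIndex n m}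
    (h : nu.1 + Pi.single i 1 = mu.1 + Pi.single k 1) (v : HallModuleOne n m) :
    (hallModuleBasis n m).repr (unitAct n m (vertexEquiv n i) (vertexEquiv n k) v) mu =
      mu.1 i * (hallModuleBasis n m).repr v nu := by
  classical
  conv_lhs => rw [← (hallModuleBasis n m).sum_repr v]
  simp_rw [map_sum, Finsupp.finsetSum_apply, map_smul, Finsupp.smul_apply, repr_unitAct_basis]
  rw [Finset.sum_eq_single nu, if_pos h, smul_eq_mul, mul_comm]
  · intro tau _ hne
    rw [if_neg, smul_zero]
    intro h'
    exact hne (Subtype.ext (add_right_cancel (h'.trans h.symm)))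
  · exact fun h => absurd (Finset.mem_univ _) h

theorem exists_of_repr_unitAct_ne_zero {i k : ZMod n} {mu : LatticeIndex n m}
    {v : HallModuleOne n m}
    (h : (hallModuleBasis n m).repr (unitAct n m (vertexEquiv n i) (vertexEquiv n k) v) mu ≠ 0) :
    ∃ nu : LatticeIndex n m, nu.1 + Pi.single i 1 = mu.1 + Pi.single k 1 ∧ mu.1 i ≠ 0 ∧
      (hallModuleBasis n m).repr v nu ≠ 0 := by
  classical
  by_contra! hcon
  refine h ?_
  conv_lhs => rw [← (hallModuleBasis n m).sum_repr v]
  simp_rw [map_sum, Finsupp.finsetSum_apply, map_smul, Finsupp.smul_apply, repr_unitAct_basis]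
  refine Finset.sum_eq_zero fun nu _ => ?_
  split_ifs with h1
  · rcases eq_or_ne (mu.1 i) 0 with h2 | h2
    · rw [h2, Nat.cast_zero, smul_zero]
    · rw [hcon nu h1 h2, zero_smul]
  · rw [smul_zero]

/-- A box can be moved from `k` to `i`. -/
theorem exists_move (mu : LatticeIndex n m) {k : ZMod n} (hk : mu.1 k ≠ 0) (i : ZMod n) :
    ∃ nu : LatticeIndex n m, mu.1 + Pi.single i 1 = nu.1 + Pi.single k 1 := by
  have h1 : mu.1 + Pi.single i 1 - Pi.single k 1 + Pi.single k 1 = mu.1 + Pi.single i 1 := by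
    refine tsub_add_cancel_of_le fun x => ?_
    rcases eq_or_ne x k with rfl | hx
    · rw [Pi.single_eq_same, Pi.add_apply]
      exact (Nat.one_le_iff_ne_zero.2 hk).trans (Nat.le_add_right _ _)
    · rw [Pi.single_eq_of_ne hx]
      exact Nat.zero_le _
  refine ⟨⟨mu.1 + Pi.single i 1 - Pi.single k 1, ?_⟩, h1.symm⟩
  have h2 := congrArg (fun f : ZMod n → ℕ => ∑ x, f x) h1
  simp only [Pi.add_apply, Finset.sum_add_distrib, Finset.sum_pi_single', Finset.mem_univ,
    if_true, mu.2] at h2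
  exact add_right_cancel h2

/-- The tuple concentrated at `o`. -/
def topIndex (m : ℕ) (o : ZMod n) : LatticeIndex n m :=
  ⟨Pi.single o m, by rw [Finset.sum_pi_single', if_pos (Finset.mem_univ _)]⟩

theorem apply_le (mu : LatticeIndex n m) (i : ZMod n) : mu.1 i ≤ m :=
  (Finset.single_le_sum (fun _ _ => Nat.zero_le _) (Finset.mem_univ i)).trans mu.2.le

theorem eq_topIndex (mu : LatticeIndex n m) (o : ZMod n) (h : ∀ k ≠ o, mu.1 k = 0) :
    mu = topIndex m o := by
  have h1 : mu.1 o = m := (Finset.sum_eq_single o (fun k _ hk => h k hk)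
    fun h => absurd (Finset.mem_univ _) h).symm.trans mu.2
  refine Subtype.ext (funext fun k => ?_)
  change _ = (Pi.single o m : ZMod n → ℕ) k
  rcases eq_or_ne k o with rfl | hk
  · rw [Pi.single_eq_same, h1]
  · rw [Pi.single_eq_of_ne hk, h k hk]

section Simple

variable {N : Submodule ℂ (HallModuleOne n m)}
  (hN : ∀ i k : ZMod n, i ≠ k → ∀ v ∈ N, unitAct n m (vertexEquiv n i) (vertexEquiv n k) v ∈ N)

include hN

/-- The operator `E_(o,k)` moves a box from `k` to `o`. The number `d` bounds the boxes outside `o`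
in every monomial of `v`. A move lowers this bound, and it does not kill `v` as long as some
monomial with nonzero coefficient has a box at `k`, because the coefficients of distinct monomials
cannot merge. -/
theorem basis_topIndex_mem (o : ZMod n) (d : ℕ) : ∀ v ∈ N, v ≠ 0 →
    (∀ mu, (hallModuleBasis n m).repr v mu ≠ 0 → m ≤ mu.1 o + d) →
      hallModuleBasis n m (topIndex m o) ∈ N := by
  induction d with
  | zero =>
    intro v hv hv0 hd
    have h1 : ∀ mu, (hallModuleBasis n m).repr v mu ≠ 0 → mu = topIndex m o := by
      intro mu hmu
      refine eq_topIndex mu o fun k hk => ?_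
      by_contra h
      obtain ⟨nu, hnu⟩ := exists_move mu h o
      have h2 := congrFun hnu o
      rw [Pi.add_apply, Pi.add_apply, Pi.single_eq_same, Pi.single_eq_of_ne hk.symm] at h2
      have := apply_le nu o
      have := hd mu hmu
      omega
    have h2 : v = (hallModuleBasis n m).repr v (topIndex m o) •
        hallModuleBasis n m (topIndex m o) := by
      conv_lhs => rw [← (hallModuleBasis n m).sum_repr v]
      refine Finset.sum_eq_single _ (fun mu _ hmu => ?_) fun h => absurd (Finset.mem_univ _) h
      rw [not_not.1 fun h => hmu (h1 mu h), zero_smul]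
    have h3 : (hallModuleBasis n m).repr v (topIndex m o) ≠ 0 := by
      intro h
      rw [h, zero_smul] at h2
      exact hv0 h2
    rw [h2] at hv
    exact (N.smul_mem_iff h3).1 hv
  | succ d ih =>
    intro v hv hv0 hd
    by_cases h : ∃ mu, (hallModuleBasis n m).repr v mu ≠ 0 ∧ ∃ k ≠ o, mu.1 k ≠ 0
    · obtain ⟨mu, hmu, k, hk, hmuk⟩ := h
      obtain ⟨nu, hnu⟩ := exists_move mu hmuk o
      have h2 : mu.1 o + 1 = nu.1 o := by
        have := congrFun hnu o
        rwa [Pi.add_apply, Pi.add_apply, Pi.single_eq_same, Pi.single_eq_of_ne hk.symm] at this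
      refine ih _ (hN o k hk.symm v hv) ?_ ?_
      · intro h3
        have h4 := repr_unitAct_of_eq hnu v
        rw [h3, map_zero, Finsupp.zero_apply, ← h2] at h4
        exact mul_ne_zero (Nat.cast_ne_zero.2 (Nat.succ_ne_zero _)) hmu h4.symm
      · intro tau htau
        obtain ⟨sigma, h3, -, h4⟩ := exists_of_repr_unitAct_ne_zero htau
        have h5 := congrFun h3 o
        rw [Pi.add_apply, Pi.add_apply, Pi.single_eq_same, Pi.single_eq_of_ne hk.symm] at h5
        have := hd sigma h4
        omega
    · push Not at h
      refine ih v hv hv0 fun mu hmu => ?_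
      rw [eq_topIndex mu o (h mu hmu)]
      change m ≤ (Pi.single o m : ZMod n → ℕ) o + d
      rw [Pi.single_eq_same]
      omega

/-- The moves are reversed: `E_(k,o)` takes a box out of `o` and produces the wanted basis vector
times the positive integer `μ_k`. -/
theorem basis_mem_of_basis_topIndex_mem {o : ZMod n}
    (h0 : hallModuleBasis n m (topIndex m o) ∈ N) (d : ℕ) :
    ∀ mu : LatticeIndex n m, m ≤ mu.1 o + d → hallModuleBasis n m mu ∈ N := by
  classical
  have key : ∀ mu : LatticeIndex n m, (∀ k ≠ o, mu.1 k = 0) → hallModuleBasis n m mu ∈ N := by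
    intro mu h
    rwa [eq_topIndex mu o h]
  induction d with
  | zero =>
    intro mu hmu
    refine key mu fun k hk => ?_
    by_contra h
    obtain ⟨nu, hnu⟩ := exists_move mu h o
    have h2 := congrFun hnu o
    rw [Pi.add_apply, Pi.add_apply, Pi.single_eq_same, Pi.single_eq_of_ne hk.symm] at h2
    have := apply_le nu o
    omega
  | succ d ih =>
    intro mu hmu
    by_cases h : ∃ k ≠ o, mu.1 k ≠ 0
    · obtain ⟨k, hk, hmuk⟩ := h
      obtain ⟨nu, hnu⟩ := exists_move mu hmuk o
      have h2 : mu.1 o + 1 = nu.1 o := by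
        have := congrFun hnu o
        rwa [Pi.add_apply, Pi.add_apply, Pi.single_eq_same, Pi.single_eq_of_ne hk.symm] at this
      have h3 := hN k o hk _ (ih nu (by omega))
      have h4 : unitAct n m (vertexEquiv n k) (vertexEquiv n o) (hallModuleBasis n m nu) =
          (mu.1 k : ℂ) • hallModuleBasis n m mu := by
        refine (hallModuleBasis n m).ext_elem fun tau => ?_
        rw [repr_unitAct_basis, map_smul, Finsupp.smul_apply, Module.Basis.repr_self,
          Finsupp.single_apply]
        by_cases htau : mu = tau
        · subst htau
          rw [if_pos hnu.symm, if_pos rfl, smul_eq_mul, mul_one]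
        · rw [if_neg, if_neg htau, smul_zero]
          intro h5
          exact htau (Subtype.ext (add_right_cancel (hnu.trans h5)))
      rw [h4] at h3
      exact (N.smul_mem_iff (Nat.cast_ne_zero.2 hmuk)).1 h3
    · push Not at h
      exact key mu h

theorem eq_bot_or_eq_top_of_unitAct_mem : N = ⊥ ∨ N = ⊤ := by
  by_cases h : N = ⊥
  · exact Or.inl h
  right
  obtain ⟨v, hv, hv0⟩ := Submodule.exists_mem_ne_zero_of_ne_bot h
  have h1 := basis_topIndex_mem hN 0 m v hv hv0 fun mu _ => Nat.le_add_left _ _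
  rw [eq_top_iff, ← (hallModuleBasis n m).span_eq, Submodule.span_le]
  rintro _ ⟨mu, rfl⟩
  exact basis_mem_of_basis_topIndex_mem hN h1 m mu (Nat.le_add_left _ _)

end Simple

theorem uslAct_single {i j : Fin n} (hij : i ≠ j) :
    (uglAct n m).comp (UslToUgl n)
      (UniversalEnvelopingAlgebra.ι ℂ (LieAlgebra.SpecialLinear.single i j hij 1)) =
        unitAct n m i j := by
  rw [AlgHom.comp_apply, UslToUgl, UniversalEnvelopingAlgebra.lift_ι_apply]
  exact uglAct_matrixUnit i j

theorem uslAct_hElem (i : ℕ) (hi : i + 1 < n) :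
    (uglAct n m).comp (UslToUgl n) (UniversalEnvelopingAlgebra.ι ℂ (hElem n i hi)) =
      unitAct n m ⟨i, Nat.lt_of_succ_lt hi⟩ ⟨i, Nat.lt_of_succ_lt hi⟩ -
        unitAct n m ⟨i + 1, hi⟩ ⟨i + 1, hi⟩ := by
  rw [AlgHom.comp_apply, UslToUgl, UniversalEnvelopingAlgebra.lift_ι_apply]
  change uglAct n m (UniversalEnvelopingAlgebra.ι ℂ (Matrix.single _ _ 1 - Matrix.single _ _ 1)) = _
  rw [map_sub, map_sub]
  exact congrArg₂ _ (uglAct_matrixUnit _ _) (uglAct_matrixUnit _ _)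

theorem isIrreducibleModule_uglAct : IsIrreducibleModule ((uglAct n m).comp (UslToUgl n)) := by
  let ρ := (uglAct n m).comp (UslToUgl n)
  let _ : Module (Usl n) (HallModuleOne n m) := Module.compHom _ ρ.toRingHom
  change IsSimpleModule (Usl n) (HallModuleOne n m)
  have : Nontrivial (HallModuleOne n m) :=
    ⟨⟨hallModuleBasis n m (topIndex m 0), 0, (hallModuleBasis n m).ne_zero _⟩⟩
  refine { eq_bot_or_eq_top := fun N => ?_ }
  let N' : Submodule ℂ (HallModuleOne n m) :=
    { carrier := N
      add_mem' := N.add_mem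
      zero_mem' := N.zero_mem
      smul_mem' := fun a v hv => by
        have h1 := N.smul_mem (algebraMap ℂ (Usl n) a) hv
        have h2 : algebraMap ℂ (Usl n) a • v = ρ (algebraMap ℂ (Usl n) a) v := rfl
        rwa [h2, AlgHom.commutes, Module.algebraMap_end_apply] at h1 }
  have hN : ∀ i k : ZMod n, i ≠ k → ∀ v ∈ N',
      unitAct n m (vertexEquiv n i) (vertexEquiv n k) v ∈ N' := by
    intro i k hik v hv
    rw [← uslAct_single ((vertexEquiv n).injective.ne hik)]
    exact N.smul_mem _ hv
  rcases eq_bot_or_eq_top_of_unitAct_mem hN with h | h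
  · left
    rw [eq_bot_iff]
    intro v hv
    have h1 : v ∈ N' := hv
    rw [h] at h1
    exact h1
  · right
    rw [eq_top_iff]
    intro v _
    have h1 : v ∈ N' := by
      rw [h]
      trivial
    exact h1

theorem unitAct_self_basis (i : Fin n) (nu : LatticeIndex n m) :
    unitAct n m i i (hallModuleBasis n m nu) =
      (nu.1 ((vertexEquiv n).symm i) : ℂ) • hallModuleBasis n m nu := by
  classical
  obtain ⟨i, rfl⟩ := (vertexEquiv n).surjective i
  rw [Equiv.symm_apply_apply]
  refine (hallModuleBasis n m).ext_elem fun tau => ?_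
  rw [repr_unitAct_basis, map_smul, Finsupp.smul_apply, Module.Basis.repr_self,
    Finsupp.single_apply]
  by_cases htau : nu = tau
  · subst htau
    rw [if_pos rfl, if_pos rfl, smul_eq_mul, mul_one]
  · rw [if_neg, if_neg htau, smul_zero]
    intro h5
    exact htau (Subtype.ext (add_right_cancel h5))

/-- The highest weight vector has all `m` boxes in the first row. A unit `E_(i,j)` with `i < j`
needs a box in row `j`, which is never the first row, so it gives zero; the diagonal units count the
boxes. -/
theorem hasHighestWeight_uglAct :
    HasHighestWeight ((uglAct n m).comp (UslToUgl n)) fun i => (m : ℂ) * omegaOne i := by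
  let o : ZMod n := (vertexEquiv n).symm ⟨0, NeZero.pos n⟩
  have hval : ∀ i : Fin n, (topIndex m o).1 ((vertexEquiv n).symm i) = if i.1 = 0 then m else 0 := by
    intro i
    change (Pi.single o m : ZMod n → ℕ) _ = _
    rw [Pi.single_apply]
    refine if_congr ?_ rfl rfl
    rw [(vertexEquiv n).symm.injective.eq_iff, Fin.ext_iff]
  refine ⟨hallModuleBasis n m (topIndex m o), (hallModuleBasis n m).ne_zero _, ?_, ?_⟩
  · intro i j hij
    rw [uslAct_single]
    refine (hallModuleBasis n m).ext_elem fun tau => ?_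
    rw [map_zero, Finsupp.zero_apply]
    by_contra hne
    have hj := hval j
    obtain ⟨i, rfl⟩ := (vertexEquiv n).surjective i
    obtain ⟨j, rfl⟩ := (vertexEquiv n).surjective j
    obtain ⟨nu, h1, -, h2⟩ := exists_of_repr_unitAct_ne_zero hne
    obtain rfl : nu = topIndex m o := by
      by_contra h3
      exact h2 (by rw [Module.Basis.repr_self, Finsupp.single_eq_of_ne h3])
    have h3 := congrFun h1 j
    rw [Equiv.symm_apply_apply, if_neg (Nat.ne_zero_of_lt (Fin.lt_def.1 hij))] at hj
    rw [Pi.add_apply, Pi.add_apply, Pi.single_eq_same, hj,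
      Pi.single_eq_of_ne (fun h => hij.ne (by rw [h]))] at h3
    omega
  · intro i hi
    rw [uslAct_hElem, LinearMap.sub_apply, unitAct_self_basis, unitAct_self_basis, ← sub_smul,
      hval, hval]
    congr 1
    rw [if_neg (Nat.succ_ne_zero i), Nat.cast_zero, sub_zero]
    simp [omegaOne]

/-! ### The ideal -/

theorem exists_ideal (n : ℕ) [NeZero n] :
    ∃ (I : TwoSidedIdeal (HallAlgebraOne n)) (θ : I.ringCon.Quotient ≃+* Ugl n),
      (∀ x, θ (RingCon.toQuotient (c := I.ringCon) x) = hallToUgl n x) ∧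
        ∀ x ∈ I, hallToUgl n x = 0 := by
  let I : TwoSidedIdeal (HallAlgebraOne n) := TwoSidedIdeal.ker (hallToUgl n)
  have h1 : ∀ x y, I.ringCon x y ↔ hallToUgl n x = hallToUgl n y := fun x y => Iff.rfl
  let f : I.ringCon.Quotient → Ugl n :=
    Quotient.lift (hallToUgl n) fun x y h => (h1 x y).1 h
  have hf : ∀ x, f (RingCon.toQuotient (c := I.ringCon) x) = hallToUgl n x := fun _ => rfl
  have hsurj : ∀ a : I.ringCon.Quotient, ∃ x, RingCon.toQuotient (c := I.ringCon) x = a :=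
    fun a => Quotient.exists_rep a
  have hbij : Function.Bijective f := by
    constructor
    · intro a b hab
      obtain ⟨x, rfl⟩ := hsurj a
      obtain ⟨y, rfl⟩ := hsurj b
      rw [hf, hf] at hab
      exact (RingCon.eq _).2 ((h1 x y).2 hab)
    · intro y
      obtain ⟨x, rfl⟩ := hallToUgl_surjective y
      exact ⟨_, hf x⟩
  refine ⟨I, { Equiv.ofBijective f hbij with
    map_mul' := ?_
    map_add' := ?_ }, hf, fun x hx => (TwoSidedIdeal.mem_ker (hallToUgl n)).1 hx⟩
  · intro a b
    obtain ⟨x, rfl⟩ := hsurj a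
    obtain ⟨y, rfl⟩ := hsurj b
    exact map_mul (hallToUgl n) x y
  · intro a b
    obtain ⟨x, rfl⟩ := hsurj a
    obtain ⟨y, rfl⟩ := hsurj b
    exact map_add (hallToUgl n) x y

end IyamaHall
end

/-! ### The theorem -/

open IyamaHall in
theorem mainTheorem8 (n : ℕ) [NeZero n] :
    -- the Hall polynomials exist and are unique, and define an associative unital algebra
    -- together with modules over it
    (∀ lam mu nu : PartitionTuple n, ∃! p, IsHallPolynomial n lam mu nu p) ∧
    (∀ (m : ℕ) (lam : PartitionTuple n) (mu nu : LatticeIndex n m),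
      ∃! p, IsHallModulePolynomial n m lam mu nu p) ∧
    (∀ lam nu : PartitionTuple n, {mu | hallPolynomial n lam mu nu ≠ 0}.Finite) ∧
    (∀ x y z : GenericHallAlgebra n,
      genericMul n (genericMul n x y) z = genericMul n x (genericMul n y z)) ∧
    (∀ x : GenericHallAlgebra n,
      genericMul n (GenericHallAlgebra.u 0) x = x ∧ genericMul n x (GenericHallAlgebra.u 0) = x) ∧
    (∀ (m : ℕ) (v : GenericHallModule n m),
      genericAct n m (GenericHallAlgebra.u 0) v = v ∧
      ∀ x y : GenericHallAlgebra n,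
        genericAct n m (genericMul n x y) v = genericAct n m x (genericAct n m y v)) ∧
    -- the ideal
    ∃ (I : TwoSidedIdeal (HallAlgebraOne n)) (θ : I.ringCon.Quotient ≃+* Ugl n),
      (∀ (c : ℂ) (x : HallAlgebraOne n),
        θ (RingCon.toQuotient (c := I.ringCon) (c • x)) = c • θ (RingCon.toQuotient (c := I.ringCon) x)) ∧
      ∀ m : ℕ,
        (∀ x ∈ I, ∀ v : HallModuleOne n m, actOne n m x v = 0) ∧
        Module.finrank ℂ (HallModuleOne n m) = (m + n - 1).choose (n - 1) ∧
        ∃ ρ : Ugl n →ₐ[ℂ] Module.End ℂ (HallModuleOne n m),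
          (∀ x : HallAlgebraOne n, ρ (θ (RingCon.toQuotient (c := I.ringCon) x)) = actOne n m x) ∧
          IsIrreducibleModule (ρ.comp (UslToUgl n)) ∧
          HasHighestWeight (ρ.comp (UslToUgl n)) (fun i => (m : ℂ) * omegaOne i) := by
  refine ⟨existsUnique_isHallPolynomial, fun m => existsUnique_isHallModulePolynomial,
    finite_hallPolynomial, genericMul_assoc, fun x => ⟨genericMul_zero_left x,
      genericMul_zero_right x⟩, fun m v => ⟨genericAct_zero v, fun x y =>
        genericAct_genericMul x y v⟩, ?_⟩
  obtain ⟨I, θ, hθ, hI⟩ := exists_ideal n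
  refine ⟨I, θ, fun c x => ?_, fun m => ⟨fun x hx v => ?_, finrank_hallModuleOne,
    uglAct n m, fun x => ?_, isIrreducibleModule_uglAct, hasHighestWeight_uglAct⟩⟩
  · rw [hθ, hθ, hallToUgl_smul]
  · rw [← uglAct_hallToUgl, hI x hx, map_zero, LinearMap.zero_apply]
  · rw [hθ, uglAct_hallToUgl]
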